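/- **Setting.** Let $d\in\mathbb N$. Let $\rho\in H^{1,2}_{loc}(\mathbb R^d)\cap L^\infty_{loc}(\mathbb R^d)$ and $\psi\in L^1_{loc}(\mathbb R^d)$ be a.e. strictly positive with $\frac1\rho,\frac1\psi\in L^\infty_{loc}(\mathbb R^d)$, and put $\mu:=\rho\psi\,dx$. Let $A=(a_{ij})_{1\le i,j\le d}$ be a symmetric matrix of functions $a_{ij}\in H^{1,2}_{loc}(\mathbb R^d)$ that is locally uniformly strictly elliptic: for every open ball $B'$ there are $\lambda,\Lambda>0$ with $\lambda\|\xi\|^2\le\langle A(x)\xi,\xi\rangle\le\Lambda\|\xi\|^2$ for all $\xi\in\mathbb R^d$, $x\in B'$. Put $\widehat A:=\frac1\psi A$. Let $\mathbf B\in L^2_{loc}(\mathbb R^d,\mathbb R^d,\mu)$ satisfy $\int\langle\mathbf B,\nabla u\rangle\,d\mu=0$ for all $u\in C_0^\infty(\mathbb R^d)$ and $\rho\psi\mathbf B\in L^2_{loc}(\mathbb R^d,\mathbb R^d)$ (with respect to $dx$). For $U=\mathbb R^d$ or $U\subset\mathbb R^d$ bounded and open, let $(\mathcal E^{0,U},D(\mathcal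 E^{0,U}))$ be the closure in $L^2(U,\mu)$ of $\mathcal E^{0,U}(f,g)=\frac12\int_U\langle\widehat A\nabla f,\nabla g\rangle\,d\mu$, $f,g\in C_0^\infty(U)$, and let $(L^{0,U},D(L^{0,U}))$ be its generator on $L^2(U,\mu)$, i.e. $\mathcal E^{0,U}(u,v)=-\int_U L^{0,U}u\,v\,d\mu$ for all $u\in D(L^{0,U})$, $v\in D(\mathcal E^{0,U})$. Write $\mathcal E^0,L^0$ when $U=\mathbb R^d$. Let $\widehat H^{1,2}_0(\mathbb R^d,\mu)$ be the closure of $C_0^\infty(\mathbb R^d)$ in $L^2(\mathbb R^d,\mu)$ with respect to the norm $(\int\|\nabla u\|^2dx+\int u^2d\mu)^{1/2}$. For a space $W$ of functions, $W_b$ denotes its essentially bounded elements and $W_{0,b}$ those that in addition have compact support; $\nabla$ is the weak gradient. Put $Lu:=L^0u+\langle\mathbf B,\nabla u\rangle$ for $u\in D(L^0)_{0,b}$. For a bounded open set $V$, put $L^Vu:=L^{0,V}u+\langle\mathbf B,\nabla u\rangle\in L^1(V,\mu)$ for $u\in D(L^{0,V})_b$. For $\alpha>0$ let $\overline G^V_\alpha:=(\alpha-\overline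 L^V)^{-1}$, where $\overline L^V$ is the closure of $(L^V,D(L^{0,V})_b)$ on $L^1(V,\mu)$, and for $f\in L^1(\mathbb R^d,\mu)$ let $\overline G^V_\alpha f$ denote $\overline G^V_\alpha(f1_V)$ extended by $0$ to $\mathbb R^d\setminus V$. (It is part of the claim, for the sets $V=U_n$ in (b), that this closure exists, generates a sub-Markovian $C_0$-semigroup of contractions on $L^1(V,\mu)$, and that $\overline G_\alpha^V$ is a well-defined bounded operator.) A semigroup $(T_t)_{t>0}$ is sub-Markovian if $0\le f\le1$ implies $0\le T_tf\le1$ a.e. **Theorem.** There exists a closed operator $(\overline L,D(\overline L))$ on $L^1(\mathbb R^d,\mu)$ that extends $(L,D(L^0)_{0,b})$ (in particular $u,Lu\in L^1(\mathbb R^d,\mu)$ for $u\in D(L^0)_{0,b}$) and satisfies: (a) $(\overline L,D(\overline L))$ generates a sub-Markovian $C_0$-semigroup of contractions on $L^1(\mathbb R^d,\mu)$. (b) Let $(U_n)_{n\ge1}$ be bounded open subsets of $\mathbb R^d$ with $\overline U_n\subset U_{n+1}$ and $\mathbb R^d=\bigcup_{n\ge1}U_n$. Then for all $\alpha>0$ and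 $f\in L^1(\mathbb R^d,\mu)$, $$\lim_{n\to\infty}\overline G^{U_n}_\alpha f=(\alpha-\overline L)^{-1}f\quad\text{in }L^1(\mathbb R^d,\mu),$$ where $(\alpha-\overline L)^{-1}$ exists as a bounded operator on $L^1(\mathbb R^d,\mu)$. (c) $D(\overline L)_b\subset D(\mathcal E^0)$, and for all $u\in D(\overline L)_b$ and $v\in\widehat H^{1,2}_0(\mathbb R^d,\mu)_{0,b}$ one has $v\in D(\mathcal E^0)$, $\langle\mathbf B,\nabla u\rangle v\in L^1(\mathbb R^d,\mu)$, and $$\mathcal E^0(u,u)\le-\int_{\mathbb R^d}\overline Lu\cdot u\,d\mu,\qquad \mathcal E^0(u,v)-\int_{\mathbb R^d}\langle\mathbf B,\nabla u\rangle v\,d\mu=-\int_{\mathbb R^d}\overline Lu\cdot v\,d\mu .$$ -/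

import Mathlib

open MeasureTheory Filter Topology Set
open scoped ENNReal ContDiff Matrix

noncomputable section

namespace DegenerateDiffusion

/-- `ℝ^d` with the Euclidean norm. -/
abbrev Sp (d : ℕ) : Type := EuclideanSpace ℝ (Fin d)

variable {d : ℕ}

/-! ### Function spaces on `ℝ^d` -/

/-- `φ ∈ C_0^∞(U)`: smooth with compact support contained in the open set `U`. -/
def IsTest (U : Set (Sp d)) (φ : Sp d → ℝ) : Prop :=
  ContDiff ℝ ∞ φ ∧ HasCompactSupport φ ∧ tsupport φ ⊆ U

/-- `f ∈ L^p_loc(ℝ^d, ν)`. -/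
def MemLpLoc {F : Type} [NormedAddCommGroup F] (f : Sp d → F) (p : ℝ≥0∞)
    (ν : Measure (Sp d)) : Prop :=
  ∀ K : Set (Sp d), IsCompact K → MemLp f p (ν.restrict K)

/-- `g` is the weak gradient of `u` on the open set `U` (with respect to Lebesgue measure). -/
def HasWeakGradient (U : Set (Sp d)) (u : Sp d → ℝ) (g : Sp d → Sp d) : Prop :=
  LocallyIntegrableOn u U volume ∧ LocallyIntegrableOn g U volume ∧
    ∀ φ : Sp d → ℝ, IsTest U φ → ∀ i : Fin d,
      ∫ x in U, u x * gradient φ x i = - ∫ x in U, g x i * φ x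

open Classical in
/-- The weak gradient `∇u` on `U`; it is determined a.e. on `U` whenever it exists. -/
def weakGrad (U : Set (Sp d)) (u : Sp d → ℝ) : Sp d → Sp d :=
  if h : ∃ g, HasWeakGradient U u g then h.choose else 0

/-- `f ∈ H^{1,2}_loc(ℝ^d)`. -/
def MemH12Loc (f : Sp d → ℝ) : Prop :=
  MemLpLoc f 2 volume ∧ ∃ g : Sp d → Sp d, HasWeakGradient univ f g ∧ MemLpLoc g 2 volume

/-- `A` is locally uniformly strictly elliptic. -/
def LocUnifElliptic (A : Sp d → Matrix (Fin d) (Fin d) ℝ) : Prop :=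
  ∀ (z : Sp d) (r : ℝ), ∃ lam Lam : ℝ, 0 < lam ∧ 0 < Lam ∧
    ∀ x ∈ Metric.ball z r, ∀ ξ : Sp d,
      lam * ‖ξ‖ ^ 2 ≤ (A x *ᵥ ξ.ofLp) ⬝ᵥ ξ.ofLp ∧ (A x *ᵥ ξ.ofLp) ⬝ᵥ ξ.ofLp ≤ Lam * ‖ξ‖ ^ 2

/-- The measure `μ = ρ ψ dx`. -/
def mu (ρ ψ : Sp d → ℝ) : Measure (Sp d) :=
  volume.withDensity fun x => ENNReal.ofReal (ρ x * ψ x)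

/-- `u` is bounded `ν`-a.e. -/
def EssBdd (ν : Measure (Sp d)) (u : Sp d → ℝ) : Prop := ∃ M : ℝ, ∀ᵐ x ∂ν, |u x| ≤ M

/-- The support of the measure `|u| dν` is compact. -/
def EssCompactSupp (ν : Measure (Sp d)) (u : Sp d → ℝ) : Prop :=
  ∃ K : Set (Sp d), IsCompact K ∧ ∀ᵐ x ∂ν, x ∉ K → u x = 0

/-- `u ∈ Ĥ_0^{1,2}(U, μ)`: `u` lies in the closure of `C_0^∞(U)` in `L²(U, μ)` with respect to the
norm `(∫_U ‖∇u‖² dx + ∫_U u² dμ)^{1/2}`. -/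
def MemHHat (ρ ψ : Sp d → ℝ) (U : Set (Sp d)) (u : Sp d → ℝ) : Prop :=
  MemLp u 2 ((mu ρ ψ).restrict U) ∧ ∃ un : ℕ → Sp d → ℝ, (∀ n, IsTest U (un n)) ∧
    Tendsto (fun n => eLpNorm (un n - u) 2 ((mu ρ ψ).restrict U)) atTop (𝓝 0) ∧
    Tendsto (fun p : ℕ × ℕ => ∫ x in U, ‖gradient (un p.1 - un p.2) x‖ ^ 2) atTop (𝓝 0)

/-! ### The Dirichlet forms `E^{0,U}`; the choice `U = univ` gives `E^0` -/

/-- `½ ∫_U ⟨Â ∇f, ∇g⟩ dμ` with `Â = ψ⁻¹ A`, for `f, g ∈ C_0^∞(U)`. -/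
def preForm (ρ ψ : Sp d → ℝ) (A : Sp d → Matrix (Fin d) (Fin d) ℝ) (U : Set (Sp d))
    (f g : Sp d → ℝ) : ℝ :=
  (1 / 2) * ∫ x in U,
    (((ψ x)⁻¹ • A x) *ᵥ (gradient f x).ofLp) ⬝ᵥ (gradient g x).ofLp ∂(mu ρ ψ)

/-- `un` is a sequence in `C_0^∞(U)` that is Cauchy for the form and converges to `u` in
`L²(U, μ)`. -/
def FormApprox (ρ ψ : Sp d → ℝ) (A : Sp d → Matrix (Fin d) (Fin d) ℝ) (U : Set (Sp d))
    (u : Sp d → ℝ) (un : ℕ → Sp d → ℝ) : Prop :=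
  (∀ n, IsTest U (un n)) ∧
    Tendsto (fun n => eLpNorm (un n - u) 2 ((mu ρ ψ).restrict U)) atTop (𝓝 0) ∧
    Tendsto (fun p : ℕ × ℕ => preForm ρ ψ A U (un p.1 - un p.2) (un p.1 - un p.2)) atTop (𝓝 0)

/-- `u ∈ D(E^{0,U})`, the domain of the closure of the form on `C_0^∞(U)` in `L²(U, μ)`. -/
def FormDomain (ρ ψ : Sp d → ℝ) (A : Sp d → Matrix (Fin d) (Fin d) ℝ) (U : Set (Sp d))
    (u : Sp d → ℝ) : Prop :=
  MemLp u 2 ((mu ρ ψ).restrict U) ∧ ∃ un, FormApprox ρ ψ A U u un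

/-- The closed form `E^{0,U}(u, v)`: the common limit of `E^{0,U}(u_n, v_n)` along all
approximating sequences (meaningful for `u, v ∈ D(E^{0,U})`). -/
def form (ρ ψ : Sp d → ℝ) (A : Sp d → Matrix (Fin d) (Fin d) ℝ) (U : Set (Sp d))
    (u v : Sp d → ℝ) : ℝ :=
  Classical.epsilon fun c : ℝ => ∀ un vn : ℕ → Sp d → ℝ,
    FormApprox ρ ψ A U u un → FormApprox ρ ψ A U v vn →
      Tendsto (fun n => preForm ρ ψ A U (un n) (vn n)) atTop (𝓝 c)

/-- `u ∈ D(L^{0,U})` and `L^{0,U} u = w`, where `L^{0,U}` is the generator on `L²(U, μ)` of the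
closed form `E^{0,U}`. -/
def IsL0 (ρ ψ : Sp d → ℝ) (A : Sp d → Matrix (Fin d) (Fin d) ℝ) (U : Set (Sp d))
    (u w : Sp d → ℝ) : Prop :=
  FormDomain ρ ψ A U u ∧ MemLp w 2 ((mu ρ ψ).restrict U) ∧
    ∀ v : Sp d → ℝ, FormDomain ρ ψ A U v →
      form ρ ψ A U u v = - ∫ x in U, w x * v x ∂(mu ρ ψ)

/-- For `w = L^{0,U} u`, the function `L^{0,U} u + ⟨B, ∇u⟩`. -/
def addDrift (B : Sp d → Sp d) (U : Set (Sp d)) (u w : Sp d → ℝ) : Sp d → ℝ :=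
  fun x => w x + inner ℝ (B x) (weakGrad U u x)

/-- The graph in `L¹(V, μ) × L¹(V, μ)` of `L^V u = L^{0,V} u + ⟨B, ∇u⟩`, `u ∈ D(L^{0,V})_b`. -/
def graphLV (ρ ψ : Sp d → ℝ) (A : Sp d → Matrix (Fin d) (Fin d) ℝ) (B : Sp d → Sp d)
    (V : Set (Sp d)) :
    Set (Lp ℝ 1 ((mu ρ ψ).restrict V) × Lp ℝ 1 ((mu ρ ψ).restrict V)) :=
  {p | ∃ u w : Sp d → ℝ, IsL0 ρ ψ A V u w ∧ EssBdd ((mu ρ ψ).restrict V) u ∧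
    (p.1 : Sp d → ℝ) =ᵐ[(mu ρ ψ).restrict V] u ∧
    (p.2 : Sp d → ℝ) =ᵐ[(mu ρ ψ).restrict V] addDrift B V u w}

/-- `LV` is the closure on `L¹(V, μ)` of `(L^V, D(L^{0,V})_b)`, which maps `D(L^{0,V})_b` into
`L¹(V, μ)`. -/
def IsClosureLV (ρ ψ : Sp d → ℝ) (A : Sp d → Matrix (Fin d) (Fin d) ℝ) (B : Sp d → Sp d)
    (V : Set (Sp d))
    (LV : Lp ℝ 1 ((mu ρ ψ).restrict V) →ₗ.[ℝ] Lp ℝ 1 ((mu ρ ψ).restrict V)) : Prop :=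
  (∀ u w : Sp d → ℝ, IsL0 ρ ψ A V u w → EssBdd ((mu ρ ψ).restrict V) u →
    MemLp u 1 ((mu ρ ψ).restrict V) ∧ MemLp (addDrift B V u w) 1 ((mu ρ ψ).restrict V)) ∧
  (LV.graph : Set (Lp ℝ 1 ((mu ρ ψ).restrict V) × Lp ℝ 1 ((mu ρ ψ).restrict V))) =
    closure (graphLV ρ ψ A B V)

/-! ### Semigroups, generators, resolvents -/

/-- `(T_t)_{t>0}` is a `C_0`-semigroup of contractions on `X` (only `t > 0` is used). -/
structure IsC0ContractionSemigroup {X : Type} [NormedAddCommGroup X] [NormedSpace ℝ X]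
    (T : ℝ → X →L[ℝ] X) : Prop where
  add : ∀ s t : ℝ, 0 < s → 0 < t → ∀ f, T (s + t) f = T s (T t f)
  contraction : ∀ t : ℝ, 0 < t → ∀ f, ‖T t f‖ ≤ ‖f‖
  cont : ∀ f, Tendsto (fun t => T t f) (𝓝[>] 0) (𝓝 f)

/-- `S` is the generator of `(T_t)_{t>0}`: `S u = lim_{t ↓ 0} (T_t u - u) / t`, defined exactly for
those `u` for which the limit exists. -/
def IsGenerator {X : Type} [NormedAddCommGroup X] [NormedSpace ℝ X]
    (S : X →ₗ.[ℝ] X) (T : ℝ → X →L[ℝ] X) : Prop :=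
  ∀ u w : X, (u, w) ∈ S.graph ↔ Tendsto (fun t : ℝ => t⁻¹ • (T t u - u)) (𝓝[>] 0) (𝓝 w)

/-- `S` generates a sub-Markovian `C_0`-semigroup of contractions on `L¹(ν)`. -/
def GeneratesSubMarkovian {ν : Measure (Sp d)} (S : Lp ℝ 1 ν →ₗ.[ℝ] Lp ℝ 1 ν) : Prop :=
  ∃ T : ℝ → Lp ℝ 1 ν →L[ℝ] Lp ℝ 1 ν, IsC0ContractionSemigroup T ∧ IsGenerator S T ∧
    ∀ t : ℝ, 0 < t → ∀ f : Lp ℝ 1 ν, (∀ᵐ x ∂ν, 0 ≤ f x ∧ f x ≤ 1) →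
      ∀ᵐ x ∂ν, 0 ≤ T t f x ∧ T t f x ≤ 1

/-- `G = (α - S)⁻¹`, a bounded operator on the whole space. -/
def IsResolvent {X : Type} [NormedAddCommGroup X] [NormedSpace ℝ X]
    (S : X →ₗ.[ℝ] X) (α : ℝ) (G : X →L[ℝ] X) : Prop :=
  (∀ f : X, ∃ h : G f ∈ S.domain, α • G f - S ⟨G f, h⟩ = f) ∧
    ∀ u : S.domain, G (α • (u : X) - S u) = u

end DegenerateDiffusion

end

open DegenerateDiffusion MeasureTheory Filter Topology Set
open scoped ENNReal ContDiff Matrix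

/-!
The theorem constructs a Markovian operator `L u = L⁰ u + ⟨B, ∇u⟩` on `L¹(μ)` although the drift `B`
is in no sense a small perturbation of the symmetric part. What makes this possible is that `B` is
divergence free with respect to `μ`: the drift drops out of every equation tested with a function of
the solution itself, `∫ h(u) ⟨B, ∇u⟩ dμ = 0` (`IsFrame.integral_comp_mul_drift_eq_zero`).

**Setting.** With `S = (ρ / 2)^{1/2} A^{1/2}` the form is `∫ ⟨S ∇f, S ∇g⟩ dx`, and the drift term is
`⟨c, S ∇u⟩` for `c = S⁻¹ B` (`exists_isFrame`). The form domain on an open set `U` becomes the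
closed subspace `energy m S U` of `L²(μ) × L²(dx)` generated by the pairs `(φ, S ∇φ)`. All functions
live on the whole space, so the spaces increase with `U`. Because `ρ` and `A` are locally bounded below, the
second component of such a pair is `S` applied to the weak gradient of the first, whence the form is
closable.

**The key estimate** concerns `L¹`-limits `(u, y)` of solutions `u n` on bounded sets with images
`y n` under the operator with drift (`GenLimit`). Testing with smooth bounded increasing `h` gives
`∫ y h(u) dμ ≤ 0`. If `u` is bounded, then `u` belongs to the form domain, its energy is at most
`-∫ y u dμ`, and `u` satisfies the weak equation (`GenLimit.exists_energy`). Here one tests with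
`h'(u n) v`, and the term containing `h''` vanishes in the limit, since the energy of `u n` on
the set where it exceeds the bound of `u` does.

**Generation.** A relation on `L¹` with `∫ y h(u) dμ ≤ 0` for all such `h` is dissipative and
satisfies a maximum principle. If `α - L` is onto and the domain is dense, then the Hille–Yosida
theorem produces a sub-Markovian semigroup of contractions
(`TruncationDissipative.exists_generator`).

* On a bounded open set `V` both conditions follow by duality. A bounded function `h` which
  annihilates the range of `α - L^V` coincides with the Lax–Milgram solution `v` of
  `α (v, q) + E(v, q) = ∫ ⟨B, ∇q⟩ h dμ`, and testing this equation with `q = v = h` gives `h = 0`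
  (`IsFrame.eq_zero_of_annihilates_range`).
* The resolvents on bounded sets increase with the set on nonnegative functions
  (`IsFrame.resolventExt_le`): subtract the equations on `V ⊆ W` and test with a truncation of
  `(u_V - u_W)⁺`, which belongs to the form domain of `V`. As `α G_α` contracts the `L¹`-norm,
  monotone convergence along balls yields limits, which are the resolvents of the graph limit
  `globalRel` of the operators on the balls. Comparison of the sets shows that every exhaustion
  gives the same limit.

Elements of the graph limit fall under the key estimate, which is the assertion on bounded elements
of the domain. A bounded `u ∈ D(L⁰)` with compact support solves the same equation on every large ball,
because `L⁰` is local, so the graph limit extends `L`.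
-/

open MeasureTheory Filter Topology Set
open scoped ENNReal ContDiff Matrix

noncomputable section

namespace DegenerateDiffusion

/-! ### Generation of contraction semigroups from resolvents -/

section HilleYosida

variable {X : Type} [NormedAddCommGroup X] [NormedSpace ℝ X]

variable {S : X →ₗ.[ℝ] X} {G : ℝ → X →L[ℝ] X}

theorem IsResolvent.sub_eq {α β : ℝ} {Gα Gβ : X →L[ℝ] X} (hα : IsResolvent S α Gα)
    (hβ : IsResolvent S β Gβ) (f : X) : Gα f - Gβ f = (β - α) • Gβ (Gα f) := by
  obtain ⟨h, hf⟩ := hα.1 f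
  have := hβ.2 ⟨Gα f, h⟩
  have h2 : S ⟨Gα f, h⟩ = α • Gα f - f := by
    rw [eq_sub_iff_add_eq, add_comm, ← eq_sub_iff_add_eq]; exact hf.symm |>.trans rfl
  simp only [h2] at this
  have h3 : β • Gα f - (α • Gα f - f) = (β - α) • Gα f + f := by rw [sub_smul]; abel
  rw [h3, map_add, map_smul] at this
  rw [sub_eq_iff_eq_add, this]

theorem IsResolvent.commute {α β : ℝ} {Gα Gβ : X →L[ℝ] X} (hα : IsResolvent S α Gα)
    (hβ : IsResolvent S β Gβ) : Commute Gα Gβ := by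
  rcases eq_or_ne α β with rfl | hne
  · have : Gα = Gβ := by
      ext f
      have := hα.sub_eq hβ f
      rwa [sub_self, zero_smul, sub_eq_zero] at this
    rw [this]
  · ext f
    have h1 := hα.sub_eq hβ f
    have h2 := hβ.sub_eq hα f
    have h3 : (β - α) • Gβ (Gα f) = (β - α) • Gα (Gβ f) := by
      rw [← h1, ← neg_sub (Gβ f), h2, ← neg_smul, neg_sub]
    exact (smul_right_injective X (sub_ne_zero.2 hne.symm) h3).symm

variable [CompleteSpace X]

/-- `exp (s (R - 1)) f = e^{-s} ∑ s^k / k! R^k f` is a limit of convex combinations of the iterates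
`R^k f`. -/
theorem exp_smul_sub_one_mem {R : X →L[ℝ] X} {C : Set X} (hC : Convex ℝ C) (hCc : IsClosed C)
    (hR : ∀ f ∈ C, R f ∈ C) {s : ℝ} (hs : 0 ≤ s) {f : X} (hf : f ∈ C) :
    NormedSpace.exp (s • (R - 1)) f ∈ C := by
  have hit : ∀ k : ℕ, (R ^ k) f ∈ C := by
    intro k
    induction k with
    | zero => simpa using hf
    | succ k ih =>
      rw [pow_succ']
      exact hR _ ih
  have hsum1 : HasSum (fun k : ℕ => s ^ k / (k.factorial : ℝ)) (Real.exp s) := by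
    rw [Real.exp_eq_exp_ℝ]
    exact NormedSpace.expSeries_div_hasSum_exp s
  have hsum2 : HasSum (fun k : ℕ => (s ^ k / (k.factorial : ℝ)) • (R ^ k) f)
      (NormedSpace.exp (s • R) f) := by
    have h := (NormedSpace.exp_series_hasSum_exp' (𝕂 := ℝ) (s • R)).mapL
      (ContinuousLinearMap.apply ℝ X f)
    refine h.congr_fun ?_ |> fun h => by simpa using h
    intro k
    simp [smul_pow, smul_smul, div_eq_inv_mul]
  have hlim := (hsum1.tendsto_sum_nat.inv₀ (Real.exp_pos s).ne').smul hsum2.tendsto_sum_nat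
  let _ : NormedAlgebra ℚ (X →L[ℝ] X) := NormedAlgebra.restrictScalars ℚ ℝ _
  have hexp : NormedSpace.exp (s • (R - 1)) f
      = (Real.exp s)⁻¹ • NormedSpace.exp (s • R) f := by
    have h1 : s • (R - 1) = (-s) • (1 : X →L[ℝ] X) + s • R := by
      rw [smul_sub, neg_smul]; abel
    have h2 : Commute ((-s) • (1 : X →L[ℝ] X)) (s • R) :=
      (Commute.one_left _).smul_left _
    have h3 : NormedSpace.exp ((-s) • (1 : X →L[ℝ] X)) = Real.exp (-s) • 1 := by
      have := (NormedSpace.algebraMap_exp_comm (𝕂 := ℝ) (𝔸 := X →L[ℝ] X) (-s)).symm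
      rw [← Real.exp_eq_exp_ℝ] at this
      simpa [Algebra.algebraMap_eq_smul_one] using this
    rw [h1, NormedSpace.exp_add_of_commute h2, h3, Real.exp_neg]
    simp
  rw [hexp]
  refine hCc.mem_of_tendsto hlim (Filter.eventually_atTop.2 ⟨1, fun N hN => ?_⟩)
  refine hC.centerMass_mem (t := Finset.range N) (fun k _ => by positivity) ?_ (fun k _ => hit k)
  refine Finset.sum_pos' (fun k _ => by positivity) ⟨0, by simp; omega, by simp⟩

theorem norm_exp_smul_sub_one_le {R : X →L[ℝ] X} (hR : ∀ f, ‖R f‖ ≤ ‖f‖) {s : ℝ} (hs : 0 ≤ s)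
    (f : X) : ‖NormedSpace.exp (s • (R - 1)) f‖ ≤ ‖f‖ := by
  have := exp_smul_sub_one_mem (convex_closedBall (0 : X) ‖f‖) Metric.isClosed_closedBall
    (R := R) (fun g hg => by
      simp only [mem_closedBall_zero_iff] at hg ⊢
      exact (hR g).trans hg) hs (f := f) (by simp)
  simpa using this

/-- Two commuting generators of contraction semigroups: `‖e^{tL} f - e^{tM} f‖ ≤ t ‖L f - M f‖`. -/
theorem norm_exp_sub_exp_le {L M : X →L[ℝ] X} (hLM : Commute L M)
    (hL : ∀ s : ℝ, 0 ≤ s → ∀ f, ‖NormedSpace.exp (s • L) f‖ ≤ ‖f‖)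
    (hM : ∀ s : ℝ, 0 ≤ s → ∀ f, ‖NormedSpace.exp (s • M) f‖ ≤ ‖f‖) {t : ℝ} (ht : 0 ≤ t) (f : X) :
    ‖NormedSpace.exp (t • L) f - NormedSpace.exp (t • M) f‖ ≤ t * ‖L f - M f‖ := by
  let _ : NormedAlgebra ℚ (X →L[ℝ] X) := NormedAlgebra.restrictScalars ℚ ℝ _
  -- interpolate along `s ↦ e^{(t - s) M} e^{s L} f`, which has the derivative
  -- `e^{(t - s) M} e^{s L} (L f - M f)`
  have hcomm : Commute M (L - M) := hLM.symm.sub_right (Commute.refl M)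
  have hsplit : ∀ s : ℝ, NormedSpace.exp (t • M) * NormedSpace.exp (s • (L - M))
      = NormedSpace.exp ((t - s) • M) * NormedSpace.exp (s • L) := by
    intro s
    rw [← NormedSpace.exp_add_of_commute ((hcomm.smul_left t).smul_right s),
      ← NormedSpace.exp_add_of_commute ((hLM.symm.smul_left (t - s)).smul_right s)]
    congr 1
    rw [smul_sub, sub_smul]; abel
  have hder : ∀ s ∈ Icc (0 : ℝ) t, HasDerivWithinAt
      (fun s : ℝ => (NormedSpace.exp (t • M) * NormedSpace.exp (s • (L - M))) f)
      ((NormedSpace.exp (t • M) * (NormedSpace.exp (s • (L - M)) * (L - M))) f) (Icc 0 t) s := by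
    intro s _
    have h1 := (hasDerivAt_exp_smul_const (𝕂 := ℝ) (L - M) s).const_mul (NormedSpace.exp (t • M))
    exact (((ContinuousLinearMap.apply ℝ X f).hasFDerivAt.comp_hasDerivAt s h1)).hasDerivWithinAt
  have hb := norm_image_sub_le_of_norm_deriv_le_segment' hder (C := ‖L f - M f‖) (by
    intro s hs
    rw [← mul_assoc, hsplit]
    simp only [mul_apply_eq_comp, sub_apply]
    exact (hM _ (by linarith [hs.2]) _).trans (hL _ hs.1 _)) t (right_mem_Icc.2 ht)
  have h0 := hsplit t
  rw [sub_self, zero_smul, NormedSpace.exp_zero, one_mul] at h0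
  simp only [h0, zero_smul, NormedSpace.exp_zero, mul_one, sub_zero] at hb
  rw [mul_comm]; exact hb

/-- The **Hille–Yosida theorem** for contractions: a densely defined operator with contractive
resolvents `α G_α` generates a `C_0`-semigroup of contractions. Closed convex sets that are
invariant under all `α G_α` are invariant under the semigroup. -/
theorem exists_semigroup_of_isResolvent (hS : Dense (S.domain : Set X))
    (hG : ∀ α : ℝ, 0 < α → IsResolvent S α (G α))
    (hc : ∀ α : ℝ, 0 < α → ∀ f, ‖α • G α f‖ ≤ ‖f‖) :
    ∃ T : ℝ → X →L[ℝ] X, IsC0ContractionSemigroup T ∧ IsGenerator S T ∧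
      ∀ C : Set X, Convex ℝ C → IsClosed C →
        (∀ α : ℝ, 0 < α → ∀ f ∈ C, α • G α f ∈ C) → ∀ t : ℝ, 0 < t → ∀ f ∈ C, T t f ∈ C := by
  let _ : NormedAlgebra ℚ (X →L[ℝ] X) := NormedAlgebra.restrictScalars ℚ ℝ _
  -- the Yosida approximations of `S`
  let a : ℕ → ℝ := fun n => (n : ℝ) + 1
  have ha : ∀ n, 0 < a n := fun n => by positivity
  have hat : Tendsto a atTop atTop :=
    tendsto_atTop_add_const_right _ _ tendsto_natCast_atTop_atTop
  let R : ℕ → X →L[ℝ] X := fun n => a n • G (a n)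
  let L : ℕ → X →L[ℝ] X := fun n => a n • (R n - 1)
  have hRc : ∀ n f, ‖R n f‖ ≤ ‖f‖ := fun n f => hc _ (ha n) f
  have hRS : ∀ n (u : S.domain), R n u - u = G (a n) (S u) := by
    intro n u
    have := (hG _ (ha n)).2 u
    rw [map_sub, map_smul] at this
    change a n • G (a n) (u : X) - u = _
    nth_rewrite 2 [← this]
    abel
  have hLS : ∀ n (u : S.domain), L n u = R n (S u) := by
    intro n u
    change a n • (R n u - u) = a n • G (a n) (S u)
    rw [hRS]
  have hGt : ∀ f, Tendsto (fun n => G (a n) f) atTop (𝓝 0) := by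
    intro f
    refine squeeze_zero_norm (a := fun n => ‖f‖ / a n) (fun n => ?_)
      (hat.const_div_atTop _)
    rw [le_div_iff₀ (ha n), mul_comm]
    have := hc _ (ha n) f
    rwa [norm_smul, Real.norm_of_nonneg (ha n).le] at this
  have hRt : ∀ f, Tendsto (fun n => R n f) atTop (𝓝 f) := by
    intro f
    rw [Metric.tendsto_atTop]
    intro ε hε
    obtain ⟨u, hu, hfu⟩ := hS.exists_dist_lt f (ε := ε / 3) (by positivity)
    obtain ⟨N, hN⟩ := Metric.tendsto_atTop.1 (hGt (S ⟨u, hu⟩)) (ε / 3) (by positivity)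
    refine ⟨N, fun n hn => ?_⟩
    have h1 := hN n hn
    rw [dist_zero_right, ← hRS n ⟨u, hu⟩] at h1
    have h2 : ‖R n f - R n u‖ ≤ ‖f - u‖ := by rw [← map_sub]; exact hRc n _
    rw [dist_eq_norm] at hfu ⊢
    calc ‖R n f - f‖ = ‖(R n f - R n u) + (R n u - u) + (u - f)‖ := by congr 1; abel
      _ ≤ ‖R n f - R n u‖ + ‖R n u - u‖ + ‖u - f‖ := norm_add₃_le
      _ < ε := by rw [norm_sub_rev u f]; linarith
  have hLt : ∀ u : S.domain, Tendsto (fun n => L n u) atTop (𝓝 (S u)) := fun u => by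
    simpa only [hLS] using hRt (S u)
  have hcommG : ∀ n m, Commute (G (a n)) (G (a m)) := fun n m =>
    (hG _ (ha n)).commute (hG _ (ha m))
  have hcommR : ∀ n m, Commute (R n) (R m) := fun n m =>
    ((hcommG n m).smul_left _).smul_right _
  have hcommL : ∀ n m, Commute (L n) (L m) := fun n m =>
    ((((hcommR n m).sub_left (Commute.one_left _)).sub_right
      (((Commute.one_right _)).sub_left (Commute.one_left _))).smul_left _).smul_right _
  let E : ℕ → ℝ → X →L[ℝ] X := fun n t => NormedSpace.exp (t • L n)
  have hEeq : ∀ n t, E n t = NormedSpace.exp ((t * a n) • (R n - 1)) := fun n t => by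
    simp only [E, L, smul_smul]
  have hEc : ∀ n t, 0 ≤ t → ∀ f, ‖E n t f‖ ≤ ‖f‖ := fun n t ht f => by
    rw [hEeq]; exact norm_exp_smul_sub_one_le (hRc n) (mul_nonneg ht (ha n).le) f
  have hEd : ∀ n m t, 0 ≤ t → ∀ f, ‖E n t f - E m t f‖ ≤ t * ‖L n f - L m f‖ :=
    fun n m t ht f => norm_exp_sub_exp_le (hcommL n m) (hEc n) (hEc m) ht f
  have hconv : ∀ t, 0 ≤ t → ∀ f, ∃ g, Tendsto (fun n => E n t f) atTop (𝓝 g) := by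
    intro t ht f
    refine cauchySeq_tendsto_of_complete (Metric.cauchySeq_iff.2 fun ε hε => ?_)
    obtain ⟨u, hu, hfu⟩ := hS.exists_dist_lt f (ε := ε / 3) (by positivity)
    obtain ⟨N, hN⟩ := Metric.cauchySeq_iff.1 (hLt ⟨u, hu⟩).cauchySeq (ε / (3 * (t + 1)))
      (by positivity)
    refine ⟨N, fun n hn m hm => ?_⟩
    have h1 := hEd n m t ht u
    have h2 := hN n hn m hm
    rw [dist_eq_norm] at h2 hfu ⊢
    have h3 : t * ‖L n u - L m u‖ ≤ ε / 3 := by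
      calc t * ‖L n u - L m u‖ ≤ (t + 1) * (ε / (3 * (t + 1))) := by gcongr; linarith
        _ = ε / 3 := by field_simp
    have h4 : ‖E n t f - E n t u‖ ≤ ‖f - u‖ := by rw [← map_sub]; exact hEc n t ht _
    have h5 : ‖E m t u - E m t f‖ ≤ ‖f - u‖ := by
      rw [← map_sub, norm_sub_rev f]; exact hEc m t ht _
    calc ‖E n t f - E m t f‖
        = ‖(E n t f - E n t u) + (E n t u - E m t u) + (E m t u - E m t f)‖ := by congr 1; abel
      _ ≤ _ := norm_add₃_le
      _ < ε := by linarith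
  have hT : ∀ t, ∃ T : X →L[ℝ] X, 0 ≤ t → ∀ f, Tendsto (fun n => E n t f) atTop (𝓝 (T f)) := by
    intro t
    by_cases ht : 0 ≤ t
    · choose g hg using hconv t ht
      refine ⟨continuousLinearMapOfTendsto (l := atTop) (fun n => E n t) (f := g) ?_, fun _ f => ?_⟩
      · exact tendsto_pi_nhds.2 hg
      · exact hg f
    · exact ⟨0, fun h => absurd h ht⟩
  choose T hT using hT
  have hTc : ∀ t, 0 ≤ t → ∀ f, ‖T t f‖ ≤ ‖f‖ := fun t ht f =>
    le_of_tendsto (hT t ht f).norm (Eventually.of_forall fun n => hEc n t ht f)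
  -- first order expansion of the approximating semigroups
  have hE1 : ∀ n t, 0 ≤ t → ∀ u z : S.domain,
      ‖E n t u - u - t • L n u‖ ≤ t * (2 * ‖L n u - z‖ + t * ‖S z‖) := by
    intro n t ht u z
    have hder : ∀ s ∈ Icc (0 : ℝ) t, HasDerivWithinAt (fun s : ℝ => E n s u - s • L n u)
        (E n s (L n u) - L n u) (Icc 0 t) s := by
      intro s _
      have h1 := hasDerivAt_exp_smul_const (𝕂 := ℝ) (L n) s
      have h2 := (ContinuousLinearMap.apply ℝ X (u : X)).hasFDerivAt.comp_hasDerivAt s h1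
      have h3 := h2.sub ((hasDerivAt_id s).smul_const (L n u))
      rw [one_smul] at h3
      exact h3.hasDerivWithinAt
    have hz : ∀ s, 0 ≤ s → ‖E n s z - z‖ ≤ s * ‖S z‖ := by
      intro s hs
      have := norm_exp_sub_exp_le (L := L n) (M := 0) (Commute.zero_right _) (hEc n)
        (fun s _ f => by simp) hs (z : X)
      simp only [smul_zero, NormedSpace.exp_zero, one_apply_eq_self,
        zero_apply, sub_zero] at this
      refine this.trans (mul_le_mul_of_nonneg_left ?_ hs)
      rw [hLS]; exact hRc n _
    have hb := norm_image_sub_le_of_norm_deriv_le_segment' hder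
      (C := 2 * ‖L n u - z‖ + t * ‖S z‖) (by
        intro s hs
        have h1 : ‖E n s (L n u) - E n s z‖ ≤ ‖L n u - z‖ := by
          rw [← map_sub]; exact hEc n s hs.1 _
        have h2 := hz s hs.1
        have h3 : s * ‖S z‖ ≤ t * ‖S z‖ := by gcongr; exact hs.2.le
        calc ‖E n s (L n u) - L n u‖
            = ‖(E n s (L n u) - E n s z) + (E n s z - z) + (z - L n u)‖ := by congr 1; abel
          _ ≤ _ := norm_add₃_le
          _ ≤ _ := by rw [norm_sub_rev (z : X)]; linarith) t (right_mem_Icc.2 ht)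
    simp only [zero_smul, sub_zero] at hb
    have h0 : E n 0 u = u := by simp [E]
    rw [h0] at hb
    calc _ = ‖E n t u - t • L n u - u‖ := by congr 1; abel
      _ ≤ _ := hb
      _ = _ := mul_comm _ _
  have hT1 : ∀ t, 0 ≤ t → ∀ u z : S.domain,
      ‖T t u - u - t • S u‖ ≤ t * (2 * ‖S u - z‖ + t * ‖S z‖) := by
    intro t ht u z
    refine le_of_tendsto_of_tendsto
      (((hT t ht u).sub_const (u : X)).sub ((hLt u).const_smul t)).norm ?_
      (Eventually.of_forall fun n => hE1 n t ht u z)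
    exact ((((hLt u).sub_const (z : X)).norm.const_mul 2).add_const _).const_mul t
  have hgen : ∀ u : S.domain,
      Tendsto (fun t : ℝ => t⁻¹ • (T t u - u)) (𝓝[>] 0) (𝓝 (S u)) := by
    intro u
    rw [Metric.tendsto_nhds]
    intro ε hε
    obtain ⟨z, hz, hfz⟩ := hS.exists_dist_lt (S u) (ε := ε / 4) (by positivity)
    have hsmall : ∀ᶠ t : ℝ in 𝓝[>] 0, t * ‖S ⟨z, hz⟩‖ < ε / 2 := by
      have : Tendsto (fun t : ℝ => t * ‖S ⟨z, hz⟩‖) (𝓝[>] 0) (𝓝 (0 * ‖S ⟨z, hz⟩‖)) :=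
        (tendsto_id.mono_left nhdsWithin_le_nhds).mul_const _
      rw [zero_mul] at this
      exact this.eventually_lt_const (by positivity)
    filter_upwards [hsmall, self_mem_nhdsWithin] with t ht ht0
    have ht0' : 0 < t := ht0
    have h1 := hT1 t ht0'.le u ⟨z, hz⟩
    rw [dist_eq_norm] at hfz ⊢
    have h2 : t⁻¹ • (T t u - u) - S u = t⁻¹ • (T t u - u - t • S u) := by
      rw [smul_sub t⁻¹ (T t u - u), smul_smul, inv_mul_cancel₀ ht0'.ne', one_smul]
    rw [h2, norm_smul, norm_inv, Real.norm_of_nonneg ht0'.le, inv_mul_lt_iff₀ ht0']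
    refine h1.trans_lt (mul_lt_mul_of_pos_left ?_ ht0')
    change 2 * ‖S u - z‖ + _ < ε
    linarith
  refine ⟨T, ⟨?_, fun t ht f => hTc t ht.le f, ?_⟩, ?_, ?_⟩
  · intro s t hs ht f
    have h1 : Tendsto (fun n => E n s (E n t f)) atTop (𝓝 (T s (T t f))) := by
      have h2 : Tendsto (fun n => E n s (E n t f - T t f)) atTop (𝓝 0) := by
        refine squeeze_zero_norm (fun n => hEc n s hs.le _) ?_
        have := ((hT t ht.le f).sub_const (T t f)).norm
        simpa using this
      have := h2.add (hT s hs.le (T t f))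
      simpa using this
    refine tendsto_nhds_unique (hT (s + t) (by positivity) f) (h1.congr fun n => ?_)
    have : E n (s + t) = E n s * E n t := by
      simp only [E]
      rw [add_smul, NormedSpace.exp_add_of_commute]
      exact ((Commute.refl (L n)).smul_left _).smul_right _
    rw [this]; rfl
  · intro f
    rw [Metric.tendsto_nhds]
    intro ε hε
    obtain ⟨u, hu, hfu⟩ := hS.exists_dist_lt f (ε := ε / 4) (by positivity)
    have h0 : Tendsto (fun t : ℝ => t • (t⁻¹ • (T t u - u))) (𝓝[>] 0)
        (𝓝 ((0 : ℝ) • S ⟨u, hu⟩)) :=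
      (tendsto_id.mono_left nhdsWithin_le_nhds).smul (hgen ⟨u, hu⟩)
    rw [zero_smul] at h0
    filter_upwards [(Metric.tendsto_nhds.1 h0) (ε / 4) (by positivity), self_mem_nhdsWithin]
      with t ht ht0
    have ht0' : 0 < t := ht0
    rw [smul_smul, mul_inv_cancel₀ ht0'.ne', one_smul, dist_zero_right] at ht
    have h4 : ‖T t f - T t u‖ ≤ ‖f - u‖ := by rw [← map_sub]; exact hTc t ht0'.le _
    rw [dist_eq_norm] at hfu ⊢
    calc ‖T t f - f‖ = ‖(T t f - T t u) + (T t u - u) + (u - f)‖ := by congr 1; abel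
      _ ≤ _ := norm_add₃_le
      _ < ε := by rw [norm_sub_rev u]; linarith
  · intro u w
    constructor
    · intro h
      rw [LinearPMap.mem_graph_iff] at h
      obtain ⟨y, rfl, rfl⟩ := h
      exact hgen y
    · intro h
      -- a contraction semigroup has no eigenvector with eigenvalue `1` of its generator
      obtain ⟨hv, hvf⟩ := (hG 1 one_pos).1 (u - w)
      set v : S.domain := ⟨G 1 (u - w), hv⟩
      have hvS : S v = v - (u - w) := by
        rw [one_smul] at hvf
        rw [eq_sub_iff_add_eq, add_comm, ← eq_sub_iff_add_eq]; exact hvf.symm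
      have hz : Tendsto (fun t : ℝ => t⁻¹ • (T t (u - v) - (u - v))) (𝓝[>] 0) (𝓝 (u - v)) := by
        have := h.sub (hgen v)
        rw [hvS] at this
        convert this using 2
        · rw [map_sub, ← smul_sub]; congr 1; abel
        · abel
      have huv : u - v = 0 := by
        by_contra hne
        have hpos : 0 < ‖u - (v : X)‖ := norm_pos_iff.2 hne
        obtain ⟨t, ht, ht0⟩ := (((Metric.tendsto_nhds.1 hz) _ hpos).and
          self_mem_nhdsWithin).exists
        have ht0' : 0 < t := ht0
        set z := u - (v : X)
        rw [dist_eq_norm] at ht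
        have h1 : (1 + t) • z = T t z - t • (t⁻¹ • (T t z - z) - z) := by
          have e : t • t⁻¹ • (T t z - z) = T t z - z := smul_inv_smul₀ ht0'.ne' _
          rw [smul_sub t (t⁻¹ • (T t z - z)) z, e, add_smul, one_smul]; abel
        have h2 : (1 + t) * ‖z‖ ≤ ‖z‖ + t * ‖t⁻¹ • (T t z - z) - z‖ := by
          calc (1 + t) * ‖z‖ = ‖(1 + t) • z‖ := by
                rw [norm_smul, Real.norm_of_nonneg (by positivity)]
            _ ≤ ‖T t z‖ + ‖t • (t⁻¹ • (T t z - z) - z)‖ := by rw [h1]; exact norm_sub_le _ _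
            _ ≤ _ := by
              rw [norm_smul, Real.norm_of_nonneg ht0'.le]
              gcongr
              exact hTc t ht0'.le z
        nlinarith
      rw [LinearPMap.mem_graph_iff]
      have huv' : (v : X) = u := (sub_eq_zero.1 huv).symm
      refine ⟨v, huv', ?_⟩
      rw [hvS, huv']; abel
  · intro C hC hCc hinv t ht f hf
    refine hCc.mem_of_tendsto (hT t ht.le f) (Eventually.of_forall fun n => ?_)
    rw [hEeq]
    exact exp_smul_sub_one_mem hC hCc (fun g hg => hinv _ (ha n) g hg)
      (mul_nonneg ht.le (ha n).le) hf

end HilleYosida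

/-! ### Smooth truncations of the real line -/

section Truncation

/-- A smooth, bounded and increasing function with bounded derivative that vanishes at `0`. Such
functions replace the usual truncations, which are only Lipschitz. -/
structure IsTruncation (h : ℝ → ℝ) : Prop where
  contDiff : ContDiff ℝ ∞ h
  zero : h 0 = 0
  mono : Monotone h
  bdd : ∃ C, ∀ s, |h s| ≤ C
  bdd_deriv : ∃ C, ∀ s, deriv h s ≤ C

theorem hasDerivAt_of_contDiff {h : ℝ → ℝ} (hh : ContDiff ℝ ∞ h) (s : ℝ) :
    HasDerivAt h (deriv h s) s :=
  ((hh.differentiable (by simp)) s).hasDerivAt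

theorem contDiff_deriv {h : ℝ → ℝ} (hh : ContDiff ℝ ∞ h) : ContDiff ℝ ∞ (deriv h) :=
  (contDiff_infty_iff_deriv.1 hh).2

theorem IsTruncation.deriv_nonneg {h : ℝ → ℝ} (hh : IsTruncation h) (s : ℝ) : 0 ≤ deriv h s :=
  hh.mono.deriv_nonneg

theorem IsTruncation.abs_deriv_le {h : ℝ → ℝ} (hh : IsTruncation h) :
    ∃ C, ∀ s, |deriv h s| ≤ C := by
  obtain ⟨C, hC⟩ := hh.bdd_deriv
  exact ⟨C, fun s => by rw [abs_of_nonneg (hh.deriv_nonneg s)]; exact hC s⟩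

theorem abs_sub_le_of_abs_deriv_le {h : ℝ → ℝ} (hh : ContDiff ℝ ∞ h) {C : ℝ}
    (hC : ∀ s, |deriv h s| ≤ C) (s t : ℝ) : |h s - h t| ≤ C * |s - t| := by
  have := convex_univ.norm_image_sub_le_of_norm_deriv_le (f := h) (x := t) (y := s) (C := C)
    (fun x _ => hh.differentiable (by simp) x) (fun x _ => hC x) (mem_univ _) (mem_univ _)
  simpa using this

theorem abs_le_of_abs_deriv_le {h : ℝ → ℝ} (hh : ContDiff ℝ ∞ h) (h0 : h 0 = 0) {C : ℝ}
    (hC : ∀ s, |deriv h s| ≤ C) (s : ℝ) : |h s| ≤ C * |s| := by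
  simpa [h0] using abs_sub_le_of_abs_deriv_le hh hC s 0

theorem exists_primitive {h : ℝ → ℝ} (hh : ContDiff ℝ ∞ h) :
    ∃ H : ℝ → ℝ, ContDiff ℝ ∞ H ∧ H 0 = 0 ∧ deriv H = h := by
  have hd : ∀ s, HasDerivAt (fun s => ∫ x in (0 : ℝ)..s, h x) (h s) s := fun s =>
    (hh.continuous.integral_hasStrictDerivAt 0 s).hasDerivAt
  have hd' : deriv (fun s => ∫ x in (0 : ℝ)..s, h x) = h := funext fun s => (hd s).deriv
  exact ⟨_, contDiff_infty_iff_deriv.2 ⟨fun s => (hd s).differentiableAt, by rwa [hd']⟩,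
    by simp, hd'⟩

theorem smoothTransition_contDiff : ContDiff ℝ ∞ Real.smoothTransition :=
  Real.smoothTransition.contDiff

theorem exists_deriv_smoothTransition_le : ∃ C, ∀ s, deriv Real.smoothTransition s ≤ C := by
  obtain ⟨C, hC⟩ := (isCompact_Icc (a := (0 : ℝ)) (b := 1)).exists_bound_of_continuousOn
    (contDiff_deriv smoothTransition_contDiff).continuous.continuousOn
  have hC0 : 0 ≤ C := (norm_nonneg _).trans (hC 0 (by simp))
  refine ⟨C, fun s => ?_⟩
  by_cases hs : s ∈ Icc (0 : ℝ) 1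
  · exact (le_abs_self _).trans (hC s hs)
  · rw [mem_Icc, not_and_or, not_le, not_le] at hs
    have : deriv Real.smoothTransition s = 0 := by
      rcases hs with hs | hs
      · have : Real.smoothTransition =ᶠ[𝓝 s] fun _ => 0 := by
          filter_upwards [Iio_mem_nhds hs] with x hx
          exact Real.smoothTransition.zero_of_nonpos hx.le
        rw [this.deriv_eq, deriv_const]
      · have : Real.smoothTransition =ᶠ[𝓝 s] fun _ => 1 := by
          filter_upwards [Ioi_mem_nhds hs] with x hx
          exact Real.smoothTransition.one_of_one_le hx.le
        rw [this.deriv_eq, deriv_const]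
    rw [this]; exact hC0

theorem IsTruncation.smoothTransition {M j : ℝ} (hM : 0 ≤ M) (hj : 0 ≤ j) :
    IsTruncation fun s => Real.smoothTransition (j * (s - M)) := by
  refine ⟨?_, ?_, ?_, ⟨1, fun s => ?_⟩, ?_⟩
  · exact smoothTransition_contDiff.comp (by fun_prop)
  · exact Real.smoothTransition.zero_of_nonpos (by nlinarith)
  · exact fun s t hst => Real.smoothTransition.monotone (by gcongr)
  · rw [abs_of_nonneg (Real.smoothTransition.nonneg _)]
    exact Real.smoothTransition.le_one _
  · obtain ⟨C, hC⟩ := exists_deriv_smoothTransition_le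
    refine ⟨C * j, fun s => ?_⟩
    have h1 : HasDerivAt (fun s : ℝ => j * (s - M)) (j * 1) s :=
      ((hasDerivAt_id s).sub_const M).const_mul j
    have := (hasDerivAt_of_contDiff smoothTransition_contDiff (j * (s - M))).comp s h1
    rw [mul_one] at this
    have h2 : deriv (fun s => Real.smoothTransition (j * (s - M))) s = _ := this.deriv
    rw [h2]
    exact mul_le_mul_of_nonneg_right (hC _) hj

theorem IsTruncation.neg_comp_neg {h : ℝ → ℝ} (hh : IsTruncation h) :
    IsTruncation fun s => -h (-s) := by
  obtain ⟨C, hC⟩ := hh.bdd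
  obtain ⟨C', hC'⟩ := hh.bdd_deriv
  refine ⟨(hh.contDiff.comp contDiff_neg).neg, by simp [hh.zero], fun s t hst => ?_,
    ⟨C, fun s => by simpa using hC _⟩, ⟨C', fun s => ?_⟩⟩
  · exact neg_le_neg (hh.mono (neg_le_neg hst))
  · have := ((hasDerivAt_of_contDiff hh.contDiff (-s)).comp s (hasDerivAt_neg s)).neg
    have h2 : deriv (fun s => -h (-s)) s = _ := this.deriv
    rw [h2]
    simpa using hC' _

theorem IsTruncation.add {h k : ℝ → ℝ} (hh : IsTruncation h) (hk : IsTruncation k) :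
    IsTruncation fun s => h s + k s := by
  obtain ⟨C, hC⟩ := hh.bdd
  obtain ⟨C', hC'⟩ := hh.bdd_deriv
  obtain ⟨D, hD⟩ := hk.bdd
  obtain ⟨D', hD'⟩ := hk.bdd_deriv
  refine ⟨hh.contDiff.add hk.contDiff, by simp [hh.zero, hk.zero], hh.mono.add hk.mono,
    ⟨C + D, fun s => (abs_add_le _ _).trans (add_le_add (hC s) (hD s))⟩, ⟨C' + D', fun s => ?_⟩⟩
  have h2 : deriv (fun s => h s + k s) s = _ :=
    ((hasDerivAt_of_contDiff hh.contDiff s).add (hasDerivAt_of_contDiff hk.contDiff s)).deriv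
  rw [h2]
  exact add_le_add (hC' s) (hD' s)

/-- A smooth approximation of the sign, which vanishes on `[-M, M]`. -/
def smoothSign (M j s : ℝ) : ℝ :=
  Real.smoothTransition (j * (s - M)) + -Real.smoothTransition (j * (-s - M))

theorem isTruncation_smoothSign {M j : ℝ} (hM : 0 ≤ M) (hj : 0 ≤ j) :
    IsTruncation (smoothSign M j) :=
  (IsTruncation.smoothTransition hM hj).add (IsTruncation.smoothTransition hM hj).neg_comp_neg

theorem smoothSign_eq_zero {M j s : ℝ} (hj : 0 ≤ j) (hs : |s| ≤ M) : smoothSign M j s = 0 := by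
  obtain ⟨h1, h2⟩ := abs_le.1 hs
  rw [smoothSign, Real.smoothTransition.zero_of_nonpos, Real.smoothTransition.zero_of_nonpos]
  · simp
  · exact mul_nonpos_of_nonneg_of_nonpos hj (by linarith)
  · exact mul_nonpos_of_nonneg_of_nonpos hj (by linarith)

theorem abs_smoothSign_le_one {M j : ℝ} (s : ℝ) : |smoothSign M j s| ≤ 1 := by
  have h1 := Real.smoothTransition.nonneg (j * (s - M))
  have h2 := Real.smoothTransition.le_one (j * (s - M))
  have h3 := Real.smoothTransition.nonneg (j * (-s - M))
  have h4 := Real.smoothTransition.le_one (j * (-s - M))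
  rw [smoothSign, abs_le]
  constructor <;> linarith

theorem tendsto_mul_smoothSign (s : ℝ) :
    Tendsto (fun n : ℕ => s * smoothSign 0 n s) atTop (𝓝 |s|) := by
  rcases eq_or_ne s 0 with rfl | hs
  · simp
  have hs' : 0 < |s| := abs_pos.2 hs
  refine tendsto_const_nhds.congr' ?_
  obtain ⟨N, hN⟩ := exists_nat_ge (1 / |s|)
  filter_upwards [eventually_ge_atTop N] with n hn
  have h1 : 1 ≤ n * |s| := by
    rw [div_le_iff₀ hs'] at hN
    have : (N : ℝ) ≤ n := by exact_mod_cast hn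
    nlinarith
  rcases lt_or_gt_of_ne hs with h | h
  · rw [abs_of_neg h] at h1 ⊢
    rw [smoothSign, Real.smoothTransition.zero_of_nonpos (by nlinarith),
      Real.smoothTransition.one_of_one_le (by linarith)]
    ring
  · rw [abs_of_pos h] at h1 ⊢
    rw [smoothSign, Real.smoothTransition.one_of_one_le (by linarith),
      Real.smoothTransition.zero_of_nonpos (by nlinarith)]
    ring

/-- A truncation `h` that is the identity on `[-M, M]`, together with a truncation `k` that vanishes
there and whose derivative dominates the second derivative of `h`. -/
theorem exists_truncation_eq_self {M : ℝ} (hM : 0 ≤ M) :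
    ∃ h k : ℝ → ℝ, IsTruncation h ∧ IsTruncation k ∧ (∀ s, deriv h s ≤ 1) ∧
      (∀ s, |s| ≤ M → h s = s ∧ deriv h s = 1 ∧ k s = 0) ∧
      ∀ s, |deriv (deriv h) s| ≤ deriv k s := by
  -- `h` is the primitive of a cutoff function `χ` of `[-M, M]`, and `k' = |χ'|`
  let χ : ℝ → ℝ := fun s => 1 - Real.smoothTransition (s - M) - Real.smoothTransition (-s - M)
  have hχ : ContDiff ℝ ∞ χ :=
    (contDiff_const.sub (smoothTransition_contDiff.comp (by fun_prop))).sub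
      (smoothTransition_contDiff.comp (by fun_prop))
  obtain ⟨h, hh, h0, hder⟩ := exists_primitive hχ
  have hχ0 : ∀ s, 0 ≤ χ s := by
    intro s
    simp only [χ]
    rcases le_total s 0 with hs | hs
    · rw [Real.smoothTransition.zero_of_nonpos (x := s - M) (by linarith)]
      linarith [Real.smoothTransition.le_one (-s - M)]
    · rw [Real.smoothTransition.zero_of_nonpos (x := -s - M) (by linarith)]
      linarith [Real.smoothTransition.le_one (s - M)]
  have hχ1 : ∀ s, χ s ≤ 1 := fun s => by
    simp only [χ]
    linarith [Real.smoothTransition.nonneg (s - M), Real.smoothTransition.nonneg (-s - M)]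
  have hχM : ∀ s, |s| ≤ M → χ s = 1 := by
    intro s hs
    obtain ⟨h1, h2⟩ := abs_le.1 hs
    simp only [χ]
    rw [Real.smoothTransition.zero_of_nonpos (by linarith),
      Real.smoothTransition.zero_of_nonpos (by linarith)]
    simp
  have hχout : ∀ s, M + 1 ≤ |s| → χ s = 0 := by
    intro s hs
    simp only [χ]
    rcases le_abs.1 hs with hs | hs
    · rw [Real.smoothTransition.one_of_one_le (by linarith),
        Real.smoothTransition.zero_of_nonpos (by linarith)]
      simp
    · rw [Real.smoothTransition.zero_of_nonpos (by linarith),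
        Real.smoothTransition.one_of_one_le (by linarith)]
      simp
  have hmono : Monotone h := monotone_of_deriv_nonneg (hh.differentiable (by simp))
    (fun s => by rw [hder]; exact hχ0 s)
  have hlip : ∀ s, |h s| ≤ 1 * |s| := abs_le_of_abs_deriv_le hh h0 (fun s => by
    rw [hder, abs_of_nonneg (hχ0 s)]; exact hχ1 s)
  have hconst : ∀ D : Set ℝ, Convex ℝ D → (∀ s ∈ D, χ s = 0) →
      ∀ s ∈ D, ∀ t ∈ D, h s = h t := by
    intro D hD hz s hs t ht
    have := hD.norm_image_sub_le_of_norm_deriv_le (f := h) (x := t) (y := s) (C := 0)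
      (fun x _ => hh.differentiable (by simp) x) (fun x hx => by rw [hder, hz x hx]; simp) ht hs
    rw [zero_mul] at this
    exact sub_eq_zero.1 (norm_le_zero_iff.1 this)
  have hbdd : ∀ s, |h s| ≤ M + 1 := by
    intro s
    rcases le_total |s| (M + 1) with hs | hs
    · exact (hlip s).trans (by linarith)
    · rcases le_abs.1 hs with hs | hs
      · rw [hconst (Ici (M + 1)) (convex_Ici _) (fun x hx => hχout x (le_abs.2 (Or.inl hx))) s hs
          (M + 1) self_mem_Ici]
        refine (hlip _).trans ?_
        rw [one_mul, abs_of_nonneg (by linarith)]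
      · rw [hconst (Iic (-(M + 1))) (convex_Iic _)
          (fun x hx => hχout x (le_abs.2 (Or.inr (by simpa using neg_le_neg (mem_Iic.1 hx))))) s
          (by simpa using neg_le_neg hs) (-(M + 1)) self_mem_Iic]
        refine (hlip _).trans ?_
        rw [one_mul, abs_neg, abs_of_nonneg (by linarith)]
  have hid : ∀ s, |s| ≤ M → h s = s := by
    intro s hs
    have h1 : ∀ x ∈ Icc (-M) M, ‖deriv (fun y => h y - y) x‖ ≤ 0 := by
      intro x hx
      have : deriv (fun y => h y - y) x = _ :=
        ((hasDerivAt_of_contDiff hh x).sub (hasDerivAt_id x)).deriv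
      rw [this, hder, hχM x (abs_le.2 hx)]
      simp
    have := (convex_Icc (-M) M).norm_image_sub_le_of_norm_deriv_le (f := fun y => h y - y) (x := 0)
      (y := s) (C := 0) (fun x _ => (hh.differentiable (by simp) x).sub differentiableAt_id) h1
      (by constructor <;> linarith) (abs_le.1 hs)
    rw [zero_mul] at this
    have := norm_le_zero_iff.1 this
    rw [h0] at this
    linarith
  have htr : ∀ s, HasDerivAt (fun s => Real.smoothTransition (s - M))
      (deriv Real.smoothTransition (s - M)) s := fun s => by
    have := (hasDerivAt_of_contDiff smoothTransition_contDiff (s - M)).comp s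
      ((hasDerivAt_id s).sub_const M)
    rwa [mul_one] at this
  have htl : ∀ s, HasDerivAt (fun s => Real.smoothTransition (-s - M))
      (-deriv Real.smoothTransition (-s - M)) s := fun s => by
    have := (hasDerivAt_of_contDiff smoothTransition_contDiff (-s - M)).comp s
      ((hasDerivAt_neg s).sub_const M)
    rwa [mul_neg, mul_one] at this
  have hderiv : ∀ s, 0 ≤ deriv Real.smoothTransition s := fun s =>
    Real.smoothTransition.monotone.deriv_nonneg
  refine ⟨h, smoothSign M 1, ⟨hh, h0, hmono, ⟨M + 1, hbdd⟩, 1, fun s => ?_⟩,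
    isTruncation_smoothSign hM zero_le_one, fun s => ?_, fun s hs => ⟨hid s hs, ?_, ?_⟩,
    fun s => ?_⟩
  · rw [hder]; exact hχ1 s
  · rw [hder]; exact hχ1 s
  · rw [hder]; exact hχM s hs
  · exact smoothSign_eq_zero zero_le_one hs
  · have h1 : deriv χ s =
        0 - deriv Real.smoothTransition (s - M) - -deriv Real.smoothTransition (-s - M) :=
      (((hasDerivAt_const s (1 : ℝ)).sub (htr s)).sub (htl s)).deriv
    have h2 : deriv (smoothSign M 1) s =
        deriv Real.smoothTransition (s - M) + - -deriv Real.smoothTransition (-s - M) := by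
      have : smoothSign M 1 = fun s =>
          Real.smoothTransition (s - M) + -Real.smoothTransition (-s - M) := by
        funext s; simp [smoothSign,]
      rw [this]
      exact ((htr s).add (htl s).neg).deriv
    rw [hder, h1, h2, abs_le]
    constructor <;> linarith [hderiv (s - M), hderiv (-s - M)]

/-- Smooth nonnegative approximations of the positive part. -/
theorem exists_smooth_posPart {ε : ℝ} (hε : 0 < ε) :
    ∃ g : ℝ → ℝ, ContDiff ℝ ∞ g ∧ g 0 = 0 ∧ (∀ s, 0 ≤ g s) ∧ (∀ s, |deriv g s| ≤ 1) ∧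
      ∀ s, 0 ≤ s → |g s - s| ≤ ε := by
  have hstc : ContDiff ℝ ∞ (fun s => Real.smoothTransition (ε⁻¹ * s)) :=
    smoothTransition_contDiff.comp (by fun_prop)
  obtain ⟨g, hg, h0, hder⟩ := exists_primitive hstc
  have hd1 : ∀ s, |deriv g s| ≤ 1 := fun s => by
    rw [hder, abs_of_nonneg (Real.smoothTransition.nonneg _)]
    exact Real.smoothTransition.le_one _
  have hmono : Monotone g := monotone_of_deriv_nonneg (hg.differentiable (by simp))
    (fun s => by rw [hder]; exact Real.smoothTransition.nonneg _)
  have hneg : ∀ s, s ≤ 0 → g s = 0 := by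
    intro s hs
    have := (convex_Iic (0 : ℝ)).norm_image_sub_le_of_norm_deriv_le (f := g) (x := 0) (y := s)
      (C := 0) (fun x _ => hg.differentiable (by simp) x) (fun x hx => by
        simp only [hder]
        rw [Real.smoothTransition.zero_of_nonpos
          (mul_nonpos_of_nonneg_of_nonpos (by positivity) hx)]
        simp) self_mem_Iic hs
    rw [zero_mul, h0, sub_zero] at this
    exact norm_le_zero_iff.1 this
  refine ⟨g, hg, h0, fun s => ?_, hd1, fun s hs => ?_⟩
  · rcases le_total s 0 with hs | hs
    · exact (hneg s hs).ge
    · exact h0.ge.trans (hmono hs)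
  · have hsub : ∀ x, deriv (fun y => y - g y) x = 1 - Real.smoothTransition (ε⁻¹ * x) := by
      intro x
      have : deriv (fun y => y - g y) x = _ :=
        ((hasDerivAt_id x).sub (hasDerivAt_of_contDiff hg x)).deriv
      rw [this, hder]
    have hdiff : Differentiable ℝ fun y => y - g y :=
      differentiable_id.sub (hg.differentiable (by simp))
    have hup : ∀ x, 0 ≤ x → x - g x ≤ x := fun x hx => by linarith [h0.ge.trans (hmono hx)]
    have hmono2 : Monotone fun y => y - g y := monotone_of_deriv_nonneg hdiff
      (fun x => by rw [hsub]; linarith [Real.smoothTransition.le_one (ε⁻¹ * x)])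
    have hlow : 0 ≤ s - g s := by simpa [h0] using hmono2 hs
    have hle : s - g s ≤ ε := by
      rcases le_total s ε with hsε | hsε
      · exact (hup s hs).trans hsε
      · have := (convex_Ici ε).norm_image_sub_le_of_norm_deriv_le (f := fun y => y - g y) (x := ε)
          (y := s) (C := 0) (fun x _ => hdiff x) (fun x hx => by
            rw [hsub, Real.smoothTransition.one_of_one_le]
            · simp
            · rw [inv_mul_eq_div, le_div_iff₀ hε, one_mul]; exact hx) self_mem_Ici hsε
        rw [zero_mul] at this
        have := norm_le_zero_iff.1 this
        linarith [hup ε hε.le]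
    rw [abs_le]
    constructor <;> linarith

end Truncation

/-! ### Dissipative operators on `L¹` and their semigroups -/

section Dissipative

/-- A convergent sequence in `L^p` has an a.e. convergent subsequence. -/
theorem exists_subseq_tendsto_ae {α : Type*} {F : Type*} [MeasurableSpace α]
    [NormedAddCommGroup F] {ν : Measure α} {p : ℝ≥0∞} [Fact (1 ≤ p)] {f : ℕ → Lp F p ν}
    {g : Lp F p ν} (h : Tendsto f atTop (𝓝 g)) :
    ∃ ns : ℕ → ℕ, StrictMono ns ∧
      ∀ᵐ x ∂ν, Tendsto (fun n => (f (ns n) : α → F) x) atTop (𝓝 (g x)) :=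
  (tendstoInMeasure_of_tendsto_Lp h).exists_seq_tendsto_ae

variable {d : ℕ} {ν : Measure (Sp d)}

/-- A linear relation `𝒮` on `L¹(ν)` with `∫ y h(u) dν ≤ 0` for all `(u, y) ∈ 𝒮` and all truncations
`h`. -/
def TruncationDissipative (𝒮 : Set (Lp ℝ 1 ν × Lp ℝ 1 ν)) : Prop :=
  ∀ p ∈ 𝒮, ∀ h : ℝ → ℝ, IsTruncation h → ∫ x, p.2 x * h (p.1 x) ∂ν ≤ 0

theorem L1_integrable (f : Lp ℝ 1 ν) : Integrable f ν := L1.integrable_coeFn f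

theorem integrable_mul_comp {f g : Sp d → ℝ} (hf : Integrable f ν) (hg : AEStronglyMeasurable g ν)
    {h : ℝ → ℝ} (hc : Continuous h) {C : ℝ} (hb : ∀ s, |h s| ≤ C) :
    Integrable (fun x => f x * h (g x)) ν :=
  hf.mul_bdd (c := C) (hc.comp_aestronglyMeasurable hg) (Eventually.of_forall fun _ => hb _)

theorem L1_smul_sub_ae (α : ℝ) (u y : Lp ℝ 1 ν) :
    ∀ᵐ x ∂ν, (α • u - y : Lp ℝ 1 ν) x = α * u x - y x := by
  filter_upwards [Lp.coeFn_sub (α • u) y, Lp.coeFn_smul α u] with x h1 h2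
  rw [h1, Pi.sub_apply, h2, Pi.smul_apply, smul_eq_mul]

namespace TruncationDissipative

variable {𝒮 : Set (Lp ℝ 1 ν × Lp ℝ 1 ν)}

theorem integral_mul_le (h𝒮 : TruncationDissipative 𝒮) {p : Lp ℝ 1 ν × Lp ℝ 1 ν} (hp : p ∈ 𝒮)
    (α : ℝ) {h : ℝ → ℝ} (hh : IsTruncation h) :
    ∫ x, (α * p.1 x - (α • p.1 - p.2 : Lp ℝ 1 ν) x) * h (p.1 x) ∂ν ≤ 0 := by
  refine le_trans (le_of_eq (integral_congr_ae ?_)) (h𝒮 p hp h hh)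
  filter_upwards [L1_smul_sub_ae α p.1 p.2] with x hx
  rw [hx]; ring

theorem norm_smul_le (h𝒮 : TruncationDissipative 𝒮) {p : Lp ℝ 1 ν × Lp ℝ 1 ν} (hp : p ∈ 𝒮)
    {α : ℝ} (hα : 0 < α) : ‖α • p.1‖ ≤ ‖α • p.1 - p.2‖ := by
  have hu := L1_integrable p.1
  have hf := L1_integrable (α • p.1 - p.2)
  have hlim : Tendsto (fun n : ℕ => ∫ x, p.1 x * smoothSign 0 n (p.1 x) ∂ν) atTop
      (𝓝 (∫ x, |p.1 x| ∂ν)) := by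
    refine tendsto_integral_of_dominated_convergence (fun x => |p.1 x|) (fun n => ?_) hu.abs
      (fun n => Eventually.of_forall fun x => ?_)
      (Eventually.of_forall fun x => tendsto_mul_smoothSign _)
    · exact (integrable_mul_comp hu hu.aestronglyMeasurable
        (isTruncation_smoothSign le_rfl n.cast_nonneg).contDiff.continuous
        abs_smoothSign_le_one).aestronglyMeasurable
    · rw [Real.norm_eq_abs, abs_mul]
      exact mul_le_of_le_one_right (abs_nonneg _) (abs_smoothSign_le_one _)
  have hb : ∀ n : ℕ, α * ∫ x, p.1 x * smoothSign 0 n (p.1 x) ∂ν ≤ ‖α • p.1 - p.2‖ := by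
    intro n
    have htr := isTruncation_smoothSign le_rfl (n.cast_nonneg (α := ℝ))
    have h1 := h𝒮.integral_mul_le hp α htr
    have i1 : Integrable (fun x => p.1 x * smoothSign 0 n (p.1 x)) ν :=
      integrable_mul_comp hu hu.aestronglyMeasurable htr.contDiff.continuous abs_smoothSign_le_one
    have i2 : Integrable
        (fun x => (α • p.1 - p.2 : Lp ℝ 1 ν) x * smoothSign 0 n (p.1 x)) ν :=
      integrable_mul_comp hf hu.aestronglyMeasurable htr.contDiff.continuous abs_smoothSign_le_one
    have h2 : ∫ x, (α * p.1 x - (α • p.1 - p.2 : Lp ℝ 1 ν) x) * smoothSign 0 n (p.1 x) ∂ν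
        = α * ∫ x, p.1 x * smoothSign 0 n (p.1 x) ∂ν
          - ∫ x, (α • p.1 - p.2 : Lp ℝ 1 ν) x * smoothSign 0 n (p.1 x) ∂ν := by
      rw [← integral_const_mul, ← integral_sub (i1.const_mul α) i2]
      congr 1; funext x; ring
    have h3 : ∫ x, (α • p.1 - p.2 : Lp ℝ 1 ν) x * smoothSign 0 n (p.1 x) ∂ν
        ≤ ‖α • p.1 - p.2‖ := by
      rw [L1.norm_eq_integral_norm]
      refine integral_mono i2 hf.norm fun x => (le_abs_self _).trans ?_
      rw [abs_mul]
      exact mul_le_of_le_one_right (abs_nonneg _) (abs_smoothSign_le_one _)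
    linarith
  rw [norm_smul, Real.norm_of_nonneg hα.le, L1.norm_eq_integral_norm]
  exact le_of_tendsto (hlim.const_mul α) (Eventually.of_forall hb)

/-- The maximum principle. -/
theorem smul_le (h𝒮 : TruncationDissipative 𝒮) {p : Lp ℝ 1 ν × Lp ℝ 1 ν} (hp : p ∈ 𝒮)
    {α c : ℝ} (hα : 0 < α) (hc : 0 ≤ c) (hf : ∀ᵐ x ∂ν, (α • p.1 - p.2 : Lp ℝ 1 ν) x ≤ c) :
    ∀ᵐ x ∂ν, α * p.1 x ≤ c := by
  have htr := IsTruncation.smoothTransition (M := c / α) (by positivity) zero_le_one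
  have h1 := h𝒮.integral_mul_le hp α htr
  obtain ⟨C, hC⟩ := htr.bdd
  have hi : Integrable (fun x => (α * p.1 x - (α • p.1 - p.2 : Lp ℝ 1 ν) x) *
      Real.smoothTransition (1 * (p.1 x - c / α))) ν :=
    integrable_mul_comp (((L1_integrable p.1).const_mul α).sub (L1_integrable _))
      (L1_integrable p.1).aestronglyMeasurable htr.contDiff.continuous hC
  have h0 : 0 ≤ᵐ[ν] fun x => (α * p.1 x - (α • p.1 - p.2 : Lp ℝ 1 ν) x) *
      Real.smoothTransition (1 * (p.1 x - c / α)) := by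
    filter_upwards [hf] with x hx
    rcases le_total (α * p.1 x) c with h | h
    · rw [Real.smoothTransition.zero_of_nonpos, mul_zero]; rfl
      rw [one_mul, sub_nonpos, le_div_iff₀ hα, mul_comm]; exact h
    · exact mul_nonneg (by linarith) (Real.smoothTransition.nonneg _)
  have hz := (integral_eq_zero_iff_of_nonneg_ae h0 hi).1
    (le_antisymm h1 (integral_nonneg_of_ae h0))
  filter_upwards [hf, hz] with x hx hz
  by_contra! hlt
  have hpos : 0 < Real.smoothTransition (1 * (p.1 x - c / α)) := by
    refine Real.smoothTransition.pos_of_pos ?_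
    rw [one_mul, sub_pos, div_lt_iff₀ hα, mul_comm]; exact hlt
  have : 0 < (α * p.1 x - (α • p.1 - p.2 : Lp ℝ 1 ν) x) *
      Real.smoothTransition (1 * (p.1 x - c / α)) := mul_pos (by linarith) hpos
  exact this.ne' hz

theorem nonneg (h𝒮 : TruncationDissipative 𝒮) (hneg : ∀ p ∈ 𝒮, -p ∈ 𝒮)
    {p : Lp ℝ 1 ν × Lp ℝ 1 ν} (hp : p ∈ 𝒮)
    {α : ℝ} (hα : 0 < α) (hf : 0 ≤ α • p.1 - p.2) : 0 ≤ p.1 := by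
  have h := h𝒮.smul_le (hneg p hp) hα le_rfl (by
    have e : α • (-p).1 - (-p).2 = -(α • p.1 - p.2) := by
      rw [Prod.fst_neg, Prod.snd_neg, smul_neg]; abel
    rw [e]
    filter_upwards [Lp.coeFn_neg (α • p.1 - p.2), (Lp.coeFn_nonneg _).2 hf] with x h1 h2
    rw [h1, Pi.neg_apply]
    simpa using h2)
  rw [← Lp.coeFn_nonneg]
  filter_upwards [h, Lp.coeFn_neg p.1] with x h1 h2
  rw [Prod.fst_neg, h2, Pi.neg_apply] at h1
  have : 0 ≤ α * p.1 x := by linarith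
  exact nonneg_of_mul_nonneg_right this hα

end TruncationDissipative

/-- The set of functions with values in `[0, 1]`. -/
def unitSet (ν : Measure (Sp d)) : Set (Lp ℝ 1 ν) := {f | ∀ᵐ x ∂ν, 0 ≤ f x ∧ f x ≤ 1}

theorem isClosed_unitSet : IsClosed (unitSet ν) := by
  refine IsSeqClosed.isClosed fun f g hf hg => ?_
  obtain ⟨ns, -, hns⟩ := exists_subseq_tendsto_ae hg
  have hall : ∀ᵐ x ∂ν, ∀ n, 0 ≤ f n x ∧ f n x ≤ 1 := ae_all_iff.2 hf
  filter_upwards [hns, hall] with x hx hf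
  exact ⟨ge_of_tendsto' hx fun n => (hf _).1, le_of_tendsto' hx fun n => (hf _).2⟩

theorem convex_unitSet : Convex ℝ (unitSet ν) := by
  intro f hf g hg a b ha hb hab
  filter_upwards [hf, hg, Lp.coeFn_add (a • f) (b • g), Lp.coeFn_smul a f, Lp.coeFn_smul b g]
    with x h1 h2 h3 h4 h5
  rw [h3, Pi.add_apply, h4, h5]
  simp only [Pi.smul_apply, smul_eq_mul]
  constructor
  · exact add_nonneg (mul_nonneg ha h1.1) (mul_nonneg hb h2.1)
  · nlinarith

/-- A truncation dissipative relation with full range and dense domain is the graph of the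
generator of a sub-Markovian semigroup. It is closed because the resolvent is defined everywhere. -/
theorem TruncationDissipative.exists_generator {𝒮 : Submodule ℝ (Lp ℝ 1 ν × Lp ℝ 1 ν)}
    (h𝒮 : TruncationDissipative (𝒮 : Set (Lp ℝ 1 ν × Lp ℝ 1 ν)))
    (hrange : ∀ α : ℝ, 0 < α → ∀ f, ∃ p ∈ 𝒮, α • p.1 - p.2 = f)
    (hdense : Dense (Prod.fst '' (𝒮 : Set (Lp ℝ 1 ν × Lp ℝ 1 ν)))) :
    ∃ (S : Lp ℝ 1 ν →ₗ.[ℝ] Lp ℝ 1 ν) (G : ℝ → Lp ℝ 1 ν →L[ℝ] Lp ℝ 1 ν),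
      S.graph = 𝒮 ∧ S.IsClosed ∧ GeneratesSubMarkovian S ∧
      ∀ α, 0 < α → IsResolvent S α (G α) ∧ ∀ f, (G α f, α • G α f - f) ∈ 𝒮 := by
  have hsv : ∀ p ∈ 𝒮, p.1 = 0 → p.2 = 0 := by
    rintro ⟨u, y⟩ hp (rfl : u = 0)
    -- compare with elements of the domain close to `y`
    have key : ∀ q ∈ 𝒮, ‖q.1‖ ≤ ‖q.1 - y‖ := by
      intro q hq
      have h1 : ∀ n : ℕ, ‖q.1‖ ≤ ‖q.1 - y - ((n : ℝ) + 1)⁻¹ • q.2‖ := by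
        intro n
        have hn : (0 : ℝ) < (n : ℝ) + 1 := by positivity
        have := h𝒮.norm_smul_le
          (𝒮.add_mem hp (𝒮.smul_mem (((n : ℝ) + 1)⁻¹) hq)) hn
        simp only [Prod.fst_add, Prod.snd_add, Prod.smul_fst, Prod.smul_snd, zero_add] at this
        rw [smul_inv_smul₀ hn.ne', ← sub_sub] at this
        exact this
      have h2 : Tendsto (fun n : ℕ => ‖q.1 - y - ((n : ℝ) + 1)⁻¹ • q.2‖) atTop
          (𝓝 ‖q.1 - y - (0 : ℝ) • q.2‖) := by
        refine (tendsto_const_nhds.sub (Tendsto.smul_const ?_ _)).norm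
        simpa [one_div] using tendsto_one_div_add_atTop_nhds_zero_nat (𝕜 := ℝ)
      rw [zero_smul, sub_zero] at h2
      exact ge_of_tendsto' h2 h1
    by_contra hy
    have hpos : 0 < ‖y‖ := norm_pos_iff.2 hy
    obtain ⟨_, ⟨q, hq, rfl⟩, hd⟩ := hdense.exists_dist_lt y (half_pos hpos)
    have h1 := key q hq
    rw [dist_eq_norm, norm_sub_rev] at hd
    have h2 : ‖y‖ ≤ ‖q.1‖ + ‖q.1 - y‖ := by
      calc ‖y‖ = ‖q.1 - (q.1 - y)‖ := by congr 1; abel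
        _ ≤ _ := norm_sub_le _ _
    linarith
  set S := 𝒮.toLinearPMap with hS
  have hgraph : S.graph = 𝒮 := 𝒮.toLinearPMap_graph_eq hsv
  have hmem : ∀ u : S.domain, ((u : Lp ℝ 1 ν), S u) ∈ 𝒮 := fun u => by
    rw [← hgraph]; exact S.mem_graph u
  have huniq : ∀ α : ℝ, 0 < α → ∀ p ∈ 𝒮, ∀ q ∈ 𝒮, α • p.1 - p.2 = α • q.1 - q.2 → p = q := by
    intro α hα p hp q hq h
    have h1 := h𝒮.norm_smul_le (𝒮.sub_mem hp hq) hα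
    have h2 : α • (p - q).1 - (p - q).2 = 0 := by
      rw [Prod.fst_sub, Prod.snd_sub, smul_sub, sub_sub_sub_comm, h, sub_self]
    rw [h2, norm_zero] at h1
    have h3 : (p - q).1 = 0 := (smul_eq_zero.1 (norm_le_zero_iff.1 h1)).resolve_left hα.ne'
    have h4 := hsv _ (𝒮.sub_mem hp hq) h3
    exact sub_eq_zero.1 (Prod.ext h3 h4)
  have hG : ∀ α : ℝ, ∃ G : Lp ℝ 1 ν →L[ℝ] Lp ℝ 1 ν, 0 < α →
      ∀ f, (G f, α • G f - f) ∈ 𝒮 := by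
    intro α
    by_cases hα : 0 < α
    swap
    · exact ⟨0, fun h => absurd h hα⟩
    choose p hp hpf using hrange α hα
    have hadd : ∀ f g, p (f + g) = p f + p g := fun f g =>
      huniq α hα _ (hp _) _ (𝒮.add_mem (hp f) (hp g)) (by
        rw [hpf, Prod.fst_add, Prod.snd_add, smul_add, add_sub_add_comm, hpf, hpf])
    have hsmul : ∀ (c : ℝ) f, p (c • f) = c • p f := fun c f =>
      huniq α hα _ (hp _) _ (𝒮.smul_mem c (hp f)) (by
        rw [hpf, Prod.smul_fst, Prod.smul_snd, smul_comm α c, ← smul_sub, hpf])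
    let Gl : Lp ℝ 1 ν →ₗ[ℝ] Lp ℝ 1 ν :=
      { toFun := fun f => (p f).1
        map_add' := fun f g => by rw [hadd]; rfl
        map_smul' := fun c f => by rw [hsmul]; rfl }
    refine ⟨Gl.mkContinuous α⁻¹ fun f => ?_, fun _ f => ?_⟩
    · have := h𝒮.norm_smul_le (hp f) hα
      rw [hpf, norm_smul, Real.norm_of_nonneg hα.le] at this
      change ‖(p f).1‖ ≤ _
      rw [inv_mul_eq_div, le_div_iff₀ hα, mul_comm]
      exact this
    · change ((p f).1, α • (p f).1 - f) ∈ 𝒮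
      have : α • (p f).1 - f = (p f).2 := by
        nth_rewrite 2 [← hpf f]; abel
      rw [this]; exact hp f
  choose G hG using hG
  have hGres : ∀ α : ℝ, 0 < α → IsResolvent S α (G α) := by
    intro α hα
    refine ⟨fun f => ?_, fun u => ?_⟩
    · have h := hG α hα f
      rw [← hgraph, LinearPMap.mem_graph_iff] at h
      obtain ⟨y, hy, hyS⟩ := h
      simp only at hy hyS
      have hm : G α f ∈ S.domain := hy ▸ y.2
      refine ⟨hm, ?_⟩
      have : S ⟨G α f, hm⟩ = α • G α f - f := by
        rw [← hyS]; congr 1; exact Subtype.ext hy.symm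
      rw [this]; abel
    · have := huniq α hα _ (hG α hα (α • (u : Lp ℝ 1 ν) - S u)) _ (hmem u) (by simp)
      exact congrArg Prod.fst this
  have hGc : ∀ α : ℝ, 0 < α → ∀ f, ‖α • G α f‖ ≤ ‖f‖ := by
    intro α hα f
    simpa using h𝒮.norm_smul_le (hG α hα f) hα
  have hdom : Dense (S.domain : Set (Lp ℝ 1 ν)) := by
    refine hdense.mono ?_
    rintro _ ⟨q, hq, rfl⟩
    rw [SetLike.mem_coe, ← hgraph] at hq
    exact LinearPMap.mem_domain_of_mem_graph (y := q.2) hq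
  obtain ⟨T, hT, hTS, hTC⟩ := exists_semigroup_of_isResolvent hdom hGres hGc
  refine ⟨S, G, hgraph, ?_, ⟨T, hT, hTS, fun t ht f hf => ?_⟩, fun α hα => ⟨hGres α hα, hG α hα⟩⟩
  · have : (S.graph : Set (Lp ℝ 1 ν × Lp ℝ 1 ν)) =
        {p | G 1 (p.1 - p.2) = p.1} := by
      ext p
      rw [hgraph]
      constructor
      · intro hp
        have := huniq 1 one_pos _ (hG 1 one_pos (p.1 - p.2)) p hp (by simp)
        exact congrArg Prod.fst this
      · intro hp
        have h := hG 1 one_pos (p.1 - p.2)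
        rw [show G 1 (p.1 - p.2) = p.1 from hp, one_smul, sub_sub_cancel] at h
        exact h
    rw [LinearPMap.IsClosed, this]
    exact isClosed_eq (by fun_prop) (by fun_prop)
  · refine hTC (unitSet ν) convex_unitSet isClosed_unitSet (fun α hα f hf => ?_) t ht f hf
    have hmf := hG α hα f
    have e : α • (G α f, α • G α f - f).1 - (G α f, α • G α f - f).2 = f := by simp
    have h1 := h𝒮.smul_le hmf hα zero_le_one (by
      rw [e]; filter_upwards [hf] with x hx using hx.2)
    have h2 := h𝒮.nonneg (fun p hp => 𝒮.neg_mem hp) hmf hα (by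
      rw [e, ← Lp.coeFn_nonneg]; filter_upwards [hf] with x hx using hx.1)
    filter_upwards [h1, (Lp.coeFn_nonneg _).2 h2, Lp.coeFn_smul α (G α f)] with x h1 h2 h3
    rw [h3, Pi.smul_apply, smul_eq_mul]
    exact ⟨mul_nonneg hα.le h2, h1⟩

end Dissipative

/-! ### Two facts from functional analysis -/

section FunctionalAnalysis

/-- Let `J` be injective on the closed subspace `D` of a Hilbert space. A bounded sequence `p n` in
`D` for which `J (p n)` converges has a weak limit in `D`, because the range of the adjoint of `J`
on `D` is dense. -/
theorem exists_weak_limit {H Y : Type*} [NormedAddCommGroup H] [InnerProductSpace ℝ H]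
    [CompleteSpace H] [NormedAddCommGroup Y] [InnerProductSpace ℝ Y] [CompleteSpace Y]
    {D : Submodule ℝ H} (hD : IsClosed (D : Set H)) (J : H →L[ℝ] Y)
    (hJ : ∀ p ∈ D, J p = 0 → p = 0) {p : ℕ → H} (hp : ∀ n, p n ∈ D) {M : ℝ}
    (hM : ∀ n, ‖p n‖ ≤ M) {y : Y} (hy : Tendsto (fun n => J (p n)) atTop (𝓝 y)) :
    ∃ q ∈ D, J q = y ∧ ∀ z : H, Tendsto (fun n => inner ℝ z (p n)) atTop (𝓝 (inner ℝ z q)) := by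
  have : CompleteSpace D := hD.completeSpace_coe
  let J' : D →L[ℝ] Y := J.comp D.subtypeL
  let p' : ℕ → D := fun n => ⟨p n, hp n⟩
  have hM' : ∀ n, ‖p' n‖ ≤ M := hM
  have hM0 : 0 ≤ M := (norm_nonneg _).trans (hM 0)
  have hdense : Dense (Set.range (ContinuousLinearMap.adjoint J')) := by
    have h1 : (LinearMap.range (ContinuousLinearMap.adjoint J').toLinearMap)ᗮ = ⊥ := by
      rw [Submodule.eq_bot_iff]
      intro x hx
      have h2 : J' x = 0 := by
        have := hx (ContinuousLinearMap.adjoint J' (J' x)) ⟨J' x, rfl⟩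
        rw [ContinuousLinearMap.adjoint_inner_left] at this
        exact inner_self_eq_zero.1 this
      exact Subtype.ext (hJ x x.2 h2)
    have h2 := Submodule.topologicalClosure_eq_top_iff.2 h1
    have h3 := Submodule.dense_iff_topologicalClosure_eq_top.2 h2
    exact h3
  have hconv : ∀ z : D, ∃ l, Tendsto (fun n => inner ℝ (p' n) z) atTop (𝓝 l) := by
    intro z
    refine cauchySeq_tendsto_of_complete (Metric.cauchySeq_iff.2 fun ε hε => ?_)
    obtain ⟨_, ⟨η, rfl⟩, hd⟩ := hdense.exists_dist_lt z (ε := ε / (3 * (M + 1))) (by positivity)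
    have hη : Tendsto (fun n => inner ℝ (p' n) (ContinuousLinearMap.adjoint J' η)) atTop
        (𝓝 (inner ℝ y η)) := by
      simp only [ContinuousLinearMap.adjoint_inner_right]
      exact hy.inner tendsto_const_nhds
    obtain ⟨N, hN⟩ := Metric.cauchySeq_iff.1 hη.cauchySeq (ε / 3) (by positivity)
    refine ⟨N, fun m hm n hn => ?_⟩
    have h1 := hN m hm n hn
    set w := ContinuousLinearMap.adjoint J' η
    have h2 : ∀ k, |inner ℝ (p' k) (z - w)| ≤ ε / 3 := by
      intro k
      refine (abs_real_inner_le_norm _ _).trans ?_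
      rw [dist_eq_norm] at hd
      calc ‖p' k‖ * ‖z - w‖ ≤ (M + 1) * (ε / (3 * (M + 1))) :=
            mul_le_mul ((hM' k).trans (by linarith)) hd.le (norm_nonneg _) (by positivity)
        _ = ε / 3 := by field_simp
    have h3 := abs_le.1 (h2 m)
    have h4 := abs_le.1 (h2 n)
    rw [inner_sub_right] at h3 h4
    rw [Real.dist_eq, abs_lt] at h1 ⊢
    constructor <;> linarith [h1.1, h1.2, h3.1, h3.2, h4.1, h4.2]
  choose l hl using hconv
  let φ : D →L[ℝ] ℝ := continuousLinearMapOfTendsto (l := atTop)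
    (fun n => innerSL ℝ (p' n)) (f := l) (tendsto_pi_nhds.2 hl)
  obtain ⟨q, hq⟩ := (InnerProductSpace.toDual ℝ D).surjective φ
  have hq' : ∀ z : D, Tendsto (fun n => inner ℝ (p' n) z) atTop (𝓝 (inner ℝ q z)) := by
    intro z
    have : inner ℝ q z = l z := by
      rw [← InnerProductSpace.toDual_apply_apply (𝕜 := ℝ), hq]; rfl
    rw [this]; exact hl z
  refine ⟨q, q.2, ?_, fun z => ?_⟩
  · refine ext_inner_right ℝ fun η => ?_
    have h1 := hq' (ContinuousLinearMap.adjoint J' η)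
    simp only [ContinuousLinearMap.adjoint_inner_right] at h1
    exact tendsto_nhds_unique h1 (hy.inner tendsto_const_nhds)
  · obtain ⟨z', hz'⟩ := (InnerProductSpace.toDual ℝ D).surjective ((innerSL ℝ z).comp D.subtypeL)
    have h1 : ∀ x : D, inner ℝ z (x : H) = inner ℝ x z' := by
      intro x
      have h := DFunLike.congr_fun hz' x
      rw [InnerProductSpace.toDual_apply_apply] at h
      exact h.symm.trans (real_inner_comm _ _)
    have h2 := hq' z'
    rw [h1 q]
    exact h2.congr fun n => (h1 (p' n)).symm

/-- On a finite measure space the functionals on `L¹` are given by bounded functions. -/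
theorem exists_bounded_of_dual_L1 {α : Type*} [MeasurableSpace α] {ν : Measure α}
    [IsFiniteMeasure ν] (l : Lp ℝ 1 ν →L[ℝ] ℝ) :
    ∃ h : α → ℝ, MemLp h 2 ν ∧ (∀ᵐ x ∂ν, |h x| ≤ ‖l‖) ∧
      ∀ f : Lp ℝ 1 ν, l f = ∫ x, f x * h x ∂ν := by
  have hmem : ∀ f : Lp ℝ 2 ν, MemLp f 1 ν := fun f => (Lp.memLp f).mono_exponent (by norm_num)
  let ι : Lp ℝ 2 ν →ₗ[ℝ] Lp ℝ 1 ν :=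
    { toFun := fun f => (hmem f).toLp f
      map_add' := fun f g => by
        rw [← MemLp.toLp_add]
        exact MemLp.toLp_congr _ _ (Lp.coeFn_add f g)
      map_smul' := fun c f => by
        rw [RingHom.id_apply, ← MemLp.toLp_const_smul]
        exact MemLp.toLp_congr _ _ (Lp.coeFn_smul c f) }
  have hbound : ∀ f, ‖ι f‖ ≤ (ν univ ^ (1 / (1 : ℝ≥0∞).toReal - 1 / (2 : ℝ≥0∞).toReal)).toReal
      * ‖f‖ := by
    intro f
    change ‖(hmem f).toLp f‖ ≤ _
    rw [Lp.norm_toLp, Lp.norm_def, mul_comm, ← ENNReal.toReal_mul]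
    refine ENNReal.toReal_mono ?_ (eLpNorm_le_eLpNorm_mul_rpow_measure_univ (by norm_num)
      (Lp.aestronglyMeasurable f))
    refine ENNReal.mul_ne_top (Lp.eLpNorm_ne_top f) (ENNReal.rpow_ne_top_of_nonneg ?_
      (measure_ne_top _ _))
    norm_num
  let ιc : Lp ℝ 2 ν →L[ℝ] Lp ℝ 1 ν := ι.mkContinuous _ hbound
  obtain ⟨h, hh⟩ := (InnerProductSpace.toDual ℝ (Lp ℝ 2 ν)).surjective (l.comp ιc)
  have hL2 : ∀ f : Lp ℝ 2 ν, l (ι f) = ∫ x, f x * h x ∂ν := by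
    intro f
    have : l (ι f) = inner ℝ h f := by
      rw [← InnerProductSpace.toDual_apply_apply (𝕜 := ℝ), hh]; rfl
    rw [this, L2.inner_def]
    refine integral_congr_ae (Eventually.of_forall fun x => ?_)
    simp
  have hhi : Integrable h ν := (Lp.memLp h).integrable (by norm_num)
  have hind : ∀ (c : ℝ) {s : Set α} (hs : MeasurableSet s),
      l (indicatorConstLp 1 hs (measure_ne_top ν s) c) = c * ∫ x in s, h x ∂ν := by
    intro c s hs
    have h1 : ι (indicatorConstLp 2 hs (measure_ne_top ν s) c)
        = indicatorConstLp 1 hs (measure_ne_top ν s) c := by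
      refine Lp.ext ?_
      exact (MemLp.coeFn_toLp (hmem _)).trans
        (indicatorConstLp_coeFn.trans indicatorConstLp_coeFn.symm)
    rw [← h1, hL2, ← integral_const_mul, ← integral_indicator hs]
    refine integral_congr_ae ?_
    filter_upwards [indicatorConstLp_coeFn (p := 2) (hs := hs) (hμs := measure_ne_top ν s) (c := c)]
      with x hx
    rw [hx]
    by_cases hxs : x ∈ s <;> simp [hxs]
  have hnorm : ∀ (c : ℝ) {s : Set α} (hs : MeasurableSet s),
      c * ∫ x in s, h x ∂ν ≤ ‖l‖ * (|c| * ν.real s) := by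
    intro c s hs
    rw [← hind c hs]
    refine (le_abs_self _).trans ((l.le_opNorm _).trans (le_of_eq ?_))
    rw [norm_indicatorConstLp (by norm_num) (by norm_num)]
    simp
  have hle : ∀ᵐ x ∂ν, |h x| ≤ ‖l‖ := by
    have h1 : (h : α → ℝ) ≤ᵐ[ν] fun _ => ‖l‖ := by
      refine ae_le_of_forall_setIntegral_le hhi (integrable_const _) fun s hs _ => ?_
      have := hnorm 1 hs
      simpa [mul_comm] using this
    have h2 : (fun x => -h x) ≤ᵐ[ν] fun _ => ‖l‖ := by
      refine ae_le_of_forall_setIntegral_le hhi.neg (integrable_const _) fun s hs _ => ?_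
      have := hnorm (-1) hs
      simpa [integral_neg, mul_comm] using this
    filter_upwards [h1, h2] with x h1 h2
    exact abs_le.2 ⟨by linarith, h1⟩
  refine ⟨h, Lp.memLp h, hle, fun f => ?_⟩
  have hint : ∀ f : Lp ℝ 1 ν, Integrable (fun x => f x * h x) ν := fun f =>
    (L1.integrable_coeFn f).mul_bdd (Lp.aestronglyMeasurable h) hle
  refine Lp.induction (by norm_num) (motive := fun f => l f = ∫ x, f x * h x ∂ν) ?_ ?_ ?_ f
  · intro c s hs hμs
    change l (indicatorConstLp 1 hs hμs.ne c) = ∫ x, (indicatorConstLp 1 hs hμs.ne c) x * h x ∂ν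
    rw [hind c hs, ← integral_const_mul, ← integral_indicator hs]
    refine integral_congr_ae ?_
    filter_upwards [indicatorConstLp_coeFn (p := 1) (hs := hs) (hμs := hμs.ne) (c := c)] with x hx
    rw [hx]
    by_cases hxs : x ∈ s <;> simp [hxs]
  · intro f g hf hg _ h1 h2
    rw [map_add, h1, h2, ← integral_add (hint _) (hint _)]
    refine integral_congr_ae ?_
    filter_upwards [Lp.coeFn_add (hf.toLp f) (hg.toLp g)] with x hx
    rw [hx, Pi.add_apply]; ring
  · have hcont : Continuous fun f : Lp ℝ 1 ν => ∫ x, f x * h x ∂ν := by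
      let Λ : Lp ℝ 1 ν →ₗ[ℝ] ℝ :=
        { toFun := fun f => ∫ x, f x * h x ∂ν
          map_add' := fun f g => by
            rw [← integral_add (hint _) (hint _)]
            refine integral_congr_ae ?_
            filter_upwards [Lp.coeFn_add f g] with x hx
            rw [hx, Pi.add_apply]; ring
          map_smul' := fun c f => by
            rw [RingHom.id_apply, smul_eq_mul, ← integral_const_mul]
            refine integral_congr_ae ?_
            filter_upwards [Lp.coeFn_smul c f] with x hx
            rw [hx, Pi.smul_apply, smul_eq_mul]; ring }
      refine (Λ.mkContinuous ‖l‖ fun f => ?_).continuous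
      change ‖∫ x, f x * h x ∂ν‖ ≤ _
      rw [L1.norm_eq_integral_norm, ← integral_const_mul]
      refine norm_integral_le_of_norm_le ((L1.integrable_coeFn f).norm.const_mul _) ?_
      filter_upwards [hle] with x hx
      rw [norm_mul, mul_comm]
      exact mul_le_mul_of_nonneg_right hx (norm_nonneg _)
    exact isClosed_eq l.continuous hcont

end FunctionalAnalysis

/-! ### A measurable square root of the diffusion matrix -/

section SquareRoot

variable {d : ℕ}

theorem exists_polynomial_tendsto {f : ℝ → ℝ} (hf : ContinuousOn f (Ioi 0)) :
    ∃ P : ℕ → Polynomial ℝ, ∀ t, 0 < t → Tendsto (fun n => (P n).eval t) atTop (𝓝 (f t)) := by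
  have h : ∀ n : ℕ, ∃ P : Polynomial ℝ, ∀ t ∈ Icc ((1 : ℝ) / (n + 1)) (n + 1),
      |P.eval t - f t| < 1 / ((n : ℝ) + 1) := fun n =>
    exists_polynomial_near_of_continuousOn _ _ f
      (hf.mono fun t ht => lt_of_lt_of_le (by positivity) ht.1) _ (by positivity)
  choose P hP using h
  refine ⟨P, fun t ht => ?_⟩
  rw [tendsto_iff_norm_sub_tendsto_zero]
  refine squeeze_zero' (Eventually.of_forall fun n => norm_nonneg _) ?_
    (tendsto_one_div_add_atTop_nhds_zero_nat (𝕜 := ℝ))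
  obtain ⟨N, hN⟩ := exists_nat_ge (t + 1 / t)
  filter_upwards [eventually_ge_atTop N] with n hn
  have hn' : (N : ℝ) ≤ n := by exact_mod_cast hn
  have h1 : 0 < 1 / t := by positivity
  refine (hP n t ⟨?_, by linarith⟩).le
  rw [div_le_iff₀ (by positivity)]
  have h2 : 1 / t ≤ n + 1 := by linarith
  rw [div_le_iff₀ ht] at h2
  linarith

/-- The functional calculus of a field of positive definite matrices is measurable: it is a limit
of polynomials in the matrices. -/
theorem aestronglyMeasurable_cfc {A : Sp d → Matrix (Fin d) (Fin d) ℝ}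
    (hA : ∀ i j, AEStronglyMeasurable (fun x => A x i j) volume) (hpos : ∀ x, (A x).PosDef)
    {f : ℝ → ℝ} (hf : ContinuousOn f (Ioi 0)) (i j : Fin d) :
    AEStronglyMeasurable (fun x => cfc f (A x) i j) volume := by
  obtain ⟨P, hP⟩ := exists_polynomial_tendsto hf
  refine aestronglyMeasurable_of_tendsto_ae atTop
    (f := fun n x => (Polynomial.aeval (A x) (P n)) i j) (fun n => ?_)
    (Eventually.of_forall fun x => ?_)
  · have hc : Continuous fun a : Fin d → Fin d → ℝ =>
        (Polynomial.aeval (Matrix.of a) (P n)) i j := by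
      have h1 : Continuous fun M : Matrix (Fin d) (Fin d) ℝ => (Polynomial.aeval M (P n)) :=
        (P n).continuous_aeval
      exact (h1.comp (continuous_id (X := Fin d → Fin d → ℝ))).matrix_elem i j
    have hm : AEMeasurable (fun x => (fun i j => A x i j : Fin d → Fin d → ℝ)) volume :=
      aemeasurable_pi_lambda _ fun i => aemeasurable_pi_lambda _ fun j => (hA i j).aemeasurable
    exact hc.comp_aestronglyMeasurable hm.aestronglyMeasurable
  · have hH : (A x).IsHermitian := (hpos x).isHermitian
    have hlim : Tendsto (fun n => hH.cfc (P n).eval) atTop (𝓝 (hH.cfc f)) := by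
      have hc : Continuous fun D : Fin d → ℝ => (hH.eigenvectorUnitary : Matrix (Fin d) (Fin d) ℝ) *
          Matrix.diagonal D * star (hH.eigenvectorUnitary : Matrix (Fin d) (Fin d) ℝ) :=
        (continuous_const.matrix_mul continuous_id.matrix_diagonal).matrix_mul continuous_const
      have ht : Tendsto (fun n => fun k => (P n).eval (hH.eigenvalues k)) atTop
          (𝓝 fun k => f (hH.eigenvalues k)) :=
        tendsto_pi_nhds.2 fun k => hP _ ((hpos x).eigenvalues_pos k)
      exact (hc.tendsto _).comp ht
    have h2 : ∀ n, Polynomial.aeval (A x) (P n) = hH.cfc (P n).eval := fun n => by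
      rw [← hH.cfc_eq, cfc_polynomial (P n) (A x) hH.isSelfAdjoint]
    simp only [h2, hH.cfc_eq]
    exact ((continuous_id.matrix_elem i j).tendsto _).comp hlim

theorem sqrt_cfc_mul {M : Matrix (Fin d) (Fin d) ℝ} (hM : M.PosDef) :
    cfc Real.sqrt M * cfc Real.sqrt M = M ∧
      cfc Real.sqrt M * cfc (fun t => (Real.sqrt t)⁻¹) M = 1 ∧
      cfc (fun t => (Real.sqrt t)⁻¹) M * cfc Real.sqrt M = 1 ∧
      (cfc Real.sqrt M)ᵀ = cfc Real.sqrt M := by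
  have hH : M.IsHermitian := hM.isHermitian
  have hsa : IsSelfAdjoint M := hH
  have hc : ∀ f : ℝ → ℝ, ContinuousOn f (spectrum ℝ M) := fun f =>
    (M.finite_real_spectrum).continuousOn f
  have hp : ∀ t ∈ spectrum ℝ M, 0 < t := by
    intro t ht
    rw [hH.spectrum_real_eq_range_eigenvalues] at ht
    obtain ⟨i, rfl⟩ := ht
    exact hM.eigenvalues_pos i
  refine ⟨?_, ?_, ?_, ?_⟩
  · rw [← cfc_mul _ _ M (hc _) (hc _)]
    conv_rhs => rw [← cfc_id ℝ M hsa]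
    exact cfc_congr fun t ht => Real.mul_self_sqrt (hp t ht).le
  · rw [← cfc_mul _ _ M (hc _) (hc _), ← cfc_one ℝ M hsa]
    exact cfc_congr fun t ht => mul_inv_cancel₀ (Real.sqrt_pos.2 (hp t ht)).ne'
  · rw [← cfc_mul _ _ M (hc _) (hc _), ← cfc_one ℝ M hsa]
    exact cfc_congr fun t ht => inv_mul_cancel₀ (Real.sqrt_pos.2 (hp t ht)).ne'
  · have : IsSelfAdjoint (cfc Real.sqrt M) := cfc_predicate _ _
    rw [IsSelfAdjoint, Matrix.star_eq_conjTranspose, Matrix.conjTranspose_eq_transpose_of_trivial]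
      at this
    exact this

theorem aestronglyMeasurable_toEuclideanCLM {R : Sp d → Matrix (Fin d) (Fin d) ℝ}
    (hR : ∀ i j, AEStronglyMeasurable (fun x => R x i j) volume) :
    AEStronglyMeasurable
      (fun x => (Matrix.toEuclideanCLM (n := Fin d) (𝕜 := ℝ) (R x) : Sp d →L[ℝ] Sp d)) volume := by
  let Λ : (Fin d → Fin d → ℝ) →ₗ[ℝ] (Sp d →L[ℝ] Sp d) :=
    { toFun := fun a => Matrix.toEuclideanCLM (n := Fin d) (𝕜 := ℝ) (Matrix.of a)
      map_add' := fun a b => map_add (Matrix.toEuclideanCLM (n := Fin d) (𝕜 := ℝ)) _ _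
      map_smul' := fun c a => map_smul (Matrix.toEuclideanCLM (n := Fin d) (𝕜 := ℝ)) c _ }
  have hm : AEMeasurable (fun x => (fun i j => R x i j : Fin d → Fin d → ℝ)) volume :=
    aemeasurable_pi_lambda _ fun i => aemeasurable_pi_lambda _ fun j => (hR i j).aemeasurable
  exact Λ.continuous_of_finiteDimensional.comp_aestronglyMeasurable hm.aestronglyMeasurable

/-- Coefficients in factorised form. `m` is the density of the reference measure, `S` a square root
of the form, so that the form is `∫ ⟨S ∇f, S ∇g⟩ dx`, and `T` is the inverse of `S`. The field `c`
is the drift in the coordinates of `S`, that is, `⟨c, S ∇f⟩` is the drift term. The condition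
`c_div` says that the drift is divergence free with respect to `m dx`. -/
structure IsFrame (m : Sp d → ℝ) (S T : Sp d → Sp d →L[ℝ] Sp d) (c : Sp d → Sp d) : Prop where
  m_meas : AEStronglyMeasurable m volume
  m_pos : ∀ᵐ x, 0 < m x
  m_loc : ∀ K, IsCompact K → IntegrableOn m K volume
  m_inv : ∀ K, IsCompact K → ∃ C, ∀ᵐ x ∂(volume.restrict K), (m x)⁻¹ ≤ C
  S_meas : AEStronglyMeasurable S volume
  T_meas : AEStronglyMeasurable T volume
  inv : ∀ᵐ x, ∀ ξ, T x (S x ξ) = ξ ∧ S x (T x ξ) = ξ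
  S_bdd : ∀ K, IsCompact K → ∃ C, ∀ᵐ x ∂(volume.restrict K), ‖S x‖ ≤ C
  T_bdd : ∀ K, IsCompact K → ∃ C, ∀ᵐ x ∂(volume.restrict K), ‖T x‖ ≤ C
  c_loc : ∀ K, IsCompact K → MemLp (fun x => m x • c x) 2 (volume.restrict K)
  c_div : ∀ φ, IsTest univ φ → ∫ x, inner ℝ (m x • c x) (S x (gradient φ x)) = 0

theorem aestronglyMeasurable_of_compact {F : Type*} [NormedAddCommGroup F] {f : Sp d → F}
    {ν : Measure (Sp d)} (h : ∀ K, IsCompact K → AEStronglyMeasurable f (ν.restrict K)) :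
    AEStronglyMeasurable f ν := by
  have := AEStronglyMeasurable.iUnion (fun n => h _ (isCompact_compactCovering (Sp d) n))
  rwa [iUnion_compactCovering, Measure.restrict_univ] at this

theorem MemLpLoc.exists_bound {F : Type} [NormedAddCommGroup F] {f : Sp d → F}
    {ν : Measure (Sp d)} (h : MemLpLoc f ⊤ ν) {K : Set (Sp d)} (hK : IsCompact K) :
    ∃ C : ℝ, 0 ≤ C ∧ ∀ᵐ x ∂(ν.restrict K), ‖f x‖ ≤ C := by
  have h1 := (h K hK).2
  rw [eLpNorm_exponent_top] at h1
  refine ⟨(eLpNormEssSup f (ν.restrict K)).toReal, ENNReal.toReal_nonneg, ?_⟩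
  filter_upwards [ae_le_eLpNormEssSup (f := f) (μ := ν.restrict K)] with x hx
  have := ENNReal.toReal_mono h1.ne hx
  simpa using this

theorem posDef_of_locUnifElliptic {A : Sp d → Matrix (Fin d) (Fin d) ℝ}
    (hA_symm : ∀ x, (A x).IsSymm) (hA : LocUnifElliptic A) (x : Sp d) : (A x).PosDef := by
  obtain ⟨lam, Lam, hl, -, h⟩ := hA x 1
  refine Matrix.PosDef.of_dotProduct_mulVec_pos ?_ fun v hv => ?_
  · rw [Matrix.IsHermitian, Matrix.conjTranspose_eq_transpose_of_trivial]; exact hA_symm x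
  · have h1 := (h x (Metric.mem_ball_self one_pos) (WithLp.toLp 2 v)).1
    have h2 : (0 : ℝ) < ‖(WithLp.toLp 2 v : Sp d)‖ := by
      rw [norm_pos_iff]
      intro h0
      exact hv (by simpa using congrArg WithLp.ofLp h0)
    rw [star_trivial, dotProduct_comm]
    exact lt_of_lt_of_le (by positivity) h1

/-- The data of the diffusion in factorised form, with `S = (ρ / 2)^{1/2} A^{1/2}`, `T = S⁻¹` and
`c = Tᵀ B`. -/
theorem exists_isFrame (ρ ψ : Sp d → ℝ) (A : Sp d → Matrix (Fin d) (Fin d) ℝ) (B : Sp d → Sp d)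
    (hρ_bdd : MemLpLoc ρ ⊤ volume) (hρ_pos : ∀ᵐ x, 0 < ρ x)
    (hρ_inv : MemLpLoc (fun x => (ρ x)⁻¹) ⊤ volume)
    (hψ : MemLpLoc ψ 1 volume) (hψ_pos : ∀ᵐ x, 0 < ψ x)
    (hψ_inv : MemLpLoc (fun x => (ψ x)⁻¹) ⊤ volume)
    (hA_symm : ∀ x, (A x).IsSymm) (hA : ∀ i j, MemH12Loc fun x => A x i j)
    (hA_ell : LocUnifElliptic A)
    (hB_div : ∀ u : Sp d → ℝ, IsTest univ u → ∫ x, inner ℝ (B x) (gradient u x) ∂(mu ρ ψ) = 0)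
    (hB_loc : MemLpLoc (fun x => (ρ x * ψ x) • B x) 2 volume) :
    ∃ (S T : Sp d → Sp d →L[ℝ] Sp d) (c : Sp d → Sp d), IsFrame (fun x => ρ x * ψ x) S T c ∧
      (∀ᵐ x, ∀ ξ η, inner ℝ (S x ξ) (S x η) = (1 / 2) * ρ x * ((A x *ᵥ ξ.ofLp) ⬝ᵥ η.ofLp)) ∧
      ∀ᵐ x, ∀ ξ, inner ℝ (B x) ξ = inner ℝ (c x) (S x ξ) := by
  have hpos := posDef_of_locUnifElliptic hA_symm hA_ell
  have hρm : AEStronglyMeasurable ρ volume :=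
    aestronglyMeasurable_of_compact fun K hK => (hρ_bdd K hK).1
  have hψm : AEStronglyMeasurable ψ volume :=
    aestronglyMeasurable_of_compact fun K hK => (hψ K hK).1
  have hAm : ∀ i j, AEStronglyMeasurable (fun x => A x i j) volume := fun i j =>
    aestronglyMeasurable_of_compact fun K hK => ((hA i j).1 K hK).1
  have hmm : AEStronglyMeasurable (fun x => ρ x * ψ x) volume := hρm.mul hψm
  have hmpos : ∀ᵐ x, 0 < ρ x * ψ x := by
    filter_upwards [hρ_pos, hψ_pos] with x h1 h2 using mul_pos h1 h2
  let R : Sp d → Sp d →L[ℝ] Sp d := fun x =>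
    Matrix.toEuclideanCLM (n := Fin d) (𝕜 := ℝ) (cfc Real.sqrt (A x))
  let Q : Sp d → Sp d →L[ℝ] Sp d := fun x =>
    Matrix.toEuclideanCLM (n := Fin d) (𝕜 := ℝ) (cfc (fun t => (Real.sqrt t)⁻¹) (A x))
  have hRm : AEStronglyMeasurable R volume := aestronglyMeasurable_toEuclideanCLM
    fun i j => aestronglyMeasurable_cfc hAm hpos Real.continuous_sqrt.continuousOn i j
  have hQm : AEStronglyMeasurable Q volume := aestronglyMeasurable_toEuclideanCLM
    fun i j => aestronglyMeasurable_cfc hAm hpos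
      (Real.continuous_sqrt.continuousOn.inv₀ fun t ht => (Real.sqrt_pos.2 ht).ne') i j
  have hQR : ∀ x ξ, Q x (R x ξ) = ξ := fun x ξ => by
    have h : Q x * R x = 1 := by
      rw [← map_mul, (sqrt_cfc_mul (hpos x)).2.2.1, map_one]
    exact DFunLike.congr_fun h ξ
  have hRQ : ∀ x ξ, R x (Q x ξ) = ξ := fun x ξ => by
    have h : R x * Q x = 1 := by
      rw [← map_mul, (sqrt_cfc_mul (hpos x)).2.1, map_one]
    exact DFunLike.congr_fun h ξ
  have hRR : ∀ x ξ η, inner ℝ (R x ξ) (R x η) = (A x *ᵥ ξ.ofLp) ⬝ᵥ η.ofLp := fun x ξ η => by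
    rw [EuclideanSpace.inner_eq_star_dotProduct, star_trivial]
    change (cfc Real.sqrt (A x) *ᵥ η.ofLp) ⬝ᵥ (cfc Real.sqrt (A x) *ᵥ ξ.ofLp) = _
    obtain ⟨h1, -, -, h4⟩ := sqrt_cfc_mul (hpos x)
    nth_rewrite 3 [← h1]
    rw [← Matrix.mulVec_mulVec]
    nth_rewrite 1 [← h4]
    rw [Matrix.mulVec_transpose, ← Matrix.dotProduct_mulVec, dotProduct_comm]
  have hell : ∀ K : Set (Sp d), IsCompact K → ∃ l L : ℝ, 0 < l ∧ 0 < L ∧ ∀ x ∈ K, ∀ ξ : Sp d,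
      l * ‖ξ‖ ^ 2 ≤ ‖R x ξ‖ ^ 2 ∧ ‖R x ξ‖ ^ 2 ≤ L * ‖ξ‖ ^ 2 := by
    intro K hK
    obtain ⟨r, hr⟩ := hK.isBounded.subset_ball 0
    obtain ⟨l, L, hl, hL, h⟩ := hA_ell 0 r
    refine ⟨l, L, hl, hL, fun x hx ξ => ?_⟩
    rw [← real_inner_self_eq_norm_sq (R x ξ), hRR]
    exact h x (hr hx) ξ
  let S : Sp d → Sp d →L[ℝ] Sp d := fun x => Real.sqrt (ρ x / 2) • R x
  let T : Sp d → Sp d →L[ℝ] Sp d := fun x => (Real.sqrt (ρ x / 2))⁻¹ • Q x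
  have hsm : AEStronglyMeasurable (fun x => Real.sqrt (ρ x / 2)) volume :=
    Real.continuous_sqrt.comp_aestronglyMeasurable (by
      simpa only [div_eq_mul_inv] using hρm.mul_const (2 : ℝ)⁻¹)
  have hSm : AEStronglyMeasurable S volume := hsm.smul hRm
  have hTm : AEStronglyMeasurable T volume := hsm.inv₀.smul hQm
  have hinv : ∀ᵐ x, ∀ ξ, T x (S x ξ) = ξ ∧ S x (T x ξ) = ξ := by
    filter_upwards [hρ_pos] with x hx ξ
    have h0 : Real.sqrt (ρ x / 2) ≠ 0 := (Real.sqrt_pos.2 (by positivity)).ne'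
    simp only [S, T, smul_apply, map_smul, smul_smul, hQR, hRQ, inv_mul_cancel₀ h0,
      mul_inv_cancel₀ h0, one_smul, and_self]
  have hBm : AEStronglyMeasurable B volume := by
    have h1 : AEStronglyMeasurable (fun x => (ρ x * ψ x) • B x) volume :=
      aestronglyMeasurable_of_compact fun K hK => (hB_loc K hK).1
    refine (hmm.inv₀.smul h1).congr ?_
    filter_upwards [hmpos] with x hx
    change (ρ x * ψ x)⁻¹ • (ρ x * ψ x) • B x = B x
    exact inv_smul_smul₀ hx.ne' _
  let c : Sp d → Sp d := fun x => ContinuousLinearMap.adjoint (T x) (B x)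
  have hadj : AEStronglyMeasurable (fun x => ContinuousLinearMap.adjoint (T x)) volume :=
    (ContinuousLinearMap.adjoint (𝕜 := ℝ) (E := Sp d)
      (F := Sp d)).continuous.comp_aestronglyMeasurable hTm
  have hcm : AEStronglyMeasurable c volume := by
    have : Continuous fun p : (Sp d →L[ℝ] Sp d) × Sp d => p.1 p.2 :=
      isBoundedBilinearMap_apply.continuous
    exact this.comp_aestronglyMeasurable (hadj.prodMk hBm)
  have hcB : ∀ᵐ x, ∀ ξ, inner ℝ (B x) ξ = inner ℝ (c x) (S x ξ) := by
    filter_upwards [hinv] with x hx ξ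
    rw [ContinuousLinearMap.adjoint_inner_left, (hx ξ).1]
  have hTb : ∀ K, IsCompact K → ∃ C, ∀ᵐ x ∂(volume.restrict K), ‖T x‖ ≤ C := by
    intro K hK
    obtain ⟨C, hC0, hC⟩ := hρ_inv.exists_bound hK
    obtain ⟨l, L, hl, hL, h⟩ := hell K hK
    refine ⟨Real.sqrt (2 * C) * Real.sqrt l⁻¹, ?_⟩
    filter_upwards [hC, ae_restrict_of_ae hρ_pos, ae_restrict_mem hK.measurableSet]
      with x hx hp hxK
    rw [norm_smul, norm_inv, Real.norm_of_nonneg (Real.sqrt_nonneg _), ← Real.sqrt_inv]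
    gcongr
    · rw [inv_div, div_eq_mul_inv]
      rw [Real.norm_of_nonneg (by positivity)] at hx
      gcongr
    · refine ContinuousLinearMap.opNorm_le_bound _ (Real.sqrt_nonneg _) fun ξ => ?_
      have h1 := (h x hxK (Q x ξ)).1
      rw [hRQ] at h1
      refine le_of_sq_le_sq ?_ (by positivity)
      rw [mul_pow, Real.sq_sqrt (by positivity), inv_mul_eq_div, le_div_iff₀ hl, mul_comm]
      exact h1
  refine ⟨S, T, c, ⟨hmm, hmpos, fun K hK => ?_, fun K hK => ?_, hSm, hTm, hinv, fun K hK => ?_, hTb,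
    fun K hK => ?_, fun φ hφ => ?_⟩, ?_, hcB⟩
  · obtain ⟨C, hC0, hC⟩ := hρ_bdd.exists_bound hK
    exact (memLp_one_iff_integrable.1 (hψ K hK)).bdd_mul hρm.restrict hC
  · obtain ⟨C, hC0, hC⟩ := hρ_inv.exists_bound hK
    obtain ⟨D, hD0, hD⟩ := hψ_inv.exists_bound hK
    refine ⟨C * D, ?_⟩
    filter_upwards [hC, hD] with x h1 h2
    rw [mul_inv]
    refine (le_abs_self _).trans ?_
    rw [abs_mul]
    exact mul_le_mul h1 h2 (abs_nonneg _) hC0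
  · obtain ⟨C, hC0, hC⟩ := hρ_bdd.exists_bound hK
    obtain ⟨l, L, hl, hL, h⟩ := hell K hK
    refine ⟨Real.sqrt (C / 2) * Real.sqrt L, ?_⟩
    filter_upwards [hC, ae_restrict_mem hK.measurableSet] with x hx hxK
    rw [norm_smul, Real.norm_of_nonneg (Real.sqrt_nonneg _)]
    gcongr
    · exact (le_abs_self _).trans hx
    · refine ContinuousLinearMap.opNorm_le_bound _ (Real.sqrt_nonneg _) fun ξ => ?_
      refine le_of_sq_le_sq ?_ (by positivity)
      rw [mul_pow, Real.sq_sqrt hL.le]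
      exact (h x hxK ξ).2
  · obtain ⟨C, hC⟩ := hTb K hK
    refine MemLp.of_le_mul (c := C) (hB_loc K hK) (hmm.smul hcm).restrict ?_
    filter_upwards [hC] with x hx
    have : (ρ x * ψ x) • c x = ContinuousLinearMap.adjoint (T x) ((ρ x * ψ x) • B x) := by
      rw [map_smul]
    rw [this]
    refine (ContinuousLinearMap.le_opNorm _ _).trans ?_
    gcongr
    rw [LinearIsometryEquiv.norm_map]
    exact hx
  · rw [← hB_div φ hφ, mu, integral_withDensity_eq_integral_toReal_smul₀
      hmm.aemeasurable.ennreal_ofReal (Eventually.of_forall fun x => ENNReal.ofReal_lt_top)]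
    refine integral_congr_ae ?_
    filter_upwards [hcB, hmpos] with x h1 h2
    rw [ENNReal.toReal_ofReal h2.le, inner_smul_left, ← h1]
    rfl
  · filter_upwards [hρ_pos] with x hx ξ η
    simp only [S, smul_apply, inner_smul_left, inner_smul_right, hRR]
    rw [← mul_assoc]
    congr 1
    simp only [conj_trivial]
    rw [Real.mul_self_sqrt (by positivity)]
    ring

end SquareRoot

/-! ### Test functions and the weighted measure -/

section TestFunctions

variable {d : ℕ}

theorem continuous_gradient {φ : Sp d → ℝ} (hφ : ContDiff ℝ ∞ φ) : Continuous (gradient φ) :=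
  (InnerProductSpace.toDual ℝ (Sp d)).symm.continuous.comp (hφ.continuous_fderiv (by simp))

theorem gradient_comp_mul {φ v : Sp d → ℝ} {h : ℝ → ℝ} (hφ : ContDiff ℝ ∞ φ) (hv : ContDiff ℝ ∞ v)
    (hh : ContDiff ℝ ∞ h) (x : Sp d) :
    gradient (fun x => h (φ x) * v x) x
      = (deriv h (φ x) * v x) • gradient φ x + h (φ x) • gradient v x := by
  refine HasGradientAt.gradient ?_
  rw [hasGradientAt_iff_hasFDerivAt]
  have h1 := (hφ.differentiable (by simp) x).hasFDerivAt
  have h2 := (hv.differentiable (by simp) x).hasFDerivAt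
  have h3 := ((hasDerivAt_of_contDiff hh (φ x)).comp_hasFDerivAt x h1).mul h2
  have h4 : (InnerProductSpace.toDual ℝ (Sp d))
      ((deriv h (φ x) * v x) • gradient φ x + h (φ x) • gradient v x)
      = (h ∘ φ) x • fderiv ℝ v x + v x • deriv h (φ x) • fderiv ℝ φ x := by
    rw [map_add, map_smul, map_smul, toDual_gradient, toDual_gradient, smul_smul, add_comm,
      mul_comm (v x)]
    rfl
  rw [h4]
  exact h3

theorem gradient_add_of_contDiff {φ v : Sp d → ℝ} (hφ : ContDiff ℝ ∞ φ) (hv : ContDiff ℝ ∞ v)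
    (x : Sp d) : gradient (φ + v) x = gradient φ x + gradient v x := by
  simp only [gradient]
  rw [fderiv_add (hφ.differentiable (by simp) x) (hv.differentiable (by simp) x), map_add]

theorem gradient_const_smul_of_contDiff {φ : Sp d → ℝ} (c : ℝ) (hφ : ContDiff ℝ ∞ φ) (x : Sp d) :
    gradient (c • φ) x = c • gradient φ x := by
  simp only [gradient]
  rw [fderiv_const_smul (hφ.differentiable (by simp) x), map_smul]

theorem tsupport_gradient_subset (φ : Sp d → ℝ) : tsupport (gradient φ) ⊆ tsupport φ := by
  refine closure_minimal (fun x hx => ?_) (isClosed_tsupport φ)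
  by_contra h
  refine hx ?_
  rw [gradient, fderiv_of_notMem_tsupport (𝕜 := ℝ) h, map_zero]

namespace IsTest

variable {U V : Set (Sp d)} {φ v : Sp d → ℝ}

theorem mono (h : U ⊆ V) (hφ : IsTest U φ) : IsTest V φ := ⟨hφ.1, hφ.2.1, hφ.2.2.trans h⟩

theorem zero : IsTest U (0 : Sp d → ℝ) :=
  ⟨contDiff_const, HasCompactSupport.zero, by
    rw [show tsupport (0 : Sp d → ℝ) = ∅ from by simp [tsupport]]; exact empty_subset _⟩

theorem of_tsupport_subset (hφ : IsTest U φ) (hv : ContDiff ℝ ∞ v) (h : ∀ x, φ x = 0 → v x = 0) :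
    IsTest U v := by
  have hs : Function.support v ⊆ Function.support φ := fun x hx h0 => hx (h x h0)
  exact ⟨hv, hφ.2.1.mono hs, (closure_mono hs).trans hφ.2.2⟩

theorem add (hφ : IsTest U φ) (hv : IsTest U v) : IsTest U (φ + v) :=
  ⟨hφ.1.add hv.1, hφ.2.1.add hv.2.1,
    (tsupport_add φ v).trans (union_subset hφ.2.2 hv.2.2)⟩

theorem const_smul (c : ℝ) (hφ : IsTest U φ) : IsTest U (c • φ) :=
  hφ.of_tsupport_subset (contDiff_const.smul hφ.1) fun x hx => by simp [hx]

theorem sub (hφ : IsTest U φ) (hv : IsTest U v) : IsTest U (φ - v) := by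
  have := hφ.add (hv.const_smul (-1))
  rwa [neg_one_smul, ← sub_eq_add_neg] at this

theorem comp (hφ : IsTest U φ) {h : ℝ → ℝ} (hh : ContDiff ℝ ∞ h) (h0 : h 0 = 0) :
    IsTest U fun x => h (φ x) :=
  hφ.of_tsupport_subset (hh.comp hφ.1) fun x hx => by simp [hx, h0]

theorem comp_mul (hv : IsTest U v) (hφ : ContDiff ℝ ∞ φ) {h : ℝ → ℝ} (hh : ContDiff ℝ ∞ h) :
    IsTest U fun x => h (φ x) * v x :=
  hv.of_tsupport_subset ((hh.comp hφ).mul hv.1) fun x hx => by simp [hx]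

theorem eq_zero (hφ : IsTest U φ) {x : Sp d} (hx : x ∉ U) : φ x = 0 :=
  image_eq_zero_of_notMem_tsupport fun h => hx (hφ.2.2 h)

theorem gradient_eq_zero (hφ : IsTest U φ) {x : Sp d} (hx : x ∉ tsupport φ) :
    gradient φ x = 0 :=
  image_eq_zero_of_notMem_tsupport fun h => hx (tsupport_gradient_subset φ h)

theorem gradient_hasCompactSupport (hφ : IsTest U φ) : HasCompactSupport (gradient φ) :=
  hφ.2.1.of_isClosed_subset (isClosed_tsupport _) (tsupport_gradient_subset φ)

theorem exists_bound (hφ : IsTest U φ) : ∃ C, ∀ x, ‖φ x‖ ≤ C :=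
  hφ.2.1.exists_bound_of_continuous hφ.1.continuous

theorem memLp (hφ : IsTest U φ) {ν : Measure (Sp d)} [IsFiniteMeasureOnCompacts ν] (p : ℝ≥0∞) :
    MemLp φ p ν :=
  hφ.1.continuous.memLp_of_hasCompactSupport hφ.2.1

end IsTest

/-- The measure `m dx`. -/
abbrev wm (m : Sp d → ℝ) : Measure (Sp d) := volume.withDensity fun x => ENNReal.ofReal (m x)

namespace IsFrame

variable {m : Sp d → ℝ} {S T : Sp d → Sp d →L[ℝ] Sp d} {c : Sp d → Sp d}

theorem ac (_ : IsFrame m S T c) : wm m ≪ volume := withDensity_absolutelyContinuous _ _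

theorem ac' (F : IsFrame m S T c) : volume ≪ wm m := by
  refine withDensity_absolutelyContinuous' F.m_meas.aemeasurable.ennreal_ofReal ?_
  filter_upwards [F.m_pos] with x hx
  simpa using hx

theorem ae_iff (F : IsFrame m S T c) {p : Sp d → Prop} : (∀ᵐ x ∂(wm m), p x) ↔ ∀ᵐ x, p x :=
  ⟨fun h => F.ac'.ae_le h, fun h => F.ac.ae_le h⟩

theorem aesm_iff (F : IsFrame m S T c) {E : Type*} [TopologicalSpace E] {f : Sp d → E} :
    AEStronglyMeasurable f (wm m) ↔ AEStronglyMeasurable f volume :=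
  ⟨fun h => h.mono_ac F.ac', fun h => h.mono_ac F.ac⟩

theorem isFiniteMeasureOnCompacts (F : IsFrame m S T c) : IsFiniteMeasureOnCompacts (wm m) := by
  refine ⟨fun K hK => ?_⟩
  rw [withDensity_apply _ hK.measurableSet]
  exact (F.m_loc K hK).lintegral_lt_top

theorem wm_lt_top (F : IsFrame m S T c) {V : Set (Sp d)} (hV : Bornology.IsBounded V) :
    wm m V < ⊤ :=
  (measure_mono subset_closure).trans_lt
    (F.isFiniteMeasureOnCompacts.lt_top_of_isCompact hV.isCompact_closure)

theorem integral_wm (F : IsFrame m S T c) (f : Sp d → ℝ) :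
    ∫ x, f x ∂(wm m) = ∫ x, m x * f x := by
  rw [integral_withDensity_eq_integral_toReal_smul₀
      F.m_meas.aemeasurable.ennreal_ofReal (Eventually.of_forall fun x => ENNReal.ofReal_lt_top)]
  refine integral_congr_ae ?_
  filter_upwards [F.m_pos] with x hx
  rw [ENNReal.toReal_ofReal hx.le, smul_eq_mul]

theorem integrable_wm (F : IsFrame m S T c) {f : Sp d → ℝ} :
    Integrable f (wm m) ↔ Integrable fun x => m x * f x := by
  rw [integrable_withDensity_iff_integrable_smul₀'
    F.m_meas.aemeasurable.ennreal_ofReal (Eventually.of_forall fun x => ENNReal.ofReal_lt_top)]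
  refine integrable_congr ?_
  filter_upwards [F.m_pos] with x hx
  rw [ENNReal.toReal_ofReal hx.le, smul_eq_mul]

/-- On compact sets Lebesgue measure is dominated by `m dx`. -/
theorem exists_restrict_le (F : IsFrame m S T c) {K : Set (Sp d)} (hK : IsCompact K) :
    ∃ C : ℝ≥0∞, C ≠ ⊤ ∧ volume.restrict K ≤ C • wm m := by
  obtain ⟨C, hC⟩ := F.m_inv K hK
  refine ⟨ENNReal.ofReal C, ENNReal.ofReal_ne_top, ?_⟩
  refine Measure.le_iff.2 fun s hs => ?_
  rw [Measure.smul_apply, smul_eq_mul, withDensity_apply _ hs,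
    ← lintegral_const_mul' _ _ ENNReal.ofReal_ne_top]
  calc volume.restrict K s = ∫⁻ _ in s, 1 ∂(volume.restrict K) := by simp
    _ ≤ ∫⁻ x in s, ENNReal.ofReal C * ENNReal.ofReal (m x) ∂(volume.restrict K) := by
      refine lintegral_mono_ae (ae_restrict_of_ae ?_)
      filter_upwards [hC, ae_restrict_of_ae F.m_pos] with x hx hp
      rw [← ENNReal.ofReal_mul ((inv_pos.2 hp).le.trans hx), ← ENNReal.ofReal_one]
      refine ENNReal.ofReal_le_ofReal ?_
      have := mul_le_mul_of_nonneg_right hx hp.le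
      rwa [inv_mul_cancel₀ hp.ne'] at this
    _ ≤ ∫⁻ x in s, ENNReal.ofReal C * ENNReal.ofReal (m x) := by
      refine lintegral_mono' ?_ le_rfl
      exact Measure.restrict_mono_measure Measure.restrict_le_self _

theorem exists_eLpNorm_le (F : IsFrame m S T c) {K : Set (Sp d)} (hK : IsCompact K) :
    ∃ C : ℝ≥0∞, C ≠ ⊤ ∧ ∀ f : Sp d → ℝ,
      eLpNorm f 2 (volume.restrict K) ≤ C * eLpNorm f 2 (wm m) := by
  obtain ⟨C, hC, hle⟩ := F.exists_restrict_le hK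
  refine ⟨C ^ (1 / (2 : ℝ≥0∞).toReal), ENNReal.rpow_ne_top_of_nonneg (by positivity) hC,
    fun f => ?_⟩
  refine (eLpNorm_mono_measure f hle).trans ?_
  rw [eLpNorm_smul_measure_of_ne_top (by norm_num), smul_eq_mul]
  simp

theorem memLp_restrict (F : IsFrame m S T c) {K : Set (Sp d)} (hK : IsCompact K) {f : Sp d → ℝ}
    (hf : MemLp f 2 (wm m)) : MemLp f 2 (volume.restrict K) := by
  obtain ⟨C, hC, hle⟩ := F.exists_eLpNorm_le hK
  exact ⟨(F.aesm_iff.1 hf.1).restrict,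
    (hle f).trans_lt (ENNReal.mul_lt_top hC.lt_top hf.2)⟩

/-- Multiplication by a bounded field with compact support maps `L²(m dx)` to `L²(dx)`. -/
theorem exists_eLpNorm_smul_le (F : IsFrame m S T c) {w : Sp d → Sp d} {K : Set (Sp d)}
    (hK : IsCompact K) {D : ℝ} (hw : ∀ᵐ x, ‖w x‖ ≤ D) (hwK : ∀ x, x ∉ K → w x = 0) :
    ∃ C : ℝ≥0∞, C ≠ ⊤ ∧ ∀ f : Sp d → ℝ,
      eLpNorm (fun x => f x • w x) 2 volume ≤ C * eLpNorm f 2 (wm m) := by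
  obtain ⟨C, hC, hle⟩ := F.exists_eLpNorm_le hK
  refine ⟨ENNReal.ofReal D * C, ENNReal.mul_ne_top ENNReal.ofReal_ne_top hC, fun f => ?_⟩
  have h1 : eLpNorm (fun x => f x • w x) 2 volume
      = eLpNorm (fun x => f x • w x) 2 (volume.restrict K) := by
    rw [← eLpNorm_indicator_eq_eLpNorm_restrict hK.measurableSet]
    congr 1
    funext x
    by_cases hx : x ∈ K
    · simp [hx]
    · simp [hx, hwK x hx]
  rw [h1, mul_assoc]
  refine (eLpNorm_le_mul_eLpNorm_of_ae_le_mul (g := f) (c := D) ?_ 2).trans (by gcongr; exact hle f)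
  filter_upwards [ae_restrict_of_ae hw] with x hx
  rw [norm_smul, mul_comm]
  gcongr

theorem memLp_smul (F : IsFrame m S T c) {w : Sp d → Sp d} (hwm : AEStronglyMeasurable w volume)
    {K : Set (Sp d)} (hK : IsCompact K) {D : ℝ} (hw : ∀ᵐ x, ‖w x‖ ≤ D) (hwK : ∀ x, x ∉ K → w x = 0)
    {f : Sp d → ℝ} (hf : MemLp f 2 (wm m)) : MemLp (fun x => f x • w x) 2 volume := by
  obtain ⟨C, hC, hle⟩ := F.exists_eLpNorm_smul_le hK hw hwK
  exact ⟨(F.aesm_iff.1 hf.1).smul hwm, (hle f).trans_lt (ENNReal.mul_lt_top hC.lt_top hf.2)⟩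

theorem aesm_S_apply (F : IsFrame m S T c) {g : Sp d → Sp d} (hg : AEStronglyMeasurable g volume) :
    AEStronglyMeasurable (fun x => S x (g x)) volume := by
  have : Continuous fun p : (Sp d →L[ℝ] Sp d) × Sp d => p.1 p.2 :=
    isBoundedBilinearMap_apply.continuous
  exact this.comp_aestronglyMeasurable (F.S_meas.prodMk hg)

theorem aesm_T_apply (F : IsFrame m S T c) {g : Sp d → Sp d} (hg : AEStronglyMeasurable g volume) :
    AEStronglyMeasurable (fun x => T x (g x)) volume := by
  have : Continuous fun p : (Sp d →L[ℝ] Sp d) × Sp d => p.1 p.2 :=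
    isBoundedBilinearMap_apply.continuous
  exact this.comp_aestronglyMeasurable (F.T_meas.prodMk hg)

theorem S_gradient_bdd (F : IsFrame m S T c) {g : Sp d → Sp d} (hg : Continuous g)
    (hgc : HasCompactSupport g) : ∃ D, ∀ᵐ x, ‖S x (g x)‖ ≤ D := by
  obtain ⟨C, hC⟩ := F.S_bdd _ hgc
  obtain ⟨D, hD⟩ := hgc.exists_bound_of_continuous hg
  refine ⟨max (C * D) 0, ?_⟩
  rw [ae_restrict_iff' hgc.measurableSet] at hC
  filter_upwards [hC] with x hx
  by_cases hxK : x ∈ tsupport g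
  · refine le_max_of_le_left ?_
    have h1 := hx hxK
    exact ((S x).le_opNorm _).trans
      (mul_le_mul h1 (hD x) (norm_nonneg _) ((norm_nonneg _).trans h1))
  · rw [image_eq_zero_of_notMem_tsupport hxK, map_zero, norm_zero]
    exact le_max_right _ _

theorem memLp_S (F : IsFrame m S T c) {g : Sp d → Sp d} (hg : Continuous g)
    (hgc : HasCompactSupport g) : MemLp (fun x => S x (g x)) 2 volume := by
  obtain ⟨D, hD⟩ := F.S_gradient_bdd hg hgc
  have h1 : MemLp (fun x => S x (g x)) 2 (volume.restrict (tsupport g)) := by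
    have : IsFiniteMeasure (volume.restrict (tsupport g)) :=
      ⟨by rw [Measure.restrict_apply_univ]; exact hgc.isCompact.measure_lt_top⟩
    exact MemLp.of_bound (F.aesm_S_apply hg.aestronglyMeasurable).restrict D
      (ae_restrict_of_ae hD)
  rw [← memLp_indicator_iff_restrict hgc.measurableSet] at h1
  refine h1.ae_eq (Eventually.of_forall fun x => ?_)
  by_cases hx : x ∈ tsupport g
  · simp [hx]
  · simp [hx, image_eq_zero_of_notMem_tsupport hx]

end IsFrame

end TestFunctions

/-! ### The energy space -/

section EnergySpace

variable {d : ℕ}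

/-- Dominated convergence in `L^p`. -/
theorem tendsto_eLpNorm_of_dominated {α : Type*} {E : Type*} [MeasurableSpace α]
    [NormedAddCommGroup E] {ν : Measure α} {p : ℝ≥0∞} (hp0 : p ≠ 0) (hp : p ≠ ⊤) {f : ℕ → α → E}
    {g : α → ℝ} (hf : ∀ n, AEStronglyMeasurable (f n) ν) (hg : MemLp g p ν)
    (hb : ∀ n, ∀ᵐ x ∂ν, ‖f n x‖ ≤ g x) (hlim : ∀ᵐ x ∂ν, Tendsto (fun n => f n x) atTop (𝓝 0)) :
    Tendsto (fun n => eLpNorm (f n) p ν) atTop (𝓝 0) := by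
  have hpr : 0 < p.toReal := ENNReal.toReal_pos hp0 hp
  have h1 : Tendsto (fun n => ∫⁻ x, ‖f n x‖ₑ ^ p.toReal ∂ν) atTop (𝓝 (∫⁻ _, 0 ∂ν)) := by
    refine tendsto_lintegral_of_dominated_convergence' (fun x => ‖g x‖ₑ ^ p.toReal)
      (fun n => (hf n).enorm.pow_const _) (fun n => ?_) ?_ ?_
    · filter_upwards [hb n] with x hx
      gcongr
      rw [enorm_le_iff_norm_le]
      exact hx.trans (le_abs_self _)
    · exact (lintegral_rpow_enorm_lt_top_of_eLpNorm_lt_top hp0 hp hg.2).ne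
    · filter_upwards [hlim] with x hx
      have h2 : Tendsto (fun n => ‖f n x‖ₑ ^ p.toReal) atTop (𝓝 (‖(0 : E)‖ₑ ^ p.toReal)) :=
        (ENNReal.continuous_rpow_const.tendsto _).comp hx.enorm
      simpa [hpr] using h2
  rw [lintegral_zero] at h1
  have h2 := (ENNReal.continuous_rpow_const (y := 1 / p.toReal)).tendsto 0 |>.comp h1
  rw [ENNReal.zero_rpow_of_pos (by positivity)] at h2
  refine h2.congr fun n => ?_
  rw [eLpNorm_eq_lintegral_rpow_enorm_toReal hp0 hp]
  rfl

/-- Pairs of a function in `L²(m dx)` and a field in `L²(dx)`. -/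
abbrev GSp (m : Sp d → ℝ) : Type :=
  WithLp 2 (Lp ℝ 2 (wm m) × Lp (Sp d) 2 (volume : Measure (Sp d)))

theorem tendsto_GSp {m : Sp d → ℝ} {P : ℕ → GSp m} {q : GSp m}
    (h1 : Tendsto (fun n => (P n).fst) atTop (𝓝 q.fst))
    (h2 : Tendsto (fun n => (P n).snd) atTop (𝓝 q.snd)) : Tendsto P atTop (𝓝 q) := by
  have := (WithLp.prod_continuous_toLp 2 (Lp ℝ 2 (wm m))
    (Lp (Sp d) 2 (volume : Measure (Sp d)))).tendsto (q.fst, q.snd) |>.comp (h1.prodMk_nhds h2)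
  exact this

theorem tendsto_fst {m : Sp d → ℝ} {P : ℕ → GSp m} {q : GSp m} (h : Tendsto P atTop (𝓝 q)) :
    Tendsto (fun n => (P n).fst) atTop (𝓝 q.fst) :=
  ((WithLp.continuous_fst 2 _ _).tendsto q).comp h

theorem tendsto_snd {m : Sp d → ℝ} {P : ℕ → GSp m} {q : GSp m} (h : Tendsto P atTop (𝓝 q)) :
    Tendsto (fun n => (P n).snd) atTop (𝓝 q.snd) :=
  ((WithLp.continuous_snd 2 _ _).tendsto q).comp h

/-- `p` is the pair `(φ, S ∇φ)` for the test function `φ` on `U`. -/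
def IsTestPair (m : Sp d → ℝ) (S : Sp d → Sp d →L[ℝ] Sp d) (U : Set (Sp d)) (φ : Sp d → ℝ)
    (p : GSp m) : Prop :=
  IsTest U φ ∧ p.fst =ᵐ[wm m] φ ∧ p.snd =ᵐ[volume] fun x => S x (gradient φ x)

theorem IsTestPair.add {m : Sp d → ℝ} {S : Sp d → Sp d →L[ℝ] Sp d} {U : Set (Sp d)}
    {φ v : Sp d → ℝ} {p q : GSp m} (hp : IsTestPair m S U φ p) (hq : IsTestPair m S U v q) :
    IsTestPair m S U (φ + v) (p + q) := by
  refine ⟨hp.1.add hq.1, ?_, ?_⟩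
  · rw [WithLp.add_fst]
    filter_upwards [Lp.coeFn_add p.fst q.fst, hp.2.1, hq.2.1] with x h1 h2 h3
    rw [h1, Pi.add_apply, h2, h3]; rfl
  · rw [WithLp.add_snd]
    filter_upwards [Lp.coeFn_add p.snd q.snd, hp.2.2, hq.2.2] with x h1 h2 h3
    rw [h1, Pi.add_apply, h2, h3, gradient_add_of_contDiff hp.1.1 hq.1.1, map_add]

theorem IsTestPair.const_smul {m : Sp d → ℝ} {S : Sp d → Sp d →L[ℝ] Sp d} {U : Set (Sp d)}
    {φ : Sp d → ℝ} {p : GSp m} (hp : IsTestPair m S U φ p) (r : ℝ) :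
    IsTestPair m S U (r • φ) (r • p) := by
  refine ⟨hp.1.const_smul r, ?_, ?_⟩
  · rw [WithLp.smul_fst]
    filter_upwards [Lp.coeFn_smul r p.fst, hp.2.1] with x h1 h2
    rw [h1, Pi.smul_apply, h2]; rfl
  · rw [WithLp.smul_snd]
    filter_upwards [Lp.coeFn_smul r p.snd, hp.2.2] with x h1 h2
    rw [h1, Pi.smul_apply, h2, gradient_const_smul_of_contDiff r hp.1.1, map_smul]

theorem IsTestPair.sub {m : Sp d → ℝ} {S : Sp d → Sp d →L[ℝ] Sp d} {U : Set (Sp d)}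
    {φ v : Sp d → ℝ} {p q : GSp m} (hp : IsTestPair m S U φ p) (hq : IsTestPair m S U v q) :
    IsTestPair m S U (φ - v) (p - q) := by
  have := hp.add (hq.const_smul (-1))
  rwa [neg_one_smul, neg_one_smul, ← sub_eq_add_neg, ← sub_eq_add_neg] at this

theorem IsTestPair.mono {m : Sp d → ℝ} {S : Sp d → Sp d →L[ℝ] Sp d} {U V : Set (Sp d)} (h : U ⊆ V)
    {φ : Sp d → ℝ} {p : GSp m} (hp : IsTestPair m S U φ p) : IsTestPair m S V φ p :=
  ⟨hp.1.mono h, hp.2⟩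

/-- The pairs `(φ, S ∇φ)` with `φ ∈ C_0^∞(U)`. -/
def testSub (m : Sp d → ℝ) (S : Sp d → Sp d →L[ℝ] Sp d) (U : Set (Sp d)) :
    Submodule ℝ (GSp m) where
  carrier := {p | ∃ φ, IsTestPair m S U φ p}
  add_mem' := fun ⟨φ, hφ⟩ ⟨v, hv⟩ => ⟨φ + v, hφ.add hv⟩
  zero_mem' := ⟨0, IsTest.zero, Lp.coeFn_zero _ _ _, by
    filter_upwards [Lp.coeFn_zero (Sp d) 2 (volume : Measure (Sp d))] with x hx
    have : gradient (0 : Sp d → ℝ) x = 0 := gradient_fun_const x 0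
    rw [this, map_zero]
    exact hx⟩
  smul_mem' := fun r _ ⟨φ, hφ⟩ => ⟨r • φ, hφ.const_smul r⟩

/-- The domain of the closed form on `U`: the closure of the pairs `(φ, S ∇φ)`, `φ ∈ C_0^∞(U)`. Its
elements consist of a function and its gradient in the coordinates of `S`. They live on the whole
space and vanish off `U`. -/
def energy (m : Sp d → ℝ) (S : Sp d → Sp d →L[ℝ] Sp d) (U : Set (Sp d)) : Submodule ℝ (GSp m) :=
  (testSub m S U).topologicalClosure

theorem isClosed_energy (m : Sp d → ℝ) (S : Sp d → Sp d →L[ℝ] Sp d) (U : Set (Sp d)) :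
    IsClosed (energy m S U : Set (GSp m)) := Submodule.isClosed_topologicalClosure _

theorem IsTestPair.mem {m : Sp d → ℝ} {S : Sp d → Sp d →L[ℝ] Sp d} {U : Set (Sp d)}
    {φ : Sp d → ℝ} {p : GSp m} (hp : IsTestPair m S U φ p) : p ∈ energy m S U :=
  Submodule.le_topologicalClosure _ ⟨φ, hp⟩

theorem energy_mono {m : Sp d → ℝ} {S : Sp d → Sp d →L[ℝ] Sp d} {U V : Set (Sp d)} (h : U ⊆ V) :
    energy m S U ≤ energy m S V :=
  Submodule.topologicalClosure_mono fun _ ⟨φ, hφ⟩ => ⟨φ, hφ.mono h⟩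

theorem mem_energy_iff {m : Sp d → ℝ} {S : Sp d → Sp d →L[ℝ] Sp d} {U : Set (Sp d)} {p : GSp m} :
    p ∈ energy m S U ↔ ∃ (φ : ℕ → Sp d → ℝ) (P : ℕ → GSp m),
      (∀ n, IsTestPair m S U (φ n) (P n)) ∧ Tendsto P atTop (𝓝 p) := by
  constructor
  · intro h
    obtain ⟨P, hP, hlim⟩ := mem_closure_iff_seq_limit.1 h
    choose φ hφ using hP
    exact ⟨φ, P, hφ, hlim⟩
  · rintro ⟨φ, P, hφ, hlim⟩
    exact (isClosed_energy m S U).mem_of_tendsto hlim (Eventually.of_forall fun n => (hφ n).mem)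

namespace IsFrame

variable {m : Sp d → ℝ} {S T : Sp d → Sp d →L[ℝ] Sp d} {c : Sp d → Sp d}

theorem exists_testPair (F : IsFrame m S T c) {U : Set (Sp d)} {φ : Sp d → ℝ} (hφ : IsTest U φ) :
    ∃ p, IsTestPair m S U φ p := by
  have := F.isFiniteMeasureOnCompacts
  have h1 : MemLp φ 2 (wm m) := hφ.memLp 2
  have h2 := F.memLp_S (continuous_gradient hφ.1) hφ.gradient_hasCompactSupport
  exact ⟨WithLp.toLp 2 (h1.toLp φ, h2.toLp _), hφ, h1.coeFn_toLp, h2.coeFn_toLp⟩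

theorem memLp_comp_mul (F : IsFrame m S T c) {W : Set (Sp d)} {φ : Sp d → ℝ} (hφ : IsTest W φ)
    {u : Sp d → ℝ} (hu : MemLp u 2 (wm m)) {h : ℝ → ℝ} (hh : ContDiff ℝ ∞ h) {C : ℝ}
    (hC : ∀ s, |deriv h s| ≤ C) {v : Sp d → ℝ} (hv : ContDiff ℝ ∞ v) {D : ℝ}
    (hD : ∀ x, |v x| ≤ D) (htest : MemLp (fun x => h (φ x) * v x) 2 (wm m)) :
    MemLp (fun x => h (u x) * v x) 2 (wm m) := by
  have := F.isFiniteMeasureOnCompacts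
  have hC0 : 0 ≤ C := (abs_nonneg _).trans (hC 0)
  have hlip : ∀ x, ‖h (u x) - h (φ x)‖ ≤ C * ‖u x - φ x‖ := fun x =>
    abs_sub_le_of_abs_deriv_le hh hC _ _
  have hm : AEStronglyMeasurable (fun x => h (u x)) (wm m) :=
    hh.continuous.comp_aestronglyMeasurable hu.1
  have hq : MemLp (fun x => (h (u x) - h (φ x)) * v x) 2 (wm m) := by
    refine (hu.sub (hφ.memLp 2)).of_le_mul (c := C * D)
      ((hm.sub (hh.continuous.comp hφ.1.continuous).aestronglyMeasurable).mul
        hv.continuous.aestronglyMeasurable) (Eventually.of_forall fun x => ?_)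
    rw [norm_mul]
    calc _ ≤ (C * ‖u x - φ x‖) * D :=
          mul_le_mul (hlip x) (hD x) (abs_nonneg _) (by positivity)
      _ = _ := by rw [Pi.sub_apply]; ring
  refine (hq.add htest).ae_eq (Eventually.of_forall fun x => ?_)
  simp only [Pi.add_apply]; ring

theorem memLp_gradient_comp_mul (F : IsFrame m S T c) {W : Set (Sp d)} {φ : Sp d → ℝ}
    (hφ : IsTest W φ) {u : Sp d → ℝ} (hu : MemLp u 2 (wm m)) {G : Sp d → Sp d}
    (hG : MemLp G 2 volume) {h : ℝ → ℝ} (hh : ContDiff ℝ ∞ h) {C : ℝ}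
    (hC : ∀ s, |deriv h s| ≤ C) {v : Sp d → ℝ} (hv : ContDiff ℝ ∞ v) {D : ℝ}
    (hD : ∀ x, |v x| ≤ D) (hvc : HasCompactSupport (gradient v)) :
    MemLp (fun x => (deriv h (u x) * v x) • G x + h (u x) • S x (gradient v x)) 2 volume := by
  have := F.isFiniteMeasureOnCompacts
  obtain ⟨E, hE⟩ := F.S_gradient_bdd (continuous_gradient hv) hvc
  have hwK : ∀ x, x ∉ tsupport (gradient v) → S x (gradient v x) = 0 := fun x hx => by
    rw [image_eq_zero_of_notMem_tsupport hx, map_zero]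
  have hum : AEStronglyMeasurable u volume := F.aesm_iff.1 hu.1
  have i1 : MemLp (fun x => (deriv h (u x) * v x) • G x) 2 volume := by
    refine hG.of_le_mul (c := C * D)
      ((((contDiff_deriv hh).continuous.comp_aestronglyMeasurable hum).mul
        hv.continuous.aestronglyMeasurable).smul hG.1) (Eventually.of_forall fun x => ?_)
    rw [norm_smul, norm_mul]
    exact mul_le_mul_of_nonneg_right
      (mul_le_mul (hC _) (hD x) (abs_nonneg _) ((abs_nonneg _).trans (hC 0))) (norm_nonneg _)
  have hd : MemLp (fun x => h (u x) - h (φ x)) 2 (wm m) :=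
    (hu.sub (hφ.memLp 2)).of_le_mul (c := C)
      ((hh.continuous.comp_aestronglyMeasurable hu.1).sub
        (hh.continuous.comp hφ.1.continuous).aestronglyMeasurable)
      (Eventually.of_forall fun x => abs_sub_le_of_abs_deriv_le hh hC _ _)
  have i2 := F.memLp_smul (F.aesm_S_apply (continuous_gradient hv).aestronglyMeasurable) hvc hE
    hwK hd
  have i3 : MemLp (fun x => S x (h (φ x) • gradient v x)) 2 volume :=
    F.memLp_S ((hh.continuous.comp hφ.1.continuous).smul (continuous_gradient hv))
      (hvc.smul_left (f := fun x => h (φ x)))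
  refine (i1.add (i2.add i3)).ae_eq (Eventually.of_forall fun x => ?_)
  simp only [Pi.add_apply, map_smul]
  rw [← add_smul, sub_add_cancel]

theorem tendsto_eLpNorm_comp_mul {ν : Measure (Sp d)} {φ : ℕ → Sp d → ℝ} {u : Sp d → ℝ}
    (hlim : Tendsto (fun n => eLpNorm (fun x => φ n x - u x) 2 ν) atTop (𝓝 0))
    {h : ℝ → ℝ} (hh : ContDiff ℝ ∞ h) {C : ℝ} (hC : ∀ s, |deriv h s| ≤ C) {v : Sp d → ℝ} {D : ℝ}
    (hD : ∀ x, |v x| ≤ D) :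
    Tendsto (fun n => eLpNorm (fun x => h (φ n x) * v x - h (u x) * v x) 2 ν) atTop (𝓝 0) := by
  have h1 : Tendsto (fun n => ENNReal.ofReal (C * D) *
      eLpNorm (fun x => φ n x - u x) 2 ν) atTop (𝓝 (ENNReal.ofReal (C * D) * 0)) :=
    ENNReal.Tendsto.const_mul hlim (Or.inr ENNReal.ofReal_ne_top)
  rw [mul_zero] at h1
  refine tendsto_of_tendsto_of_tendsto_of_le_of_le tendsto_const_nhds h1 (fun _ => zero_le)
    fun n => ?_
  refine eLpNorm_le_mul_eLpNorm_of_ae_le_mul (Eventually.of_forall fun x => ?_) 2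
  rw [← sub_mul, norm_mul]
  calc _ ≤ (C * ‖φ n x - u x‖) * D :=
        mul_le_mul (abs_sub_le_of_abs_deriv_le hh hC _ _) (hD x) (abs_nonneg _)
          (mul_nonneg ((abs_nonneg _).trans (hC 0)) (norm_nonneg _))
    _ = _ := by ring

theorem tendsto_eLpNorm_gradient_comp_mul (F : IsFrame m S T c) {W : Set (Sp d)}
    {φ : ℕ → Sp d → ℝ} (hφ : ∀ n, IsTest W (φ n)) {u : Sp d → ℝ}
    (hu : AEStronglyMeasurable u volume)
    (hlim : Tendsto (fun n => eLpNorm (fun x => φ n x - u x) 2 (wm m)) atTop (𝓝 0))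
    (hae : ∀ᵐ x, Tendsto (fun n => φ n x) atTop (𝓝 (u x)))
    {G : Sp d → Sp d} (hG : MemLp G 2 volume)
    (hGlim : Tendsto (fun n => eLpNorm (fun x => S x (gradient (φ n) x) - G x) 2 volume) atTop
      (𝓝 0))
    {h : ℝ → ℝ} (hh : ContDiff ℝ ∞ h) {C : ℝ} (hC : ∀ s, |deriv h s| ≤ C) {v : Sp d → ℝ}
    (hv : ContDiff ℝ ∞ v) {D : ℝ} (hD : ∀ x, |v x| ≤ D) (hvc : HasCompactSupport (gradient v)) :
    Tendsto (fun n => eLpNorm (fun x => S x (gradient (fun x => h (φ n x) * v x) x) -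
      ((deriv h (u x) * v x) • G x + h (u x) • S x (gradient v x))) 2 volume) atTop (𝓝 0) := by
  have hC0 : 0 ≤ C := (abs_nonneg _).trans (hC 0)
  have hD0 : 0 ≤ D := (abs_nonneg _).trans (hD 0)
  have hvm : AEStronglyMeasurable v volume := hv.continuous.aestronglyMeasurable
  have hdm : ∀ {f : Sp d → ℝ}, AEStronglyMeasurable f volume →
      AEStronglyMeasurable (fun x => deriv h (f x)) volume := fun hf =>
    (contDiff_deriv hh).continuous.comp_aestronglyMeasurable hf
  have hwm : AEStronglyMeasurable (fun x => S x (gradient v x)) volume :=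
    F.aesm_S_apply (continuous_gradient hv).aestronglyMeasurable
  have hφm : ∀ n, AEStronglyMeasurable (φ n) volume := fun n =>
    (hφ n).1.continuous.aestronglyMeasurable
  obtain ⟨E, hE⟩ := F.S_gradient_bdd (continuous_gradient hv) hvc
  have hwK : ∀ x, x ∉ tsupport (gradient v) → S x (gradient v x) = 0 := fun x hx => by
    rw [image_eq_zero_of_notMem_tsupport hx, map_zero]
  obtain ⟨E', hE', hEle⟩ := F.exists_eLpNorm_smul_le hvc hE hwK
  have l1 : Tendsto (fun n => ENNReal.ofReal (C * D) *
      eLpNorm (fun x => S x (gradient (φ n) x) - G x) 2 volume) atTop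
        (𝓝 (ENNReal.ofReal (C * D) * 0)) :=
    ENNReal.Tendsto.const_mul hGlim (Or.inr ENNReal.ofReal_ne_top)
  have l2 : Tendsto (fun n => eLpNorm (fun x =>
      ((deriv h (φ n x) - deriv h (u x)) * v x) • G x) 2 volume) atTop (𝓝 0) := by
    refine tendsto_eLpNorm_of_dominated (by norm_num) (by norm_num) (fun n => ?_)
      (hG.norm.const_mul (2 * C * D)) (fun n => Eventually.of_forall fun x => ?_) ?_
    · exact (((hdm (hφm n)).sub (hdm hu)).mul hvm).smul hG.1
    · rw [norm_smul, norm_mul]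
      have e1 := hC (φ n x)
      have e2 := hC (u x)
      exact mul_le_mul_of_nonneg_right (mul_le_mul
        ((norm_sub_le _ _).trans (by simp only [Real.norm_eq_abs]; linarith)) (hD x)
        (abs_nonneg _) (by positivity)) (norm_nonneg _)
    · filter_upwards [hae] with x h1
      have h3 := ((contDiff_deriv hh).continuous.tendsto (u x)).comp h1
      have h4 := (h3.sub_const (deriv h (u x))).mul_const (v x) |>.smul_const (G x)
      simpa using h4
  have l3 : Tendsto (fun n => E' * (ENNReal.ofReal C *
      eLpNorm (fun x => φ n x - u x) 2 (wm m))) atTop (𝓝 (E' * (ENNReal.ofReal C * 0))) :=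
    ENNReal.Tendsto.const_mul (ENNReal.Tendsto.const_mul hlim
      (Or.inr ENNReal.ofReal_ne_top)) (Or.inr hE')
  have l := (l1.add l2).add l3
  simp only [mul_zero, add_zero] at l
  refine tendsto_of_tendsto_of_tendsto_of_le_of_le tendsto_const_nhds l (fun _ => zero_le)
    fun n => ?_
  have key : (fun x => S x (gradient (fun x => h (φ n x) * v x) x) -
      ((deriv h (u x) * v x) • G x + h (u x) • S x (gradient v x))) =
      ((fun x => (deriv h (φ n x) * v x) • (S x (gradient (φ n) x) - G x))
      + (fun x => ((deriv h (φ n x) - deriv h (u x)) * v x) • G x))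
      + fun x => (h (φ n x) - h (u x)) • S x (gradient v x) := by
    funext x
    rw [gradient_comp_mul (hφ n).1 hv hh]
    simp only [map_add, map_smul, Pi.add_apply]
    module
  have m1 : AEStronglyMeasurable (fun x =>
      (deriv h (φ n x) * v x) • (S x (gradient (φ n) x) - G x)) volume :=
    ((hdm (hφm n)).mul hvm).smul
      ((F.aesm_S_apply (continuous_gradient (hφ n).1).aestronglyMeasurable).sub hG.1)
  have m2 : AEStronglyMeasurable (fun x =>
      ((deriv h (φ n x) - deriv h (u x)) * v x) • G x) volume :=
    (((hdm (hφm n)).sub (hdm hu)).mul hvm).smul hG.1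
  have m3 : AEStronglyMeasurable (fun x =>
      (h (φ n x) - h (u x)) • S x (gradient v x)) volume :=
    ((hh.continuous.comp_aestronglyMeasurable (hφm n)).sub
      (hh.continuous.comp_aestronglyMeasurable hu)).smul hwm
  rw [key]
  refine (eLpNorm_add_le (m1.add m2) m3 (by norm_num)).trans (add_le_add
    ((eLpNorm_add_le m1 m2 (by norm_num)).trans (add_le_add ?_ le_rfl)) ?_)
  · refine eLpNorm_le_mul_eLpNorm_of_ae_le_mul (Eventually.of_forall fun x => ?_) 2
    rw [norm_smul, norm_mul]
    exact mul_le_mul_of_nonneg_right (mul_le_mul (hC _) (hD x) (abs_nonneg _) hC0) (norm_nonneg _)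
  · refine (hEle _).trans ?_
    gcongr
    exact eLpNorm_le_mul_eLpNorm_of_ae_le_mul
      (Eventually.of_forall fun x => abs_sub_le_of_abs_deriv_le hh hC _ _) 2

/-- Composition with a smooth Lipschitz function `h` and multiplication by a smooth function `v` is
continuous on the energy space, up to subsequences. The cases `v = 1` and `v` a test function are
used. -/
theorem exists_subseq_comp_mul (F : IsFrame m S T c) {U W : Set (Sp d)} {φ : ℕ → Sp d → ℝ}
    {P : ℕ → GSp m} {p : GSp m} (hP : ∀ n, IsTestPair m S W (φ n) (P n))
    (hlim : Tendsto P atTop (𝓝 p)) {h : ℝ → ℝ} (hh : ContDiff ℝ ∞ h) {C : ℝ}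
    (hC : ∀ s, |deriv h s| ≤ C) {v : Sp d → ℝ} (hv : ContDiff ℝ ∞ v) {D : ℝ}
    (hD : ∀ x, |v x| ≤ D) (hvc : HasCompactSupport (gradient v))
    (htest : ∀ n, IsTest U fun x => h (φ n x) * v x) :
    ∃ (ns : ℕ → ℕ) (Q : ℕ → GSp m) (q : GSp m), StrictMono ns ∧
      (∀ n, IsTestPair m S U (fun x => h (φ (ns n) x) * v x) (Q n)) ∧
      Tendsto Q atTop (𝓝 q) ∧
      (q.fst =ᵐ[wm m] fun x => h (p.fst x) * v x) ∧
      q.snd =ᵐ[volume] fun x => (deriv h (p.fst x) * v x) • p.snd x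
        + h (p.fst x) • S x (gradient v x) := by
  have := F.isFiniteMeasureOnCompacts
  obtain ⟨ns, hns, hae⟩ := exists_subseq_tendsto_ae (tendsto_fst hlim)
  choose Q hQ using fun n => F.exists_testPair (htest (ns n))
  have hφ0 : Tendsto (fun n => eLpNorm (fun x => φ n x - p.fst x) 2 (wm m)) atTop (𝓝 0) := by
    have := (Lp.tendsto_Lp_iff_tendsto_eLpNorm' _ _).1 (tendsto_fst hlim)
    refine this.congr fun n => eLpNorm_congr_ae ?_
    filter_upwards [(hP n).2.1] with x hx
    rw [Pi.sub_apply, hx]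
  have hG0 : Tendsto (fun n => eLpNorm (fun x => S x (gradient (φ n) x) - p.snd x) 2 volume) atTop
      (𝓝 0) := by
    have := (Lp.tendsto_Lp_iff_tendsto_eLpNorm' _ _).1 (tendsto_snd hlim)
    refine this.congr fun n => eLpNorm_congr_ae ?_
    filter_upwards [(hP n).2.2] with x hx
    rw [Pi.sub_apply, hx]
  have hae' : ∀ᵐ x, Tendsto (fun n => φ (ns n) x) atTop (𝓝 (p.fst x)) := by
    have hall : ∀ᵐ x, ∀ n, (P (ns n)).fst x = φ (ns n) x :=
      ae_all_iff.2 fun n => F.ae_iff.1 (hP (ns n)).2.1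
    filter_upwards [F.ae_iff.1 hae, hall] with x h1 h2
    simpa only [h2] using h1
  have hq1 := F.memLp_comp_mul (hP 0).1 (Lp.memLp p.fst) hh hC hv hD ((htest 0).memLp 2)
  have hq2 := F.memLp_gradient_comp_mul (hP 0).1 (Lp.memLp p.fst) (Lp.memLp p.snd) hh hC hv hD hvc
  have e1 := hq1.coeFn_toLp
  have e2 := hq2.coeFn_toLp
  generalize hq1.toLp _ = q1 at e1
  generalize hq2.toLp _ = q2 at e2
  refine ⟨ns, Q, WithLp.toLp 2 (q1, q2), hns, hQ, tendsto_GSp ?_ ?_, e1, e2⟩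
  · rw [Lp.tendsto_Lp_iff_tendsto_eLpNorm']
    refine (tendsto_eLpNorm_comp_mul (hφ0.comp hns.tendsto_atTop) hh hC hD).congr fun n =>
      eLpNorm_congr_ae ?_
    filter_upwards [(hQ n).2.1, e1] with x h1 h2
    rw [Pi.sub_apply, h1]
    exact congrArg _ h2.symm
  · rw [Lp.tendsto_Lp_iff_tendsto_eLpNorm']
    refine (F.tendsto_eLpNorm_gradient_comp_mul (fun n => (hP (ns n)).1)
      (F.aesm_iff.1 (Lp.aestronglyMeasurable p.fst)) (hφ0.comp hns.tendsto_atTop) hae'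
      (Lp.memLp p.snd) (hG0.comp hns.tendsto_atTop) hh hC hv hD hvc).congr fun n =>
      eLpNorm_congr_ae ?_
    filter_upwards [(hQ n).2.2, e2] with x h1 h2
    rw [Pi.sub_apply, h1]
    exact congrArg _ h2.symm

/-- The chain rule in the energy space. -/
theorem energy_comp (F : IsFrame m S T c) {U : Set (Sp d)} {p : GSp m} (hp : p ∈ energy m S U)
    {h : ℝ → ℝ} (hh : ContDiff ℝ ∞ h) (h0 : h 0 = 0) {C : ℝ} (hC : ∀ s, |deriv h s| ≤ C) :
    ∃ q ∈ energy m S U, (q.fst =ᵐ[wm m] fun x => h (p.fst x)) ∧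
      q.snd =ᵐ[volume] fun x => deriv h (p.fst x) • p.snd x := by
  obtain ⟨φ, P, hP, hlim⟩ := mem_energy_iff.1 hp
  obtain ⟨ns, Q, q, -, hQ, hQq, h1, h2⟩ := F.exists_subseq_comp_mul (U := U) hP hlim hh hC
    (v := fun _ => 1) contDiff_const (D := 1) (by simp) (by
      have : gradient (fun _ : Sp d => (1 : ℝ)) = 0 := funext fun x => gradient_fun_const x 1
      rw [this]; exact HasCompactSupport.zero) (fun n => by
      simpa using (hP n).1.comp hh h0)
  refine ⟨q, mem_energy_iff.2 ⟨_, Q, hQ, hQq⟩, ?_, ?_⟩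
  · simpa using h1
  · simpa [gradient_fun_const] using h2

/-- The product rule in the energy space. -/
theorem energy_comp_mul (F : IsFrame m S T c) {U W : Set (Sp d)} {p : GSp m}
    (hp : p ∈ energy m S W) {h : ℝ → ℝ} (hh : ContDiff ℝ ∞ h) {C : ℝ} (hC : ∀ s, |deriv h s| ≤ C)
    {v : Sp d → ℝ} (hv : IsTest U v) :
    ∃ q ∈ energy m S U, (q.fst =ᵐ[wm m] fun x => h (p.fst x) * v x) ∧
      q.snd =ᵐ[volume] fun x => (deriv h (p.fst x) * v x) • p.snd x
        + h (p.fst x) • S x (gradient v x) := by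
  obtain ⟨φ, P, hP, hlim⟩ := mem_energy_iff.1 hp
  obtain ⟨D, hD⟩ := hv.exists_bound
  obtain ⟨ns, Q, q, -, hQ, hQq, h1, h2⟩ := F.exists_subseq_comp_mul (U := U) hP hlim hh hC
    hv.1 hD hv.gradient_hasCompactSupport (fun n => hv.comp_mul (hP n).1.1 hh)
  exact ⟨q, mem_energy_iff.2 ⟨_, Q, hQ, hQq⟩, h1, h2⟩

end IsFrame

end EnergySpace

/-! ### Weak gradients and closability -/

section WeakGradients

variable {d : ℕ}

theorem inner_toLp_right {α E : Type*} [MeasurableSpace α] [NormedAddCommGroup E]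
    [InnerProductSpace ℝ E] {ν : Measure α} (f : Lp E 2 ν) {g : α → E} (hg : MemLp g 2 ν) :
    inner ℝ f (hg.toLp g) = ∫ x, inner ℝ (f x) (g x) ∂ν := by
  rw [L2.inner_def]
  refine integral_congr_ae ?_
  filter_upwards [hg.coeFn_toLp] with x hx
  rw [hx]

theorem tendsto_integral_inner {α E : Type*} [MeasurableSpace α] [NormedAddCommGroup E]
    [InnerProductSpace ℝ E] {ν : Measure α} {f : ℕ → Lp E 2 ν} {f₀ : Lp E 2 ν}
    (hf : Tendsto f atTop (𝓝 f₀)) {g : α → E} (hg : MemLp g 2 ν) :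
    Tendsto (fun n => ∫ x, inner ℝ (f n x) (g x) ∂ν) atTop (𝓝 (∫ x, inner ℝ (f₀ x) (g x) ∂ν)) := by
  simp only [← inner_toLp_right _ hg]
  exact hf.inner tendsto_const_nhds

theorem memLp_of_bound_of_compact {E : Type*} [NormedAddCommGroup E] {ν : Measure (Sp d)}
    [IsFiniteMeasureOnCompacts ν] {f : Sp d → E} (hf : AEStronglyMeasurable f ν) {K : Set (Sp d)}
    (hK : IsCompact K) {C : ℝ} (hC : ∀ᵐ x ∂ν, x ∈ K → ‖f x‖ ≤ C) (hfK : ∀ x, x ∉ K → f x = 0)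
    (p : ℝ≥0∞) : MemLp f p ν := by
  have h1 : MemLp f p (ν.restrict K) := by
    have : IsFiniteMeasure (ν.restrict K) :=
      ⟨by rw [Measure.restrict_apply_univ]; exact hK.measure_lt_top⟩
    exact MemLp.of_bound hf.restrict C ((ae_restrict_iff' hK.measurableSet).2 hC)
  rw [← memLp_indicator_iff_restrict hK.measurableSet] at h1
  refine h1.ae_eq (Eventually.of_forall fun x => ?_)
  by_cases hx : x ∈ K
  · simp [hx]
  · simp [hx, hfK x hx]

theorem HasWeakGradient.mono {U V : Set (Sp d)} (hU : MeasurableSet U) (h : U ⊆ V)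
    {u u' : Sp d → ℝ} {g g' : Sp d → Sp d} (hw : HasWeakGradient V u g)
    (hu : u' =ᵐ[volume.restrict U] u) (hg : g' =ᵐ[volume.restrict U] g) :
    HasWeakGradient U u' g' := by
  have huU : ∀ᵐ x, x ∈ U → u' x = u x := (ae_restrict_iff' hU).1 hu
  have hgU : ∀ᵐ x, x ∈ U → g' x = g x := (ae_restrict_iff' hU).1 hg
  refine ⟨?_, ?_, fun φ hφ i => ?_⟩
  · intro x hx
    obtain ⟨t, ht, hi⟩ := hw.1.mono_set h x hx
    refine ⟨t ∩ U, inter_mem ht self_mem_nhdsWithin, ?_⟩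
    exact (hi.mono_set inter_subset_left).congr_fun_ae
      (EventuallyEq.symm (ae_restrict_of_ae_restrict_of_subset inter_subset_right hu))
  · intro x hx
    obtain ⟨t, ht, hi⟩ := hw.2.1.mono_set h x hx
    refine ⟨t ∩ U, inter_mem ht self_mem_nhdsWithin, ?_⟩
    exact (hi.mono_set inter_subset_left).congr_fun_ae
      (EventuallyEq.symm (ae_restrict_of_ae_restrict_of_subset inter_subset_right hg))
  · have e : ∀ (s : Set (Sp d)), U ⊆ s → ∀ f : Sp d → ℝ, (∀ x, x ∉ U → f x = 0) →
        ∫ x in s, f x = ∫ x, f x := fun s hs f hf =>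
      setIntegral_eq_integral_of_forall_compl_eq_zero fun x hx => hf x fun hxU => hx (hs hxU)
    have h1 : ∀ f : Sp d → ℝ, ∀ x, x ∉ U → f x * gradient φ x i = 0 := fun f x hx => by
      rw [hφ.gradient_eq_zero fun h => hx (hφ.2.2 h)]; simp
    have h2 : ∀ f : Sp d → ℝ, ∀ x, x ∉ U → f x * φ x = 0 := fun f x hx => by
      rw [hφ.eq_zero hx, mul_zero]
    have h3 := hw.2.2 φ (hφ.mono h) i
    rw [e V h _ (h1 _), e V h _ (h2 fun x => g x i)] at h3
    rw [setIntegral_congr_ae (f := fun x => u' x * gradient φ x i)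
        (g := fun x => u x * gradient φ x i) hU
        (huU.mono fun x hx hxU => by rw [hx hxU]),
      setIntegral_congr_ae (f := fun x => g' x i * φ x) (g := fun x => g x i * φ x) hU
        (hgU.mono fun x hx hxU => by rw [hx hxU]),
      e U subset_rfl _ (h1 _), e U subset_rfl _ (h2 fun x => g x i), h3]

theorem HasWeakGradient.unique {U : Set (Sp d)} (hU : IsOpen U) {u : Sp d → ℝ}
    {g g' : Sp d → Sp d} (h : HasWeakGradient U u g) (h' : HasWeakGradient U u g') :
    g =ᵐ[volume.restrict U] g' := by
  have key : ∀ i : Fin d, ∀ᵐ x, x ∈ U → g x i - g' x i = 0 := by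
    intro i
    have hl : ∀ {f : Sp d → Sp d}, LocallyIntegrableOn f U volume →
        LocallyIntegrableOn (fun x => f x i) U volume := fun hf x hx => by
      obtain ⟨t, ht, hi⟩ := hf x hx
      exact ⟨t, ht, (EuclideanSpace.proj (𝕜 := ℝ) i).integrable_comp hi⟩
    refine hU.ae_eq_zero_of_integral_contDiff_smul_eq_zero ((hl h.2.1).sub (hl h'.2.1))
      fun φ h1 h2 h3 => ?_
    have hφ : IsTest U φ := ⟨h1, h2, h3⟩
    have hi : ∀ {f : Sp d → Sp d}, LocallyIntegrableOn f U volume →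
        Integrable fun x => f x i * φ x := fun {f} hf => by
      have hK : IntegrableOn (fun x => f x i) (tsupport φ) :=
        (hl hf).integrableOn_compact_subset h3 h2
      have := hK.mul_continuousOn h1.continuous.continuousOn h2
      refine (integrableOn_iff_integrable_of_support_subset fun x hx => ?_).1 this
      exact subset_tsupport _ fun h0 => hx (by simp [h0])
    have e : ∀ f : Sp d → Sp d, ∫ x in U, f x i * φ x = ∫ x, f x i * φ x := fun f =>
      setIntegral_eq_integral_of_forall_compl_eq_zero fun x hx => by
        rw [hφ.eq_zero hx, mul_zero]
    have h4 := h.2.2 φ hφ i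
    rw [h'.2.2 φ hφ i, e, e, neg_inj] at h4
    have h5 := integral_sub (hi h.2.1) (hi h'.2.1)
    rw [h4, sub_self] at h5
    rw [← h5]
    refine integral_congr_ae (Eventually.of_forall fun x => ?_)
    simp only [smul_eq_mul]; ring
  rw [Filter.EventuallyEq, ae_restrict_iff' hU.measurableSet]
  filter_upwards [ae_all_iff.2 key] with x hx hxU
  ext i
  exact sub_eq_zero.1 (hx i hxU)

theorem gradient_apply {φ : Sp d → ℝ} (i : Fin d) (x : Sp d) :
    gradient φ x i = fderiv ℝ φ x (EuclideanSpace.single i 1) := by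
  have h := InnerProductSpace.toDual_symm_apply (𝕜 := ℝ) (x := EuclideanSpace.single i (1 : ℝ))
    (y := fderiv ℝ φ x)
  rw [← h, EuclideanSpace.inner_single_right]
  simp [gradient]

theorem IsTest.integral_mul_gradient {U V : Set (Sp d)} {φ v : Sp d → ℝ} (hφ : IsTest U φ)
    (hv : IsTest V v) (i : Fin d) :
    ∫ x, v x * gradient φ x i = - ∫ x, gradient v x i * φ x := by
  have hc : ∀ {f : Sp d → ℝ}, ContDiff ℝ ∞ f → Continuous fun x => gradient f x i := fun hf =>
    (EuclideanSpace.proj (𝕜 := ℝ) i).continuous.comp (continuous_gradient hf)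
  simp only [gradient_apply] at hc ⊢
  refine integral_mul_fderiv_eq_neg_fderiv_mul_of_integrable ?_ ?_ ?_
    (fun x _ => hv.1.differentiable (by simp) x) (fun x _ => hφ.1.differentiable (by simp) x)
  · exact ((hc hv.1).mul hφ.1.continuous).integrable_of_hasCompactSupport hφ.2.1.mul_left
  · exact (hv.1.continuous.mul (hc hφ.1)).integrable_of_hasCompactSupport hv.2.1.mul_right
  · exact (hv.1.continuous.mul hφ.1.continuous).integrable_of_hasCompactSupport hφ.2.1.mul_left

theorem norm_GSp_sq {m : Sp d → ℝ} (p : GSp m) : ‖p‖ ^ 2 = ‖p.fst‖ ^ 2 + ‖p.snd‖ ^ 2 :=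
  WithLp.prod_norm_sq_eq_of_L2 p

theorem norm_sq_le_of_weak_limit {H : Type*} [NormedAddCommGroup H] [InnerProductSpace ℝ H]
    {p : ℕ → H} {q : H} (h : Tendsto (fun n => inner ℝ q (p n)) atTop (𝓝 (inner ℝ q q)))
    {a : ℕ → ℝ} {b : ℝ} (ha : Tendsto a atTop (𝓝 b)) (hle : ∀ n, ‖p n‖ ^ 2 ≤ a n) :
    ‖q‖ ^ 2 ≤ b := by
  rw [real_inner_self_eq_norm_sq] at h
  have h1 : Tendsto (fun n => 2 * inner ℝ q (p n) - a n) atTop (𝓝 (2 * ‖q‖ ^ 2 - b)) :=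
    (h.const_mul 2).sub ha
  have h2 : 2 * ‖q‖ ^ 2 - b ≤ ‖q‖ ^ 2 := by
    refine le_of_tendsto' h1 fun n => ?_
    have h3 := real_inner_le_norm q (p n)
    nlinarith [hle n, sq_nonneg (‖q‖ - ‖p n‖)]
  linarith

namespace IsFrame

variable {m : Sp d → ℝ} {S T : Sp d → Sp d →L[ℝ] Sp d} {c : Sp d → Sp d}

theorem energy_eq_zero (F : IsFrame m S T c) {U : Set (Sp d)} {p : GSp m}
    (hp : p ∈ energy m S U) : ∀ᵐ x, x ∉ U → p.fst x = 0 ∧ p.snd x = 0 := by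
  obtain ⟨φ, P, hP, hlim⟩ := mem_energy_iff.1 hp
  obtain ⟨ns, -, h1⟩ := exists_subseq_tendsto_ae (tendsto_fst hlim)
  obtain ⟨ks, -, h2⟩ := exists_subseq_tendsto_ae (tendsto_snd hlim)
  have h3 : ∀ᵐ x, ∀ n, (P n).fst x = φ n x := ae_all_iff.2 fun n => F.ae_iff.1 (hP n).2.1
  have h4 : ∀ᵐ x, ∀ n, (P n).snd x = S x (gradient (φ n) x) := ae_all_iff.2 fun n => (hP n).2.2
  filter_upwards [F.ae_iff.1 h1, h2, h3, h4] with x h1 h2 h3 h4 hx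
  refine ⟨tendsto_nhds_unique h1 (tendsto_const_nhds.congr fun n => ?_),
    tendsto_nhds_unique h2 (tendsto_const_nhds.congr fun n => ?_)⟩
  · rw [h3, (hP _).1.eq_zero hx]
  · rw [h4, (hP _).1.gradient_eq_zero fun h => hx ((hP _).1.2.2 h), map_zero]

theorem memLp_inv_mul (F : IsFrame m S T c) {g : Sp d → ℝ} (hg : Continuous g)
    (hgc : HasCompactSupport g) : MemLp (fun x => (m x)⁻¹ * g x) 2 (wm m) := by
  have := F.isFiniteMeasureOnCompacts
  obtain ⟨C, hC⟩ := F.m_inv _ hgc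
  obtain ⟨D, hD⟩ := hgc.exists_bound_of_continuous hg
  refine memLp_of_bound_of_compact (F.aesm_iff.2 ?_) hgc (C := C * D) ?_ (fun x hx => ?_) 2
  · exact F.m_meas.aemeasurable.inv.aestronglyMeasurable.mul hg.aestronglyMeasurable
  · rw [ae_restrict_iff' hgc.measurableSet] at hC
    rw [F.ae_iff]
    filter_upwards [hC, F.m_pos] with x hx hp hxK
    rw [norm_mul, Real.norm_of_nonneg (inv_nonneg.2 hp.le)]
    exact mul_le_mul (hx hxK) (hD x) (norm_nonneg _) ((inv_nonneg.2 hp.le).trans (hx hxK))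
  · simp [image_eq_zero_of_notMem_tsupport hx]

theorem integral_mul_eq_wm (F : IsFrame m S T c) (f g : Sp d → ℝ) :
    ∫ x, f x * g x = ∫ x, inner ℝ (f x) ((m x)⁻¹ * g x) ∂(wm m) := by
  rw [F.integral_wm]
  refine integral_congr_ae ?_
  filter_upwards [F.m_pos] with x hx
  simp only [RCLike.inner_apply, conj_trivial]
  field_simp

/-- The first component of an element of the energy space is weakly differentiable, and the second
component is `S` applied to its weak gradient. -/
theorem hasWeakGradient (F : IsFrame m S T c) {U : Set (Sp d)} {p : GSp m}
    (hp : p ∈ energy m S U) : HasWeakGradient univ p.fst fun x => T x (p.snd x) := by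
  have hTm : AEStronglyMeasurable (fun x => T x (p.snd x)) volume :=
    F.aesm_T_apply (Lp.aestronglyMeasurable _)
  refine ⟨?_, ?_, fun φ hφ i => ?_⟩
  · rw [locallyIntegrableOn_univ, locallyIntegrable_iff]
    intro K hK
    have : IsFiniteMeasure (volume.restrict K) :=
      ⟨by rw [Measure.restrict_apply_univ]; exact hK.measure_lt_top⟩
    exact (F.memLp_restrict hK (Lp.memLp p.fst)).integrable (by norm_num)
  · rw [locallyIntegrableOn_univ, locallyIntegrable_iff]
    intro K hK
    have : IsFiniteMeasure (volume.restrict K) :=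
      ⟨by rw [Measure.restrict_apply_univ]; exact hK.measure_lt_top⟩
    obtain ⟨C, hC⟩ := F.T_bdd K hK
    have h1 : MemLp (fun x => T x (p.snd x)) 2 (volume.restrict K) := by
      refine ((Lp.memLp p.snd).restrict K).of_le_mul (c := C) hTm.restrict ?_
      filter_upwards [hC] with x hx
      exact ((T x).le_opNorm _).trans (by gcongr)
    exact h1.integrable (by norm_num)
  · rw [setIntegral_univ, setIntegral_univ]
    obtain ⟨v, P, hP, hlim⟩ := mem_energy_iff.1 hp
    have hc : Continuous fun x => gradient φ x i :=
      (EuclideanSpace.proj (𝕜 := ℝ) i).continuous.comp (continuous_gradient hφ.1)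
    have hcc : HasCompactSupport fun x => gradient φ x i :=
      hφ.gradient_hasCompactSupport.comp_left (g := fun y : Sp d => y i) rfl
    have l1 := tendsto_integral_inner (tendsto_fst hlim) (F.memLp_inv_mul hc hcc)
    let e : Sp d := EuclideanSpace.single i 1
    have hw : MemLp (fun x => φ x • ContinuousLinearMap.adjoint (T x) e) 2 volume := by
      obtain ⟨C, hC⟩ := F.T_bdd _ hφ.2.1
      obtain ⟨D, hD⟩ := hφ.exists_bound
      refine memLp_of_bound_of_compact ?_ hφ.2.1 (C := D * (C * ‖e‖)) ?_ (fun x hx => ?_) 2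
      · refine hφ.1.continuous.aestronglyMeasurable.smul ?_
        have h1 : Continuous fun L : Sp d →L[ℝ] Sp d => ContinuousLinearMap.adjoint L e :=
          ((ContinuousLinearMap.adjoint (𝕜 := ℝ) (E := Sp d) (F := Sp d)).continuous).clm_apply
            continuous_const
        exact h1.comp_aestronglyMeasurable F.T_meas
      · filter_upwards [(ae_restrict_iff' hφ.2.1.measurableSet).1 hC] with x hx hxK
        rw [norm_smul]
        refine mul_le_mul (hD x) ((ContinuousLinearMap.le_opNorm _ _).trans ?_) (norm_nonneg _)
          ((norm_nonneg _).trans (hD x))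
        rw [LinearIsometryEquiv.norm_map]
        exact mul_le_mul_of_nonneg_right (hx hxK) (norm_nonneg _)
      · rw [image_eq_zero_of_notMem_tsupport hx, zero_smul]
    have l2 := (tendsto_integral_inner (tendsto_snd hlim) hw).neg
    have e2 : ∀ g : Sp d → Sp d, ∀ x, inner ℝ (g x) (φ x • ContinuousLinearMap.adjoint (T x) e)
        = T x (g x) i * φ x := fun g x => by
      rw [inner_smul_right, ContinuousLinearMap.adjoint_inner_right,
        EuclideanSpace.inner_single_right]
      simp [mul_comm]
    simp only [e2, ← F.integral_mul_eq_wm] at l1 l2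
    refine tendsto_nhds_unique l1 (l2.congr fun n => ?_)
    have e3 : ∫ x, (P n).fst x * gradient φ x i = ∫ x, v n x * gradient φ x i := by
      refine integral_congr_ae ?_
      filter_upwards [F.ae_iff.1 (hP n).2.1] with x h1
      rw [h1]
    have e4 : ∫ x, T x ((P n).snd x) i * φ x = ∫ x, gradient (v n) x i * φ x := by
      refine integral_congr_ae ?_
      filter_upwards [(hP n).2.2, F.inv] with x h1 h2
      rw [h1, (h2 _).1]
    rw [e3, e4, hφ.integral_mul_gradient (hP n).1]

/-- The form is closable: an element of the energy space is determined by its first component. -/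
theorem energy_snd_eq_zero (F : IsFrame m S T c) {U : Set (Sp d)} {p : GSp m}
    (hp : p ∈ energy m S U) (h0 : p.fst = 0) : p = 0 := by
  have h1 := F.hasWeakGradient hp
  have h2 : HasWeakGradient univ p.fst fun _ => 0 := by
    refine ⟨h1.1, (locallyIntegrable_zero (X := Sp d)).locallyIntegrableOn _, fun φ hφ i => ?_⟩
    rw [integral_congr_ae (g := fun _ => 0)]
    · simp
    · rw [Measure.restrict_univ]
      rw [h0]
      filter_upwards [F.ae_iff.1 (Lp.coeFn_zero ℝ 2 (wm m))] with x hx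
      rw [hx]; simp
  have h3 := h1.unique isOpen_univ h2
  rw [Measure.restrict_univ] at h3
  have h4 : p.snd = 0 := by
    refine Lp.ext ?_
    filter_upwards [h3, F.inv, Lp.coeFn_zero (Sp d) 2 (volume : Measure (Sp d))] with x h3 h4 h5
    rw [h5, ← (h4 (p.snd x)).2, h3, map_zero]; rfl
  have : p = WithLp.toLp 2 (p.fst, p.snd) := rfl
  rw [this, h0, h4]
  rfl

theorem energy_ext (F : IsFrame m S T c) {U : Set (Sp d)} {p q : GSp m}
    (hp : p ∈ energy m S U) (hq : q ∈ energy m S U) (h : p.fst = q.fst) : p = q :=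
  sub_eq_zero.1 (F.energy_snd_eq_zero ((energy m S U).sub_mem hp hq)
    (by rw [WithLp.sub_fst, h, sub_self]))

/-- A sequence with bounded energy which converges in `L²` has its limit in the energy space, and
the gradients converge weakly. -/
theorem exists_energy_weak_limit (F : IsFrame m S T c) {U : Set (Sp d)} {p : ℕ → GSp m}
    (hp : ∀ n, p n ∈ energy m S U) {M : ℝ} (hM : ∀ n, ‖(p n).snd‖ ≤ M) {u : Lp ℝ 2 (wm m)}
    (hu : Tendsto (fun n => (p n).fst) atTop (𝓝 u)) :
    ∃ q ∈ energy m S U, q.fst = u ∧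
      ∀ z, Tendsto (fun n => inner ℝ z (p n).snd) atTop (𝓝 (inner ℝ z q.snd)) := by
  obtain ⟨M', hM'⟩ := hu.norm.bddAbove_range
  let J : GSp m →L[ℝ] Lp ℝ 2 (wm m) :=
    WithLp.fstL 2 ℝ (Lp ℝ 2 (wm m)) (Lp (Sp d) 2 (volume : Measure (Sp d)))
  have hb : ∀ n, ‖p n‖ ≤ M' + M := fun n => by
    have h1 := hM n
    have h2 := hM' ⟨n, rfl⟩
    have h0 := norm_nonneg (p n).fst
    have h0' := norm_nonneg (p n).snd
    simp only at h2
    refine abs_le_of_sq_le_sq' ?_ (by linarith) |>.2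
    rw [norm_GSp_sq]
    nlinarith
  obtain ⟨q, hq, hqu, hw⟩ := exists_weak_limit (isClosed_energy m S U) J
    (fun p hp h => F.energy_snd_eq_zero hp h) hp hb hu
  refine ⟨q, hq, hqu, fun z => ?_⟩
  have := hw (WithLp.toLp 2 (0, z))
  simpa [WithLp.prod_inner_apply] using this

/-! ### The divergence free drift -/

theorem memLp_drift (F : IsFrame m S T c) {V : Set (Sp d)} (hV : Bornology.IsBounded V)
    (hVm : MeasurableSet V) : MemLp (V.indicator fun x => m x • c x) 2 volume := by
  rw [memLp_indicator_iff_restrict hVm]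
  exact (F.c_loc _ hV.isCompact_closure).mono_measure (Measure.restrict_mono subset_closure le_rfl)

theorem drift_eq (_ : IsFrame m S T c) {V : Set (Sp d)} {g : Sp d → Sp d}
    (hg : ∀ᵐ x, x ∉ V → g x = 0) :
    (fun x => inner ℝ (g x) (V.indicator (fun x => m x • c x) x)) =ᵐ[volume]
      fun x => m x * inner ℝ (c x) (g x) := by
  filter_upwards [hg] with x hx
  by_cases h : x ∈ V
  · rw [indicator_of_mem h, inner_smul_right, real_inner_comm]
  · rw [hx h, inner_zero_left, inner_zero_right, mul_zero]

theorem integrable_drift (F : IsFrame m S T c) {V : Set (Sp d)} (hV : Bornology.IsBounded V)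
    (hVm : MeasurableSet V) {g : Sp d → Sp d} (hg2 : MemLp g 2 volume)
    (hg : ∀ᵐ x, x ∉ V → g x = 0) : Integrable (fun x => inner ℝ (c x) (g x)) (wm m) := by
  rw [F.integrable_wm]
  refine Integrable.congr ?_ (F.drift_eq hg)
  have := L2.integrable_inner (𝕜 := ℝ) (hg2.toLp g) ((F.memLp_drift hV hVm).toLp _)
  refine this.congr ?_
  filter_upwards [hg2.coeFn_toLp, (F.memLp_drift hV hVm).coeFn_toLp] with x h1 h2
  rw [h1, h2]

theorem integral_drift (F : IsFrame m S T c) {V : Set (Sp d)} {g : Sp d → Sp d}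
    (hg : ∀ᵐ x, x ∉ V → g x = 0) : ∫ x, inner ℝ (c x) (g x) ∂(wm m) =
      ∫ x, inner ℝ (g x) (V.indicator (fun x => m x • c x) x) := by
  rw [F.integral_wm]
  exact (integral_congr_ae (F.drift_eq hg)).symm

/-- The drift is orthogonal to all gradients in the energy space of a bounded set. -/
theorem integral_drift_eq_zero (F : IsFrame m S T c) {V : Set (Sp d)}
    (hV : Bornology.IsBounded V) (hVm : MeasurableSet V) {p : GSp m} (hp : p ∈ energy m S V) :
    ∫ x, inner ℝ (c x) (p.snd x) ∂(wm m) = 0 := by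
  obtain ⟨φ, P, hP, hlim⟩ := mem_energy_iff.1 hp
  rw [F.integral_drift ((F.energy_eq_zero hp).mono fun x hx h => (hx h).2)]
  refine tendsto_nhds_unique (tendsto_integral_inner (tendsto_snd hlim) (F.memLp_drift hV hVm))
    (tendsto_const_nhds.congr fun n => ?_)
  rw [← F.integral_drift ((F.energy_eq_zero (hP n).mem).mono fun x hx h => (hx h).2),
    F.integral_wm, ← F.c_div (φ n) ((hP n).1.mono (subset_univ _))]
  refine integral_congr_ae ?_
  filter_upwards [(hP n).2.2] with x hx
  rw [hx, inner_smul_left]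
  rfl

theorem integral_comp_mul_drift_eq_zero (F : IsFrame m S T c) {V : Set (Sp d)}
    (hV : Bornology.IsBounded V) (hVm : MeasurableSet V) {p : GSp m} (hp : p ∈ energy m S V)
    {h : ℝ → ℝ} (hh : ContDiff ℝ ∞ h) {C : ℝ} (hC : ∀ s, |h s| ≤ C) :
    ∫ x, h (p.fst x) * inner ℝ (c x) (p.snd x) ∂(wm m) = 0 := by
  obtain ⟨H, hH, h0, hd⟩ := exists_primitive hh
  obtain ⟨q, hq, -, h2⟩ := F.energy_comp hp hH h0 (C := C) (by simpa [hd] using hC)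
  rw [← F.integral_drift_eq_zero hV hVm hq]
  refine integral_congr_ae ?_
  filter_upwards [F.ae_iff.2 h2] with x hx
  rw [hx, inner_smul_right, hd]

end IsFrame

end WeakGradients

/-! ### Limits of solutions -/

section Limits

variable {d : ℕ}

/-- `w` is the image of `p.fst` under the generator of the closed form on `U`, extended by zero off
`U`. -/
def IsGen (m : Sp d → ℝ) (S : Sp d → Sp d →L[ℝ] Sp d) (U : Set (Sp d)) (p : GSp m)
    (w : Lp ℝ 2 (wm m)) : Prop :=
  p ∈ energy m S U ∧ (∀ᵐ x ∂(wm m), x ∉ U → w x = 0) ∧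
    ∀ q ∈ energy m S U, inner ℝ p.snd q.snd = - inner ℝ w q.fst

/-- The function `w + ⟨c, G⟩`, where `G` is the second component of `p`. -/
def drifted {m : Sp d → ℝ} (c : Sp d → Sp d) (p : GSp m) (w : Lp ℝ 2 (wm m)) : Sp d → ℝ :=
  fun x => w x + inner ℝ (c x) (p.snd x)

theorem eLpNorm_two_le_of_bound {α : Type*} [MeasurableSpace α] {ν : Measure α} {f g : α → ℝ}
    {A B : ℝ} (hA : ∀ x, |f x| ≤ A) (hB : ∀ x, |f x| ≤ B * |g x|) :
    eLpNorm f 2 ν ≤ (ENNReal.ofReal (A * B) * eLpNorm g 1 ν) ^ (1 / 2 : ℝ) := by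
  rw [eLpNorm_eq_lintegral_rpow_enorm_toReal (by norm_num) (by norm_num),
    eLpNorm_one_eq_lintegral_enorm, ENNReal.toReal_ofNat,
    ← lintegral_const_mul' _ _ ENNReal.ofReal_ne_top]
  gcongr with x
  have h1 : ‖f x‖ₑ ^ (2 : ℝ) = ENNReal.ofReal (|f x| * |f x|) := by
    rw [Real.enorm_eq_ofReal_abs, ENNReal.ofReal_mul (abs_nonneg _)]
    norm_num [sq]
  rw [h1, Real.enorm_eq_ofReal_abs, ← ENNReal.ofReal_mul' (abs_nonneg _)]
  refine ENNReal.ofReal_le_ofReal ?_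
  have hA0 : 0 ≤ A := (abs_nonneg _).trans (hA x)
  calc |f x| * |f x| ≤ A * (B * |g x|) := mul_le_mul (hA x) (hB x) (abs_nonneg _) hA0
    _ = A * B * |g x| := by ring

theorem tendsto_eLpNorm_two_comp {α : Type*} [MeasurableSpace α] {ν : Measure α} {u : ℕ → α → ℝ}
    {u₀ : α → ℝ} (hu : Tendsto (fun n => eLpNorm (fun x => u n x - u₀ x) 1 ν) atTop (𝓝 0))
    {h : ℝ → ℝ} (hh : ContDiff ℝ ∞ h) {C D : ℝ} (hC : ∀ s, |h s| ≤ C) (hD : ∀ s, |deriv h s| ≤ D) :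
    Tendsto (fun n => eLpNorm (fun x => h (u n x) - h (u₀ x)) 2 ν) atTop (𝓝 0) := by
  have h1 : Tendsto (fun n => (ENNReal.ofReal (2 * C * D) *
      eLpNorm (fun x => u n x - u₀ x) 1 ν) ^ (1 / 2 : ℝ)) atTop (𝓝 0) := by
    have h2 := ENNReal.Tendsto.const_mul hu (Or.inr (ENNReal.ofReal_ne_top (r := 2 * C * D)))
    rw [mul_zero] at h2
    have h3 := (ENNReal.continuous_rpow_const (y := 1 / 2)).tendsto 0 |>.comp h2
    rwa [ENNReal.zero_rpow_of_pos (by positivity)] at h3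
  refine tendsto_of_tendsto_of_tendsto_of_le_of_le tendsto_const_nhds h1 (fun _ => zero_le)
    fun n => ?_
  refine eLpNorm_two_le_of_bound (fun x => ?_) fun x => abs_sub_le_of_abs_deriv_le hh hD _ _
  have e1 := hC (u n x)
  have e2 := hC (u₀ x)
  exact (abs_sub _ _).trans (by linarith)

theorem memLp_two_comp {α : Type*} [MeasurableSpace α] {ν : Measure α} {u : α → ℝ}
    (hu : Integrable u ν) {h : ℝ → ℝ} (hh : ContDiff ℝ ∞ h) (h0 : h 0 = 0) {C D : ℝ}
    (hC : ∀ s, |h s| ≤ C) (hD : ∀ s, |deriv h s| ≤ D) : MemLp (fun x => h (u x)) 2 ν := by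
  refine ⟨hh.continuous.comp_aestronglyMeasurable hu.1, (eLpNorm_two_le_of_bound (fun x => hC _)
    fun x => abs_le_of_abs_deriv_le hh h0 hD (u x)).trans_lt ?_⟩
  refine ENNReal.rpow_lt_top_of_nonneg (by positivity)
    (ENNReal.mul_ne_top ENNReal.ofReal_ne_top ?_)
  exact (memLp_one_iff_integrable.2 hu).2.ne

theorem tendsto_integral_mul {α : Type*} [MeasurableSpace α] {ν : Measure α} {y : ℕ → α → ℝ}
    {y₀ : α → ℝ} (hyn : ∀ n, Integrable (y n) ν) (hy₀ : Integrable y₀ ν)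
    (hy : Tendsto (fun n => eLpNorm (fun x => y n x - y₀ x) 1 ν) atTop (𝓝 0))
    {g : ℕ → α → ℝ} {g₀ : α → ℝ} (hg : ∀ n, AEStronglyMeasurable (g n) ν) {C : ℝ}
    (hC : ∀ n x, |g n x| ≤ C) (hlim : ∀ᵐ x ∂ν, Tendsto (fun n => g n x) atTop (𝓝 (g₀ x))) :
    Tendsto (fun n => ∫ x, y n x * g n x ∂ν) atTop (𝓝 (∫ x, y₀ x * g₀ x ∂ν)) := by
  have h1 : Tendsto (fun n => ∫ x, y₀ x * g n x ∂ν) atTop (𝓝 (∫ x, y₀ x * g₀ x ∂ν)) := by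
    refine tendsto_integral_of_dominated_convergence (fun x => |y₀ x| * C)
      (fun n => hy₀.1.mul (hg n)) (hy₀.abs.mul_const C)
      (fun n => Eventually.of_forall fun x => ?_) (hlim.mono fun x hx => hx.const_mul _)
    rw [norm_mul]
    exact mul_le_mul_of_nonneg_left (hC n x) (abs_nonneg _)
  have h2 : Tendsto (fun n => ∫ x, (y n x - y₀ x) * g n x ∂ν) atTop (𝓝 0) := by
    have h3 : Tendsto (fun n => (eLpNorm (fun x => y n x - y₀ x) 1 ν).toReal * C) atTop
        (𝓝 0) := by
      have := ((ENNReal.tendsto_toReal ENNReal.zero_ne_top).comp hy).mul_const C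
      simpa using this
    refine squeeze_zero_norm (fun n => ?_) h3
    have hi : Integrable (fun x => y n x - y₀ x) ν := (hyn n).sub hy₀
    have h4 : (eLpNorm (fun x => y n x - y₀ x) 1 ν).toReal = ∫ x, ‖y n x - y₀ x‖ ∂ν := by
      rw [integral_norm_eq_lintegral_enorm hi.1, eLpNorm_one_eq_lintegral_enorm]
    rw [h4, ← integral_mul_const]
    refine norm_integral_le_of_norm_le (hi.norm.mul_const C) (Eventually.of_forall fun x => ?_)
    rw [norm_mul]
    exact mul_le_mul_of_nonneg_left (hC n x) (norm_nonneg _)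
  have h5 := h2.add h1
  rw [zero_add] at h5
  refine h5.congr fun n => ?_
  have hb : ∀ {f : α → ℝ}, Integrable f ν → Integrable (fun x => f x * g n x) ν := fun hf =>
    hf.mul_bdd (c := C) (hg n) (Eventually.of_forall fun x => hC n x)
  have hi : Integrable (fun x => y n x - y₀ x) ν := (hyn n).sub hy₀
  rw [← integral_add (hb hi) (hb hy₀)]
  refine integral_congr_ae (Eventually.of_forall fun x => ?_)
  simp only; ring

namespace IsFrame

variable {m : Sp d → ℝ} {S T : Sp d → Sp d →L[ℝ] Sp d} {c : Sp d → Sp d}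

theorem integrable_of_bounded (F : IsFrame m S T c) {V : Set (Sp d)} (hV : Bornology.IsBounded V)
    (hVm : MeasurableSet V) {f : Lp ℝ 2 (wm m)} (hf : ∀ᵐ x, x ∉ V → f x = 0) :
    Integrable f (wm m) := by
  have : IsFiniteMeasure ((wm m).restrict V) :=
    ⟨by rw [Measure.restrict_apply_univ]; exact F.wm_lt_top hV⟩
  have h1 : Integrable f ((wm m).restrict V) :=
    ((Lp.memLp f).restrict V).integrable (by norm_num)
  refine ((integrable_indicator_iff hVm).2 h1).congr ?_
  filter_upwards [F.ae_iff.2 hf] with x hx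
  by_cases hxV : x ∈ V
  · simp [hxV]
  · simp [hxV, hx hxV]

theorem drifted_integrable (F : IsFrame m S T c) {V : Set (Sp d)} (hV : Bornology.IsBounded V)
    (hVm : MeasurableSet V) {p : GSp m} {w : Lp ℝ 2 (wm m)} (h : IsGen m S V p w) :
    Integrable (drifted c p w) (wm m) := by
  exact (F.integrable_of_bounded hV hVm (F.ae_iff.1 h.2.1)).add
    (F.integrable_drift hV hVm (Lp.memLp p.snd)
      ((F.energy_eq_zero h.1).mono fun x hx h => (hx h).2))

theorem integrable_mul_norm_sq {g : Sp d → ℝ} (hg : AEStronglyMeasurable g volume) {C : ℝ}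
    (hC : ∀ x, |g x| ≤ C) (G : Lp (Sp d) 2 (volume : Measure (Sp d))) :
    Integrable fun x => g x * ‖G x‖ ^ 2 := by
  have h1 : Integrable fun x => ‖G x‖ ^ 2 := (Lp.memLp G).integrable_norm_pow (by norm_num)
  exact h1.bdd_mul (c := C) hg (Eventually.of_forall hC)

/-- Testing the equation with `h(u)`: the drift does not contribute. -/
theorem integral_deriv_mul_norm_sq (F : IsFrame m S T c) {V : Set (Sp d)}
    (hV : Bornology.IsBounded V) (hVm : MeasurableSet V) {p : GSp m} {w : Lp ℝ 2 (wm m)}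
    (hg : IsGen m S V p w) {h : ℝ → ℝ} (hh : IsTruncation h) :
    ∫ x, deriv h (p.fst x) * ‖p.snd x‖ ^ 2 = - ∫ x, drifted c p w x * h (p.fst x) ∂(wm m) := by
  obtain ⟨C, hC⟩ := hh.bdd
  obtain ⟨D, hD⟩ := hh.abs_deriv_le
  obtain ⟨q, hq, h1, h2⟩ := F.energy_comp hg.1 hh.contDiff hh.zero hD
  have e1 : inner ℝ p.snd q.snd = ∫ x, deriv h (p.fst x) * ‖p.snd x‖ ^ 2 := by
    rw [L2.inner_def]
    refine integral_congr_ae ?_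
    filter_upwards [h2] with x hx
    rw [hx, inner_smul_right, real_inner_self_eq_norm_sq]
  have hwh : (fun x => inner ℝ (w x) (q.fst x)) =ᵐ[wm m] fun x => w x * h (p.fst x) := by
    filter_upwards [h1] with x hx
    rw [hx]
    simp [mul_comm]
  have e2 : inner ℝ w q.fst = ∫ x, w x * h (p.fst x) ∂(wm m) := by
    rw [L2.inner_def]
    exact integral_congr_ae hwh
  have e3 := F.integral_comp_mul_drift_eq_zero hV hVm hg.1 hh.contDiff hC
  have e4 := hg.2.2 q hq
  rw [e1, e2] at e4
  rw [e4]
  congr 1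
  have i1 : Integrable (fun x => w x * h (p.fst x)) (wm m) :=
    (L2.integrable_inner (𝕜 := ℝ) w q.fst).congr hwh
  have i2 : Integrable (fun x => h (p.fst x) * inner ℝ (c x) (p.snd x)) (wm m) :=
    (F.integrable_drift hV hVm (Lp.memLp p.snd)
      ((F.energy_eq_zero hg.1).mono fun x hx h => (hx h).2)).bdd_mul (c := C)
      (hh.contDiff.continuous.comp_aestronglyMeasurable (Lp.aestronglyMeasurable _))
      (Eventually.of_forall fun x => hC _)
  rw [← add_zero (∫ x, w x * h (p.fst x) ∂(wm m)), ← e3, ← integral_add i1 i2]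
  refine integral_congr_ae (Eventually.of_forall fun x => ?_)
  simp only [drifted]; ring

theorem memLp_smul_drift (F : IsFrame m S T c) {U : Set (Sp d)} {v : Sp d → ℝ} (hv : IsTest U v) :
    MemLp (fun x => v x • m x • c x) 2 volume := by
  obtain ⟨D, hD⟩ := hv.exists_bound
  have h1 : MemLp (fun x => v x • m x • c x) 2 (volume.restrict (tsupport v)) := by
    refine (F.c_loc _ hv.2.1).of_le_mul (c := D)
      (hv.1.continuous.aestronglyMeasurable.restrict.smul (F.c_loc _ hv.2.1).1)
      (Eventually.of_forall fun x => ?_)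
    rw [norm_smul]
    exact mul_le_mul_of_nonneg_right (hD x) (norm_nonneg _)
  rw [← memLp_indicator_iff_restrict hv.2.1.measurableSet] at h1
  refine h1.ae_eq (Eventually.of_forall fun x => ?_)
  by_cases hx : x ∈ tsupport v
  · simp [hx]
  · simp [hx, image_eq_zero_of_notMem_tsupport hx]

theorem integral_mul_drift (F : IsFrame m S T c) (g : Sp d → Sp d) (v : Sp d → ℝ) :
    ∫ x, inner ℝ (c x) (g x) * v x ∂(wm m) = ∫ x, inner ℝ (g x) (v x • m x • c x) := by
  rw [F.integral_wm]
  refine integral_congr_ae (Eventually.of_forall fun x => ?_)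
  simp only [inner_smul_right]
  rw [real_inner_comm]; ring

end IsFrame

/-- Solutions `(p n).fst` on bounded sets `V n ⊆ U` which converge to `u`, and whose images under
the operators with drift converge to `y`, both in `L¹`. -/
structure GenLimit (m : Sp d → ℝ) (S : Sp d → Sp d →L[ℝ] Sp d) (c : Sp d → Sp d) (U : Set (Sp d))
    (V : ℕ → Set (Sp d)) (p : ℕ → GSp m) (w : ℕ → Lp ℝ 2 (wm m)) (u y : Sp d → ℝ) : Prop where
  bounded : ∀ n, Bornology.IsBounded (V n)
  meas : ∀ n, MeasurableSet (V n)
  sub : ∀ n, V n ⊆ U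
  gen : ∀ n, IsGen m S (V n) (p n) (w n)
  integrable_fst : Integrable u (wm m)
  integrable_snd : Integrable y (wm m)
  lim_fst : Tendsto (fun n => eLpNorm (fun x => (p n).fst x - u x) 1 (wm m)) atTop (𝓝 0)
  lim_snd : Tendsto (fun n => eLpNorm (fun x => drifted c (p n) (w n) x - y x) 1 (wm m)) atTop
    (𝓝 0)

namespace GenLimit

variable {m : Sp d → ℝ} {S T : Sp d → Sp d →L[ℝ] Sp d} {c : Sp d → Sp d} {U : Set (Sp d)}
  {V : ℕ → Set (Sp d)} {p : ℕ → GSp m} {w : ℕ → Lp ℝ 2 (wm m)} {u y : Sp d → ℝ}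

theorem subseq (L : GenLimit m S c U V p w u y) {ns : ℕ → ℕ} (hns : StrictMono ns) :
    GenLimit m S c U (V ∘ ns) (p ∘ ns) (w ∘ ns) u y :=
  ⟨fun _ => L.bounded _, fun _ => L.meas _, fun _ => L.sub _, fun _ => L.gen _,
    L.integrable_fst, L.integrable_snd, L.lim_fst.comp hns.tendsto_atTop,
    L.lim_snd.comp hns.tendsto_atTop⟩

theorem exists_subseq (L : GenLimit m S c U V p w u y) : ∃ ns : ℕ → ℕ, StrictMono ns ∧
    ∀ᵐ x ∂(wm m), Tendsto (fun n => (p (ns n)).fst x) atTop (𝓝 (u x)) := by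
  let f : ℕ → Sp d → ℝ := fun n => (p n).fst
  have hf : ∀ n, AEStronglyMeasurable (f n) (wm m) := fun n => Lp.aestronglyMeasurable _
  have h : Tendsto (fun n => eLpNorm (f n - u) 1 (wm m)) atTop (𝓝 0) := L.lim_fst
  exact (tendstoInMeasure_of_tendsto_eLpNorm one_ne_zero hf
    L.integrable_fst.1 h).exists_seq_tendsto_ae

theorem tendsto_integral (F : IsFrame m S T c) (L : GenLimit m S c U V p w u y)
    (hae : ∀ᵐ x ∂(wm m), Tendsto (fun n => (p n).fst x) atTop (𝓝 (u x)))
    {h : ℝ → ℝ} (hc : Continuous h) {C : ℝ} (hC : ∀ s, |h s| ≤ C) {v : Sp d → ℝ}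
    (hv : AEStronglyMeasurable v (wm m)) {D : ℝ} (hD : ∀ x, |v x| ≤ D) :
    Tendsto (fun n => ∫ x, drifted c (p n) (w n) x * (h ((p n).fst x) * v x) ∂(wm m)) atTop
      (𝓝 (∫ x, y x * (h (u x) * v x) ∂(wm m))) := by
  refine tendsto_integral_mul (fun n => F.drifted_integrable (L.bounded n) (L.meas n) (L.gen n))
    L.integrable_snd L.lim_snd
    (fun n => (hc.comp_aestronglyMeasurable (Lp.aestronglyMeasurable _)).mul hv) (C := C * D)
    (fun n x => ?_) ?_
  · rw [abs_mul]
    exact mul_le_mul (hC _) (hD _) (abs_nonneg _) ((abs_nonneg _).trans (hC 0))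
  · filter_upwards [hae] with x hx
    exact ((hc.tendsto _).comp hx).mul_const _

theorem tendsto_integral' (F : IsFrame m S T c) (L : GenLimit m S c U V p w u y)
    (hae : ∀ᵐ x ∂(wm m), Tendsto (fun n => (p n).fst x) atTop (𝓝 (u x)))
    {h : ℝ → ℝ} (hc : Continuous h) {C : ℝ} (hC : ∀ s, |h s| ≤ C) :
    Tendsto (fun n => ∫ x, drifted c (p n) (w n) x * h ((p n).fst x) ∂(wm m)) atTop
      (𝓝 (∫ x, y x * h (u x) ∂(wm m))) := by
  simpa using L.tendsto_integral F hae hc hC (v := fun _ => 1) aestronglyMeasurable_const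
    (D := 1) (by simp)

/-- Truncations `h(u)` of the limit belong to the energy space, since the energies of `h(u n)` are
bounded by testing the approximating equations with `h(u n)`. -/
theorem truncate (F : IsFrame m S T c) (L : GenLimit m S c U V p w u y)
    (hae : ∀ᵐ x ∂(wm m), Tendsto (fun n => (p n).fst x) atTop (𝓝 (u x)))
    {h : ℝ → ℝ} (hh : IsTruncation h) {C : ℝ} (hC : ∀ s, deriv h s ≤ C) :
    ∃ q ∈ energy m S U, (q.fst =ᵐ[wm m] fun x => h (u x)) ∧
      ‖q.snd‖ ^ 2 ≤ C * -∫ x, y x * h (u x) ∂(wm m) ∧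
      ∃ r : ℕ → GSp m, (∀ n, (r n).snd =ᵐ[volume]
        fun x => deriv h ((p n).fst x) • (p n).snd x) ∧
        ∀ z, Tendsto (fun n => inner ℝ z (r n).snd) atTop (𝓝 (inner ℝ z q.snd)) := by
  obtain ⟨M, hM⟩ := hh.bdd
  have hD : ∀ s, |deriv h s| ≤ C := fun s => by
    rw [abs_of_nonneg (hh.deriv_nonneg s)]; exact hC s
  choose r hr hr1 hr2 using fun n => F.energy_comp (L.gen n).1 hh.contDiff hh.zero hD
  have hu := memLp_two_comp L.integrable_fst hh.contDiff hh.zero hM hD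
  have hlim : Tendsto (fun n => (r n).fst) atTop (𝓝 (hu.toLp _)) := by
    rw [Lp.tendsto_Lp_iff_tendsto_eLpNorm']
    refine (tendsto_eLpNorm_two_comp L.lim_fst hh.contDiff hM hD).congr fun n =>
      eLpNorm_congr_ae ?_
    filter_upwards [hr1 n, hu.coeFn_toLp] with x h1 h2
    rw [Pi.sub_apply, h1, h2]
  have hle : ∀ n, ‖(r n).snd‖ ^ 2 ≤
      C * -∫ x, drifted c (p n) (w n) x * h ((p n).fst x) ∂(wm m) := by
    intro n
    rw [← F.integral_deriv_mul_norm_sq (L.bounded n) (L.meas n) (L.gen n) hh,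
      ← real_inner_self_eq_norm_sq, L2.inner_def, ← integral_const_mul]
    have hm : AEStronglyMeasurable (fun x => deriv h ((p n).fst x)) volume :=
      (contDiff_deriv hh.contDiff).continuous.comp_aestronglyMeasurable
        (F.aesm_iff.1 (Lp.aestronglyMeasurable _))
    refine integral_mono_ae (L2.integrable_inner _ _)
      ((IsFrame.integrable_mul_norm_sq hm (fun x => hD _) _).const_mul C) ?_
    filter_upwards [hr2 n] with x hx
    rw [hx, inner_smul_left, inner_smul_right, real_inner_self_eq_norm_sq]
    exact mul_le_mul_of_nonneg_right (hC _) (mul_nonneg (hh.deriv_nonneg _) (sq_nonneg _))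
  have ha := ((L.tendsto_integral' F hae hh.contDiff.continuous hM).neg).const_mul C
  obtain ⟨A, hA⟩ := ha.bddAbove_range
  have hrb : ∀ n, ‖(r n).snd‖ ≤ 1 + A := fun n => by
    have h1 := (hle n).trans (hA ⟨n, rfl⟩)
    nlinarith [sq_nonneg (‖(r n).snd‖ - 1), norm_nonneg (r n).snd]
  obtain ⟨q, hq, hqu, hw⟩ := F.exists_energy_weak_limit
    (fun n => energy_mono (L.sub n) (hr n)) hrb hlim
  refine ⟨q, hq, ?_, norm_sq_le_of_weak_limit (hw q.snd) ha hle, r, hr2, hw⟩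
  rw [hqu]
  exact hu.coeFn_toLp

/-- The limit relation is truncation dissipative. -/
theorem integral_mul_nonpos (F : IsFrame m S T c) (L : GenLimit m S c U V p w u y) {h : ℝ → ℝ}
    (hh : IsTruncation h) : ∫ x, y x * h (u x) ∂(wm m) ≤ 0 := by
  obtain ⟨ns, hns, hae⟩ := L.exists_subseq
  obtain ⟨C, hC⟩ := hh.bdd_deriv
  obtain ⟨q, -, -, h1, -⟩ := (L.subseq hns).truncate F hae hh (C := C + 1)
    (fun s => (hC s).trans (by linarith))
  have h2 : 0 ≤ C := (hh.deriv_nonneg 0).trans (hC 0)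
  have h3 := (sq_nonneg _).trans h1
  have h4 := nonneg_of_mul_nonneg_right h3 (by linarith : (0 : ℝ) < C + 1)
  linarith

/-- A bounded limit belongs to the energy space and solves the limit equation. In the proof the
approximating equations are tested with `h'(u n) v`, where `h` is a truncation which is the identity
on the range of `u`. The term with `h''` is controlled by the energy on the set where `u n` is
large, and this energy tends to zero. -/
theorem exists_energy (F : IsFrame m S T c) (L : GenLimit m S c U V p w u y) {M : ℝ} (hM0 : 0 ≤ M)
    (hM : ∀ᵐ x ∂(wm m), |u x| ≤ M) :
    ∃ q ∈ energy m S U, q.fst =ᵐ[wm m] u ∧ ‖q.snd‖ ^ 2 ≤ -∫ x, y x * u x ∂(wm m) ∧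
      ∀ v P, IsTestPair m S U v P → (∀ᶠ n in atTop, IsTest (V n) v) →
        inner ℝ q.snd P.snd - ∫ x, inner ℝ (c x) (q.snd x) * v x ∂(wm m) =
          -∫ x, y x * v x ∂(wm m) := by
  obtain ⟨ns, hns, hae⟩ := L.exists_subseq
  replace L := L.subseq hns
  obtain ⟨h, k, hh, hk, h1, hid, hhk⟩ := exists_truncation_eq_self hM0
  obtain ⟨q, hq, hqu, hqn, r, hr, hw⟩ := L.truncate F hae hh h1
  have hhu : ∀ᵐ x ∂(wm m), h (u x) = u x ∧ deriv h (u x) = 1 ∧ k (u x) = 0 :=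
    hM.mono fun x hx => hid _ hx
  have hyu : ∫ x, y x * h (u x) ∂(wm m) = ∫ x, y x * u x ∂(wm m) := by
    refine integral_congr_ae ?_
    filter_upwards [hhu] with x hx
    rw [hx.1]
  rw [hyu, one_mul] at hqn
  refine ⟨q, hq, hqu.trans (hhu.mono fun x hx => hx.1), hqn, fun v P hP hev => ?_⟩
  replace hev := hns.tendsto_atTop.eventually hev
  obtain ⟨D, hD⟩ := hP.1.exists_bound
  obtain ⟨K, hK⟩ := hk.bdd
  obtain ⟨K', hK'⟩ := hk.abs_deriv_le
  have hh1 : ∀ s, |deriv h s| ≤ 1 := fun s => by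
    rw [abs_of_nonneg (hh.deriv_nonneg s)]; exact h1 s
  have hh2 : ∀ s, |deriv (deriv h) s| ≤ K' := fun s =>
    ((hhk s).trans (le_abs_self _)).trans (hK' s)
  have hdm : ∀ n, AEStronglyMeasurable (fun x => deriv k (((p ∘ ns) n).fst x)) volume := fun n =>
    (contDiff_deriv hk.contDiff).continuous.comp_aestronglyMeasurable
      (F.aesm_iff.1 (Lp.aestronglyMeasurable _))
  -- the energy where the approximations are large
  have ltail : Tendsto (fun n => D * ∫ x, deriv k (((p ∘ ns) n).fst x) * ‖((p ∘ ns) n).snd x‖ ^ 2)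
      atTop (𝓝 0) := by
    have l1 := ((L.tendsto_integral' F hae hk.contDiff.continuous hK).neg).const_mul D
    have e : ∫ x, y x * k (u x) ∂(wm m) = 0 := by
      rw [integral_congr_ae (g := fun _ => 0)]
      · simp
      · filter_upwards [hhu] with x hx
        rw [hx.2.2, mul_zero]
    rw [e, neg_zero, mul_zero] at l1
    refine l1.congr fun n => ?_
    rw [F.integral_deriv_mul_norm_sq (L.bounded n) (L.meas n) (L.gen n) hk]
  have lI : Tendsto (fun n => ∫ x, deriv (deriv h) (((p ∘ ns) n).fst x) * v x *
      ‖((p ∘ ns) n).snd x‖ ^ 2) atTop (𝓝 0) := by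
    refine squeeze_zero_norm (fun n => ?_) ltail
    rw [← integral_const_mul]
    refine norm_integral_le_of_norm_le
      ((IsFrame.integrable_mul_norm_sq (hdm n) (fun x => hK' _) _).const_mul D)
      (Eventually.of_forall fun x => ?_)
    rw [norm_mul, norm_mul, Real.norm_of_nonneg (sq_nonneg _)]
    calc _ ≤ deriv k (((p ∘ ns) n).fst x) * D * ‖((p ∘ ns) n).snd x‖ ^ 2 := by
          refine mul_le_mul_of_nonneg_right ?_ (sq_nonneg _)
          exact mul_le_mul (hhk _) (hD x) (abs_nonneg _) (hk.deriv_nonneg _)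
      _ = _ := by ring
  have lY := (L.tendsto_integral F hae (contDiff_deriv hh.contDiff).continuous hh1
    hP.1.1.continuous.aestronglyMeasurable hD).neg
  have eY : ∫ x, y x * (deriv h (u x) * v x) ∂(wm m) = ∫ x, y x * v x ∂(wm m) := by
    refine integral_congr_ae ?_
    filter_upwards [hhu] with x hx
    rw [hx.2.1, one_mul]
  rw [eY] at lY
  have hmc := F.memLp_smul_drift hP.1
  have lhs : Tendsto (fun n => inner ℝ P.snd (r n).snd - inner ℝ (hmc.toLp _) (r n).snd) atTop
      (𝓝 (inner ℝ P.snd q.snd - inner ℝ (hmc.toLp _) q.snd)) := (hw _).sub (hw _)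
  have edrift : ∀ G : Lp (Sp d) 2 (volume : Measure (Sp d)),
      inner ℝ (hmc.toLp _) G = ∫ x, inner ℝ (c x) (G x) * v x ∂(wm m) := fun G => by
    rw [real_inner_comm, inner_toLp_right, F.integral_mul_drift]
  rw [real_inner_comm, ← edrift]
  refine tendsto_nhds_unique lhs ?_
  have := lY.sub lI
  rw [sub_zero] at this
  refine this.congr' ?_
  filter_upwards [hev] with n hn
  obtain ⟨s, hs, hs1, hs2⟩ := F.energy_comp_mul (L.gen n).1 (contDiff_deriv hh.contDiff) hh2 hn
  set pn := (p ∘ ns) n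
  set wn := (w ∘ ns) n
  have hdh : AEStronglyMeasurable (fun x => deriv (deriv h) (pn.fst x) * v x) volume :=
    ((contDiff_deriv (contDiff_deriv hh.contDiff)).continuous.comp_aestronglyMeasurable
      (F.aesm_iff.1 (Lp.aestronglyMeasurable _))).mul hP.1.1.continuous.aestronglyMeasurable
  have e1 : inner ℝ pn.snd s.snd = (∫ x, deriv (deriv h) (pn.fst x) * v x * ‖pn.snd x‖ ^ 2)
      + inner ℝ P.snd (r n).snd := by
    rw [L2.inner_def, L2.inner_def, ← integral_add]
    · refine integral_congr_ae ?_
      filter_upwards [hs2, hr n, hP.2.2] with x h1 h2 h3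
      rw [h1, h2, h3, inner_add_right, inner_smul_right, inner_smul_right, inner_smul_right,
        real_inner_self_eq_norm_sq, real_inner_comm (pn.snd x)]
    · refine IsFrame.integrable_mul_norm_sq hdh (C := K' * D) (fun x => ?_) _
      rw [abs_mul]
      exact mul_le_mul (hh2 _) (hD x) (abs_nonneg _) ((abs_nonneg _).trans (hh2 0))
    · exact L2.integrable_inner _ _
  have hdh' : AEStronglyMeasurable (fun x => deriv h (pn.fst x) * v x) (wm m) :=
    ((contDiff_deriv hh.contDiff).continuous.comp_aestronglyMeasurable
      (Lp.aestronglyMeasurable _)).mul hP.1.1.continuous.aestronglyMeasurable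
  have e2 : ∫ x, drifted c pn wn x * (deriv h (pn.fst x) * v x) ∂(wm m)
      = inner ℝ wn s.fst + inner ℝ (hmc.toLp _) (r n).snd := by
    rw [edrift, L2.inner_def, ← integral_add]
    · refine integral_congr_ae ?_
      filter_upwards [hs1, F.ae_iff.2 (hr n)] with x h1 h2
      rw [h1, h2, inner_smul_right]
      simp only [drifted, RCLike.inner_apply, conj_trivial]
      ring
    · exact L2.integrable_inner _ _
    · have i1 : Integrable (fun x => inner ℝ (c x) (pn.snd x)) (wm m) :=
        F.integrable_drift (L.bounded n) (L.meas n) (Lp.memLp _)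
          ((F.energy_eq_zero (L.gen n).1).mono fun x hx h => (hx h).2)
      refine (i1.mul_bdd (c := 1 * D) hdh' (Eventually.of_forall fun x => ?_)).congr ?_
      · rw [norm_mul]
        exact mul_le_mul (hh1 _) (hD x) (abs_nonneg _) zero_le_one
      · filter_upwards [F.ae_iff.2 (hr n)] with x h2
        rw [h2, inner_smul_right]; ring
  have e3 := (L.gen n).2.2 s hs
  rw [e1] at e3
  rw [e2]
  linarith

end GenLimit

end Limits

/-! ### Bounded elements of the energy space -/

section BoundedElements

variable {d : ℕ}

namespace IsFrame

variable {m : Sp d → ℝ} {S T : Sp d → Sp d →L[ℝ] Sp d} {c : Sp d → Sp d}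

/-- Bounded elements of the energy space are limits of uniformly bounded test functions. -/
theorem exists_bounded_approx (F : IsFrame m S T c) {V : Set (Sp d)} {p : GSp m}
    (hp : p ∈ energy m S V) {M : ℝ} (hM0 : 0 ≤ M) (hM : ∀ᵐ x ∂(wm m), |p.fst x| ≤ M) :
    ∃ (φ : ℕ → Sp d → ℝ) (P : ℕ → GSp m) (A : ℝ), (∀ n, IsTestPair m S V (φ n) (P n)) ∧
      Tendsto P atTop (𝓝 p) ∧ (∀ n x, |φ n x| ≤ A) ∧
      ∀ᵐ x, Tendsto (fun n => φ n x) atTop (𝓝 (p.fst x)) := by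
  obtain ⟨h, k, hh, -, h1, hid, -⟩ := exists_truncation_eq_self hM0
  obtain ⟨A, hA⟩ := hh.bdd
  obtain ⟨D, hD⟩ := hh.abs_deriv_le
  obtain ⟨φ, P, hP, hlim⟩ := mem_energy_iff.1 hp
  obtain ⟨ns, Q, q, -, hQ, hQq, hq1, -⟩ := F.exists_subseq_comp_mul (U := V) hP hlim hh.contDiff hD
    (v := fun _ => 1) contDiff_const (D := 1) (by simp) (by
      have : gradient (fun _ : Sp d => (1 : ℝ)) = 0 := funext fun x => gradient_fun_const x 1
      rw [this]; exact HasCompactSupport.zero) (fun n => by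
      simpa using (hP n).1.comp hh.contDiff hh.zero)
  have hqp : q = p := by
    refine F.energy_ext (mem_energy_iff.2 ⟨_, Q, hQ, hQq⟩) hp (Lp.ext ?_)
    filter_upwards [hq1, hM] with x h1 h2
    rw [h1, mul_one, (hid _ h2).1]
  rw [hqp] at hQq
  obtain ⟨ks, hks, hae⟩ := exists_subseq_tendsto_ae (tendsto_fst hQq)
  refine ⟨fun n x => h (φ (ns (ks n)) x) * 1, fun n => Q (ks n), A, fun n => hQ (ks n),
    hQq.comp hks.tendsto_atTop, fun n x => by simpa using hA _, ?_⟩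
  have hall : ∀ᵐ x, ∀ n, (Q n).fst x = h (φ (ns n) x) * 1 :=
    ae_all_iff.2 fun n => F.ae_iff.1 (hQ n).2.1
  filter_upwards [F.ae_iff.1 hae, hall] with x h1 h2
  simpa only [h2] using h1

theorem integrable_indicator_drift (F : IsFrame m S T c) {V : Set (Sp d)}
    (hV : Bornology.IsBounded V) (hVm : MeasurableSet V)
    (G : Lp (Sp d) 2 (volume : Measure (Sp d))) :
    Integrable (V.indicator fun x => inner ℝ (c x) (G x)) (wm m) := by
  have h1 : MemLp (V.indicator G) 2 volume := (Lp.memLp G).indicator hVm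
  refine (F.integrable_drift hV hVm h1 (Eventually.of_forall fun x hx => by simp [hx])).congr
    (Eventually.of_forall fun x => ?_)
  by_cases hx : x ∈ V <;> simp [hx]

theorem integrable_drift_mul (F : IsFrame m S T c) {V : Set (Sp d)}
    (hV : Bornology.IsBounded V) (hVm : MeasurableSet V)
    (G : Lp (Sp d) 2 (volume : Measure (Sp d))) {v : Sp d → ℝ}
    (hv : AEStronglyMeasurable v (wm m)) (hvV : ∀ᵐ x, x ∉ V → v x = 0) {M : ℝ}
    (hM : ∀ᵐ x ∂(wm m), |v x| ≤ M) :
    Integrable (fun x => inner ℝ (c x) (G x) * v x) (wm m) := by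
  refine ((F.integrable_indicator_drift hV hVm G).mul_bdd (c := M) hv hM).congr ?_
  filter_upwards [F.ae_iff.2 hvV] with x hx
  by_cases hxV : x ∈ V
  · simp [hxV]
  · simp [hxV, hx hxV]

/-- An equation which holds for test functions on a bounded set holds for all bounded elements of
the energy space. -/
theorem equation_of_bounded (F : IsFrame m S T c) {V : Set (Sp d)}
    (hV : Bornology.IsBounded V) (hVm : MeasurableSet V)
    {G : Lp (Sp d) 2 (volume : Measure (Sp d))} {y : Sp d → ℝ} (hy : Integrable y (wm m))
    (h : ∀ v P, IsTestPair m S V v P →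
      inner ℝ G P.snd - ∫ x, inner ℝ (c x) (G x) * v x ∂(wm m) = -∫ x, y x * v x ∂(wm m))
    {p : GSp m} (hp : p ∈ energy m S V) {M : ℝ} (hM : ∀ᵐ x ∂(wm m), |p.fst x| ≤ M) :
    inner ℝ G p.snd - ∫ x, inner ℝ (c x) (G x) * p.fst x ∂(wm m) =
      -∫ x, y x * p.fst x ∂(wm m) := by
  obtain ⟨φ, P, A, hP, hlim, hA, hae⟩ := F.exists_bounded_approx hp (M := max M 0)
    (le_max_right _ _) (hM.mono fun x hx => hx.trans (le_max_left _ _))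
  have hφm : ∀ n, AEStronglyMeasurable (φ n) (wm m) := fun n =>
    (hP n).1.1.continuous.aestronglyMeasurable
  have key : ∀ f : Sp d → ℝ, Integrable f (wm m) →
      Tendsto (fun n => ∫ x, f x * φ n x ∂(wm m)) atTop (𝓝 (∫ x, f x * p.fst x ∂(wm m))) := by
    intro f hf
    refine tendsto_integral_of_dominated_convergence (fun x => |f x| * A)
      (fun n => hf.1.mul (hφm n)) (hf.abs.mul_const A)
      (fun n => Eventually.of_forall fun x => ?_) ((F.ae_iff.2 hae).mono fun x hx => hx.const_mul _)
    rw [norm_mul]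
    exact mul_le_mul_of_nonneg_left (hA n x) (abs_nonneg _)
  have e : ∀ v : Sp d → ℝ, (∀ᵐ x, x ∉ V → v x = 0) → ∫ x, inner ℝ (c x) (G x) * v x ∂(wm m) =
      ∫ x, V.indicator (fun x => inner ℝ (c x) (G x)) x * v x ∂(wm m) := fun v hv => by
    refine integral_congr_ae ?_
    filter_upwards [F.ae_iff.2 hv] with x hx
    by_cases hxV : x ∈ V
    · simp [hxV]
    · simp [hx hxV]
  have l1 := ((tendsto_const_nhds (x := G)).inner (𝕜 := ℝ) (tendsto_snd hlim)).sub
    (key _ (F.integrable_indicator_drift hV hVm G))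
  rw [e _ ((F.energy_eq_zero hp).mono fun x hx h => (hx h).1)]
  refine tendsto_nhds_unique l1 ((key y hy).neg.congr fun n => ?_)
  rw [← e _ (Eventually.of_forall fun x hx => (hP n).1.eq_zero hx)]
  exact (h _ _ (hP n)).symm

theorem memLp_const_indicator (F : IsFrame m S T c) {W : Set (Sp d)}
    (hW : Bornology.IsBounded W) (hWm : MeasurableSet W) (r : ℝ) :
    MemLp (W.indicator fun _ => r) 2 (wm m) :=
  memLp_indicator_const 2 hWm r (Or.inr (F.wm_lt_top hW).ne)

/-- If `q' ≥ 0`, then `τ(q - q')` vanishes where `q` vanishes and belongs to the energy space of the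
smaller set. -/
theorem energy_comp_sub (F : IsFrame m S T c) {V W : Set (Sp d)} (hVW : V ⊆ W)
    (hW : Bornology.IsBounded W) (hWm : MeasurableSet W) {q q' : GSp m} (hq : q ∈ energy m S V)
    (hq' : q' ∈ energy m S W) (hpos : ∀ᵐ x ∂(wm m), 0 ≤ q'.fst x) {τ : ℝ → ℝ}
    (hτ : IsTruncation τ) (hτ0 : ∀ s, s ≤ 0 → τ s = 0) :
    ∃ v ∈ energy m S V, v.fst =ᵐ[wm m] fun x => τ (q.fst x - q'.fst x) := by
  obtain ⟨C, hC⟩ := hτ.abs_deriv_le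
  have hC0 : 0 ≤ C := (abs_nonneg _).trans (hC 0)
  have hone : HasCompactSupport (gradient fun _ : Sp d => (1 : ℝ)) := by
    have : gradient (fun _ : Sp d => (1 : ℝ)) = 0 := funext fun x => gradient_fun_const x 1
    rw [this]; exact HasCompactSupport.zero
  -- smooth approximations of the positive part of `q'`
  have step : ∀ n : ℕ, ∃ v ∈ energy m S V, ‖v.snd‖ ≤ C * (‖q.snd‖ + ‖q'.snd‖) ∧
      ∀ᵐ x ∂(wm m), |v.fst x - τ (q.fst x - q'.fst x)| ≤
        W.indicator (fun _ => C) x * (1 / ((n : ℝ) + 1)) := by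
    intro n
    obtain ⟨g, hg, hg0, hgpos, hg1, hgε⟩ := exists_smooth_posPart (ε := 1 / ((n : ℝ) + 1))
      (by positivity)
    obtain ⟨φ, P, hP, hPlim⟩ := mem_energy_iff.1 hq
    obtain ⟨φ', P', hP', hPlim'⟩ := mem_energy_iff.1 hq'
    obtain ⟨ns, Q, r, hns, hQ, hQr, hr1, hr2⟩ := F.exists_subseq_comp_mul (U := W) hP' hPlim' hg hg1
      (v := fun _ => 1) contDiff_const (D := 1) (by simp) hone (fun n => by
        simpa using (hP' n).1.comp hg hg0)
    have hdiff : ∀ k, IsTestPair m S W (φ (ns k) - fun x => g (φ' (ns k) x) * 1)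
        (P (ns k) - Q k) := fun k => ((hP (ns k)).mono hVW).sub (hQ k)
    obtain ⟨ks, R, v, -, hR, hRv, hv1, hv2⟩ := F.exists_subseq_comp_mul (U := V) hdiff
      ((hPlim.comp hns.tendsto_atTop).sub hQr) hτ.contDiff hC
      (v := fun _ => 1) contDiff_const (D := 1) (by simp) hone (fun k => by
        refine (hP (ns k)).1.of_tsupport_subset
          ((hτ.contDiff.comp (hdiff k).1.1).mul contDiff_const) fun x hx => ?_
        rw [hτ0, zero_mul]
        simp [hx, hgpos])
    refine ⟨v, mem_energy_iff.2 ⟨_, R, hR, hRv⟩, ?_, ?_⟩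
    · have h1 : ‖r.snd‖ ≤ ‖q'.snd‖ := by
        refine Lp.norm_le_norm_of_ae_le ?_
        filter_upwards [hr2] with x hx
        rw [hx]
        simp only [gradient_fun_const, map_zero, smul_zero, add_zero, mul_one, norm_smul]
        exact mul_le_of_le_one_left (norm_nonneg _) (hg1 _)
      have h2 : ‖v.snd‖ ≤ C * ‖(q - r).snd‖ := by
        refine Lp.norm_le_mul_norm_of_ae_le_mul ?_
        filter_upwards [hv2] with x hx
        rw [hx]
        simp only [gradient_fun_const, map_zero, smul_zero, add_zero, mul_one, norm_smul]
        exact mul_le_mul_of_nonneg_right (hC _) (norm_nonneg _)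
      refine h2.trans (mul_le_mul_of_nonneg_left ?_ hC0)
      rw [WithLp.sub_snd]
      exact (norm_sub_le _ _).trans (by linarith)
    · have hqr : (q - r).fst =ᵐ[wm m] fun x => q.fst x - r.fst x := by
        rw [WithLp.sub_fst]; exact Lp.coeFn_sub _ _
      filter_upwards [hv1, hqr, hr1, hpos, F.ae_iff.2 (F.energy_eq_zero hq'),
        F.ae_iff.2 (F.energy_eq_zero (energy_mono hVW hq))] with x h1 h2 h3 h4 h5 h6
      rw [h1, h2, h3, mul_one, mul_one]
      by_cases hx : x ∈ W
      · rw [indicator_of_mem hx]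
        refine (abs_sub_le_of_abs_deriv_le hτ.contDiff hC _ _).trans
          (mul_le_mul_of_nonneg_left ?_ hC0)
        rw [sub_sub_sub_cancel_left, abs_sub_comm]
        exact hgε _ h4
      · rw [(h5 hx).1, (h6 hx).1, hg0]
        simp [hx]
  choose v hv hvb hvlim using step
  have hq'V := energy_mono hVW hq
  obtain ⟨q₀, -, hq₀, -⟩ := F.energy_comp ((energy m S W).sub_mem hq'V hq') hτ.contDiff hτ.zero hC
  have hq₀' : q₀.fst =ᵐ[wm m] fun x => τ (q.fst x - q'.fst x) := by
    filter_upwards [hq₀, Lp.coeFn_sub q.fst q'.fst] with x h1 h2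
    rw [h1, WithLp.sub_fst, h2, Pi.sub_apply]
  have hlim : Tendsto (fun n => (v n).fst) atTop (𝓝 q₀.fst) := by
    rw [tendsto_iff_norm_sub_tendsto_zero]
    have hCm := F.memLp_const_indicator hW hWm C
    have l : Tendsto (fun n : ℕ => 1 / ((n : ℝ) + 1) * ‖hCm.toLp _‖) atTop (𝓝 0) := by
      simpa using (tendsto_one_div_add_atTop_nhds_zero_nat (𝕜 := ℝ)).mul_const ‖hCm.toLp _‖
    refine squeeze_zero (fun n => norm_nonneg _) (fun n => ?_) l
    refine Lp.norm_le_mul_norm_of_ae_le_mul ?_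
    filter_upwards [hvlim n, hq₀', Lp.coeFn_sub (v n).fst q₀.fst, hCm.coeFn_toLp]
      with x h1 h2 h3 h4
    rw [h3, Pi.sub_apply, h2, h4, mul_comm]
    refine h1.trans (mul_le_mul_of_nonneg_right (le_abs_self _) (by positivity))
  obtain ⟨z, hz, hzu, -⟩ := F.exists_energy_weak_limit hv hvb hlim
  exact ⟨z, hz, by rw [hzu]; exact hq₀'⟩

/-- The Lax–Milgram theorem for the form `α (u, v) + E(u, v)`. -/
theorem exists_solution (_ : IsFrame m S T c) (U : Set (Sp d)) {α : ℝ} (hα : 0 < α) (z : GSp m) :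
    ∃ v ∈ energy m S U, ∀ q ∈ energy m S U, α * inner ℝ v.fst q.fst + inner ℝ v.snd q.snd =
      inner ℝ z.fst q.fst + inner ℝ z.snd q.snd := by
  have : CompleteSpace (energy m S U) := (isClosed_energy m S U).completeSpace_coe
  let J1 : energy m S U →L[ℝ] Lp ℝ 2 (wm m) :=
    (WithLp.fstL 2 ℝ (Lp ℝ 2 (wm m)) (Lp (Sp d) 2 (volume : Measure (Sp d)))).comp
      (energy m S U).subtypeL
  let J2 : energy m S U →L[ℝ] Lp (Sp d) 2 (volume : Measure (Sp d)) :=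
    (WithLp.sndL 2 ℝ (Lp ℝ 2 (wm m)) (Lp (Sp d) 2 (volume : Measure (Sp d)))).comp
      (energy m S U).subtypeL
  let b : energy m S U →L[ℝ] energy m S U →L[ℝ] ℝ :=
    α • (innerSL ℝ).bilinearComp J1 J1 + (innerSL ℝ).bilinearComp J2 J2
  have hb : ∀ v q : energy m S U, b v q = α * inner ℝ (v : GSp m).fst (q : GSp m).fst
      + inner ℝ (v : GSp m).snd (q : GSp m).snd := fun v q => rfl
  have hco : IsCoercive b := by
    refine ⟨min α 1, lt_min hα one_pos, fun v => ?_⟩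
    rw [hb, real_inner_self_eq_norm_sq, real_inner_self_eq_norm_sq]
    have h1 : ‖v‖ * ‖v‖ = ‖(v : GSp m).fst‖ ^ 2 + ‖(v : GSp m).snd‖ ^ 2 := by
      rw [← norm_GSp_sq, ← sq]; rfl
    rw [mul_assoc, h1, mul_add]
    have h2 := mul_le_mul_of_nonneg_right (min_le_left α 1) (sq_nonneg ‖(v : GSp m).fst‖)
    have h3 := mul_le_mul_of_nonneg_right (min_le_right α 1) (sq_nonneg ‖(v : GSp m).snd‖)
    linarith
  obtain ⟨f, hf⟩ := (InnerProductSpace.toDual ℝ (energy m S U)).surjective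
    ((innerSL ℝ z).comp (energy m S U).subtypeL)
  obtain ⟨v, hv⟩ := hco.continuousLinearEquivOfBilin.surjective f
  refine ⟨v, v.2, fun q hq => ?_⟩
  have h1 := hco.continuousLinearEquivOfBilin_apply v ⟨q, hq⟩
  rw [hv, hb] at h1
  rw [← h1]
  have h2 : inner ℝ f (⟨q, hq⟩ : energy m S U) = inner ℝ z q := by
    rw [← InnerProductSpace.toDual_apply_apply, hf]; rfl
  rw [h2]
  exact WithLp.prod_inner_apply z q

theorem exists_isGen (F : IsFrame m S T c) (U : Set (Sp d)) {α : ℝ} (hα : 0 < α)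
    {k : Lp ℝ 2 (wm m)} (hk : ∀ᵐ x, x ∉ U → k x = 0) :
    ∃ p, IsGen m S U p (α • p.fst - k) := by
  obtain ⟨v, hv, h⟩ := F.exists_solution U hα (WithLp.toLp 2 (k, 0))
  refine ⟨v, hv, ?_, fun q hq => ?_⟩
  · filter_upwards [F.ae_iff.2 hk, F.ae_iff.2 (F.energy_eq_zero hv),
      Lp.coeFn_sub (α • v.fst) k, Lp.coeFn_smul α v.fst] with x h1 h2 h3 h4 hx
    rw [h3, Pi.sub_apply, h4, Pi.smul_apply, (h2 hx).1, h1 hx]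
    simp
  · have h1 : α * inner ℝ v.fst q.fst + inner ℝ v.snd q.snd = inner ℝ k q.fst
        + inner ℝ (0 : Lp (Sp d) 2 (volume : Measure (Sp d))) q.snd := h q hq
    rw [inner_zero_left, add_zero] at h1
    rw [inner_sub_left, real_inner_smul_left]
    linarith

end IsFrame

end BoundedElements

/-! ### The operator with drift on a bounded set -/

section BoundedSets

variable {d : ℕ}

theorem memLp_indicator_of_restrict {ν : Measure (Sp d)} {V : Set (Sp d)} (hV : MeasurableSet V)
    (f : Lp ℝ 1 (ν.restrict V)) : MemLp (V.indicator f) 1 ν :=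
  (memLp_indicator_iff_restrict hV).2 (Lp.memLp f)

/-- Extension of integrable functions by zero. -/
def extendL1 {ν : Measure (Sp d)} {V : Set (Sp d)} (hV : MeasurableSet V) :
    Lp ℝ 1 (ν.restrict V) →ₗᵢ[ℝ] Lp ℝ 1 ν where
  toFun f := (memLp_indicator_of_restrict hV f).toLp _
  map_add' f g := by
    rw [← MemLp.toLp_add]
    refine MemLp.toLp_congr _ _ ?_
    have h := (ae_restrict_iff' hV).1 (Lp.coeFn_add f g)
    filter_upwards [h] with x hx
    rw [← indicator_add']
    by_cases hxV : x ∈ V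
    · rw [indicator_of_mem hxV, indicator_of_mem hxV, hx hxV]
    · rw [indicator_of_notMem hxV, indicator_of_notMem hxV]
  map_smul' r f := by
    rw [RingHom.id_apply, ← MemLp.toLp_const_smul]
    refine MemLp.toLp_congr _ _ ?_
    have h := (ae_restrict_iff' hV).1 (Lp.coeFn_smul r f)
    filter_upwards [h] with x hx
    rw [Pi.smul_apply]
    by_cases hxV : x ∈ V
    · rw [indicator_of_mem hxV, indicator_of_mem hxV, hx hxV, Pi.smul_apply]
    · rw [indicator_of_notMem hxV, indicator_of_notMem hxV, smul_zero]
  norm_map' f := by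
    have h : ‖(memLp_indicator_of_restrict hV f).toLp _‖ = ‖f‖ := by
      rw [Lp.norm_toLp, eLpNorm_indicator_eq_eLpNorm_restrict hV]
      rfl
    exact h

theorem extendL1_coeFn {ν : Measure (Sp d)} {V : Set (Sp d)} (hV : MeasurableSet V)
    (f : Lp ℝ 1 (ν.restrict V)) : extendL1 hV f =ᵐ[ν] V.indicator f :=
  (memLp_indicator_of_restrict hV f).coeFn_toLp

theorem extendL1_restrict_coeFn {ν : Measure (Sp d)} {V : Set (Sp d)} (hV : MeasurableSet V)
    (f : Lp ℝ 1 ν) : extendL1 hV (LpToLpRestrictCLM (Sp d) ℝ ℝ ν 1 V f) =ᵐ[ν] V.indicator f := by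
  have h := (ae_restrict_iff' hV).1 (LpToLpRestrictCLM_coeFn (p := 1) ℝ V f)
  filter_upwards [extendL1_coeFn hV (LpToLpRestrictCLM (Sp d) ℝ ℝ ν 1 V f), h] with x h1 h2
  rw [h1]
  by_cases hxV : x ∈ V
  · simp [hxV, h2 hxV]
  · simp [hxV]

theorem drifted_add (m : Sp d → ℝ) (c : Sp d → Sp d) (p p' : GSp m) (w w' : Lp ℝ 2 (wm m)) :
    drifted c (p + p') (w + w') =ᵐ[wm m] fun x => drifted c p w x + drifted c p' w' x := by
  have h := (withDensity_absolutelyContinuous volume fun x => ENNReal.ofReal (m x)).ae_le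
    (Lp.coeFn_add p.snd p'.snd)
  filter_upwards [h, Lp.coeFn_add w w'] with x h1 h2
  simp only [drifted]
  rw [WithLp.add_snd, h1, h2, Pi.add_apply, Pi.add_apply, inner_add_right]
  ring

theorem drifted_smul (m : Sp d → ℝ) (c : Sp d → Sp d) (r : ℝ) (p : GSp m) (w : Lp ℝ 2 (wm m)) :
    drifted c (r • p) (r • w) =ᵐ[wm m] fun x => r * drifted c p w x := by
  have h := (withDensity_absolutelyContinuous volume fun x => ENNReal.ofReal (m x)).ae_le
    (Lp.coeFn_smul r p.snd)
  filter_upwards [h, Lp.coeFn_smul r w] with x h1 h2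
  simp only [drifted]
  rw [WithLp.smul_snd, h1, h2, Pi.smul_apply, Pi.smul_apply, inner_smul_right, smul_eq_mul]
  ring

theorem IsGen.add {m : Sp d → ℝ} {S : Sp d → Sp d →L[ℝ] Sp d} {V : Set (Sp d)} {p p' : GSp m}
    {w w' : Lp ℝ 2 (wm m)} (h : IsGen m S V p w) (h' : IsGen m S V p' w') :
    IsGen m S V (p + p') (w + w') := by
  refine ⟨(energy m S V).add_mem h.1 h'.1, ?_, fun q hq => ?_⟩
  · filter_upwards [h.2.1, h'.2.1, Lp.coeFn_add w w'] with x h1 h2 h3 hx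
    rw [h3, Pi.add_apply, h1 hx, h2 hx, add_zero]
  · rw [WithLp.add_snd, inner_add_left, inner_add_left, h.2.2 q hq, h'.2.2 q hq]; ring

theorem IsGen.smul {m : Sp d → ℝ} {S : Sp d → Sp d →L[ℝ] Sp d} {V : Set (Sp d)} {p : GSp m}
    {w : Lp ℝ 2 (wm m)} (h : IsGen m S V p w) (r : ℝ) : IsGen m S V (r • p) (r • w) := by
  refine ⟨(energy m S V).smul_mem r h.1, ?_, fun q hq => ?_⟩
  · filter_upwards [h.2.1, Lp.coeFn_smul r w] with x h1 h3 hx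
    rw [h3, Pi.smul_apply, h1 hx, smul_zero]
  · rw [WithLp.smul_snd, real_inner_smul_left, real_inner_smul_left, h.2.2 q hq]; ring

theorem IsGen.zero (m : Sp d → ℝ) (S : Sp d → Sp d →L[ℝ] Sp d) (V : Set (Sp d)) :
    IsGen m S V 0 0 := by
  refine ⟨(energy m S V).zero_mem, ?_, fun q hq => ?_⟩
  · filter_upwards [Lp.coeFn_zero ℝ 2 (wm m)] with x h1 hx
    rw [h1]; rfl
  · rw [WithLp.zero_snd, inner_zero_left, inner_zero_left, neg_zero]

/-- The graph in `L¹ × L¹` of the operator with drift on the bounded elements of the domain of the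
generator of the form. -/
def driftRel (m : Sp d → ℝ) (S : Sp d → Sp d →L[ℝ] Sp d) (c : Sp d → Sp d) (V : Set (Sp d)) :
    Submodule ℝ (Lp ℝ 1 ((wm m).restrict V) × Lp ℝ 1 ((wm m).restrict V)) where
  carrier := {z | ∃ p w, IsGen m S V p w ∧ (∃ M : ℝ, ∀ᵐ x ∂(wm m), |p.fst x| ≤ M) ∧
    z.1 =ᵐ[(wm m).restrict V] p.fst ∧ z.2 =ᵐ[(wm m).restrict V] drifted c p w}
  add_mem' := by
    rintro z z' ⟨p, w, hg, ⟨M, hM⟩, h1, h2⟩ ⟨p', w', hg', ⟨M', hM'⟩, h1', h2'⟩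
    refine ⟨p + p', w + w', hg.add hg', ⟨M + M', ?_⟩, ?_, ?_⟩
    · filter_upwards [hM, hM', Lp.coeFn_add p.fst p'.fst] with x e1 e2 e3
      rw [WithLp.add_fst, e3, Pi.add_apply]
      exact (abs_add_le _ _).trans (add_le_add e1 e2)
    · filter_upwards [h1, h1', ae_restrict_of_ae (Lp.coeFn_add p.fst p'.fst),
        Lp.coeFn_add z.1 z'.1] with x e1 e2 e3 e4
      rw [Prod.fst_add, e4, Pi.add_apply, e1, e2, WithLp.add_fst, e3, Pi.add_apply]
    · filter_upwards [h2, h2', ae_restrict_of_ae (drifted_add m c p p' w w'),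
        Lp.coeFn_add z.2 z'.2] with x e1 e2 e3 e4
      rw [Prod.snd_add, e4, Pi.add_apply, e1, e2, e3]
  zero_mem' := by
    have e := Lp.coeFn_zero ℝ 1 ((wm m).restrict V)
    refine ⟨0, 0, IsGen.zero m S V, ⟨0, ?_⟩, ?_, ?_⟩
    · filter_upwards [Lp.coeFn_zero ℝ 2 (wm m)] with x h1
      rw [WithLp.zero_fst, h1]; simp
    · filter_upwards [ae_restrict_of_ae (Lp.coeFn_zero ℝ 2 (wm m)), e] with x h1 h2
      rw [WithLp.zero_fst, h1, Prod.fst_zero, h2]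
    · have h0 := drifted_smul m c 0 0 0
      rw [zero_smul, zero_smul] at h0
      filter_upwards [ae_restrict_of_ae h0, e] with x h1 h2
      rw [h1, zero_mul, Prod.snd_zero, h2]; rfl
  smul_mem' := by
    rintro r z ⟨p, w, hg, ⟨M, hM⟩, h1, h2⟩
    refine ⟨r • p, r • w, hg.smul r, ⟨|r| * M, ?_⟩, ?_, ?_⟩
    · filter_upwards [hM, Lp.coeFn_smul r p.fst] with x e1 e3
      rw [WithLp.smul_fst, e3, Pi.smul_apply, smul_eq_mul, abs_mul]
      exact mul_le_mul_of_nonneg_left e1 (abs_nonneg _)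
    · filter_upwards [h1, ae_restrict_of_ae (Lp.coeFn_smul r p.fst),
        Lp.coeFn_smul r z.1] with x e1 e3 e4
      rw [Prod.smul_fst, e4, Pi.smul_apply, e1, WithLp.smul_fst, e3, Pi.smul_apply]
    · filter_upwards [h2, ae_restrict_of_ae (drifted_smul m c r p w),
        Lp.coeFn_smul r z.2] with x e1 e3 e4
      rw [Prod.smul_snd, e4, Pi.smul_apply, e1, e3, smul_eq_mul]

/-- A submodule on which only the zero functional vanishes is dense. -/
theorem dense_of_dual {X : Type*} [NormedAddCommGroup X] [NormedSpace ℝ X] {R : Submodule ℝ X}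
    (h : ∀ l : X →L[ℝ] ℝ, (∀ x ∈ R, l x = 0) → l = 0) : Dense (R : Set X) := by
  intro x
  by_contra hx
  obtain ⟨f, u, hfx, hf⟩ := geometric_hahn_banach_point_closed
    (t := closure (R : Set X)) R.convex.closure isClosed_closure hx
  have h0 : ∀ b ∈ R, f b = 0 := by
    intro b hb
    by_contra hne
    have h1 := hf _ (subset_closure (R.smul_mem ((u - 1) / f b) hb))
    rw [map_smul, smul_eq_mul, div_mul_cancel₀ _ hne] at h1
    linarith
  have h1 := hf 0 (subset_closure R.zero_mem)
  rw [h f h0] at hfx h1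
  simp at hfx h1
  linarith

theorem eLpNorm_sub_coeFn {ν : Measure (Sp d)} {f g : Sp d → ℝ} {u v : Lp ℝ 1 ν}
    (hf : u =ᵐ[ν] f) (hg : v =ᵐ[ν] g) :
    eLpNorm (fun x => f x - g x) 1 ν = ENNReal.ofReal ‖u - v‖ := by
  rw [Lp.norm_def, ENNReal.ofReal_toReal (Lp.eLpNorm_ne_top _)]
  refine eLpNorm_congr_ae ?_
  filter_upwards [hf, hg, Lp.coeFn_sub u v] with x h1 h2 h3
  rw [h3, Pi.sub_apply, h1, h2]

namespace IsFrame

variable {m : Sp d → ℝ} {S T : Sp d → Sp d →L[ℝ] Sp d} {c : Sp d → Sp d}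

theorem extendL1_eq (F : IsFrame m S T c) {V : Set (Sp d)} (hVm : MeasurableSet V)
    {z : Lp ℝ 1 ((wm m).restrict V)} {f : Sp d → ℝ} (hz : z =ᵐ[(wm m).restrict V] f)
    (hf : ∀ᵐ x, x ∉ V → f x = 0) : extendL1 hVm z =ᵐ[wm m] f := by
  filter_upwards [extendL1_coeFn hVm z, (ae_restrict_iff' hVm).1 hz, F.ae_iff.2 hf] with x h1 h2 h3
  rw [h1]
  by_cases hx : x ∈ V
  · rw [indicator_of_mem hx, h2 hx]
  · rw [indicator_of_notMem hx, h3 hx]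

theorem drifted_eq_zero (F : IsFrame m S T c) {V : Set (Sp d)} {p : GSp m} {w : Lp ℝ 2 (wm m)}
    (h : IsGen m S V p w) : ∀ᵐ x, x ∉ V → drifted c p w x = 0 := by
  filter_upwards [F.energy_eq_zero h.1, F.ae_iff.1 h.2.1] with x h1 h2 hx
  rw [drifted, h2 hx, (h1 hx).2, inner_zero_right, add_zero]

/-- Convergent sequences of elements of the closed operators give rise, by a diagonal argument, to a
convergent sequence of bounded solutions. -/
theorem exists_genLimit (F : IsFrame m S T c) {U : Set (Sp d)} {V : ℕ → Set (Sp d)}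
    (hV : ∀ n, Bornology.IsBounded (V n)) (hVm : ∀ n, MeasurableSet (V n)) (hVU : ∀ n, V n ⊆ U)
    {z : ∀ n, Lp ℝ 1 ((wm m).restrict (V n)) × Lp ℝ 1 ((wm m).restrict (V n))}
    (hz : ∀ n, z n ∈ (driftRel m S c (V n)).topologicalClosure) {u y : Lp ℝ 1 (wm m)}
    (hu : Tendsto (fun n => extendL1 (hVm n) (z n).1) atTop (𝓝 u))
    (hy : Tendsto (fun n => extendL1 (hVm n) (z n).2) atTop (𝓝 y)) :
    ∃ p w, GenLimit m S c U V p w u y := by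
  have h1 : ∀ n : ℕ, ∃ z' ∈ driftRel m S c (V n), dist (z n) z' < 1 / ((n : ℝ) + 1) := fun n =>
    Metric.mem_closure_iff.1 (hz n) _ (by positivity)
  choose z' hz' hd using h1
  choose p w hg hb hp hw using hz'
  have hp' : ∀ n, extendL1 (hVm n) (z' n).1 =ᵐ[wm m] (p n).fst := fun n =>
    F.extendL1_eq (hVm n) (hp n) ((F.energy_eq_zero (hg n).1).mono fun x hx h => (hx h).1)
  have hw' : ∀ n, extendL1 (hVm n) (z' n).2 =ᵐ[wm m] drifted c (p n) (w n) := fun n =>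
    F.extendL1_eq (hVm n) (hw n) (F.drifted_eq_zero (hg n))
  have l0 : Tendsto (fun n : ℕ => 1 / ((n : ℝ) + 1)) atTop (𝓝 0) :=
    tendsto_one_div_add_atTop_nhds_zero_nat
  have key : ∀ {a b : ∀ n, Lp ℝ 1 ((wm m).restrict (V n))} {l : Lp ℝ 1 (wm m)},
      Tendsto (fun n => extendL1 (hVm n) (a n)) atTop (𝓝 l) →
      (∀ n, dist (a n) (b n) ≤ 1 / ((n : ℝ) + 1)) →
      Tendsto (fun n => ENNReal.ofReal ‖extendL1 (hVm n) (b n) - l‖) atTop (𝓝 0) := by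
    intro a b l hl hab
    rw [← ENNReal.ofReal_zero]
    refine (ENNReal.continuous_ofReal.tendsto 0).comp
      (tendsto_iff_norm_sub_tendsto_zero.1 ?_)
    refine (tendsto_iff_of_dist ?_).1 hl
    refine squeeze_zero (fun n => dist_nonneg) (fun n => ?_) l0
    rw [LinearIsometry.dist_map]
    exact hab n
  have hle1 : ∀ n, dist (z n).1 (z' n).1 ≤ 1 / ((n : ℝ) + 1) := fun n =>
    (le_max_left _ _).trans (hd n).le
  have hle2 : ∀ n, dist (z n).2 (z' n).2 ≤ 1 / ((n : ℝ) + 1) := fun n =>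
    (le_max_right _ _).trans (hd n).le
  refine ⟨p, w, hV, hVm, hVU, hg, L1_integrable u, L1_integrable y, ?_, ?_⟩
  · refine (key hu hle1).congr fun n => (eLpNorm_sub_coeFn (hp' n) EventuallyEq.rfl).symm
  · refine (key hy hle2).congr fun n => (eLpNorm_sub_coeFn (hw' n) EventuallyEq.rfl).symm

theorem exists_genLimit_const (F : IsFrame m S T c) {V : Set (Sp d)}
    (hV : Bornology.IsBounded V) (hVm : MeasurableSet V)
    {z : Lp ℝ 1 ((wm m).restrict V) × Lp ℝ 1 ((wm m).restrict V)}
    (hz : z ∈ (driftRel m S c V).topologicalClosure) :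
    ∃ p w, GenLimit m S c V (fun _ => V) p w (extendL1 hVm z.1) (extendL1 hVm z.2) :=
  F.exists_genLimit (fun _ => hV) (fun _ => hVm) (fun _ => subset_rfl) (z := fun _ => z)
    (fun _ => hz) tendsto_const_nhds tendsto_const_nhds

theorem integral_extendL1_mul_comp {ν : Measure (Sp d)} {V : Set (Sp d)} (hVm : MeasurableSet V)
    (u y : Lp ℝ 1 (ν.restrict V)) (h : ℝ → ℝ) :
    ∫ x, extendL1 hVm y x * h (extendL1 hVm u x) ∂ν = ∫ x, y x * h (u x) ∂(ν.restrict V) := by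
  rw [← integral_indicator hVm]
  refine integral_congr_ae ?_
  filter_upwards [extendL1_coeFn hVm u, extendL1_coeFn hVm y] with x h1 h2
  rw [h1, h2]
  by_cases hx : x ∈ V <;> simp [hx]

theorem truncationDissipative_driftRel (F : IsFrame m S T c) {V : Set (Sp d)}
    (hV : Bornology.IsBounded V) (hVm : MeasurableSet V) : TruncationDissipative
      ((driftRel m S c V).topologicalClosure :
        Set (Lp ℝ 1 ((wm m).restrict V) × Lp ℝ 1 ((wm m).restrict V))) := by
  intro z hz h hh
  obtain ⟨p, w, L⟩ := F.exists_genLimit_const hV hVm hz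
  rw [← integral_extendL1_mul_comp hVm]
  exact L.integral_mul_nonpos F hh

end IsFrame

end BoundedSets

/-! ### Resolvents on bounded sets -/

section BoundedGenerator

variable {d : ℕ}

namespace IsFrame

variable {m : Sp d → ℝ} {S T : Sp d → Sp d →L[ℝ] Sp d} {c : Sp d → Sp d}

theorem zero_drift (F : IsFrame m S T c) : IsFrame m S T 0 where
  m_meas := F.m_meas
  m_pos := F.m_pos
  m_loc := F.m_loc
  m_inv := F.m_inv
  S_meas := F.S_meas
  T_meas := F.T_meas
  inv := F.inv
  S_bdd := F.S_bdd
  T_bdd := F.T_bdd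
  c_loc := fun K _ => by simp
  c_div := fun φ _ => by simp

theorem smul_fst_le (F : IsFrame m S T c) {V : Set (Sp d)} (hV : Bornology.IsBounded V)
    (hVm : MeasurableSet V) {α : ℝ} (hα : 0 < α) {p : GSp m} {w : Lp ℝ 2 (wm m)}
    (h : IsGen m S V p w) {M : ℝ} (hM0 : 0 ≤ M)
    (hM : ∀ᵐ x ∂(wm m), α * p.fst x - w x ≤ M) : ∀ᵐ x ∂(wm m), α * p.fst x ≤ M := by
  let 𝒮 : Set (Lp ℝ 1 (wm m) × Lp ℝ 1 (wm m)) :=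
    {z | ∃ p w, IsGen m S V p w ∧ z.1 =ᵐ[wm m] p.fst ∧ z.2 =ᵐ[wm m] w}
  have h𝒮 : TruncationDissipative 𝒮 := by
    rintro z ⟨p, w, hg, h1, h2⟩ τ hτ
    have e := F.zero_drift.integral_deriv_mul_norm_sq hV hVm hg hτ
    have e2 : ∫ x, z.2 x * τ (z.1 x) ∂(wm m) = ∫ x, drifted 0 p w x * τ (p.fst x) ∂(wm m) := by
      refine integral_congr_ae ?_
      filter_upwards [h1, h2] with x h1 h2
      rw [h1, h2]
      simp [drifted]
    rw [e2, ← neg_nonneg, ← e]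
    exact integral_nonneg fun x => mul_nonneg (hτ.deriv_nonneg _) (sq_nonneg _)
  have i1 := memLp_one_iff_integrable.2 (F.integrable_of_bounded hV hVm
    ((F.energy_eq_zero h.1).mono fun x hx h => (hx h).1))
  have i2 := memLp_one_iff_integrable.2 (F.integrable_of_bounded hV hVm (F.ae_iff.1 h.2.1))
  have h1 := h𝒮.smul_le (p := (i1.toLp _, i2.toLp _))
    ⟨p, w, h, i1.coeFn_toLp, i2.coeFn_toLp⟩ hα hM0 (by
      filter_upwards [L1_smul_sub_ae α (i1.toLp _) (i2.toLp _), i1.coeFn_toLp, i2.coeFn_toLp, hM]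
        with x h1 h2 h3 h4
      rw [h1, h2, h3]; exact h4)
  filter_upwards [h1, i1.coeFn_toLp] with x h1 h2
  simpa only [h2] using h1

/-- The maximum principle for the form without drift. -/
theorem abs_fst_le (F : IsFrame m S T c) {V : Set (Sp d)} (hV : Bornology.IsBounded V)
    (hVm : MeasurableSet V) {α : ℝ} (hα : 0 < α) {p : GSp m} {k : Lp ℝ 2 (wm m)}
    (h : IsGen m S V p (α • p.fst - k)) {M : ℝ} (hM0 : 0 ≤ M)
    (hM : ∀ᵐ x ∂(wm m), |k x| ≤ M) : ∀ᵐ x ∂(wm m), |p.fst x| ≤ M / α := by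
  have e : ∀ᵐ x ∂(wm m), (α • p.fst - k : Lp ℝ 2 (wm m)) x = α * p.fst x - k x := by
    filter_upwards [Lp.coeFn_sub (α • p.fst) k, Lp.coeFn_smul α p.fst] with x h1 h2
    rw [h1, Pi.sub_apply, h2, Pi.smul_apply, smul_eq_mul]
  have h1 := F.smul_fst_le hV hVm hα h hM0 (by
    filter_upwards [hM, e] with x h1 h2
    rw [h2, sub_sub_cancel]
    exact (le_abs_self _).trans h1)
  have h2 := F.smul_fst_le hV hVm hα (h.smul (-1)) hM0 (by
    filter_upwards [hM, e, Lp.coeFn_smul (-1 : ℝ) p.fst,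
      Lp.coeFn_smul (-1 : ℝ) (α • p.fst - k)] with x h1 h2 h3 h4
    rw [WithLp.smul_fst, h3, h4, Pi.smul_apply, Pi.smul_apply, h2, smul_eq_mul, smul_eq_mul]
    have := neg_abs_le (k x)
    linarith)
  filter_upwards [h1, h2, Lp.coeFn_smul (-1 : ℝ) p.fst] with x h1 h2 h3
  rw [WithLp.smul_fst, h3, Pi.smul_apply, smul_eq_mul] at h2
  rw [abs_le, le_div_iff₀ hα, ← neg_div, div_le_iff₀ hα]
  constructor <;> linarith

theorem exists_isGen_bounded (F : IsFrame m S T c) {V : Set (Sp d)} (hV : Bornology.IsBounded V)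
    (hVm : MeasurableSet V) {α : ℝ} (hα : 0 < α) {k : Lp ℝ 2 (wm m)}
    (hk : ∀ᵐ x, x ∉ V → k x = 0) {M : ℝ} (hM : ∀ᵐ x ∂(wm m), |k x| ≤ M) :
    ∃ p, IsGen m S V p (α • p.fst - k) ∧ ∃ N : ℝ, ∀ᵐ x ∂(wm m), |p.fst x| ≤ N := by
  obtain ⟨p, hp⟩ := F.exists_isGen V hα hk
  exact ⟨p, hp, _, F.abs_fst_le hV hVm hα hp (le_max_right M 0)
    (hM.mono fun x hx => hx.trans (le_max_left _ _))⟩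

theorem eq_zero_of_inner_bounded {ν : Measure (Sp d)} {g : Lp ℝ 2 ν} {V : Set (Sp d)}
    (hg : ∀ᵐ x ∂ν, x ∉ V → g x = 0)
    (h : ∀ k : Lp ℝ 2 ν, (∀ᵐ x ∂ν, x ∉ V → k x = 0) → (∀ᵐ x ∂ν, |k x| ≤ 1) → inner ℝ k g = 0) :
    g = 0 := by
  have hc : Continuous fun s : ℝ => max (-1) (min 1 s) := by fun_prop
  have hle : ∀ s : ℝ, |max (-1) (min 1 s)| ≤ |s| := fun s => by
    rw [abs_le]
    constructor
    · rcases le_total 0 s with h | h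
      · have : 0 ≤ max (-1) (min 1 s) := le_max_of_le_right (le_min zero_le_one h)
        exact (neg_nonpos.2 (abs_nonneg _)).trans this
      · rw [abs_of_nonpos h, neg_neg]
        exact le_max_of_le_right (le_min (h.trans zero_le_one) le_rfl)
    · exact max_le (by linarith [abs_nonneg s]) ((min_le_right _ _).trans (le_abs_self _))
  have hk : MemLp (fun x => max (-1) (min 1 (g x))) 2 ν :=
    (Lp.memLp g).mono (hc.comp_aestronglyMeasurable (Lp.aestronglyMeasurable g))
      (Eventually.of_forall fun x => hle _)
  have h1 := h (hk.toLp _) (by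
    filter_upwards [hk.coeFn_toLp, hg] with x h1 h2 hx
    rw [h1, h2 hx]; simp) (by
    filter_upwards [hk.coeFn_toLp] with x h1
    rw [h1, abs_le]
    exact ⟨le_max_left _ _, max_le (by norm_num) (min_le_left _ _)⟩)
  rw [L2.inner_def] at h1
  have h2 : 0 ≤ᵐ[ν] fun x => inner ℝ (hk.toLp _ x) (g x) := by
    filter_upwards [hk.coeFn_toLp] with x h1
    rw [h1]
    simp only [RCLike.inner_apply, conj_trivial, Pi.zero_apply]
    rcases le_total 0 (g x) with h | h
    · exact mul_nonneg h (le_max_of_le_right (le_min zero_le_one h))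
    · exact mul_nonneg_of_nonpos_of_nonpos h
        (max_le (by norm_num) ((min_le_right _ _).trans h))
  have h3 := (integral_eq_zero_iff_of_nonneg_ae h2 (L2.integrable_inner _ _)).1 h1
  refine Lp.ext ?_
  filter_upwards [h3, hk.coeFn_toLp, Lp.coeFn_zero ℝ 2 ν] with x h1 h2 h3
  rw [h3]
  rw [h2] at h1
  simp only [RCLike.inner_apply, conj_trivial, Pi.zero_apply, mul_eq_zero] at h1
  refine h1.elim id fun h => ?_
  rcases le_total 0 (g x) with h' | h'
  · rw [max_eq_right ((by norm_num : (-1 : ℝ) ≤ 0).trans (le_min zero_le_one h'))] at h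
    rcases min_choice 1 (g x) with h4 | h4 <;> rw [h4] at h
    · norm_num at h
    · exact h
  · rw [min_eq_right (h'.trans zero_le_one)] at h
    rcases max_choice (-1) (g x) with h4 | h4 <;> rw [h4] at h
    · norm_num at h
    · exact h

/-- Uniqueness for the adjoint equation: a bounded function which annihilates the range of `α` minus
the operator with drift is a weak solution of the adjoint equation, because it solves the equation
without drift with right hand side `div (h B)`, so it belongs to the energy space and can be tested
with itself. -/
theorem eq_zero_of_annihilates_range (F : IsFrame m S T c) {V : Set (Sp d)}
    (hV : Bornology.IsBounded V) (hVm : MeasurableSet V) {α : ℝ} (hα : 0 < α) {h : Lp ℝ 2 (wm m)}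
    (hh0 : ∀ᵐ x, x ∉ V → h x = 0) {M : ℝ} (hM0 : 0 ≤ M) (hM : ∀ᵐ x ∂(wm m), |h x| ≤ M)
    (hann : ∀ p w, IsGen m S V p w → (∃ N : ℝ, ∀ᵐ x ∂(wm m), |p.fst x| ≤ N) →
      ∫ x, (α * p.fst x - drifted c p w x) * h x ∂(wm m) = 0) : h = 0 := by
  have hg : MemLp (fun x => h x • m x • c x) 2 volume := by
    have h1 : MemLp (fun x => h x • V.indicator (fun x => m x • c x) x) 2 volume := by
      refine (F.memLp_drift hV hVm).of_le_mul (c := M)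
        ((F.aesm_iff.1 (Lp.aestronglyMeasurable h)).smul (F.memLp_drift hV hVm).1) ?_
      filter_upwards [F.ae_iff.1 hM] with x hx
      rw [norm_smul]
      exact mul_le_mul_of_nonneg_right hx (norm_nonneg _)
    refine h1.ae_eq ?_
    filter_upwards [hh0] with x hx
    by_cases hxV : x ∈ V
    · simp [hxV]
    · simp [hxV, hx hxV]
  have hgi : ∀ G : Lp (Sp d) 2 (volume : Measure (Sp d)),
      inner ℝ (hg.toLp _) G = ∫ x, inner ℝ (c x) (G x) * h x ∂(wm m) := fun G => by
    rw [real_inner_comm, inner_toLp_right, F.integral_mul_drift]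
  obtain ⟨v, hv, hvq⟩ := F.exists_solution V hα (WithLp.toLp 2 (0, hg.toLp _))
  replace hvq : ∀ q ∈ energy m S V, α * inner ℝ v.fst q.fst + inner ℝ v.snd q.snd
      = inner ℝ (hg.toLp _) q.snd := fun q hq => by
    have h1 : α * inner ℝ v.fst q.fst + inner ℝ v.snd q.snd
      = inner ℝ (0 : Lp ℝ 2 (wm m)) q.fst + inner ℝ (hg.toLp _) q.snd := hvq q hq
    rwa [inner_zero_left, zero_add] at h1
  have hv0 := F.energy_eq_zero hv
  -- `h` and `v` agree by duality with the equation without drift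
  have hhv : h - v.fst = 0 := by
    refine eq_zero_of_inner_bounded (V := V) ?_ fun k hk0 hk1 => ?_
    · filter_upwards [Lp.coeFn_sub h v.fst, F.ae_iff.2 hh0, F.ae_iff.2 hv0] with x h1 h2 h3 hx
      rw [h1, Pi.sub_apply, h2 hx, (h3 hx).1, sub_zero]
    · obtain ⟨p, hp, hpb⟩ := F.exists_isGen_bounded hV hVm hα (F.ae_iff.1 hk0) hk1
      have e1 := hann p _ hp hpb
      have e2 : ∫ x, (α * p.fst x - drifted c p (α • p.fst - k) x) * h x ∂(wm m)
          = inner ℝ k h - ∫ x, inner ℝ (c x) (p.snd x) * h x ∂(wm m) := by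
        rw [L2.inner_def, ← integral_sub (L2.integrable_inner _ _)
          (F.integrable_drift_mul hV hVm _ (Lp.aestronglyMeasurable h) hh0 hM)]
        refine integral_congr_ae ?_
        filter_upwards [Lp.coeFn_sub (α • p.fst) k, Lp.coeFn_smul α p.fst] with x h1 h2
        simp only [drifted, RCLike.inner_apply, conj_trivial]
        rw [h1, Pi.sub_apply, h2, Pi.smul_apply, smul_eq_mul]
        ring
      have e3 := hp.2.2 v hv
      have e4 := hvq p hp.1
      rw [hgi] at e4
      rw [inner_sub_left, real_inner_smul_left] at e3
      rw [inner_sub_right]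
      rw [real_inner_comm, real_inner_comm p.snd] at e4
      linarith
  rw [sub_eq_zero] at hhv
  -- test the equation of `v` with `v` itself
  have e1 := hvq v hv
  obtain ⟨τ, k, hτ, -, -, hid, -⟩ := exists_truncation_eq_self hM0
  obtain ⟨C, hC⟩ := hτ.bdd
  have e2 : inner ℝ (hg.toLp _) v.snd = 0 := by
    rw [hgi, ← F.integral_comp_mul_drift_eq_zero hV hVm hv hτ.contDiff hC]
    refine integral_congr_ae ?_
    filter_upwards [hM] with x hx
    rw [hhv] at hx ⊢
    rw [(hid _ hx).1, mul_comm]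
  rw [e2, real_inner_self_eq_norm_sq, real_inner_self_eq_norm_sq] at e1
  have h3 : ‖v.fst‖ ^ 2 = 0 := by nlinarith [sq_nonneg ‖v.fst‖, sq_nonneg ‖v.snd‖]
  rw [hhv]
  simpa using h3

/-- A bounded function which annihilates the domain of the operator is zero: apply this to the
solution of the resolvent equation without drift whose right hand side is the function itself. -/
theorem eq_zero_of_annihilates_domain (F : IsFrame m S T c) {V : Set (Sp d)} (hVo : IsOpen V)
    (hV : Bornology.IsBounded V) {h : Lp ℝ 2 (wm m)}
    (hh0 : ∀ᵐ x, x ∉ V → h x = 0) {M : ℝ} (hM : ∀ᵐ x ∂(wm m), |h x| ≤ M)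
    (hann : ∀ p w, IsGen m S V p w → (∃ N : ℝ, ∀ᵐ x ∂(wm m), |p.fst x| ≤ N) →
      ∫ x, p.fst x * h x ∂(wm m) = 0) : h = 0 := by
  obtain ⟨p, hp, hpb⟩ := F.exists_isGen_bounded hV hVo.measurableSet one_pos hh0 hM
  have e1 : inner ℝ h p.fst = 0 := by
    rw [← hann p _ hp hpb, L2.inner_def]
    simp
  have e2 := hp.2.2 p hp.1
  rw [one_smul, inner_sub_left, e1, sub_zero, real_inner_self_eq_norm_sq,
    real_inner_self_eq_norm_sq] at e2
  have h1 : ‖p.fst‖ ^ 2 = 0 := by nlinarith [sq_nonneg ‖p.fst‖, sq_nonneg ‖p.snd‖]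
  have h2 : p.fst = 0 := by simpa using h1
  have h3 : ‖p.snd‖ ^ 2 = 0 := by nlinarith [sq_nonneg ‖p.fst‖, sq_nonneg ‖p.snd‖]
  have h4 : p.snd = 0 := by simpa using h3
  have e3 : ∀ q ∈ energy m S V, inner ℝ h q.fst = 0 := fun q hq => by
    have := hp.2.2 q hq
    rw [h2, h4, smul_zero, zero_sub, inner_neg_left, inner_zero_left, neg_neg] at this
    exact this.symm
  have hi : Integrable fun x => m x * h x :=
    F.integrable_wm.1 (F.integrable_of_bounded hV hVo.measurableSet hh0)
  have h5 := hVo.ae_eq_zero_of_integral_contDiff_smul_eq_zero (f := fun x => m x * h x)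
    (hi.locallyIntegrable.locallyIntegrableOn V) fun φ hφ1 hφ2 hφ3 => by
      obtain ⟨q, hq⟩ := F.exists_testPair (U := V) ⟨hφ1, hφ2, hφ3⟩
      have := e3 q hq.mem
      rw [L2.inner_def, F.integral_wm] at this
      rw [← this]
      refine integral_congr_ae ?_
      filter_upwards [F.ae_iff.1 hq.2.1] with x hx
      rw [hx]
      simp only [smul_eq_mul, RCLike.inner_apply, conj_trivial]
      ring
  refine Lp.ext (F.ae_iff.2 ?_)
  filter_upwards [h5, hh0, F.m_pos, F.ae_iff.1 (Lp.coeFn_zero ℝ 2 (wm m))] with x h1 h2 h3 h4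
  rw [h4]
  by_cases hx : x ∈ V
  · exact (mul_eq_zero.1 (h1 hx)).resolve_left h3.ne'
  · exact h2 hx

theorem exists_mem_driftRel (F : IsFrame m S T c) {V : Set (Sp d)} (hV : Bornology.IsBounded V)
    (hVm : MeasurableSet V) {p : GSp m} {w : Lp ℝ 2 (wm m)} (h : IsGen m S V p w)
    (hb : ∃ N : ℝ, ∀ᵐ x ∂(wm m), |p.fst x| ≤ N) :
    ∃ z ∈ driftRel m S c V, z.1 =ᵐ[(wm m).restrict V] p.fst ∧
      z.2 =ᵐ[(wm m).restrict V] drifted c p w := by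
  have i1 := (memLp_one_iff_integrable.2 (F.integrable_of_bounded hV hVm
    ((F.energy_eq_zero h.1).mono fun x hx h => (hx h).1))).restrict V
  have i2 := (memLp_one_iff_integrable.2 (F.drifted_integrable hV hVm h)).restrict V
  exact ⟨(i1.toLp _, i2.toLp _), ⟨p, w, h, hb, i1.coeFn_toLp, i2.coeFn_toLp⟩,
    i1.coeFn_toLp, i2.coeFn_toLp⟩

/-- Bounded functionals on `L¹` of a bounded set are given by bounded functions on the whole space
which vanish off the set. -/
theorem exists_dual (F : IsFrame m S T c) {V : Set (Sp d)} (hV : Bornology.IsBounded V)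
    (hVm : MeasurableSet V) (l : Lp ℝ 1 ((wm m).restrict V) →L[ℝ] ℝ) :
    ∃ h : Lp ℝ 2 (wm m), (∀ᵐ x, x ∉ V → h x = 0) ∧ (∀ᵐ x ∂(wm m), |h x| ≤ ‖l‖) ∧
      ∀ (z : Lp ℝ 1 ((wm m).restrict V)) (f : Sp d → ℝ), z =ᵐ[(wm m).restrict V] f →
        l z = ∫ x, f x * h x ∂(wm m) := by
  have : IsFiniteMeasure ((wm m).restrict V) :=
    ⟨by rw [Measure.restrict_apply_univ]; exact F.wm_lt_top hV⟩
  obtain ⟨h, h2, hb, hl⟩ := exists_bounded_of_dual_L1 l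
  have hm : MemLp (V.indicator h) 2 (wm m) := (memLp_indicator_iff_restrict hVm).2 h2
  refine ⟨hm.toLp _, ?_, ?_, fun z f hz => ?_⟩
  · filter_upwards [F.ae_iff.1 hm.coeFn_toLp] with x hx hxV
    rw [hx, indicator_of_notMem hxV]
  · filter_upwards [hm.coeFn_toLp, (ae_restrict_iff' hVm).1 hb] with x h1 h2
    rw [h1]
    by_cases hx : x ∈ V
    · rw [indicator_of_mem hx]; exact h2 hx
    · rw [indicator_of_notMem hx, abs_zero]; exact norm_nonneg _
  · rw [hl, integral_congr_ae (g := fun x => f x * h x), ← integral_indicator hVm]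
    · refine integral_congr_ae ?_
      filter_upwards [hm.coeFn_toLp] with x hx
      rw [hx]
      by_cases hxV : x ∈ V <;> simp [hxV]
    · filter_upwards [hz] with x hx
      rw [hx]

theorem range_driftRel (F : IsFrame m S T c) {V : Set (Sp d)} (hV : Bornology.IsBounded V)
    (hVm : MeasurableSet V) {α : ℝ} (hα : 0 < α) (f : Lp ℝ 1 ((wm m).restrict V)) :
    ∃ z ∈ (driftRel m S c V).topologicalClosure, α • z.1 - z.2 = f := by
  let X := Lp ℝ 1 ((wm m).restrict V)
  let 𝒮 := (driftRel m S c V).topologicalClosure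
  have hdis := F.truncationDissipative_driftRel hV hVm
  let Φ : 𝒮 →L[ℝ] X := (α • ContinuousLinearMap.fst ℝ X X - ContinuousLinearMap.snd ℝ X X).comp
    𝒮.subtypeL
  have hΦ : ∀ z : 𝒮, Φ z = α • (z : X × X).1 - (z : X × X).2 := fun z => rfl
  have : CompleteSpace 𝒮 :=
    (Submodule.isClosed_topologicalClosure (driftRel m S c V)).completeSpace_coe
  have hclosed : IsClosed (Set.range Φ) := by
    have hanti : AntilipschitzWith (Real.toNNReal (α⁻¹ + 2)) Φ := by
      refine ContinuousLinearMap.antilipschitz_of_bound Φ fun z => ?_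
      have h1 := hdis.norm_smul_le z.2 hα
      rw [← hΦ, norm_smul, Real.norm_of_nonneg hα.le] at h1
      have h2 : ‖(z : X × X).2‖ ≤ 2 * ‖Φ z‖ := by
        have e : (z : X × X).2 = α • (z : X × X).1 - Φ z := by rw [hΦ]; abel
        rw [e]
        refine (norm_sub_le _ _).trans ?_
        rw [norm_smul, Real.norm_of_nonneg hα.le]
        linarith
      have h3 : ‖(z : X × X).1‖ ≤ α⁻¹ * ‖Φ z‖ := by
        rw [inv_mul_eq_div, le_div_iff₀ hα, mul_comm]; exact h1
      have hp : 0 ≤ α⁻¹ := by positivity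
      rw [Real.coe_toNNReal _ (by positivity)]
      refine max_le ?_ ?_
      · exact h3.trans (mul_le_mul_of_nonneg_right (by linarith) (norm_nonneg _))
      · exact h2.trans (mul_le_mul_of_nonneg_right (by linarith) (norm_nonneg _))
    exact hanti.isClosed_range Φ.uniformContinuous
  have hdense : Dense ((LinearMap.range (Φ : 𝒮 →ₗ[ℝ] X) : Submodule ℝ X) : Set X) := by
    refine dense_of_dual fun l hl => ?_
    obtain ⟨h, hh0, hhb, hlh⟩ := F.exists_dual hV hVm l
    have h0 : h = 0 := F.eq_zero_of_annihilates_range hV hVm hα hh0 (norm_nonneg l) hhb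
      fun p w hg hb => by
        obtain ⟨z, hz, h1, h2⟩ := F.exists_mem_driftRel hV hVm hg hb
        have h3 := hl (Φ ⟨z, Submodule.le_topologicalClosure _ hz⟩) ⟨_, rfl⟩
        rw [← h3, hΦ]
        refine (hlh _ _ ?_).symm
        filter_upwards [L1_smul_sub_ae α z.1 z.2, h1, h2] with x e1 e2 e3
        rw [e1, e2, e3]
    ext z
    rw [hlh z z EventuallyEq.rfl, h0]
    refine (integral_congr_ae (g := fun _ => 0) ?_).trans (by simp)
    filter_upwards [Lp.coeFn_zero ℝ 2 (wm m)] with x hx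
    rw [hx, Pi.zero_apply, mul_zero]
  have hmem : f ∈ Set.range Φ := by
    have := hdense f
    rwa [LinearMap.coe_range, ContinuousLinearMap.coe_coe, hclosed.closure_eq] at this
  obtain ⟨z, hz⟩ := hmem
  exact ⟨z, z.2, hz⟩

theorem dense_domain_driftRel (F : IsFrame m S T c) {V : Set (Sp d)} (hVo : IsOpen V)
    (hV : Bornology.IsBounded V) :
    Dense (Prod.fst '' ((driftRel m S c V).topologicalClosure :
      Set (Lp ℝ 1 ((wm m).restrict V) × Lp ℝ 1 ((wm m).restrict V)))) := by
  have h1 : Dense (((driftRel m S c V).map (LinearMap.fst ℝ (Lp ℝ 1 ((wm m).restrict V))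
      (Lp ℝ 1 ((wm m).restrict V))) : Submodule ℝ (Lp ℝ 1 ((wm m).restrict V))) :
      Set (Lp ℝ 1 ((wm m).restrict V))) := by
    refine dense_of_dual fun l hl => ?_
    obtain ⟨h, hh0, hhb, hlh⟩ := F.exists_dual hV hVo.measurableSet l
    have h0 : h = 0 := F.eq_zero_of_annihilates_domain hVo hV hh0 hhb fun p w hg hb => by
      obtain ⟨z, hz, h1, -⟩ := F.exists_mem_driftRel hV hVo.measurableSet hg hb
      rw [← hl z.1 ⟨z, hz, rfl⟩]
      exact (hlh _ _ h1).symm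
    ext z
    rw [hlh z z EventuallyEq.rfl, h0]
    refine (integral_congr_ae (g := fun _ => 0) ?_).trans (by simp)
    filter_upwards [Lp.coeFn_zero ℝ 2 (wm m)] with x hx
    rw [hx, Pi.zero_apply, mul_zero]
  refine h1.mono ?_
  rintro _ ⟨z, hz, rfl⟩
  exact ⟨z, Submodule.le_topologicalClosure _ hz, rfl⟩

/-- On a bounded open set the closure of the operator with drift generates a sub-Markovian
semigroup. -/
theorem exists_generator_of_bounded (F : IsFrame m S T c) {V : Set (Sp d)} (hVo : IsOpen V)
    (hV : Bornology.IsBounded V) :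
    ∃ (LV : Lp ℝ 1 ((wm m).restrict V) →ₗ.[ℝ] Lp ℝ 1 ((wm m).restrict V))
      (G : ℝ → Lp ℝ 1 ((wm m).restrict V) →L[ℝ] Lp ℝ 1 ((wm m).restrict V)),
      LV.graph = (driftRel m S c V).topologicalClosure ∧ GeneratesSubMarkovian LV ∧
      ∀ α, 0 < α → IsResolvent LV α (G α) ∧
        ∀ f, (G α f, α • G α f - f) ∈ (driftRel m S c V).topologicalClosure := by
  obtain ⟨LV, G, h1, -, h2, h3⟩ :=
    (F.truncationDissipative_driftRel hV hVo.measurableSet).exists_generator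
      (fun α hα f => F.range_driftRel hV hVo.measurableSet hα f) (F.dense_domain_driftRel hVo hV)
  exact ⟨LV, G, h1, h2, h3⟩

end IsFrame

end BoundedGenerator

/-! ### Monotonicity of the resolvents in the set -/

section Monotonicity

variable {d : ℕ}

/-- The resolvent `G` on `V`, applied to the restriction of a function, extended by zero. -/
def resolventExt {ν : Measure (Sp d)} {V : Set (Sp d)} (hV : MeasurableSet V)
    (G : Lp ℝ 1 (ν.restrict V) →L[ℝ] Lp ℝ 1 (ν.restrict V)) : Lp ℝ 1 ν →L[ℝ] Lp ℝ 1 ν :=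
  (extendL1 hV).toContinuousLinearMap.comp (G.comp (LpToLpRestrictCLM (Sp d) ℝ ℝ ν 1 V))

theorem resolventExt_apply {ν : Measure (Sp d)} {V : Set (Sp d)} (hV : MeasurableSet V)
    (G : Lp ℝ 1 (ν.restrict V) →L[ℝ] Lp ℝ 1 (ν.restrict V)) (f : Lp ℝ 1 ν) :
    resolventExt hV G f = extendL1 hV (G (LpToLpRestrictCLM (Sp d) ℝ ℝ ν 1 V f)) := rfl

namespace IsFrame

variable {m : Sp d → ℝ} {S T : Sp d → Sp d →L[ℝ] Sp d} {c : Sp d → Sp d}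

/-- Bounded solutions of the resolvent equation belong to the energy space and can be tested with
bounded elements of the energy space. -/
theorem exists_energy_of_bounded (F : IsFrame m S T c) {V : Set (Sp d)}
    (hV : Bornology.IsBounded V) (hVm : MeasurableSet V) {α : ℝ} {f : Lp ℝ 1 (wm m)}
    {z : Lp ℝ 1 ((wm m).restrict V) × Lp ℝ 1 ((wm m).restrict V)}
    (hz : z ∈ (driftRel m S c V).topologicalClosure)
    (hf : α • z.1 - z.2 = LpToLpRestrictCLM (Sp d) ℝ ℝ (wm m) 1 V f)
    {M : ℝ} (hM0 : 0 ≤ M) (hM : ∀ᵐ x ∂(wm m), |extendL1 hVm z.1 x| ≤ M) :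
    ∃ q ∈ energy m S V, q.fst =ᵐ[wm m] extendL1 hVm z.1 ∧ ∀ v ∈ energy m S V,
      ∀ N : ℝ, (∀ᵐ x ∂(wm m), |v.fst x| ≤ N) →
      inner ℝ q.snd v.snd - ∫ x, inner ℝ (c x) (q.snd x) * v.fst x ∂(wm m)
        = -∫ x, (α * q.fst x - f x) * v.fst x ∂(wm m) := by
  obtain ⟨p, w, L⟩ := F.exists_genLimit_const hV hVm hz
  obtain ⟨q, hq, hqu, -, heq⟩ := L.exists_energy F hM0 hM
  refine ⟨q, hq, hqu, fun v hv N hN => ?_⟩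
  rw [F.equation_of_bounded hV hVm (L1_integrable (extendL1 hVm z.2))
    (fun v P hP => heq v P hP (Eventually.of_forall fun _ => hP.1)) hv hN]
  congr 1
  refine integral_congr_ae ?_
  have h2 : z.2 = α • z.1 - LpToLpRestrictCLM (Sp d) ℝ ℝ (wm m) 1 V f := by rw [← hf]; abel
  have h3 : extendL1 hVm z.2 = α • extendL1 hVm z.1
      - extendL1 hVm (LpToLpRestrictCLM (Sp d) ℝ ℝ (wm m) 1 V f) := by
    rw [h2, map_sub, map_smul]
  rw [h3]
  filter_upwards [L1_smul_sub_ae α (extendL1 hVm z.1)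
    (extendL1 hVm (LpToLpRestrictCLM (Sp d) ℝ ℝ (wm m) 1 V f)), extendL1_restrict_coeFn hVm f, hqu,
    F.ae_iff.2 (F.energy_eq_zero hv)] with x e1 e2 e3 e4
  rw [e1, e2, e3]
  by_cases hx : x ∈ V
  · rw [indicator_of_mem hx]
  · rw [(e4 hx).1, mul_zero, mul_zero]

theorem coeFn_extendL1_bounds {ν : Measure (Sp d)} {V : Set (Sp d)} (hVm : MeasurableSet V)
    {u : Lp ℝ 1 (ν.restrict V)} {a b : ℝ} (ha : a ≤ 0) (hb : 0 ≤ b)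
    (h : ∀ᵐ x ∂(ν.restrict V), a ≤ u x ∧ u x ≤ b) :
    ∀ᵐ x ∂ν, a ≤ extendL1 hVm u x ∧ extendL1 hVm u x ≤ b := by
  filter_upwards [extendL1_coeFn hVm u, (ae_restrict_iff' hVm).1 h] with x h1 h2
  rw [h1]
  by_cases hx : x ∈ V
  · rw [indicator_of_mem hx]; exact h2 hx
  · rw [indicator_of_notMem hx]; exact ⟨ha, hb⟩

theorem bounds_of_bounded (F : IsFrame m S T c) {V : Set (Sp d)}
    (hV : Bornology.IsBounded V) (hVm : MeasurableSet V) {α : ℝ} (hα : 0 < α) {f : Lp ℝ 1 (wm m)}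
    {z : Lp ℝ 1 ((wm m).restrict V) × Lp ℝ 1 ((wm m).restrict V)}
    (hz : z ∈ (driftRel m S c V).topologicalClosure)
    (hf : α • z.1 - z.2 = LpToLpRestrictCLM (Sp d) ℝ ℝ (wm m) 1 V f)
    {N : ℝ} (hN0 : 0 ≤ N) (hN : ∀ᵐ x ∂(wm m), 0 ≤ f x ∧ f x ≤ N) :
    ∀ᵐ x ∂(wm m), 0 ≤ extendL1 hVm z.1 x ∧ extendL1 hVm z.1 x ≤ N / α := by
  have hdis := F.truncationDissipative_driftRel hV hVm
  have hfV : ∀ᵐ x ∂((wm m).restrict V), 0 ≤ (α • z.1 - z.2 : Lp ℝ 1 ((wm m).restrict V)) x ∧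
      (α • z.1 - z.2 : Lp ℝ 1 ((wm m).restrict V)) x ≤ N := by
    rw [hf]
    filter_upwards [LpToLpRestrictCLM_coeFn (p := 1) ℝ V f, ae_restrict_of_ae hN] with x h1 h2
    rwa [h1]
  have h1 := hdis.smul_le hz hα hN0 (hfV.mono fun x hx => hx.2)
  have h2 := hdis.nonneg (fun p hp => Submodule.neg_mem _ hp) hz hα
    (by rw [← Lp.coeFn_nonneg]; exact hfV.mono fun x hx => hx.1)
  refine coeFn_extendL1_bounds hVm le_rfl (by positivity) ?_
  filter_upwards [h1, (Lp.coeFn_nonneg _).2 h2] with x h1 h2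
  exact ⟨h2, by rw [le_div_iff₀ hα, mul_comm]; exact h1⟩

/-- For bounded `f ≥ 0` the solution of the resolvent equation increases with the set. The
difference of the equations is tested with a truncation of the positive part of the difference. -/
theorem extendL1_le_of_bounded (F : IsFrame m S T c) {V W : Set (Sp d)} (hVW : V ⊆ W)
    (hW : Bornology.IsBounded W) (hVm : MeasurableSet V) (hWm : MeasurableSet W) {α : ℝ}
    (hα : 0 < α) {f : Lp ℝ 1 (wm m)}
    {z : Lp ℝ 1 ((wm m).restrict V) × Lp ℝ 1 ((wm m).restrict V)}
    (hz : z ∈ (driftRel m S c V).topologicalClosure)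
    (hf : α • z.1 - z.2 = LpToLpRestrictCLM (Sp d) ℝ ℝ (wm m) 1 V f)
    {z' : Lp ℝ 1 ((wm m).restrict W) × Lp ℝ 1 ((wm m).restrict W)}
    (hz' : z' ∈ (driftRel m S c W).topologicalClosure)
    (hf' : α • z'.1 - z'.2 = LpToLpRestrictCLM (Sp d) ℝ ℝ (wm m) 1 W f)
    {N : ℝ} (hN0 : 0 ≤ N) (hN : ∀ᵐ x ∂(wm m), 0 ≤ f x ∧ f x ≤ N) :
    extendL1 hVm z.1 ≤ extendL1 hWm z'.1 := by
  have hV := hW.subset hVW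
  have hb := F.bounds_of_bounded hV hVm hα hz hf hN0 hN
  have hb' := F.bounds_of_bounded hW hWm hα hz' hf' hN0 hN
  obtain ⟨q, hq, hqu, heq⟩ := F.exists_energy_of_bounded hV hVm hz hf (M := N / α) (by positivity)
    (hb.mono fun x hx => by rw [abs_of_nonneg hx.1]; exact hx.2)
  obtain ⟨q', hq', hqu', heq'⟩ := F.exists_energy_of_bounded hW hWm hz' hf' (M := N / α)
    (by positivity) (hb'.mono fun x hx => by rw [abs_of_nonneg hx.1]; exact hx.2)
  have hτ : IsTruncation fun s => Real.smoothTransition (1 * (s - 0)) :=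
    IsTruncation.smoothTransition le_rfl zero_le_one
  set τ : ℝ → ℝ := fun s => Real.smoothTransition (1 * (s - 0)) with hτdef
  have hτ1 : ∀ s, |τ s| ≤ 1 := fun s => by
    rw [abs_of_nonneg (Real.smoothTransition.nonneg _)]; exact Real.smoothTransition.le_one _
  obtain ⟨C, hC⟩ := hτ.abs_deriv_le
  obtain ⟨v, hv, hv1⟩ := F.energy_comp_sub hVW hW hWm hq hq'
    (by filter_upwards [hqu', hb'] with x h1 h2; rw [h1]; exact h2.1) hτ
    (fun s hs => Real.smoothTransition.zero_of_nonpos (by simpa using hs))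
  have hvW := energy_mono hVW hv
  have hqW := energy_mono hVW hq
  have hD := (energy m S W).sub_mem hqW hq'
  obtain ⟨v', hv', hv'1, hv'2⟩ := F.energy_comp hD hτ.contDiff hτ.zero hC
  have hD1 : (q - q').fst =ᵐ[wm m] fun x => q.fst x - q'.fst x := by
    rw [WithLp.sub_fst]; exact Lp.coeFn_sub _ _
  have hD2 : (q - q').snd =ᵐ[volume] fun x => q.snd x - q'.snd x := by
    rw [WithLp.sub_snd]; exact Lp.coeFn_sub _ _
  -- `τ(q - q')` lies in the energy space of the smaller set, so it is admissible in both equations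
  have hvv : v = v' := by
    refine F.energy_ext hvW hv' (Lp.ext ?_)
    filter_upwards [hv1, hv'1, hD1] with x h1 h2 h3
    rw [h1, h2, h3]
  subst hvv
  have hvb : ∀ᵐ x ∂(wm m), |v.fst x| ≤ 1 := by
    filter_upwards [hv1] with x hx
    rw [hx]; exact hτ1 _
  have e1 := heq v hv 1 hvb
  have e2 := heq' v hvW 1 hvb
  have hv0 := (F.energy_eq_zero hvW).mono fun x hx h => (hx h).1
  have hvm := Lp.aestronglyMeasurable v.fst
  have i1 := F.integrable_drift_mul hW hWm q.snd hvm hv0 hvb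
  have i2 := F.integrable_drift_mul hW hWm q'.snd hvm hv0 hvb
  -- the drift does not contribute, because it is divergence free
  have hdrift : (∫ x, inner ℝ (c x) (q.snd x) * v.fst x ∂(wm m))
      - ∫ x, inner ℝ (c x) (q'.snd x) * v.fst x ∂(wm m) = 0 := by
    rw [← integral_sub i1 i2, ← F.integral_comp_mul_drift_eq_zero hW hWm hD hτ.contDiff hτ1]
    refine integral_congr_ae ?_
    filter_upwards [hv'1, F.ae_iff.2 hD2] with x h1 h2
    rw [h1, h2, inner_sub_right]
    ring
  have i3 : ∀ r : GSp m, Integrable (fun x => (α * r.fst x - f x) * v.fst x) (wm m) := fun r => by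
    have j1 : Integrable (fun x => v.fst x * r.fst x) (wm m) :=
      (L2.integrable_inner (𝕜 := ℝ) r.fst v.fst).congr (Eventually.of_forall fun x => by simp)
    have j2 : Integrable (fun x => f x * v.fst x) (wm m) :=
      (L1_integrable f).mul_bdd (c := 1) hvm hvb
    refine ((j1.const_mul α).sub j2).congr (Eventually.of_forall fun x => ?_)
    simp only [Pi.sub_apply]; ring
  have hpos : 0 ≤ inner ℝ q.snd v.snd - inner ℝ q'.snd v.snd := by
    rw [← inner_sub_left, L2.inner_def]
    refine integral_nonneg_of_ae ?_
    filter_upwards [hv'2] with x h1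
    rw [h1, WithLp.sub_snd, inner_smul_right, real_inner_self_eq_norm_sq]
    exact mul_nonneg (hτ.deriv_nonneg _) (sq_nonneg _)
  have hint : (∫ x, (α * q.fst x - f x) * v.fst x ∂(wm m))
      - ∫ x, (α * q'.fst x - f x) * v.fst x ∂(wm m)
      = ∫ x, α * ((q.fst x - q'.fst x) * τ (q.fst x - q'.fst x)) ∂(wm m) := by
    rw [← integral_sub (i3 q) (i3 q')]
    refine integral_congr_ae ?_
    filter_upwards [hv1] with x h1
    rw [h1]; ring
  have hge : 0 ≤ᵐ[wm m] fun x => α * ((q.fst x - q'.fst x) * τ (q.fst x - q'.fst x)) := by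
    refine Eventually.of_forall fun x => mul_nonneg hα.le ?_
    rcases le_total (q.fst x - q'.fst x) 0 with h | h
    · have h0 : τ (q.fst x - q'.fst x) = 0 :=
        Real.smoothTransition.zero_of_nonpos (by simpa using h)
      rw [h0, mul_zero]
    · exact mul_nonneg h (Real.smoothTransition.nonneg _)
  have hz0 : ∫ x, α * ((q.fst x - q'.fst x) * τ (q.fst x - q'.fst x)) ∂(wm m) = 0 := by
    refine le_antisymm ?_ (integral_nonneg_of_ae hge)
    rw [← hint]
    linarith
  have hi : Integrable (fun x => α * ((q.fst x - q'.fst x) * τ (q.fst x - q'.fst x))) (wm m) := by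
    refine ((i3 q).sub (i3 q')).congr ?_
    filter_upwards [hv1] with x h1
    rw [Pi.sub_apply, h1]; ring
  have h0 := (integral_eq_zero_iff_of_nonneg_ae hge hi).1 hz0
  rw [← Lp.coeFn_le]
  filter_upwards [h0, hqu, hqu'] with x h1 h2 h3
  rw [← h2, ← h3]
  by_contra hlt
  rw [not_le, ← sub_pos] at hlt
  have h4 : 0 < τ (q.fst x - q'.fst x) :=
    Real.smoothTransition.pos_of_pos (by simpa using hlt)
  exact (mul_pos hα (mul_pos hlt h4)).ne' h1

/-- Nonnegative integrable functions are limits of bounded ones, namely of `min f n`. -/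
theorem exists_bounded_tendsto {ν : Measure (Sp d)} {f : Lp ℝ 1 ν} (hf : 0 ≤ f) :
    ∃ g : ℕ → Lp ℝ 1 ν, (∀ n, ∀ᵐ x ∂ν, 0 ≤ g n x ∧ g n x ≤ n) ∧ Tendsto g atTop (𝓝 f) := by
  have hf0 := (Lp.coeFn_nonneg f).2 hf
  have hm : ∀ n : ℕ, MemLp (fun x => min (f x) n) 1 ν := fun n => by
    refine (Lp.memLp f).mono ((Lp.aestronglyMeasurable f).inf aestronglyMeasurable_const) ?_
    filter_upwards [hf0] with x hx
    rw [Real.norm_of_nonneg (le_min hx n.cast_nonneg), Real.norm_of_nonneg hx]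
    exact min_le_left _ _
  refine ⟨fun n => (hm n).toLp _, fun n => ?_, ?_⟩
  · filter_upwards [(hm n).coeFn_toLp, hf0] with x h1 h2
    rw [h1]
    exact ⟨le_min h2 n.cast_nonneg, min_le_right _ _⟩
  · rw [Lp.tendsto_Lp_iff_tendsto_eLpNorm']
    have : Tendsto (fun n : ℕ => eLpNorm (fun x => min (f x) n - f x) 1 ν) atTop (𝓝 0) := by
      refine tendsto_eLpNorm_of_dominated one_ne_zero ENNReal.one_ne_top
        (fun n => (hm n).1.sub (Lp.aestronglyMeasurable f)) (Lp.memLp f) (fun n => ?_) ?_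
      · filter_upwards [hf0] with x hx
        have hx' : 0 ≤ f x := hx
        have h1 : 0 ≤ min (f x) n := le_min hx' n.cast_nonneg
        have h2 := min_le_left (f x) n
        rw [Real.norm_eq_abs, abs_le]
        constructor <;> linarith
      · refine Eventually.of_forall fun x => ?_
        refine tendsto_const_nhds.congr' ?_
        obtain ⟨k, hk⟩ := exists_nat_ge (f x)
        filter_upwards [eventually_ge_atTop k] with n hn
        have : (k : ℝ) ≤ n := by exact_mod_cast hn
        rw [min_eq_left (hk.trans this), sub_self]
    refine this.congr fun n => eLpNorm_congr_ae ?_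
    filter_upwards [(hm n).coeFn_toLp] with x hx
    rw [Pi.sub_apply, hx]

/-- The resolvents increase with the set. -/
theorem resolventExt_le (F : IsFrame m S T c) {V W : Set (Sp d)} (hVW : V ⊆ W)
    (hW : Bornology.IsBounded W) (hVm : MeasurableSet V) (hWm : MeasurableSet W) {α : ℝ}
    (hα : 0 < α) {G : Lp ℝ 1 ((wm m).restrict V) →L[ℝ] Lp ℝ 1 ((wm m).restrict V)}
    (hG : ∀ f, (G f, α • G f - f) ∈ (driftRel m S c V).topologicalClosure)
    {G' : Lp ℝ 1 ((wm m).restrict W) →L[ℝ] Lp ℝ 1 ((wm m).restrict W)}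
    (hG' : ∀ f, (G' f, α • G' f - f) ∈ (driftRel m S c W).topologicalClosure)
    {f : Lp ℝ 1 (wm m)} (hf : 0 ≤ f) : resolventExt hVm G f ≤ resolventExt hWm G' f := by
  obtain ⟨g, hg, hlim⟩ := exists_bounded_tendsto hf
  refine le_of_tendsto_of_tendsto' (((resolventExt hVm G).continuous.tendsto f).comp hlim)
    (((resolventExt hWm G').continuous.tendsto f).comp hlim) fun n => ?_
  have h := F.extendL1_le_of_bounded hVW hW hVm hWm hα
    (hG (LpToLpRestrictCLM (Sp d) ℝ ℝ (wm m) 1 V (g n))) (sub_sub_cancel _ _)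
    (hG' (LpToLpRestrictCLM (Sp d) ℝ ℝ (wm m) 1 W (g n))) (sub_sub_cancel _ _)
    n.cast_nonneg (hg n)
  exact h

theorem resolventExt_nonneg (F : IsFrame m S T c) {V : Set (Sp d)}
    (hV : Bornology.IsBounded V) (hVm : MeasurableSet V) {α : ℝ}
    (hα : 0 < α) {G : Lp ℝ 1 ((wm m).restrict V) →L[ℝ] Lp ℝ 1 ((wm m).restrict V)}
    (hG : ∀ f, (G f, α • G f - f) ∈ (driftRel m S c V).topologicalClosure)
    {f : Lp ℝ 1 (wm m)} (hf : 0 ≤ f) : 0 ≤ resolventExt hVm G f := by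
  obtain ⟨g, hg, hlim⟩ := exists_bounded_tendsto hf
  refine ge_of_tendsto' (((resolventExt hVm G).continuous.tendsto f).comp hlim) fun n => ?_
  rw [← Lp.coeFn_nonneg]
  exact (F.bounds_of_bounded hV hVm hα (hG (LpToLpRestrictCLM (Sp d) ℝ ℝ (wm m) 1 V (g n)))
    (sub_sub_cancel _ _) n.cast_nonneg (hg n)).mono fun x hx => hx.1

theorem norm_smul_resolventExt_le (F : IsFrame m S T c) {V : Set (Sp d)}
    (hV : Bornology.IsBounded V) (hVm : MeasurableSet V) {α : ℝ}
    (hα : 0 < α) {G : Lp ℝ 1 ((wm m).restrict V) →L[ℝ] Lp ℝ 1 ((wm m).restrict V)}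
    (hG : ∀ f, (G f, α • G f - f) ∈ (driftRel m S c V).topologicalClosure)
    (f : Lp ℝ 1 (wm m)) : ‖α • resolventExt hVm G f‖ ≤ ‖f‖ := by
  have h := (F.truncationDissipative_driftRel hV hVm).norm_smul_le
    (hG (LpToLpRestrictCLM (Sp d) ℝ ℝ (wm m) 1 V f)) hα
  rw [sub_sub_cancel] at h
  rw [resolventExt_apply, ← map_smul, LinearIsometry.norm_map]
  exact h.trans (norm_Lp_toLp_restrict_le V f)

end IsFrame

end Monotonicity

/-! ### The limit of the operators on balls -/

section Global

variable {d : ℕ}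

theorem norm_sub_of_le {ν : Measure (Sp d)} {f g : Lp ℝ 1 ν} (hf : 0 ≤ f) (hfg : f ≤ g) :
    ‖g - f‖ = ‖g‖ - ‖f‖ := by
  rw [L1.norm_eq_integral_norm, L1.norm_eq_integral_norm, L1.norm_eq_integral_norm,
    ← integral_sub (L1_integrable g).norm (L1_integrable f).norm]
  refine integral_congr_ae ?_
  filter_upwards [(Lp.coeFn_nonneg f).2 hf, (Lp.coeFn_le f g).2 hfg, Lp.coeFn_sub g f]
    with x h1 h2 h3
  have h1' : 0 ≤ f x := h1
  rw [h3, Pi.sub_apply, Real.norm_of_nonneg (sub_nonneg.2 h2), Real.norm_of_nonneg h1',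
    Real.norm_of_nonneg (h1'.trans h2)]

theorem exists_tendsto_of_monotone {ν : Measure (Sp d)} {f : ℕ → Lp ℝ 1 ν} (h0 : ∀ n, 0 ≤ f n)
    (hf : Monotone f) {C : ℝ} (hC : ∀ n, ‖f n‖ ≤ C) : ∃ g, Tendsto f atTop (𝓝 g) := by
  have hmono : Monotone fun n => ‖f n‖ := fun a b hab => by
    have h := norm_sub_of_le (h0 a) (hf hab)
    have := norm_nonneg (f b - f a)
    simp only
    linarith
  have hcau := (tendsto_atTop_ciSup hmono ⟨C, by rintro _ ⟨n, rfl⟩; exact hC n⟩).cauchySeq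
  refine cauchySeq_tendsto_of_complete ?_
  have key : ∀ a b, dist (f a) (f b) = dist ‖f a‖ ‖f b‖ := by
    intro a b
    rcases le_total a b with h | h
    · rw [dist_comm, dist_comm ‖f a‖, dist_eq_norm, norm_sub_of_le (h0 a) (hf h), Real.dist_eq,
        abs_of_nonneg (sub_nonneg.2 (hmono h))]
    · rw [dist_eq_norm, norm_sub_of_le (h0 b) (hf h), Real.dist_eq,
        abs_of_nonneg (sub_nonneg.2 (hmono h))]
  rw [Metric.cauchySeq_iff] at hcau ⊢
  simpa only [key] using hcau

/-- If `0 ≤ b ≤ a` and `‖a‖ ≤ ‖f‖`, then `a` approximates `f` in `L¹` almost as well as `b` does. -/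
theorem norm_sub_le_two_mul {ν : Measure (Sp d)} {a b f : Lp ℝ 1 ν} (hb : 0 ≤ b) (hab : b ≤ a)
    (haf : ‖a‖ ≤ ‖f‖) : ‖a - f‖ ≤ 2 * ‖b - f‖ := by
  have h1 := norm_sub_of_le hb hab
  have h2 : ‖a - f‖ ≤ ‖a - b‖ + ‖b - f‖ := norm_sub_le_norm_sub_add_norm_sub _ _ _
  have h3 : ‖f‖ - ‖b‖ ≤ ‖b - f‖ := by rw [norm_sub_rev]; exact norm_sub_norm_le _ _
  linarith

theorem smul_le_smul_L1 {ν : Measure (Sp d)} {f g : Lp ℝ 1 ν} {a : ℝ} (ha : 0 ≤ a) (h : f ≤ g) :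
    a • f ≤ a • g := by
  refine (Lp.coeFn_le _ _).1 ?_
  filter_upwards [(Lp.coeFn_le f g).2 h, Lp.coeFn_smul a f, Lp.coeFn_smul a g] with x h1 h2 h3
  rw [h2, h3]
  exact mul_le_mul_of_nonneg_left h1 ha

theorem exists_nonneg_sub {ν : Measure (Sp d)} (f : Lp ℝ 1 ν) :
    ∃ g h : Lp ℝ 1 ν, 0 ≤ g ∧ 0 ≤ h ∧ f = g - h :=
  ⟨f⁺, f⁻, posPart_nonneg f, negPart_nonneg f, (posPart_sub_negPart f).symm⟩

/-- The relation `α G_α f → f` for a densely defined dissipative operator. -/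
theorem TruncationDissipative.exists_norm_smul_sub_lt {ν : Measure (Sp d)}
    {𝒮 : Submodule ℝ (Lp ℝ 1 ν × Lp ℝ 1 ν)}
    (h𝒮 : TruncationDissipative (𝒮 : Set (Lp ℝ 1 ν × Lp ℝ 1 ν)))
    (hdense : Dense (Prod.fst '' (𝒮 : Set (Lp ℝ 1 ν × Lp ℝ 1 ν)))) {G : ℝ → Lp ℝ 1 ν →L[ℝ] Lp ℝ 1 ν}
    (hG : ∀ α, 0 < α → ∀ f, (G α f, α • G α f - f) ∈ 𝒮) (f : Lp ℝ 1 ν) {ε : ℝ} (hε : 0 < ε) :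
    ∃ α, 0 < α ∧ ‖α • G α f - f‖ < ε := by
  obtain ⟨_, ⟨z, hz, rfl⟩, hd⟩ := hdense.exists_dist_lt f (ε := ε / 3) (by positivity)
  rw [dist_eq_norm] at hd
  obtain ⟨α, hα, hα'⟩ : ∃ α : ℝ, 0 < α ∧ ‖z.2‖ < α * (ε / 3) := by
    refine ⟨(‖z.2‖ + 1) / (ε / 3), by positivity, ?_⟩
    rw [div_mul_cancel₀ _ (by positivity)]
    linarith
  refine ⟨α, hα, ?_⟩
  have h1 := h𝒮.norm_smul_le (𝒮.sub_mem (𝒮.smul_mem α (hG α hα z.1)) hz) hα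
  have e1 : α • (α • (G α z.1, α • G α z.1 - z.1) - z).1
      - (α • (G α z.1, α • G α z.1 - z.1) - z).2 = z.2 := by
    simp only [Prod.fst_sub, Prod.snd_sub, Prod.smul_fst, Prod.smul_snd, smul_sub]
    abel
  rw [e1, norm_smul, Real.norm_of_nonneg hα.le, Prod.fst_sub, Prod.smul_fst] at h1
  have h2 : ‖α • G α z.1 - z.1‖ < ε / 3 :=
    lt_of_mul_lt_mul_left (h1.trans_lt hα') hα.le
  have h3 := h𝒮.norm_smul_le (hG α hα (f - z.1)) hα
  rw [sub_sub_cancel] at h3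
  have e2 : α • G α f - f = α • G α (f - z.1) + (α • G α z.1 - z.1) - (f - z.1) := by
    rw [map_sub, smul_sub]; abel
  rw [e2]
  have h4 := norm_sub_le (α • G α (f - z.1) + (α • G α z.1 - z.1)) (f - z.1)
  have h5 := norm_add_le (α • G α (f - z.1)) (α • G α z.1 - z.1)
  linarith

theorem tendsto_extendL1_restrict {ν : Measure (Sp d)} {V : ℕ → Set (Sp d)}
    (hVm : ∀ n, MeasurableSet (V n)) (hV : ∀ x, ∀ᶠ n in atTop, x ∈ V n) (f : Lp ℝ 1 ν) :
    Tendsto (fun n => extendL1 (hVm n) (LpToLpRestrictCLM (Sp d) ℝ ℝ ν 1 (V n) f)) atTop (𝓝 f) := by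
  rw [Lp.tendsto_Lp_iff_tendsto_eLpNorm']
  have : Tendsto (fun n : ℕ => eLpNorm (fun x => (V n).indicator f x - f x) 1 ν) atTop (𝓝 0) := by
    refine tendsto_eLpNorm_of_dominated one_ne_zero ENNReal.one_ne_top (fun n => ?_)
      (Lp.memLp f).norm (fun n => Eventually.of_forall fun x => ?_)
      (Eventually.of_forall fun x => ?_)
    · exact ((Lp.aestronglyMeasurable f).indicator (hVm n)).sub (Lp.aestronglyMeasurable f)
    · by_cases hx : x ∈ V n
      · rw [indicator_of_mem hx, sub_self, norm_zero]; exact norm_nonneg _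
      · rw [indicator_of_notMem hx, zero_sub, norm_neg]
    · refine tendsto_const_nhds.congr' ?_
      filter_upwards [hV x] with n hn
      rw [indicator_of_mem hn, sub_self]
  refine this.congr fun n => eLpNorm_congr_ae ?_
  filter_upwards [extendL1_restrict_coeFn (hVm n) f] with x hx
  rw [Pi.sub_apply, hx]

/-- The exhaustion of the space by balls. -/
abbrev exhaust (d : ℕ) (n : ℕ) : Set (Sp d) := Metric.ball 0 ((n : ℝ) + 1)

theorem measurableSet_exhaust (n : ℕ) : MeasurableSet (exhaust d n) :=
  Metric.isOpen_ball.measurableSet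

theorem exhaust_mono : Monotone (exhaust d) := fun a b hab =>
  Metric.ball_subset_ball (by gcongr)

theorem exists_subset_exhaust {V : Set (Sp d)} (hV : Bornology.IsBounded V) :
    ∃ N, ∀ n, N ≤ n → V ⊆ exhaust d n := by
  obtain ⟨r, hr⟩ := hV.subset_ball 0
  obtain ⟨N, hN⟩ := exists_nat_ge r
  refine ⟨N, fun n hn => hr.trans (Metric.ball_subset_ball ?_)⟩
  have : (N : ℝ) ≤ n := by exact_mod_cast hn
  linarith

theorem eventually_mem_exhaust (x : Sp d) : ∀ᶠ n in atTop, x ∈ exhaust d n := by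
  obtain ⟨N, hN⟩ := exists_subset_exhaust (Bornology.isBounded_singleton (x := x))
  filter_upwards [eventually_ge_atTop N] with n hn
  exact hN n hn rfl

/-- The graph of the operator on the whole space: the limits in `L¹ × L¹` of elements of the closed
operators on the balls. -/
def globalRel (m : Sp d → ℝ) (S : Sp d → Sp d →L[ℝ] Sp d) (c : Sp d → Sp d) :
    Submodule ℝ (Lp ℝ 1 (wm m) × Lp ℝ 1 (wm m)) where
  carrier := {z | ∃ ζ : ∀ n, Lp ℝ 1 ((wm m).restrict (exhaust d n)) ×
      Lp ℝ 1 ((wm m).restrict (exhaust d n)),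
    (∀ n, ζ n ∈ (driftRel m S c (exhaust d n)).topologicalClosure) ∧
    Tendsto (fun n => extendL1 (measurableSet_exhaust n) (ζ n).1) atTop (𝓝 z.1) ∧
    Tendsto (fun n => extendL1 (measurableSet_exhaust n) (ζ n).2) atTop (𝓝 z.2)}
  add_mem' := by
    rintro z z' ⟨ζ, h, h1, h2⟩ ⟨ζ', h', h1', h2'⟩
    refine ⟨fun n => ζ n + ζ' n, fun n => Submodule.add_mem _ (h n) (h' n), ?_, ?_⟩
    · simpa only [Prod.fst_add, map_add] using h1.add h1'
    · simpa only [Prod.snd_add, map_add] using h2.add h2'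
  zero_mem' := by
    refine ⟨fun n => 0, fun n => Submodule.zero_mem _, ?_, ?_⟩
    · simp only [Prod.fst_zero, map_zero]; exact tendsto_const_nhds
    · simp only [Prod.snd_zero, map_zero]; exact tendsto_const_nhds
  smul_mem' := by
    rintro r z ⟨ζ, h, h1, h2⟩
    refine ⟨fun n => r • ζ n, fun n => Submodule.smul_mem _ _ (h n), ?_, ?_⟩
    · simpa only [Prod.smul_fst, map_smul] using h1.const_smul r
    · simpa only [Prod.smul_snd, map_smul] using h2.const_smul r

namespace IsFrame

variable {m : Sp d → ℝ} {S T : Sp d → Sp d →L[ℝ] Sp d} {c : Sp d → Sp d}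

theorem exists_genLimit_global (F : IsFrame m S T c) {z : Lp ℝ 1 (wm m) × Lp ℝ 1 (wm m)}
    (hz : z ∈ globalRel m S c) : ∃ p w, GenLimit m S c univ (exhaust d) p w z.1 z.2 := by
  obtain ⟨ζ, h, h1, h2⟩ := hz
  exact F.exists_genLimit (fun n => Metric.isBounded_ball) measurableSet_exhaust
    (fun n => subset_univ _) h h1 h2

theorem truncationDissipative_globalRel (F : IsFrame m S T c) : TruncationDissipative
    (globalRel m S c : Set (Lp ℝ 1 (wm m) × Lp ℝ 1 (wm m))) := by
  intro z hz h hh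
  obtain ⟨p, w, L⟩ := F.exists_genLimit_global hz
  exact L.integral_mul_nonpos F hh

theorem exists_resolvents (F : IsFrame m S T c) :
    ∃ G : ∀ n : ℕ, ℝ → Lp ℝ 1 ((wm m).restrict (exhaust d n)) →L[ℝ]
        Lp ℝ 1 ((wm m).restrict (exhaust d n)),
      ∀ n α, 0 < α → ∀ f,
        (G n α f, α • G n α f - f) ∈ (driftRel m S c (exhaust d n)).topologicalClosure := by
  have h := fun n : ℕ => F.exists_generator_of_bounded (V := exhaust d n) Metric.isOpen_ball
    Metric.isBounded_ball
  choose LV G h1 h2 h3 using h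
  exact ⟨G, fun n α hα => (h3 n α hα).2⟩

variable {G : ∀ n : ℕ, ℝ → Lp ℝ 1 ((wm m).restrict (exhaust d n)) →L[ℝ]
    Lp ℝ 1 ((wm m).restrict (exhaust d n))}

theorem monotone_resolventExt (F : IsFrame m S T c) (hG : ∀ n α, 0 < α → ∀ f,
      (G n α f, α • G n α f - f) ∈ (driftRel m S c (exhaust d n)).topologicalClosure)
    {α : ℝ} (hα : 0 < α) {f : Lp ℝ 1 (wm m)} (hf : 0 ≤ f) :
    Monotone fun n => resolventExt (measurableSet_exhaust n) (G n α) f := fun a b hab =>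
  F.resolventExt_le (exhaust_mono hab) Metric.isBounded_ball _ _ hα (hG a α hα) (hG b α hα) hf

theorem exists_tendsto_resolventExt (F : IsFrame m S T c) (hG : ∀ n α, 0 < α → ∀ f,
      (G n α f, α • G n α f - f) ∈ (driftRel m S c (exhaust d n)).topologicalClosure)
    {α : ℝ} (hα : 0 < α) (f : Lp ℝ 1 (wm m)) :
    ∃ g, Tendsto (fun n => resolventExt (measurableSet_exhaust n) (G n α) f) atTop (𝓝 g) := by
  have key : ∀ f : Lp ℝ 1 (wm m), 0 ≤ f →
      ∃ g, Tendsto (fun n => resolventExt (measurableSet_exhaust n) (G n α) f) atTop (𝓝 g) := by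
    intro f hf
    refine exists_tendsto_of_monotone (fun n => F.resolventExt_nonneg Metric.isBounded_ball _ hα
      (hG n α hα) hf) (F.monotone_resolventExt hG hα hf) (C := α⁻¹ * ‖f‖) fun n => ?_
    have h := F.norm_smul_resolventExt_le Metric.isBounded_ball (measurableSet_exhaust n) hα
      (hG n α hα) f
    rw [norm_smul, Real.norm_of_nonneg hα.le] at h
    rw [inv_mul_eq_div, le_div_iff₀ hα, mul_comm]
    exact h
  obtain ⟨a, b, ha, hb, rfl⟩ := exists_nonneg_sub f
  obtain ⟨x, hx⟩ := key a ha
  obtain ⟨y, hy⟩ := key b hb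
  exact ⟨x - y, by simpa only [map_sub] using hx.sub hy⟩

theorem mem_globalRel_of_tendsto (hG : ∀ n α, 0 < α → ∀ f,
      (G n α f, α • G n α f - f) ∈ (driftRel m S c (exhaust d n)).topologicalClosure)
    {α : ℝ} (hα : 0 < α) {f g : Lp ℝ 1 (wm m)}
    (hg : Tendsto (fun n => resolventExt (measurableSet_exhaust n) (G n α) f) atTop (𝓝 g)) :
    (g, α • g - f) ∈ globalRel m S c := by
  refine ⟨fun n => (_, _), fun n => hG n α hα (LpToLpRestrictCLM (Sp d) ℝ ℝ (wm m) 1 _ f), hg, ?_⟩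
  have h := (hg.const_smul α).sub
    (tendsto_extendL1_restrict measurableSet_exhaust eventually_mem_exhaust f)
  refine h.congr fun n => ?_
  rw [map_sub, map_smul, resolventExt_apply]

theorem range_globalRel (F : IsFrame m S T c) {α : ℝ} (hα : 0 < α) (f : Lp ℝ 1 (wm m)) :
    ∃ z ∈ globalRel m S c, α • z.1 - z.2 = f := by
  obtain ⟨G, hG⟩ := F.exists_resolvents
  obtain ⟨g, hg⟩ := F.exists_tendsto_resolventExt hG hα f
  exact ⟨_, mem_globalRel_of_tendsto hG hα hg, sub_sub_cancel _ _⟩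

/-- For `f ≥ 0` the resolvent on the whole space dominates the one on a ball, and `α G_α f` has norm
at most `‖f‖`. Hence `α G_α f` is close to `f` as soon as this holds for the ball. -/
theorem dense_domain_globalRel (F : IsFrame m S T c) :
    Dense (Prod.fst '' (globalRel m S c : Set (Lp ℝ 1 (wm m) × Lp ℝ 1 (wm m)))) := by
  obtain ⟨G, hG⟩ := F.exists_resolvents
  let D : Submodule ℝ (Lp ℝ 1 (wm m)) :=
    (globalRel m S c).map (LinearMap.fst ℝ (Lp ℝ 1 (wm m)) (Lp ℝ 1 (wm m)))
  have hpos : ∀ f : Lp ℝ 1 (wm m), 0 ≤ f → f ∈ D.topologicalClosure := by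
    intro f hf
    refine Metric.mem_closure_iff.2 fun ε hε => ?_
    obtain ⟨n, hn⟩ := (Metric.tendsto_atTop.1 (tendsto_extendL1_restrict measurableSet_exhaust
      eventually_mem_exhaust f) (ε / 4) (by positivity))
    have hn := hn n le_rfl
    obtain ⟨α, hα, hαn⟩ := (F.truncationDissipative_driftRel (V := exhaust d n)
      Metric.isBounded_ball (measurableSet_exhaust n)).exists_norm_smul_sub_lt
      (F.dense_domain_driftRel Metric.isOpen_ball Metric.isBounded_ball) (hG n)
      (LpToLpRestrictCLM (Sp d) ℝ ℝ (wm m) 1 (exhaust d n) f) (ε := ε / 4) (by positivity)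
    obtain ⟨g, hg⟩ := F.exists_tendsto_resolventExt hG hα f
    have hgm := mem_globalRel_of_tendsto hG hα hg
    set H := resolventExt (measurableSet_exhaust n) (G n α) f with hH
    have hHg : H ≤ g := (F.monotone_resolventExt hG hα hf).ge_of_tendsto hg n
    have hH0 : 0 ≤ H := F.resolventExt_nonneg Metric.isBounded_ball _ hα (hG n α hα) hf
    have h1 : ‖α • g‖ ≤ ‖f‖ := by
      have := F.truncationDissipative_globalRel.norm_smul_le hgm hα
      rwa [sub_sub_cancel] at this
    have h2 := norm_sub_le_two_mul (by simpa only [smul_zero] using smul_le_smul_L1 hα.le hH0)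
      (smul_le_smul_L1 hα.le hHg) h1
    have h3 : ‖α • H - f‖ < ε / 2 := by
      rw [dist_eq_norm] at hn
      have e : α • H - f = extendL1 (measurableSet_exhaust n)
          (α • G n α (LpToLpRestrictCLM (Sp d) ℝ ℝ (wm m) 1 (exhaust d n) f)
            - LpToLpRestrictCLM (Sp d) ℝ ℝ (wm m) 1 (exhaust d n) f)
          + (extendL1 (measurableSet_exhaust n)
            (LpToLpRestrictCLM (Sp d) ℝ ℝ (wm m) 1 (exhaust d n) f) - f) := by
        rw [map_sub, map_smul, hH, resolventExt_apply]; abel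
      rw [e]
      refine (norm_add_le _ _).trans_lt ?_
      rw [LinearIsometry.norm_map]
      linarith
    refine ⟨α • g, D.smul_mem α ⟨_, hgm, rfl⟩, ?_⟩
    rw [dist_comm, dist_eq_norm]
    linarith
  have htop : Dense (D : Set (Lp ℝ 1 (wm m))) := fun f => by
    obtain ⟨a, b, ha, hb, rfl⟩ := exists_nonneg_sub f
    exact D.topologicalClosure.sub_mem (hpos a ha) (hpos b hb)
  refine htop.mono ?_
  rintro _ ⟨z, hz, rfl⟩
  exact ⟨z, hz, rfl⟩

/-- The operator on the whole space generates a sub-Markovian semigroup. -/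
theorem exists_generator_global (F : IsFrame m S T c) :
    ∃ (L : Lp ℝ 1 (wm m) →ₗ.[ℝ] Lp ℝ 1 (wm m)) (R : ℝ → Lp ℝ 1 (wm m) →L[ℝ] Lp ℝ 1 (wm m)),
      L.graph = globalRel m S c ∧ L.IsClosed ∧ GeneratesSubMarkovian L ∧
      ∀ α, 0 < α → IsResolvent L α (R α) ∧ ∀ f, (R α f, α • R α f - f) ∈ globalRel m S c :=
  F.truncationDissipative_globalRel.exists_generator (fun _ hα f => F.range_globalRel hα f)
    F.dense_domain_globalRel

/-- The resolvent on the whole space is the limit of the resolvents along every exhaustion by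
bounded sets, by comparison with the resolvents on the balls. -/
theorem tendsto_resolventExt (F : IsFrame m S T c) {α : ℝ} (hα : 0 < α)
    {R : Lp ℝ 1 (wm m) →L[ℝ] Lp ℝ 1 (wm m)}
    (hR : ∀ f, (R f, α • R f - f) ∈ globalRel m S c) {U : ℕ → Set (Sp d)}
    (hUm : ∀ n, MeasurableSet (U n)) (hUb : ∀ n, Bornology.IsBounded (U n))
    (hU : ∀ k, ∀ᶠ n in atTop, exhaust d k ⊆ U n)
    {GU : ∀ n, Lp ℝ 1 ((wm m).restrict (U n)) →L[ℝ] Lp ℝ 1 ((wm m).restrict (U n))}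
    (hGU : ∀ n f, (GU n f, α • GU n f - f) ∈ (driftRel m S c (U n)).topologicalClosure)
    (f : Lp ℝ 1 (wm m)) :
    Tendsto (fun n => resolventExt (hUm n) (GU n) f) atTop (𝓝 (R f)) := by
  obtain ⟨G, hG⟩ := F.exists_resolvents
  have hlim : ∀ f, Tendsto (fun n => resolventExt (measurableSet_exhaust n) (G n α) f) atTop
      (𝓝 (R f)) := by
    intro f
    obtain ⟨g, hg⟩ := F.exists_tendsto_resolventExt hG hα f
    have h1 := F.truncationDissipative_globalRel.norm_smul_le
      ((globalRel m S c).sub_mem (mem_globalRel_of_tendsto hG hα hg) (hR f)) hα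
    have e : α • ((g, α • g - f) - (R f, α • R f - f)).1
        - ((g, α • g - f) - (R f, α • R f - f)).2 = 0 := by
      simp only [Prod.fst_sub, Prod.snd_sub, smul_sub]; abel
    rw [e, norm_zero] at h1
    have h2 := (smul_eq_zero.1 (norm_le_zero_iff.1 h1)).resolve_left hα.ne'
    have h3 : g = R f := sub_eq_zero.1 h2
    rwa [← h3]
  have key : ∀ f, 0 ≤ f → Tendsto (fun n => resolventExt (hUm n) (GU n) f) atTop (𝓝 (R f)) := by
    intro f hf
    rw [Metric.tendsto_atTop]
    intro ε hε
    obtain ⟨k, hk⟩ := Metric.tendsto_atTop.1 (hlim f) ε hε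
    obtain ⟨N, hN⟩ := eventually_atTop.1 (hU k)
    refine ⟨N, fun n hn => ?_⟩
    have hk := hk k le_rfl
    have h1 : resolventExt (measurableSet_exhaust k) (G k α) f ≤ resolventExt (hUm n) (GU n) f :=
      F.resolventExt_le (hN n hn) (hUb n) _ _ hα (hG k α hα) (hGU n) hf
    obtain ⟨j, hj⟩ := exists_subset_exhaust (hUb n)
    have h2 : resolventExt (hUm n) (GU n) f ≤ R f :=
      (F.resolventExt_le (hj j le_rfl) Metric.isBounded_ball _ (measurableSet_exhaust j) hα (hGU n)
        (hG j α hα) hf).trans ((F.monotone_resolventExt hG hα hf).ge_of_tendsto (hlim f) j)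
    have h0 : 0 ≤ resolventExt (measurableSet_exhaust k) (G k α) f :=
      F.resolventExt_nonneg Metric.isBounded_ball _ hα (hG k α hα) hf
    rw [dist_comm, dist_eq_norm] at hk ⊢
    rw [norm_sub_of_le h0 (h1.trans h2)] at hk
    rw [norm_sub_of_le (h0.trans h1) h2]
    have h4 := norm_sub_of_le h0 h1
    have h5 := norm_nonneg (resolventExt (hUm n) (GU n) f
      - resolventExt (measurableSet_exhaust k) (G k α) f)
    linarith
  obtain ⟨a, b, ha, hb, rfl⟩ := exists_nonneg_sub f
  simpa only [map_sub] using (key a ha).sub (key b hb)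

end IsFrame

end Global

/-! ### The closed forms and their generators in terms of the energy space -/

/-- The field `S`, its inverse `T` and the drift `c` encode the coefficients `ρ, ψ, A, B`: the form
is `⟨S ∇f, S ∇g⟩` integrated with respect to `dx`, and `⟨B, ∇u⟩ = ⟨c, S ∇u⟩`. -/
structure Encodes (ρ ψ : Sp d → ℝ) (A : Sp d → Matrix (Fin d) (Fin d) ℝ) (B : Sp d → Sp d)
    (S T : Sp d → Sp d →L[ℝ] Sp d) (c : Sp d → Sp d) : Prop where
  frame : IsFrame (fun x => ρ x * ψ x) S T c
  psi_pos : ∀ᵐ x, 0 < ψ x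
  inner_S : ∀ᵐ x, ∀ ξ η, inner ℝ (S x ξ) (S x η) = (1 / 2) * ρ x * ((A x *ᵥ ξ.ofLp) ⬝ᵥ η.ofLp)
  inner_c : ∀ᵐ x, ∀ ξ, inner ℝ (B x) ξ = inner ℝ (c x) (S x ξ)

namespace IsFrame

variable {m : Sp d → ℝ} {S T : Sp d → Sp d →L[ℝ] Sp d} {c : Sp d → Sp d}

theorem fst_eq_indicator (F : IsFrame m S T c) {U : Set (Sp d)} (hU : MeasurableSet U) {p : GSp m}
    (hp : p ∈ energy m S U) {u : Sp d → ℝ} (h : p.fst =ᵐ[(wm m).restrict U] u) :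
    p.fst =ᵐ[wm m] U.indicator u := by
  filter_upwards [(ae_restrict_iff' hU).1 h, F.ae_iff.2 (F.energy_eq_zero hp)] with x h1 h2
  by_cases hx : x ∈ U
  · rw [indicator_of_mem hx, h1 hx]
  · rw [indicator_of_notMem hx, (h2 hx).1]

end IsFrame

theorem ae_eq_of_restrict {ν : Measure (Sp d)} {U : Set (Sp d)} (hU : MeasurableSet U)
    {f u : Sp d → ℝ} (h : f =ᵐ[ν] U.indicator u) : f =ᵐ[ν.restrict U] u := by
  rw [Filter.EventuallyEq, ae_restrict_iff' hU]
  filter_upwards [h] with x hx hxU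
  rw [hx, indicator_of_mem hxU]

namespace Encodes

variable {ρ ψ : Sp d → ℝ} {A : Sp d → Matrix (Fin d) (Fin d) ℝ} {B : Sp d → Sp d}
  {S T : Sp d → Sp d →L[ℝ] Sp d} {c : Sp d → Sp d}

theorem preForm_eq (E : Encodes ρ ψ A B S T c) {U : Set (Sp d)} {f g : Sp d → ℝ}
    {P Q : GSp fun x => ρ x * ψ x} (hP : IsTestPair (fun x => ρ x * ψ x) S U f P)
    (hQ : IsTestPair (fun x => ρ x * ψ x) S U g Q) :
    preForm ρ ψ A U f g = inner ℝ P.snd Q.snd := by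
  rw [preForm, setIntegral_eq_integral_of_forall_compl_eq_zero fun x hx => by
    rw [hP.1.gradient_eq_zero fun h => hx (hP.1.2.2 h)]; simp]
  have h1 := E.frame.integral_wm fun x =>
    (((ψ x)⁻¹ • A x) *ᵥ (gradient f x).ofLp) ⬝ᵥ (gradient g x).ofLp
  rw [mu, h1, L2.inner_def, ← integral_const_mul]
  refine integral_congr_ae ?_
  filter_upwards [E.psi_pos, E.inner_S, hP.2.2, hQ.2.2] with x h1 h2 h3 h4
  rw [h3, h4, h2, Matrix.smul_mulVec, smul_dotProduct, smul_eq_mul]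
  field_simp

theorem eLpNorm_restrict_eq {ν : Measure (Sp d)} {U : Set (Sp d)} (hU : MeasurableSet U)
    {φ u : Sp d → ℝ} (hφ : IsTest U φ) :
    eLpNorm (φ - u) 2 (ν.restrict U) = eLpNorm (fun x => φ x - U.indicator u x) 2 ν := by
  rw [← eLpNorm_indicator_eq_eLpNorm_restrict hU]
  congr 1
  funext x
  by_cases hx : x ∈ U
  · rw [indicator_of_mem hx, indicator_of_mem hx, Pi.sub_apply]
  · rw [indicator_of_notMem hx, indicator_of_notMem hx, hφ.eq_zero hx, sub_zero]

theorem eLpNorm_fst_sub {m : Sp d → ℝ} {U : Set (Sp d)} (hU : MeasurableSet U) {φ u : Sp d → ℝ}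
    {P p : GSp m} {S : Sp d → Sp d →L[ℝ] Sp d} (hP : IsTestPair m S U φ P)
    (hp : p.fst =ᵐ[wm m] U.indicator u) :
    eLpNorm (φ - u) 2 ((wm m).restrict U) = eLpNorm (P.fst - p.fst : Sp d → ℝ) 2 (wm m) := by
  rw [eLpNorm_restrict_eq hU hP.1]
  refine eLpNorm_congr_ae ?_
  filter_upwards [hP.2.1, hp] with x h1 h2
  rw [Pi.sub_apply, h1, h2]

/-- An approximating sequence for the form converges in the energy space. -/
theorem exists_tendsto_of_formApprox (E : Encodes ρ ψ A B S T c) {U : Set (Sp d)}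
    (hU : MeasurableSet U) {u : Sp d → ℝ} (hu : MemLp u 2 ((mu ρ ψ).restrict U))
    {φ : ℕ → Sp d → ℝ} (h : FormApprox ρ ψ A U u φ) :
    ∃ (P : ℕ → GSp fun x => ρ x * ψ x) (p : GSp fun x => ρ x * ψ x),
      (∀ n, IsTestPair (fun x => ρ x * ψ x) S U (φ n) (P n)) ∧ Tendsto P atTop (𝓝 p) ∧
      p.fst =ᵐ[mu ρ ψ] U.indicator u := by
  choose P hP using fun n => E.frame.exists_testPair (h.1 n)
  have hi : MemLp (U.indicator u) 2 (wm fun x => ρ x * ψ x) :=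
    (memLp_indicator_iff_restrict hU).2 hu
  have h1 : Tendsto (fun n => (P n).fst) atTop (𝓝 (hi.toLp _)) := by
    rw [Lp.tendsto_Lp_iff_tendsto_eLpNorm']
    refine h.2.1.congr fun n => ?_
    exact eLpNorm_fst_sub hU (p := WithLp.toLp 2 (hi.toLp _, 0)) (hP n) hi.coeFn_toLp
  have h2 : CauchySeq fun n => (P n).snd := by
    rw [cauchySeq_iff_tendsto_dist_atTop_0]
    have h3 := h.2.2.sqrt
    rw [Real.sqrt_zero] at h3
    refine h3.congr fun n => ?_
    have h4 := E.preForm_eq ((hP n.1).sub (hP n.2)) ((hP n.1).sub (hP n.2))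
    rw [h4, real_inner_self_eq_norm_sq, Real.sqrt_sq (norm_nonneg _), WithLp.sub_snd, dist_eq_norm]
  obtain ⟨g, hg⟩ := cauchySeq_tendsto_of_complete h2
  exact ⟨P, WithLp.toLp 2 (hi.toLp _, g), hP, tendsto_GSp h1 hg, hi.coeFn_toLp⟩

theorem formApprox_of_tendsto (E : Encodes ρ ψ A B S T c) {U : Set (Sp d)}
    (hU : MeasurableSet U) {u : Sp d → ℝ} {φ : ℕ → Sp d → ℝ}
    {P : ℕ → GSp fun x => ρ x * ψ x} {p : GSp fun x => ρ x * ψ x}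
    (hP : ∀ n, IsTestPair (fun x => ρ x * ψ x) S U (φ n) (P n)) (hlim : Tendsto P atTop (𝓝 p))
    (hp : p.fst =ᵐ[mu ρ ψ] U.indicator u) : FormApprox ρ ψ A U u φ := by
  refine ⟨fun n => (hP n).1, ?_, ?_⟩
  · have h1 := (Lp.tendsto_Lp_iff_tendsto_eLpNorm' _ _).1 (tendsto_fst hlim)
    exact h1.congr fun n => (eLpNorm_fst_sub hU (hP n) hp).symm
  · have h1 := (cauchySeq_iff_tendsto_dist_atTop_0.1 (tendsto_snd hlim).cauchySeq).pow 2
    rw [zero_pow two_ne_zero] at h1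
    refine h1.congr fun n => ?_
    rw [E.preForm_eq ((hP n.1).sub (hP n.2)) ((hP n.1).sub (hP n.2)), real_inner_self_eq_norm_sq,
      WithLp.sub_snd, dist_eq_norm]

/-- The domain of the closed form consists of the first components of the energy space. -/
theorem formDomain_iff (E : Encodes ρ ψ A B S T c) {U : Set (Sp d)} (hU : MeasurableSet U)
    {u : Sp d → ℝ} : FormDomain ρ ψ A U u ↔
      ∃ p ∈ energy (fun x => ρ x * ψ x) S U, p.fst =ᵐ[(mu ρ ψ).restrict U] u := by
  constructor
  · rintro ⟨hu, φ, hφ⟩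
    obtain ⟨P, p, hP, hlim, hp⟩ := E.exists_tendsto_of_formApprox hU hu hφ
    exact ⟨p, mem_energy_iff.2 ⟨φ, P, hP, hlim⟩, ae_eq_of_restrict hU hp⟩
  · rintro ⟨p, hp, hpu⟩
    obtain ⟨φ, P, hP, hlim⟩ := mem_energy_iff.1 hp
    exact ⟨((Lp.memLp p.fst).restrict U).ae_eq hpu, φ,
      E.formApprox_of_tendsto hU hP hlim (E.frame.fst_eq_indicator hU hp hpu)⟩

/-- The limit defining the closed form exists along all approximating sequences, and it is the inner
product of the second components. -/
theorem form_eq (E : Encodes ρ ψ A B S T c) {U : Set (Sp d)} (hU : MeasurableSet U)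
    {u v : Sp d → ℝ} {p q : GSp fun x => ρ x * ψ x} (hp : p ∈ energy (fun x => ρ x * ψ x) S U)
    (hq : q ∈ energy (fun x => ρ x * ψ x) S U) (hpu : p.fst =ᵐ[(mu ρ ψ).restrict U] u)
    (hqv : q.fst =ᵐ[(mu ρ ψ).restrict U] v) :
    form ρ ψ A U u v = inner ℝ p.snd q.snd := by
  have key : ∀ {u : Sp d → ℝ} {p : GSp fun x => ρ x * ψ x},
      p ∈ energy (fun x => ρ x * ψ x) S U → p.fst =ᵐ[(mu ρ ψ).restrict U] u →
      ∀ φ, FormApprox ρ ψ A U u φ → ∃ P : ℕ → GSp fun x => ρ x * ψ x,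
        (∀ n, IsTestPair (fun x => ρ x * ψ x) S U (φ n) (P n)) ∧ Tendsto P atTop (𝓝 p) := by
    intro u p hp hpu φ hφ
    obtain ⟨P, p', hP, hlim, hp'⟩ :=
      E.exists_tendsto_of_formApprox hU (((Lp.memLp p.fst).restrict U).ae_eq hpu) hφ
    have := E.frame.energy_ext (mem_energy_iff.2 ⟨φ, P, hP, hlim⟩) hp
      (Lp.ext (hp'.trans (E.frame.fst_eq_indicator hU hp hpu).symm))
    exact ⟨P, hP, this ▸ hlim⟩
  have hlim : ∀ un vn : ℕ → Sp d → ℝ, FormApprox ρ ψ A U u un → FormApprox ρ ψ A U v vn →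
      Tendsto (fun n => preForm ρ ψ A U (un n) (vn n)) atTop (𝓝 (inner ℝ p.snd q.snd)) := by
    intro un vn hun hvn
    obtain ⟨P, hP, hPp⟩ := key hp hpu un hun
    obtain ⟨Q, hQ, hQq⟩ := key hq hqv vn hvn
    exact ((tendsto_snd hPp).inner (tendsto_snd hQq)).congr
      fun n => (E.preForm_eq (hP n) (hQ n)).symm
  obtain ⟨-, un, hun⟩ := (E.formDomain_iff hU).2 ⟨p, hp, hpu⟩
  obtain ⟨-, vn, hvn⟩ := (E.formDomain_iff hU).2 ⟨q, hq, hqv⟩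
  have hform : ∀ un vn : ℕ → Sp d → ℝ, FormApprox ρ ψ A U u un → FormApprox ρ ψ A U v vn →
      Tendsto (fun n => preForm ρ ψ A U (un n) (vn n)) atTop (𝓝 (form ρ ψ A U u v)) :=
    Classical.epsilon_spec (p := fun a : ℝ => ∀ un vn : ℕ → Sp d → ℝ,
      FormApprox ρ ψ A U u un → FormApprox ρ ψ A U v vn →
        Tendsto (fun n => preForm ρ ψ A U (un n) (vn n)) atTop (𝓝 a)) ⟨_, hlim⟩
  exact tendsto_nhds_unique (hform un vn hun hvn) (hlim un vn hun hvn)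

theorem setIntegral_mul_eq_inner {m : Sp d → ℝ} {U : Set (Sp d)} (hU : MeasurableSet U)
    {w' f : Lp ℝ 2 (wm m)} {w v : Sp d → ℝ} (h0 : ∀ᵐ x ∂(wm m), x ∉ U → w' x = 0)
    (hw : w' =ᵐ[(wm m).restrict U] w) (hv : f =ᵐ[(wm m).restrict U] v) :
    ∫ x in U, w x * v x ∂(wm m) = inner ℝ w' f := by
  rw [L2.inner_def, ← integral_indicator hU]
  refine integral_congr_ae ?_
  filter_upwards [h0, (ae_restrict_iff' hU).1 hw, (ae_restrict_iff' hU).1 hv] with x h1 h2 h3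
  by_cases hx : x ∈ U
  · rw [indicator_of_mem hx, h2 hx, h3 hx, RCLike.inner_apply, conj_trivial, mul_comm]
  · rw [indicator_of_notMem hx, h1 hx, inner_zero_left]

/-- The generator of the closed form in terms of the energy space. -/
theorem isL0_iff (E : Encodes ρ ψ A B S T c) {U : Set (Sp d)} (hU : MeasurableSet U)
    {u w : Sp d → ℝ} : IsL0 ρ ψ A U u w ↔ ∃ p w', IsGen (fun x => ρ x * ψ x) S U p w' ∧
      p.fst =ᵐ[(mu ρ ψ).restrict U] u ∧ w' =ᵐ[(mu ρ ψ).restrict U] w := by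
  constructor
  · rintro ⟨hu, hw, h⟩
    obtain ⟨p, hp, hpu⟩ := (E.formDomain_iff hU).1 hu
    have hi : MemLp (U.indicator w) 2 (wm fun x => ρ x * ψ x) :=
      (memLp_indicator_iff_restrict hU).2 hw
    obtain ⟨w', hw'⟩ : ∃ w' : Lp ℝ 2 (wm fun x => ρ x * ψ x), w' =ᵐ[mu ρ ψ] U.indicator w :=
      ⟨hi.toLp _, hi.coeFn_toLp⟩
    have h0 : ∀ᵐ x ∂(mu ρ ψ), x ∉ U → w' x = 0 := by
      filter_upwards [hw'] with x hx hxU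
      rw [hx, indicator_of_notMem hxU]
    refine ⟨p, w', ⟨hp, h0, fun q hq => ?_⟩, hpu, ae_eq_of_restrict hU hw'⟩
    rw [← E.form_eq hU hp hq hpu (EventuallyEq.refl _ _),
      h _ ((E.formDomain_iff hU).2 ⟨q, hq, EventuallyEq.refl _ _⟩)]
    exact congrArg Neg.neg (setIntegral_mul_eq_inner hU h0 (ae_eq_of_restrict hU hw')
      (EventuallyEq.refl _ _))
  · rintro ⟨p, w', ⟨hp, h0, h⟩, hpu, hw'⟩
    refine ⟨(E.formDomain_iff hU).2 ⟨p, hp, hpu⟩, ((Lp.memLp w').restrict U).ae_eq hw', ?_⟩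
    intro v hv
    obtain ⟨q, hq, hqv⟩ := (E.formDomain_iff hU).1 hv
    rw [E.form_eq hU hp hq hpu hqv, h q hq]
    exact congrArg Neg.neg (setIntegral_mul_eq_inner hU h0 hw' hqv).symm

/-- The drift term does not depend on the choice of the weak gradient. -/
theorem inner_weakGrad_eq (E : Encodes ρ ψ A B S T c) {U : Set (Sp d)} (hU : IsOpen U)
    {p : GSp fun x => ρ x * ψ x} (hp : p ∈ energy (fun x => ρ x * ψ x) S U) {u : Sp d → ℝ}
    (hpu : p.fst =ᵐ[(mu ρ ψ).restrict U] u) :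
    (fun x => inner ℝ (B x) (weakGrad U u x)) =ᵐ[(mu ρ ψ).restrict U]
      fun x => inner ℝ (c x) (p.snd x) := by
  have hm := hU.measurableSet
  have hu : u =ᵐ[volume.restrict U] p.fst := by
    have h1 : ∀ᵐ x ∂(wm fun x => ρ x * ψ x), x ∈ U → p.fst x = u x := (ae_restrict_iff' hm).1 hpu
    exact EventuallyEq.symm ((ae_restrict_iff' hm).2 (E.frame.ae_iff.1 h1))
  have h1 : HasWeakGradient U u fun x => T x (p.snd x) :=
    (E.frame.hasWeakGradient hp).mono hm (subset_univ _) hu (EventuallyEq.refl _ _)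
  have h2 : HasWeakGradient U u (weakGrad U u) := by
    have h : ∃ g, HasWeakGradient U u g := ⟨_, h1⟩
    rw [weakGrad, dif_pos h]
    exact h.choose_spec
  have h3 := (ae_restrict_iff' hm).1 (h2.unique hU h1)
  rw [Filter.EventuallyEq, ae_restrict_iff' hm]
  refine E.frame.ac.ae_le ?_
  filter_upwards [h3, E.inner_c, E.frame.inv] with x h4 h5 h6 hx
  rw [h4 hx, h5, (h6 _).2]

theorem addDrift_eq (E : Encodes ρ ψ A B S T c) {U : Set (Sp d)} (hU : IsOpen U)
    {p : GSp fun x => ρ x * ψ x} (hp : p ∈ energy (fun x => ρ x * ψ x) S U)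
    {w' : Lp ℝ 2 (wm fun x => ρ x * ψ x)} {u w : Sp d → ℝ}
    (hpu : p.fst =ᵐ[(mu ρ ψ).restrict U] u) (hw : w' =ᵐ[(mu ρ ψ).restrict U] w) :
    addDrift B U u w =ᵐ[(mu ρ ψ).restrict U] drifted c p w' := by
  filter_upwards [E.inner_weakGrad_eq hU hp hpu, hw] with x h1 h2
  rw [addDrift, drifted, h1, h2]

theorem exists_bound_iff (E : Encodes ρ ψ A B S T c) {U : Set (Sp d)} (hU : MeasurableSet U)
    {p : GSp fun x => ρ x * ψ x} (hp : p ∈ energy (fun x => ρ x * ψ x) S U) {u : Sp d → ℝ}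
    (hpu : p.fst =ᵐ[(mu ρ ψ).restrict U] u) : EssBdd ((mu ρ ψ).restrict U) u ↔
      ∃ M : ℝ, ∀ᵐ x ∂(wm fun x => ρ x * ψ x), |p.fst x| ≤ M := by
  constructor
  · rintro ⟨M, hM⟩
    refine ⟨max M 0, ?_⟩
    filter_upwards [(ae_restrict_iff' hU).1 hM, (ae_restrict_iff' hU).1 hpu,
      E.frame.ae_iff.2 (E.frame.energy_eq_zero hp)] with x h1 h2 h3
    by_cases hx : x ∈ U
    · rw [h2 hx]; exact (h1 hx).trans (le_max_left _ _)
    · rw [(h3 hx).1, abs_zero]; exact le_max_right _ _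
  · rintro ⟨M, hM⟩
    have hM' : ∀ᵐ x ∂((mu ρ ψ).restrict U), |p.fst x| ≤ M := ae_restrict_of_ae hM
    refine ⟨M, ?_⟩
    filter_upwards [hM', hpu] with x h1 h2
    rwa [← h2]

theorem graphLV_eq (E : Encodes ρ ψ A B S T c) {V : Set (Sp d)} (hV : IsOpen V) :
    graphLV ρ ψ A B V = (driftRel (fun x => ρ x * ψ x) S c V :
      Set (Lp ℝ 1 ((wm fun x => ρ x * ψ x).restrict V) ×
        Lp ℝ 1 ((wm fun x => ρ x * ψ x).restrict V))) := by
  ext z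
  constructor
  · rintro ⟨u, w, h, hb, h1, h2⟩
    obtain ⟨p, w', hg, hpu, hw⟩ := (E.isL0_iff hV.measurableSet).1 h
    exact ⟨p, w', hg, (E.exists_bound_iff hV.measurableSet hg.1 hpu).1 hb, h1.trans hpu.symm,
      h2.trans (E.addDrift_eq hV hg.1 hpu hw)⟩
  · rintro ⟨p, w', hg, hb, h1, h2⟩
    exact ⟨p.fst, w', (E.isL0_iff hV.measurableSet).2
      ⟨p, w', hg, EventuallyEq.refl _ _, EventuallyEq.refl _ _⟩,
      (E.exists_bound_iff hV.measurableSet hg.1 (EventuallyEq.refl _ _)).2 hb, h1,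
      h2.trans (E.addDrift_eq hV hg.1 (EventuallyEq.refl _ _) (EventuallyEq.refl _ _)).symm⟩

/-- The operator with graph the closure of `driftRel` is the closure of `L^V`. -/
theorem isClosureLV (E : Encodes ρ ψ A B S T c) {V : Set (Sp d)} (hV : IsOpen V)
    (hVb : Bornology.IsBounded V)
    {LV : Lp ℝ 1 ((wm fun x => ρ x * ψ x).restrict V) →ₗ.[ℝ]
      Lp ℝ 1 ((wm fun x => ρ x * ψ x).restrict V)}
    (hLV : LV.graph = (driftRel (fun x => ρ x * ψ x) S c V).topologicalClosure) :
    IsClosureLV ρ ψ A B V LV := by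
  refine ⟨fun u w h _ => ?_, ?_⟩
  · obtain ⟨p, w', hg, hpu, hw⟩ := (E.isL0_iff hV.measurableSet).1 h
    refine ⟨?_, ?_⟩
    · have h1 := (memLp_one_iff_integrable.2 (E.frame.integrable_of_bounded hVb hV.measurableSet
        ((E.frame.energy_eq_zero hg.1).mono fun x hx h => (hx h).1))).restrict V
      exact h1.ae_eq hpu
    · have h1 := (memLp_one_iff_integrable.2
        (E.frame.drifted_integrable hVb hV.measurableSet hg)).restrict V
      exact h1.ae_eq (E.addDrift_eq hV hg.1 hpu hw).symm
  · have h1 : (LV.graph : Set (Lp ℝ 1 ((wm fun x => ρ x * ψ x).restrict V) ×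
        Lp ℝ 1 ((wm fun x => ρ x * ψ x).restrict V))) =
        closure (driftRel (fun x => ρ x * ψ x) S c V) := by
      rw [hLV, Submodule.topologicalClosure_coe]
    exact h1.trans (congrArg closure (E.graphLV_eq hV).symm)

end Encodes

/-! ### Localization -/

theorem exists_cutoff {K : Set (Sp d)} (hK : Bornology.IsBounded K) :
    ∃ (χ : Sp d → ℝ) (n : ℕ), IsTest (exhaust d n) χ ∧ ∀ x ∈ K, χ x = 1 := by
  obtain ⟨N, hN⟩ := exists_subset_exhaust hK
  let f : ContDiffBump (0 : Sp d) := ⟨(N : ℝ) + 1, (N : ℝ) + 2, by positivity, by linarith⟩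
  refine ⟨f, N + 2, ⟨f.contDiff, f.hasCompactSupport, ?_⟩, fun x hx => ?_⟩
  · rw [f.tsupport_eq]
    refine Metric.closedBall_subset_ball ?_
    push_cast
    change (N : ℝ) + 2 < _
    linarith
  · exact f.one_of_mem_closedBall (Metric.ball_subset_closedBall (hN N le_rfl hx))

/-- An exhaustion by open sets eventually contains each ball. -/
theorem eventually_exhaust_subset {U : ℕ → Set (Sp d)} (hU : ∀ n, IsOpen (U n))
    (hmono : ∀ n, closure (U n) ⊆ U (n + 1)) (huniv : (⋃ n, U n) = univ) (k : ℕ) :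
    ∀ᶠ n in atTop, exhaust d k ⊆ U n := by
  have hm : Monotone U := monotone_nat_of_le_succ fun n => subset_closure.trans (hmono n)
  obtain ⟨N, hN⟩ := (isCompact_closedBall (0 : Sp d) ((k : ℝ) + 1)).elim_directed_cover U hU
    (by rw [huniv]; exact subset_univ _) hm.directed_le
  filter_upwards [eventually_ge_atTop N] with n hn
  exact (Metric.ball_subset_closedBall.trans hN).trans (hm hn)

namespace IsFrame

variable {m : Sp d → ℝ} {S T : Sp d → Sp d →L[ℝ] Sp d} {c : Sp d → Sp d}

/-- An element of the energy space with compact support belongs to the energy space of a ball. -/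
theorem exists_mem_energy_exhaust (F : IsFrame m S T c) {U K : Set (Sp d)} {p : GSp m}
    (hp : p ∈ energy m S U) (hK : IsCompact K) (hpK : ∀ᵐ x ∂(wm m), x ∉ K → p.fst x = 0) :
    ∃ n, p ∈ energy m S (exhaust d n) := by
  obtain ⟨χ, n, hχ, h1⟩ := exists_cutoff hK.isBounded
  obtain ⟨q, hq, hq1, -⟩ := F.energy_comp_mul hp contDiff_id (C := 1) (fun s => by simp) hχ
  have hqp : q.fst = p.fst := by
    refine Lp.ext ?_
    filter_upwards [hq1, hpK] with x h2 h3
    rw [h2, id_eq]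
    by_cases hx : x ∈ K
    · rw [h1 x hx, mul_one]
    · rw [h3 hx, zero_mul]
  have := F.energy_ext (energy_mono (subset_univ _) hq) (energy_mono (subset_univ U) hp) hqp
  exact ⟨n, this ▸ hq⟩

/-- The generator is local: if `p` belongs to the energy space of `V`, then its image `w` vanishes
off the closure of `V`. -/
theorem eq_zero_of_notMem_closure (F : IsFrame m S T c) {p : GSp m} {w : Lp ℝ 2 (wm m)}
    (h : IsGen m S univ p w) {V : Set (Sp d)} (hp : p ∈ energy m S V) :
    ∀ᵐ x ∂(wm m), x ∉ closure V → w x = 0 := by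
  have := F.isFiniteMeasureOnCompacts
  have hO : IsOpen (closure V)ᶜ := isClosed_closure.isOpen_compl
  have hloc : LocallyIntegrable w (wm m) := (Lp.memLp w).locallyIntegrable (by norm_num)
  refine hO.ae_eq_zero_of_integral_contDiff_smul_eq_zero (hloc.locallyIntegrableOn _)
    fun φ hφ hφc hφs => ?_
  have hφt : IsTest (closure V)ᶜ φ := ⟨hφ, hφc, hφs⟩
  obtain ⟨Q, hQ⟩ := F.exists_testPair hφt
  have h1 := h.2.2 Q (energy_mono (subset_univ _) hQ.mem)
  have h2 : inner ℝ p.snd Q.snd = 0 := by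
    rw [L2.inner_def]
    refine integral_eq_zero_of_ae ?_
    filter_upwards [F.energy_eq_zero hp, F.energy_eq_zero hQ.mem] with x e1 e2
    by_cases hx : x ∈ V
    · rw [(e2 fun hx' => hx' (subset_closure hx)).2, inner_zero_right]; rfl
    · rw [(e1 hx).2, inner_zero_left]; rfl
  rw [h2, eq_comm, neg_eq_zero, L2.inner_def] at h1
  rw [← h1]
  refine integral_congr_ae ?_
  filter_upwards [hQ.2.1] with x hx
  rw [hx, RCLike.inner_apply, conj_trivial, smul_eq_mul]

/-- Bounded solutions of the same equation on all large balls belong to the global operator. -/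
theorem exists_mem_globalRel (F : IsFrame m S T c) {p : GSp m} {w : Lp ℝ 2 (wm m)} {N : ℕ}
    (h : ∀ n, N ≤ n → IsGen m S (exhaust d n) p w)
    (hb : ∃ M : ℝ, ∀ᵐ x ∂(wm m), |p.fst x| ≤ M) :
    ∃ z ∈ globalRel m S c, z.1 =ᵐ[wm m] p.fst ∧ z.2 =ᵐ[wm m] drifted c p w := by
  have hzero : ∀ n, N ≤ n → ∀ᵐ x, x ∉ exhaust d n → p.fst x = 0 := fun n hn =>
    (F.energy_eq_zero (h n hn).1).mono fun x hx h => (hx h).1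
  have i1 := memLp_one_iff_integrable.2 (F.integrable_of_bounded Metric.isBounded_ball
    (measurableSet_exhaust N) (hzero N le_rfl))
  have i2 := memLp_one_iff_integrable.2 (F.drifted_integrable Metric.isBounded_ball
    (measurableSet_exhaust N) (h N le_rfl))
  obtain ⟨z1, hz1⟩ : ∃ z : Lp ℝ 1 (wm m), z =ᵐ[wm m] p.fst := ⟨i1.toLp _, i1.coeFn_toLp⟩
  obtain ⟨z2, hz2⟩ : ∃ z : Lp ℝ 1 (wm m), z =ᵐ[wm m] drifted c p w := ⟨i2.toLp _, i2.coeFn_toLp⟩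
  have key : ∀ n, ∃ ζ ∈ (driftRel m S c (exhaust d n)).topologicalClosure, N ≤ n →
      extendL1 (measurableSet_exhaust n) ζ.1 = z1 ∧
        extendL1 (measurableSet_exhaust n) ζ.2 = z2 := by
    intro n
    by_cases hn : N ≤ n
    · obtain ⟨ζ, hζ, h1, h2⟩ := F.exists_mem_driftRel Metric.isBounded_ball
        (measurableSet_exhaust n) (h n hn) hb
      exact ⟨ζ, Submodule.le_topologicalClosure _ hζ, fun _ =>
        ⟨Lp.ext ((F.extendL1_eq _ h1 (hzero n hn)).trans hz1.symm),
          Lp.ext ((F.extendL1_eq _ h2 (F.drifted_eq_zero (h n hn))).trans hz2.symm)⟩⟩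
    · exact ⟨0, Submodule.zero_mem _, fun h => absurd h hn⟩
  choose ζ hζ hζz using key
  refine ⟨(z1, z2), ⟨ζ, hζ, ?_, ?_⟩, hz1, hz2⟩
  · refine tendsto_const_nhds.congr' ?_
    filter_upwards [eventually_ge_atTop N] with n hn
    exact (hζz n hn).1.symm
  · refine tendsto_const_nhds.congr' ?_
    filter_upwards [eventually_ge_atTop N] with n hn
    exact (hζz n hn).2.symm

theorem eLpNorm_eq_sqrt {g : Sp d → Sp d} (hg : MemLp g 2 volume) :
    eLpNorm g 2 volume = ENNReal.ofReal (√(∫ x, ‖g x‖ ^ 2)) := by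
  rw [hg.eLpNorm_eq_integral_rpow_norm (by norm_num) (by norm_num), Real.sqrt_eq_rpow]
  norm_num

/-- Let the gradients of test functions `φ n` be Cauchy in `L²(dx)`. Since `S` is only locally
bounded, `S ∇φ n` need not converge, but it does once `φ n` is multiplied by a cutoff function. -/
theorem exists_energy_of_gradient_cauchy (F : IsFrame m S T c) {φ : ℕ → Sp d → ℝ}
    (hφ : ∀ n, IsTest univ (φ n)) {v : Sp d → ℝ} (hv : MemLp v 2 (wm m))
    (hlim : Tendsto (fun n => eLpNorm (φ n - v) 2 (wm m)) atTop (𝓝 0))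
    (hgrad : Tendsto (fun p : ℕ × ℕ => ∫ x, ‖gradient (φ p.1 - φ p.2) x‖ ^ 2) atTop (𝓝 0))
    {U : Set (Sp d)} {χ : Sp d → ℝ} (hχ : IsTest U χ) :
    ∃ q ∈ energy m S U, q.fst =ᵐ[wm m] fun x => v x * χ x := by
  have := F.isFiniteMeasureOnCompacts
  have htest : ∀ n, IsTest U fun x => φ n x * χ x := fun n => hχ.comp_mul (hφ n).1 contDiff_id
  choose P hP using fun n => F.exists_testPair (htest n)
  obtain ⟨D, hD⟩ := hχ.exists_bound
  have hvχ : MemLp (fun x => v x * χ x) 2 (wm m) := by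
    refine hv.of_le_mul (c := D) (hv.1.mul hχ.1.continuous.aestronglyMeasurable)
      (Eventually.of_forall fun x => ?_)
    rw [norm_mul, mul_comm]
    exact mul_le_mul_of_nonneg_right (hD x) (norm_nonneg _)
  have h1 : Tendsto (fun n => (P n).fst) atTop (𝓝 (hvχ.toLp _)) := by
    rw [Lp.tendsto_Lp_iff_tendsto_eLpNorm']
    have h2 := ENNReal.Tendsto.const_mul hlim (Or.inr (ENNReal.ofReal_ne_top (r := D)))
    rw [mul_zero] at h2
    refine tendsto_of_tendsto_of_tendsto_of_le_of_le tendsto_const_nhds h2 (fun _ => zero_le)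
      fun n => eLpNorm_le_mul_eLpNorm_of_ae_le_mul ?_ 2
    filter_upwards [(hP n).2.1, hvχ.coeFn_toLp] with x e1 e2
    rw [Pi.sub_apply, e1, e2, ← sub_mul, norm_mul, mul_comm]
    exact mul_le_mul_of_nonneg_right (hD x) (norm_nonneg _)
  obtain ⟨C, hC0, hC⟩ : ∃ C : ℝ, 0 ≤ C ∧ ∀ᵐ x ∂(volume.restrict (tsupport χ)), ‖S x‖ ≤ C := by
    obtain ⟨C, hC⟩ := F.S_bdd _ hχ.2.1
    exact ⟨max C 0, le_max_right _ _, hC.mono fun x hx => hx.trans (le_max_left _ _)⟩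
  obtain ⟨C', hC', hle⟩ : ∃ C' : ℝ≥0∞, C' ≠ ⊤ ∧ ∀ f : Sp d → ℝ,
      eLpNorm (fun x => f x • S x (gradient χ x)) 2 volume ≤ C' * eLpNorm f 2 (wm m) := by
    obtain ⟨E, hE⟩ := F.S_gradient_bdd (continuous_gradient hχ.1) hχ.gradient_hasCompactSupport
    exact F.exists_eLpNorm_smul_le hχ.gradient_hasCompactSupport hE fun x hx => by
      rw [image_eq_zero_of_notMem_tsupport hx, map_zero]
  have hφL : ∀ n, MemLp (φ n) 2 (wm m) := fun n => (hφ n).memLp 2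
  have h2 : CauchySeq fun n => (P n).snd := by
    rw [Lp.cauchySeq_Lp_iff_cauchySeq_eLpNorm]
    have hb : ∀ k : ℕ × ℕ, eLpNorm ((P k.1).snd - (P k.2).snd : Sp d → Sp d) 2 volume ≤
        ENNReal.ofReal (D * C) * ENNReal.ofReal (√(∫ x, ‖gradient (φ k.1 - φ k.2) x‖ ^ 2)) +
          C' * (eLpNorm (φ k.1 - v) 2 (wm m) + eLpNorm (φ k.2 - v) 2 (wm m)) := by
      intro k
      have ht := (hφ k.1).sub (hφ k.2)
      have hgr := continuous_gradient ht.1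
      have hgL : MemLp (gradient (φ k.1 - φ k.2)) 2 volume :=
        hgr.memLp_of_hasCompactSupport ht.gradient_hasCompactSupport
      have e1 : ((P k.1).snd - (P k.2).snd : Sp d → Sp d) =ᵐ[volume]
          (fun x => χ x • S x (gradient (φ k.1 - φ k.2) x)) +
            fun x => (φ k.1 - φ k.2) x • S x (gradient χ x) := by
        have hsub := ((hP k.1).sub (hP k.2)).2.2
        rw [WithLp.sub_snd] at hsub
        filter_upwards [hsub, Lp.coeFn_sub (P k.1).snd (P k.2).snd] with x h3 h4
        rw [← h4, h3]
        have h5 := gradient_comp_mul ht.1 hχ.1 contDiff_id x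
        have h6 : ((fun x => φ k.1 x * χ x) - fun x => φ k.2 x * χ x) =
            fun x => id ((φ k.1 - φ k.2) x) * χ x := by
          funext y
          simp only [Pi.sub_apply, id_eq]
          ring
        rw [h6, h5, map_add, map_smul, map_smul, deriv_id, one_mul]
        rfl
      have m1 : AEStronglyMeasurable (fun x => χ x • S x (gradient (φ k.1 - φ k.2) x)) volume :=
        hχ.1.continuous.aestronglyMeasurable.smul
          (F.memLp_S hgr ht.gradient_hasCompactSupport).1
      have m2 : AEStronglyMeasurable (fun x => (φ k.1 - φ k.2) x • S x (gradient χ x)) volume :=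
        ht.1.continuous.aestronglyMeasurable.smul
          (F.memLp_S (continuous_gradient hχ.1) hχ.gradient_hasCompactSupport).1
      rw [eLpNorm_congr_ae e1]
      refine (eLpNorm_add_le m1 m2 (by norm_num)).trans (add_le_add ?_ ?_)
      · rw [← eLpNorm_eq_sqrt hgL]
        refine eLpNorm_le_mul_eLpNorm_of_ae_le_mul ?_ 2
        filter_upwards [(ae_restrict_iff' hχ.2.1.measurableSet).1 hC] with x hx
        rw [norm_smul, mul_assoc]
        by_cases hxK : x ∈ tsupport χ
        · exact mul_le_mul (hD x) ((S x).le_of_opNorm_le (hx hxK) _) (norm_nonneg _)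
            ((norm_nonneg _).trans (hD x))
        · have hD0 : 0 ≤ D := (norm_nonneg _).trans (hD x)
          rw [image_eq_zero_of_notMem_tsupport hxK, norm_zero, zero_mul]
          exact mul_nonneg hD0 (mul_nonneg hC0 (norm_nonneg _))
      · refine (hle _).trans (mul_le_mul_right ?_ _)
        have e2 : φ k.1 - φ k.2 = (φ k.1 - v) - (φ k.2 - v) := (sub_sub_sub_cancel_right _ _ _).symm
        rw [e2]
        exact eLpNorm_sub_le ((hφL _).1.sub hv.1) ((hφL _).1.sub hv.1) (by norm_num)
    have t1 : Tendsto (fun k : ℕ × ℕ => ENNReal.ofReal (D * C) *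
        ENNReal.ofReal (√(∫ x, ‖gradient (φ k.1 - φ k.2) x‖ ^ 2))) atTop (𝓝 0) := by
      have := ENNReal.Tendsto.const_mul (ENNReal.tendsto_ofReal hgrad.sqrt)
        (Or.inr (ENNReal.ofReal_ne_top (r := D * C)))
      rwa [Real.sqrt_zero, ENNReal.ofReal_zero, mul_zero] at this
    have t2 : Tendsto (fun k : ℕ × ℕ => C' * (eLpNorm (φ k.1 - v) 2 (wm m) +
        eLpNorm (φ k.2 - v) 2 (wm m))) atTop (𝓝 0) := by
      rw [← prod_atTop_atTop_eq]
      have := ENNReal.Tendsto.const_mul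
        ((hlim.comp Filter.tendsto_fst).add (hlim.comp Filter.tendsto_snd)) (Or.inr hC')
      rwa [add_zero, mul_zero] at this
    have t3 := t1.add t2
    rw [add_zero] at t3
    exact tendsto_of_tendsto_of_tendsto_of_le_of_le tendsto_const_nhds t3 (fun _ => zero_le) hb
  obtain ⟨g, hg⟩ := cauchySeq_tendsto_of_complete h2
  exact ⟨WithLp.toLp 2 (hvχ.toLp _, g), mem_energy_iff.2 ⟨_, P, hP, tendsto_GSp h1 hg⟩,
    hvχ.coeFn_toLp⟩

end IsFrame

/-! ### The operator in terms of the coefficients -/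

namespace Encodes

variable {ρ ψ : Sp d → ℝ} {A : Sp d → Matrix (Fin d) (Fin d) ℝ} {B : Sp d → Sp d}
  {S T : Sp d → Sp d →L[ℝ] Sp d} {c : Sp d → Sp d}

/-- The global operator extends `L` on the bounded elements of `D(L⁰)` with compact support: such an
element solves the same equation on every large ball. -/
theorem exists_extension (E : Encodes ρ ψ A B S T c) {u w : Sp d → ℝ} (h : IsL0 ρ ψ A univ u w)
    (hb : EssBdd (mu ρ ψ) u) (hK : EssCompactSupp (mu ρ ψ) u) :
    ∃ z ∈ globalRel (fun x => ρ x * ψ x) S c, z.1 =ᵐ[mu ρ ψ] u ∧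
      z.2 =ᵐ[mu ρ ψ] addDrift B univ u w := by
  obtain ⟨p, w', hg, hpu, hw⟩ := (E.isL0_iff MeasurableSet.univ).1 h
  obtain ⟨M, hM⟩ := (E.exists_bound_iff MeasurableSet.univ hg.1 hpu).1
    (by rwa [Measure.restrict_univ])
  have hd := E.addDrift_eq isOpen_univ hg.1 hpu hw
  rw [Measure.restrict_univ] at hpu hd
  obtain ⟨K, hKc, hK⟩ := hK
  obtain ⟨N, hN⟩ := E.frame.exists_mem_energy_exhaust hg.1 hKc (by
    filter_upwards [hK, hpu] with x h1 h2 hx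
    rw [h2, h1 hx])
  have h0 := E.frame.eq_zero_of_notMem_closure hg hN
  have hcl : closure (exhaust d N) ⊆ exhaust d (N + 1) := by
    refine Metric.closure_ball_subset_closedBall.trans (Metric.closedBall_subset_ball ?_)
    push_cast
    linarith
  obtain ⟨z, hz, h1, h2⟩ := E.frame.exists_mem_globalRel (p := p) (w := w') (N := N + 1)
    (fun n hn => ⟨energy_mono (exhaust_mono (by omega)) hN, h0.mono fun x hx hxn =>
      hx fun hxc => hxn (exhaust_mono hn (hcl hxc)),
      fun q hq => hg.2.2 q (energy_mono (subset_univ _) hq)⟩) ⟨M, hM⟩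
  exact ⟨z, hz, h1.trans hpu, h2.trans hd.symm⟩

/-- Functions in `Ĥ_0^{1,2}` with compact support belong to the energy space of a ball. -/
theorem exists_energy_of_memHHat (E : Encodes ρ ψ A B S T c) {v : Sp d → ℝ}
    (hv : MemHHat ρ ψ univ v) (hK : EssCompactSupp (mu ρ ψ) v) :
    ∃ n, ∃ q ∈ energy (fun x => ρ x * ψ x) S (exhaust d n), q.fst =ᵐ[mu ρ ψ] v := by
  obtain ⟨hv2, φ, hφ, hlim, hgrad⟩ := hv
  rw [Measure.restrict_univ] at hv2 hlim
  simp only [Measure.restrict_univ] at hgrad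
  obtain ⟨K, hKc, hK⟩ := hK
  obtain ⟨χ, n, hχ, h1⟩ := exists_cutoff hKc.isBounded
  obtain ⟨q, hq, hqv⟩ := E.frame.exists_energy_of_gradient_cauchy hφ hv2 hlim hgrad hχ
  refine ⟨n, q, hq, hqv.trans ?_⟩
  filter_upwards [hK] with x hx
  by_cases hxK : x ∈ K
  · rw [h1 x hxK, mul_one]
  · rw [hx hxK, zero_mul]

/-- Bounded elements of the domain belong to the domain of the form, and satisfy the energy estimate
and the weak equation. -/
theorem equation_of_mem_globalRel (E : Encodes ρ ψ A B S T c)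
    {z : Lp ℝ 1 (mu ρ ψ) × Lp ℝ 1 (mu ρ ψ)} (hz : z ∈ globalRel (fun x => ρ x * ψ x) S c)
    (hb : EssBdd (mu ρ ψ) z.1) :
    FormDomain ρ ψ A univ z.1 ∧
      form ρ ψ A univ z.1 z.1 ≤ - ∫ x, z.2 x * z.1 x ∂(mu ρ ψ) ∧
      ∀ v : Sp d → ℝ, MemHHat ρ ψ univ v → EssBdd (mu ρ ψ) v → EssCompactSupp (mu ρ ψ) v →
        FormDomain ρ ψ A univ v ∧
        Integrable (fun x => inner ℝ (B x) (weakGrad univ z.1 x) * v x) (mu ρ ψ) ∧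
        form ρ ψ A univ z.1 v - ∫ x, inner ℝ (B x) (weakGrad univ z.1 x) * v x ∂(mu ρ ψ) =
          - ∫ x, z.2 x * v x ∂(mu ρ ψ) := by
  obtain ⟨M, hM⟩ := hb
  obtain ⟨p, w, L⟩ := E.frame.exists_genLimit_global hz
  obtain ⟨q, hq, hqz, hle, heq⟩ := L.exists_energy E.frame (le_max_right M 0)
    (hM.mono fun x hx => hx.trans (le_max_left _ _))
  have hqr : q.fst =ᵐ[(mu ρ ψ).restrict univ] z.1 := by rwa [Measure.restrict_univ]
  have hB := E.inner_weakGrad_eq isOpen_univ hq hqr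
  rw [Measure.restrict_univ] at hB
  refine ⟨(E.formDomain_iff MeasurableSet.univ).2 ⟨q, hq, hqr⟩, ?_, fun v hv hvb hvK => ?_⟩
  · rw [E.form_eq MeasurableSet.univ hq hq hqr hqr, real_inner_self_eq_norm_sq]
    exact hle
  · obtain ⟨n, r, hr, hrv⟩ := E.exists_energy_of_memHHat hv hvK
    obtain ⟨N, hN⟩ := hvb
    have hr' := energy_mono (subset_univ _) hr
    have hrr : r.fst =ᵐ[(mu ρ ψ).restrict univ] v := by rwa [Measure.restrict_univ]
    have hvm : AEStronglyMeasurable v (wm fun x => ρ x * ψ x) :=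
      (Lp.aestronglyMeasurable r.fst).congr hrv
    have hv0 : ∀ᵐ x, x ∉ exhaust d n → v x = 0 := by
      filter_upwards [E.frame.energy_eq_zero hr, E.frame.ae_iff.1 hrv] with x h1 h2 hx
      rw [← h2, (h1 hx).1]
    have hcongr : (fun x => inner ℝ (B x) (weakGrad univ z.1 x) * v x) =ᵐ[mu ρ ψ]
        fun x => inner ℝ (c x) (q.snd x) * v x := by
      filter_upwards [hB] with x hx
      rw [hx]
    refine ⟨(E.formDomain_iff MeasurableSet.univ).2 ⟨r, hr', hrr⟩, ?_, ?_⟩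
    · exact (E.frame.integrable_drift_mul Metric.isBounded_ball (measurableSet_exhaust n) q.snd
        hvm hv0 hN).congr hcongr.symm
    · have h1 := E.frame.equation_of_bounded Metric.isBounded_ball (measurableSet_exhaust n)
        L.integrable_snd (fun φ P hP => heq φ P (hP.mono (subset_univ _)) (by
          filter_upwards [eventually_ge_atTop n] with k hk
          exact hP.1.mono (exhaust_mono hk))) hr (M := N) (by
          filter_upwards [hN, hrv] with x h1 h2
          rwa [h2])
      rw [E.form_eq MeasurableSet.univ hq hr' hqr hrr, integral_congr_ae hcongr]
      have e1 : ∫ x, inner ℝ (c x) (q.snd x) * r.fst x ∂(wm fun x => ρ x * ψ x) =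
          ∫ x, inner ℝ (c x) (q.snd x) * v x ∂(mu ρ ψ) := by
        refine integral_congr_ae ?_
        filter_upwards [hrv] with x hx
        rw [hx]
      have e2 : ∫ x, z.2 x * r.fst x ∂(wm fun x => ρ x * ψ x) =
          ∫ x, z.2 x * v x ∂(mu ρ ψ) := by
        refine integral_congr_ae ?_
        filter_upwards [hrv] with x hx
        rw [hx]
      rw [← e1, ← e2]
      exact h1

/-- Existence of the operators on the sets `U n` and convergence of their resolvents. -/
theorem exists_resolvent_approximation (E : Encodes ρ ψ A B S T c)
    {L : Lp ℝ 1 (mu ρ ψ) →ₗ.[ℝ] Lp ℝ 1 (mu ρ ψ)}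
    {R : ℝ → Lp ℝ 1 (mu ρ ψ) →L[ℝ] Lp ℝ 1 (mu ρ ψ)}
    (hR : ∀ α, 0 < α → IsResolvent L α (R α) ∧
      ∀ f, (R α f, α • R α f - f) ∈ globalRel (fun x => ρ x * ψ x) S c)
    {U : ℕ → Set (Sp d)} (hU : ∀ n, IsOpen (U n)) (hUb : ∀ n, Bornology.IsBounded (U n))
    (hmono : ∀ n, closure (U n) ⊆ U (n + 1)) (huniv : (⋃ n, U n) = univ) :
    ∃ LU : ∀ n, Lp ℝ 1 ((mu ρ ψ).restrict (U n)) →ₗ.[ℝ] Lp ℝ 1 ((mu ρ ψ).restrict (U n)),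
      (∀ n, IsClosureLV ρ ψ A B (U n) (LU n) ∧ GeneratesSubMarkovian (LU n)) ∧
      ∀ α : ℝ, 0 < α →
        ∃ (G : Lp ℝ 1 (mu ρ ψ) →L[ℝ] Lp ℝ 1 (mu ρ ψ))
          (GU : ∀ n, Lp ℝ 1 ((mu ρ ψ).restrict (U n)) →L[ℝ] Lp ℝ 1 ((mu ρ ψ).restrict (U n))),
          IsResolvent L α G ∧ (∀ n, IsResolvent (LU n) α (GU n)) ∧
          ∀ f : Lp ℝ 1 (mu ρ ψ),
            Tendsto (fun n => eLpNorm
              (fun x => (U n).indicator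
                (GU n (LpToLpRestrictCLM (Sp d) ℝ ℝ (mu ρ ψ) 1 (U n) f)) x - G f x) 1 (mu ρ ψ))
              atTop (𝓝 0) := by
  choose LU GU hgraph hgen hGU using fun n => E.frame.exists_generator_of_bounded (hU n) (hUb n)
  refine ⟨LU, fun n => ⟨E.isClosureLV (hU n) (hUb n) (hgraph n), hgen n⟩, fun α hα =>
    ⟨R α, fun n => GU n α, (hR α hα).1, fun n => (hGU n α hα).1, fun f => ?_⟩⟩
  have h1 := E.frame.tendsto_resolventExt hα (hR α hα).2 (fun n => (hU n).measurableSet) hUb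
    (eventually_exhaust_subset hU hmono huniv) (fun n => (hGU n α hα).2) f
  have h2 := ENNReal.tendsto_ofReal (tendsto_iff_norm_sub_tendsto_zero.1 h1)
  rw [ENNReal.ofReal_zero] at h2
  refine h2.congr fun n => ?_
  exact (eLpNorm_sub_coeFn (extendL1_coeFn (hU n).measurableSet _) (EventuallyEq.refl _ _)).symm

end Encodes

end DegenerateDiffusion

end

theorem theorem4p6 (d : ℕ) (ρ ψ : Sp d → ℝ) (A : Sp d → Matrix (Fin d) (Fin d) ℝ)
    (B : Sp d → Sp d)
    (hρ : MemH12Loc ρ) (hρ_bdd : MemLpLoc ρ ⊤ volume) (hρ_pos : ∀ᵐ x, 0 < ρ x)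
    (hρ_inv : MemLpLoc (fun x => (ρ x)⁻¹) ⊤ volume)
    (hψ : MemLpLoc ψ 1 volume) (hψ_pos : ∀ᵐ x, 0 < ψ x)
    (hψ_inv : MemLpLoc (fun x => (ψ x)⁻¹) ⊤ volume)
    (hA_symm : ∀ x, (A x).IsSymm) (hA : ∀ i j, MemH12Loc fun x => A x i j)
    (hA_ell : LocUnifElliptic A)
    (hB : MemLpLoc B 2 (mu ρ ψ))
    (hB_div : ∀ u : Sp d → ℝ, IsTest univ u → ∫ x, inner ℝ (B x) (gradient u x) ∂(mu ρ ψ) = 0)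
    (hB_loc : MemLpLoc (fun x => (ρ x * ψ x) • B x) 2 volume) :
    ∃ Lbar : Lp ℝ 1 (mu ρ ψ) →ₗ.[ℝ] Lp ℝ 1 (mu ρ ψ),
      -- `Lbar` is a closed extension of `(L, D(L⁰)_{0,b})`
      Lbar.IsClosed ∧
      (∀ u w : Sp d → ℝ, IsL0 ρ ψ A univ u w → EssBdd (mu ρ ψ) u → EssCompactSupp (mu ρ ψ) u →
        ∃ p : Lbar.domain, ((p : Lp ℝ 1 (mu ρ ψ)) : Sp d → ℝ) =ᵐ[mu ρ ψ] u ∧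
          (Lbar p : Sp d → ℝ) =ᵐ[mu ρ ψ] addDrift B univ u w) ∧
      -- (a)
      GeneratesSubMarkovian Lbar ∧
      -- (b)
      (∀ U : ℕ → Set (Sp d), (∀ n, IsOpen (U n)) → (∀ n, Bornology.IsBounded (U n)) →
        (∀ n, closure (U n) ⊆ U (n + 1)) → (⋃ n, U n) = univ →
        ∃ LU : ∀ n, Lp ℝ 1 ((mu ρ ψ).restrict (U n)) →ₗ.[ℝ] Lp ℝ 1 ((mu ρ ψ).restrict (U n)),
          (∀ n, IsClosureLV ρ ψ A B (U n) (LU n) ∧ GeneratesSubMarkovian (LU n)) ∧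
          ∀ α : ℝ, 0 < α →
            ∃ (G : Lp ℝ 1 (mu ρ ψ) →L[ℝ] Lp ℝ 1 (mu ρ ψ))
              (GU : ∀ n, Lp ℝ 1 ((mu ρ ψ).restrict (U n)) →L[ℝ] Lp ℝ 1 ((mu ρ ψ).restrict (U n))),
              IsResolvent Lbar α G ∧ (∀ n, IsResolvent (LU n) α (GU n)) ∧
              ∀ f : Lp ℝ 1 (mu ρ ψ),
                Tendsto (fun n => eLpNorm
                  (fun x => (U n).indicator
                    (GU n (LpToLpRestrictCLM (Sp d) ℝ ℝ (mu ρ ψ) 1 (U n) f)) x - G f x) 1 (mu ρ ψ))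
                  atTop (𝓝 0)) ∧
      -- (c)
      ∀ u : Lbar.domain, EssBdd (mu ρ ψ) (u : Lp ℝ 1 (mu ρ ψ)) →
        FormDomain ρ ψ A univ (u : Lp ℝ 1 (mu ρ ψ)) ∧
        form ρ ψ A univ (u : Lp ℝ 1 (mu ρ ψ)) (u : Lp ℝ 1 (mu ρ ψ)) ≤
          - ∫ x, Lbar u x * (u : Lp ℝ 1 (mu ρ ψ)) x ∂(mu ρ ψ) ∧
        ∀ v : Sp d → ℝ, MemHHat ρ ψ univ v → EssBdd (mu ρ ψ) v → EssCompactSupp (mu ρ ψ) v →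
          FormDomain ρ ψ A univ v ∧
          Integrable (fun x => inner ℝ (B x) (weakGrad univ (u : Lp ℝ 1 (mu ρ ψ)) x) * v x)
            (mu ρ ψ) ∧
          form ρ ψ A univ (u : Lp ℝ 1 (mu ρ ψ)) v
              - ∫ x, inner ℝ (B x) (weakGrad univ (u : Lp ℝ 1 (mu ρ ψ)) x) * v x ∂(mu ρ ψ) =
            - ∫ x, Lbar u x * v x ∂(mu ρ ψ) := by
  obtain ⟨S, T, c, hF, hS, hc⟩ := exists_isFrame ρ ψ A B hρ_bdd hρ_pos hρ_inv hψ hψ_pos hψ_inv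
    hA_symm hA hA_ell hB_div hB_loc
  have E : Encodes ρ ψ A B S T c := ⟨hF, hψ_pos, hS, hc⟩
  obtain ⟨L, R, hgraph, hclosed, hgen, hR⟩ := hF.exists_generator_global
  refine ⟨L, hclosed, fun u w h hb hK => ?_, hgen, fun U hU hUb hmono huniv =>
    E.exists_resolvent_approximation hR hU hUb hmono huniv, fun u hu => ?_⟩
  · obtain ⟨z, hz, h1, h2⟩ := E.exists_extension h hb hK
    obtain ⟨p, hp1, hp2⟩ := (LinearPMap.mem_graph_iff L).1 (hgraph.symm ▸ hz)
    let coe : Lp ℝ 1 (wm fun x => ρ x * ψ x) → Sp d → ℝ := fun f => f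
    exact ⟨p, (EventuallyEq.of_eq (congrArg coe hp1)).trans h1,
      (EventuallyEq.of_eq (congrArg coe hp2)).trans h2⟩
  · exact E.equation_of_mem_globalRel (z := (u, L u)) (hgraph ▸ L.mem_graph u) hu
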